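/- Let $p\ge q\ge 1$. On $\mathbb R^{p+q}=\mathbb R^p\oplus\mathbb R^q$ let $(w,w')_{p,q}=\sum_{j\le p} x_jx_j'-\sum_{j\le q} y_jy_j'$ for $w=(x,y)$, $w'=(x',y')$, let $\mathrm O(p,q)$ be its isometry group, and let $X^0=\{w\neq 0:(w,w)_{p,q}=0\}$ be the light cone. For $a\in\mathbb C$ let $S^a(X^0)$ be the space of smooth functions $f:X^0\to\mathbb C$ with $f(tw)=t^af(w)$ for all $t>0$, with the topology of uniform convergence of all derivatives on $\mathbb S^{p-1}\times\mathbb S^{q-1}$ and the action $(\rho(g)f)(w)=f(g^{-1}w)$ of $\mathrm O(p,q)$. Let $S^{a\pm}(X^0)$ be its subspaces given by $f(-w)=\pm f(w)$. A submodule is a closed invariant subspace. A constituent is an irreducible subquotient $W_1/W_2$ (submodules $W_2\subsetneq W_1$ of $S^a(X^0)$ with no submodule strictly in between). A subquotient is unitary if it possesses a continuous $\mathrm O(p,q)$-invariant positive-definite Hermitian form. For $m,n\ge0$ let $\mathcal H^m(\mathbb R^p)$ be the space of complex-valued harmonic homogeneous polynomials of degree $m$ on $\mathbb R^p$. The $K$-type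 $(m,n)$ is the space of functions on $X^0$ spanned by $h_1(x)h_2(y)\,|x|^{a-m-n}$ with $h_1\in\mathcal H^m(\mathbb R^p)$, $h_2\in\mathcal H^n(\mathbb R^q)$ (when this space is nonzero). It is contained in $W_1/W_2$ if it lies in $W_1$ and not in $W_2$. Put $$A^{++}(m,n)=a-m-n,\quad A^{+-}(m,n)=a-m+n+q-2,$$ $$A^{-+}(m,n)=a+m-n+p-2,\quad A^{--}(m,n)=a+m+n+p+q-4 .$$ Let $a$ be real. Put $\tilde a=a+\frac{p+q}2-1$ and, for a $K$-type $(m,n)$, $u(m,n)=m-n+\frac{p-q}2$. **Criterion.** A constituent of $S^a(X^0)$ is unitary if and only if $\dfrac{A^{++}(m,n)}{A^{--}(m+1,n+1)}<0$ for all pairs of $K$-types $(m,n),(m+1,n+1)$ contained in it and $\dfrac{A^{+-}(m,n)}{A^{-+}(m+1,n-1)}<0$ for all pairs of $K$-types $(m,n),(m+1,n-1)$ contained in it. **Explicit lists.** Below, $e\in\{0,1\}$, $\varepsilon=(-1)^e$ is the corresponding sign, and the sets listed are exactly the sets of $K$-types of the unitary constituents of $S^a(X^0)$; $m,n$ run over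 the non-negative integers. (1) $q\ge2$, $p+q$ even. The full module $S^{a\varepsilon}(X^0)$ is unitary if and only if either $e\equiv\frac{p-q}2\pmod 2$ and $|\tilde a|<1$, or $\tilde a=0$. The unitary constituents are: - $\{m+n\equiv e \pmod 2\}$ with $e\equiv\frac{p-q}{2}\pmod 2$, if $|\tilde a|<1$; - $\{u\in|\tilde a|+1+2\mathbb Z_{\ge0}\}$ and $\{-u\in|\tilde a|+1+2\mathbb Z_{\ge0}\}$, if $a\in\mathbb Z$; - $\{u=0\}$, with $(0,0)$ removed when $p=q=2$, if $|\tilde a|=1$; - $\{(0,0)\}$, if $a=0$ or $a=2-p-q$. (2) $q\ge2$, $p+q$ odd. The full modules $S^{a\pm}(X^0)$ are each unitary if and only if $|\tilde a|<\frac12$. The unitary constituents are: - $\{m+n\equiv e\pmod 2\}$, $e=0,1$, if $|\tilde a|<\frac12$; - $\{u\in|\tilde a|+1+2\mathbb Z_{\ge0}\}$ and $\{-u\in|\tilde a|+1+2\mathbb Z_{\ge0}\}$, if $a\in\mathbb Z$; - $\{u\in\frac12+2\mathbb Z_{\ge0}\}$ and $\{-u\in\frac12+2\mathbb Z_{\ge0}\}$,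 if $|\tilde a|=\frac12$; - $\{(0,0)\}$, if $a=0$ or $a=2-p-q$. (3) $q=1$, $p\ge2$. The full modules $S^{a\pm}(X^0)$ are each unitary if and only if $-(p-1)<a<0$. The unitary constituents are: - $\{n\le1,\ m+n\equiv e\pmod 2\}$, $e=0,1$, if $-(p-1)<a<0$; - $\{n\le1,\ m+n\equiv e\pmod 2,\ m\ge k+1\}$, $e=0,1$, if $a=k$ or $a=1-p-k$ with an integer $k\ge0$; - $\{(0,0)\}$ and $\{(0,1)\}$, if $a=0$ or $a=1-p$. -/

import Mathlib

open scoped ContDiff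

noncomputable section

namespace LightCone

/-- The space of pairs `w = (x, y)` with `x ∈ ℝ^p`, `y ∈ ℝ^q`. -/
abbrev V (p q : ℕ) : Type := (Fin p → ℝ) × (Fin q → ℝ)

/-- The indefinite inner product `(w, w')_{p,q} = ∑ x_j x'_j - ∑ y_j y'_j`. -/
def form {p q : ℕ} (w w' : V p q) : ℝ := ∑ j, w.1 j * w'.1 j - ∑ j, w.2 j * w'.2 j

/-- The isometry group `O(p,q)` of the indefinite inner product. -/
def O (p q : ℕ) : Subgroup (V p q ≃ₗ[ℝ] V p q) where
  carrier := {g | ∀ w w', form (g w) (g w') = form w w'}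
  one_mem' := fun _ _ => rfl
  mul_mem' := by
    intro g h hg hh w w'
    exact (hg (h w) (h w')).trans (hh w w')
  inv_mem' := by
    intro g hg w w'
    have h := hg (g⁻¹ w) (g⁻¹ w')
    have e : ∀ v, g (g⁻¹ v) = v := fun v => g.apply_symm_apply v
    rw [e, e] at h
    exact h.symm

/-- The light cone `X⁰`: the nonzero null vectors. -/
def cone (p q : ℕ) : Set (V p q) := {w | w ≠ 0 ∧ form w w = 0}

/-- The action of `O(p,q)` on the light cone. -/
def move {p q : ℕ} (g : O p q) (w : cone p q) : cone p q :=
  ⟨g.1 w.1, by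
    refine ⟨?_, ?_⟩
    · intro h
      exact w.2.1 (g.1.map_eq_zero_iff.1 h)
    · rw [g.2 w.1 w.1]
      exact w.2.2⟩

/-- All complex-valued functions on the light cone. -/
abbrev Fn (p q : ℕ) : Type := cone p q → ℂ

/-- The action `(ρ(g) f)(w) = f(g⁻¹ w)` on functions. -/
def rho {p q : ℕ} (g : O p q) : Fn p q →ₗ[ℂ] Fn p q := LinearMap.funLeft ℂ ℂ (move g⁻¹)

/-- Smoothness on the light cone, which is a closed submanifold of `ℝ^{p+q} ∖ {0}`:
the function is the restriction of a smooth function on `ℝ^{p+q} ∖ {0}`. -/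
def Smooth {p q : ℕ} (f : Fn p q) : Prop :=
  ∃ F : V p q → ℂ, ContDiffOn ℝ ∞ F {0}ᶜ ∧ ∀ w : cone p q, F w = f w

/-- `S^a(X⁰)`: smooth functions on the light cone with `f(tw) = t^a f(w)` for `t > 0`. -/
def S (p q : ℕ) (a : ℂ) : Submodule ℂ (Fn p q) where
  carrier := {f | Smooth f ∧
    ∀ (t : ℝ) (w w' : cone p q), 0 < t → (w' : V p q) = t • (w : V p q) →
      f w' = (t : ℂ) ^ a * f w}
  zero_mem' := ⟨⟨0, contDiffOn_const, fun _ => rfl⟩, fun _ _ _ _ _ => by simp⟩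
  add_mem' := by
    rintro f g ⟨⟨F, hF, hFf⟩, hf⟩ ⟨⟨G, hG, hGg⟩, hg⟩
    refine ⟨⟨F + G, hF.add hG, fun w => ?_⟩, fun t w w' ht h => ?_⟩
    · simp [hFf w, hGg w]
    · simp only [Pi.add_apply, hf t w w' ht h, hg t w w' ht h]
      ring
  smul_mem' := by
    rintro c f ⟨⟨F, hF, hFf⟩, hf⟩
    refine ⟨⟨fun w => c * F w, contDiffOn_const.mul hF, fun w => ?_⟩, fun t w w' ht h => ?_⟩
    · simp [hFf w]
    · simp only [Pi.smul_apply, smul_eq_mul, hf t w w' ht h]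
      ring

/-- The parity summands of `S^a(X⁰)`: functions in `S^a(X⁰)` with `f(-w) = (-1)^e f(w)`.
So `e = 0` gives `S^{a+}(X⁰)` and `e = 1` gives `S^{a-}(X⁰)`. -/
def SPar (p q : ℕ) (a : ℂ) (e : ℕ) : Submodule ℂ (Fn p q) where
  carrier := {f | f ∈ S p q a ∧
    ∀ w w' : cone p q, (w' : V p q) = -(w : V p q) → f w' = (-1) ^ e * f w}
  zero_mem' := ⟨(S p q a).zero_mem, fun _ _ _ => by simp⟩
  add_mem' := by
    rintro f g ⟨hf, hf'⟩ ⟨hg, hg'⟩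
    refine ⟨(S p q a).add_mem hf hg, fun w w' h => ?_⟩
    simp only [Pi.add_apply, hf' w w' h, hg' w w' h]
    ring
  smul_mem' := by
    rintro c f ⟨hf, hf'⟩
    refine ⟨(S p q a).smul_mem c hf, fun w w' h => ?_⟩
    simp only [Pi.smul_apply, smul_eq_mul, hf' w w' h]
    ring

/-! ### The topology of `S^a(X⁰)`

Restriction identifies `S^a(X⁰)` with the smooth functions on the product of unit spheres
`S^{p-1} × S^{q-1}`; the topology is the usual one of uniform convergence of all derivatives. -/

/-- `(x, y) ↦ (x/|x|, y/|y|)`. -/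
def toSpheres {p q : ℕ} (w : V p q) : V p q :=
  ((√(∑ j, w.1 j ^ 2))⁻¹ • w.1, (√(∑ j, w.2 j ^ 2))⁻¹ • w.2)

/-- The function `(x, y) ↦ f(x/|x|, y/|y|)` on the open set `x ≠ 0`, `y ≠ 0`
(extended by `0`): it has the same values as `f` on `S^{p-1} × S^{q-1}`. -/
def angular {p q : ℕ} (f : Fn p q) (w : V p q) : ℂ :=
  Function.extend (Subtype.val : cone p q → V p q) f 0 (toSpheres w)

/-- The product of unit spheres `S^{p-1} × S^{q-1}`. -/
def spheres (p q : ℕ) : Set (V p q) := {w | ∑ j, w.1 j ^ 2 = 1 ∧ ∑ j, w.2 j ^ 2 = 1}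

/-- The `C^N` norm of `f` over `S^{p-1} × S^{q-1}` is at most `M`. -/
def NormLE {p q : ℕ} (N : ℕ) (f : Fn p q) (M : ℝ) : Prop :=
  ∀ k ≤ N, ∀ w ∈ spheres p q, ‖iteratedFDeriv ℝ k (angular f) w‖ ≤ M

/-- `W` is an `O(p,q)`-submodule of `S^a(X⁰)`: an invariant subspace that is closed for the
topology of uniform convergence of all derivatives. -/
structure IsSubmodule (p q : ℕ) (a : ℂ) (W : Submodule ℂ (Fn p q)) : Prop where
  le : W ≤ S p q a
  invariant : ∀ (g : O p q), ∀ f ∈ W, rho g f ∈ W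
  closed : ∀ f ∈ S p q a,
    (∀ (N : ℕ) (ε : ℝ), 0 < ε → ∃ h ∈ W, NormLE N (f - h) ε) → f ∈ W

/-- The subquotient `W₁ / W₂` is a constituent of `S^a(X⁰)`: both are submodules and the
quotient is irreducible (nonzero, with no submodules strictly in between). -/
structure IsConstituent (p q : ℕ) (a : ℂ) (W₁ W₂ : Submodule ℂ (Fn p q)) : Prop where
  top_sub : IsSubmodule p q a W₁
  bot_sub : IsSubmodule p q a W₂
  lt : W₂ < W₁
  irreducible : ∀ W, IsSubmodule p q a W → W₂ ≤ W → W ≤ W₁ → W = W₂ ∨ W = W₁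

/-- The subquotient `W₁ / W₂` is unitary: it carries a continuous `O(p,q)`-invariant positive
definite Hermitian form, i.e. there is such a form `B` on `W₁` that vanishes on `W₂` (so that
it descends to the quotient) and is positive off `W₂`. -/
def IsUnitary {p q : ℕ} (W₁ W₂ : Submodule ℂ (Fn p q)) : Prop :=
  ∃ B : W₁ →ₗ⋆[ℂ] W₁ →ₗ[ℂ] ℂ,
    (∀ u v : W₁, B v u = star (B u v)) ∧
    (∀ u v : W₁, (u : Fn p q) ∈ W₂ → B u v = 0) ∧
    (∀ u : W₁, (u : Fn p q) ∉ W₂ → 0 < (B u u).re) ∧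
    (∀ (g : O p q) (u v u' v' : W₁), (u' : Fn p q) = rho g (u : Fn p q) →
      (v' : Fn p q) = rho g (v : Fn p q) → B u' v' = B u v) ∧
    (∃ (N : ℕ) (C : ℝ), ∀ (u v : W₁) (M M' : ℝ), NormLE N (u : Fn p q) M →
      NormLE N (v : Fn p q) M' → ‖B u v‖ ≤ C * M * M')

/-! ### `K`-types -/

/-- Harmonic polynomials, homogeneous of degree `m`, in `p` variables (complex coefficients). -/
def IsHarmonic {p : ℕ} (m : ℕ) (h : MvPolynomial (Fin p) ℂ) : Prop :=
  h.IsHomogeneous m ∧ ∑ j, MvPolynomial.pderiv j (MvPolynomial.pderiv j h) = 0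

/-- The function `h₁(x) h₂(y) r_p²(x)^b` on the light cone, with `m + n + 2b = a`. -/
def jMap {p q : ℕ} (a : ℂ) (m n : ℕ)
    (h₁ : MvPolynomial (Fin p) ℂ) (h₂ : MvPolynomial (Fin q) ℂ) : Fn p q := fun w =>
  MvPolynomial.eval (fun j => ((w : V p q).1 j : ℂ)) h₁ *
    MvPolynomial.eval (fun j => ((w : V p q).2 j : ℂ)) h₂ *
    ((∑ j, (w : V p q).1 j ^ 2 : ℝ) : ℂ) ^ ((a - m - n) / 2)

/-- The space `j_a(H^m(ℝ^p) ⊗ H^n(ℝ^q))`. -/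
def KType (p q : ℕ) (a : ℂ) (m n : ℕ) : Submodule ℂ (Fn p q) :=
  Submodule.span ℂ {f | ∃ h₁ h₂, IsHarmonic m h₁ ∧ IsHarmonic n h₂ ∧ f = jMap a m n h₁ h₂}

/-- The `K`-types `(m, n)` contained in the subquotient `W₁ / W₂`: those in `W₁`
and not in `W₂` (so the spaces that are zero do not count). -/
def kTypes {p q : ℕ} (a : ℂ) (W₁ W₂ : Submodule ℂ (Fn p q)) : Set (ℕ × ℕ) :=
  {x | KType p q a x.1 x.2 ≤ W₁ ∧ ¬ KType p q a x.1 x.2 ≤ W₂}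

/-- The sets of `K`-types of the unitary constituents of `S^a(X⁰)`. -/
def unitaryKTypeSets (p q : ℕ) (a : ℂ) : Set (Set (ℕ × ℕ)) :=
  {Ω | ∃ W₁ W₂, IsConstituent p q a W₁ W₂ ∧ IsUnitary W₁ W₂ ∧ kTypes a W₁ W₂ = Ω}

/-! ### Transition coefficients -/

/-- `A^{++}(m,n)`. -/
def App (_p _q : ℕ) (a : ℝ) (m n : ℕ) : ℝ := a - m - n

/-- `A^{+-}(m,n)`. -/
def Apm (_p q : ℕ) (a : ℝ) (m n : ℕ) : ℝ := a - m + n + q - 2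

/-- `A^{-+}(m,n)`. -/
def Amp (p _q : ℕ) (a : ℝ) (m n : ℕ) : ℝ := a + m - n + p - 2

/-- `A^{--}(m,n)`. -/
def Amm (p q : ℕ) (a : ℝ) (m n : ℕ) : ℝ := a + m + n + p + q - 4

/-! ### Sets of `K`-types occurring in the explicit lists -/

/-- The shifted parameter `ã = a + (p+q)/2 - 1`. -/
def shift (p q : ℕ) (a : ℝ) : ℝ := a + ((p : ℝ) + q) / 2 - 1

/-- All points `(m,n)` with `m + n ≡ e (mod 2)`. -/
def parity (e : ℕ) : Set (ℕ × ℕ) := {x | x.1 + x.2 ≡ e [MOD 2]}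

/-- The signed offset `m - n + (p-q)/2` of `(m,n)` from the line `y - x = (p-q)/2`. -/
def offset (p q : ℕ) (x : ℕ × ℕ) : ℝ := (x.1 : ℝ) - x.2 + ((p : ℝ) - q) / 2

/-- The points whose offset is one of `c, c + 2, c + 4, …`. -/
def rightWing (p q : ℕ) (c : ℝ) : Set (ℕ × ℕ) := {x | ∃ k : ℕ, offset p q x = c + 2 * k}

/-- The points whose offset is one of `-c, -c - 2, -c - 4, …`. -/
def leftWing (p q : ℕ) (c : ℝ) : Set (ℕ × ℕ) := {x | ∃ k : ℕ, offset p q x = -(c + 2 * k)}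

/-- The points `(m,n)` with `n ≤ 1`, `m + n ≡ e (mod 2)` and `m ≥ k`. -/
def ray (e k : ℕ) : Set (ℕ × ℕ) := {x | x ∈ parity e ∧ x.2 ≤ 1 ∧ k ≤ x.1}

end LightCone

end

open MeasureTheory

set_option linter.unusedSectionVars false

noncomputable section

namespace LightCone

open MvPolynomial (pderiv X C)

section

variable {p q : ℕ}

/-! ### The light cone and the maximal compact subgroup -/

/-- The squared length of the first component. -/
def nx (w : V p q) : ℝ := ∑ j, w.1 j ^ 2

/-- The squared length of the second component. -/
def ny (w : V p q) : ℝ := ∑ j, w.2 j ^ 2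

lemma form_self (w : V p q) : form w w = nx w - ny w := by
  simp [form, nx, ny, sq]

lemma nx_nonneg (w : V p q) : 0 ≤ nx w := Finset.sum_nonneg fun _ _ => sq_nonneg _

lemma ny_nonneg (w : V p q) : 0 ≤ ny w := Finset.sum_nonneg fun _ _ => sq_nonneg _

lemma nx_eq_zero {w : V p q} : nx w = 0 ↔ w.1 = 0 := by
  unfold nx
  rw [Finset.sum_eq_zero_iff_of_nonneg fun _ _ => sq_nonneg _]
  simp [funext_iff]

lemma ny_eq_zero {w : V p q} : ny w = 0 ↔ w.2 = 0 := by
  unfold ny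
  rw [Finset.sum_eq_zero_iff_of_nonneg fun _ _ => sq_nonneg _]
  simp [funext_iff]

lemma nx_add_ny_pos {w : V p q} (hw : w ≠ 0) : 0 < nx w + ny w := by
  rcases (add_nonneg (nx_nonneg w) (ny_nonneg w)).lt_or_eq with h | h
  · exact h
  · have h1 : nx w = 0 := by linarith [nx_nonneg w, ny_nonneg w]
    have h2 : ny w = 0 := by linarith [nx_nonneg w, ny_nonneg w]
    exact absurd (Prod.ext (nx_eq_zero.1 h1) (ny_eq_zero.1 h2)) hw

lemma cone_eq (w : cone p q) : nx w.1 = ny w.1 := by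
  have := w.2.2
  rw [form_self] at this
  linarith

lemma cone_pos (w : cone p q) : 0 < nx w.1 := by
  have := nx_add_ny_pos w.2.1
  rw [← cone_eq] at this
  linarith

lemma mem_cone {w : V p q} (h : nx w = ny w) (h0 : 0 < nx w) : w ∈ cone p q := by
  refine ⟨?_, by rw [form_self, h, sub_self]⟩
  rintro rfl
  simp [nx] at h0

lemma mem_spheres {w : V p q} : w ∈ spheres p q ↔ nx w = 1 ∧ ny w = 1 := Iff.rfl

lemma spheres_subset_cone : spheres p q ⊆ cone p q := fun w hw =>
  mem_cone (by rw [(mem_spheres.1 hw).1, (mem_spheres.1 hw).2]) (by rw [(mem_spheres.1 hw).1]; simp)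

/-- The maximal compact subgroup `O(p) × O(q)`. -/
def K (p q : ℕ) : Type := Matrix.orthogonalGroup (Fin p) ℝ × Matrix.orthogonalGroup (Fin q) ℝ

/-- The element of `O(p) × O(q)` with given components. -/
def K.mk (A : Matrix.orthogonalGroup (Fin p) ℝ) (B : Matrix.orthogonalGroup (Fin q) ℝ) : K p q :=
  (A, B)

/-- The first component of an element of `O(p) × O(q)`. -/
def K.left (k : K p q) : Matrix.orthogonalGroup (Fin p) ℝ := Prod.fst k

/-- The second component of an element of `O(p) × O(q)`. -/
def K.right (k : K p q) : Matrix.orthogonalGroup (Fin q) ℝ := Prod.snd k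

instance : Group (K p q) :=
  inferInstanceAs (Group (Matrix.orthogonalGroup (Fin p) ℝ × Matrix.orthogonalGroup (Fin q) ℝ))

instance : TopologicalSpace (K p q) := inferInstanceAs
  (TopologicalSpace (Matrix.orthogonalGroup (Fin p) ℝ × Matrix.orthogonalGroup (Fin q) ℝ))

instance : IsTopologicalGroup (K p q) := inferInstanceAs
  (IsTopologicalGroup (Matrix.orthogonalGroup (Fin p) ℝ × Matrix.orthogonalGroup (Fin q) ℝ))

@[simp] lemma K.left_mk (A : Matrix.orthogonalGroup (Fin p) ℝ)
    (B : Matrix.orthogonalGroup (Fin q) ℝ) : (K.mk A B).left = A := rfl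

@[simp] lemma K.right_mk (A : Matrix.orthogonalGroup (Fin p) ℝ)
    (B : Matrix.orthogonalGroup (Fin q) ℝ) : (K.mk A B).right = B := rfl

lemma K.mk_mul (A A' : Matrix.orthogonalGroup (Fin p) ℝ) (B B' : Matrix.orthogonalGroup (Fin q) ℝ) :
    K.mk (A * A') (B * B') = K.mk A B * K.mk A' B' := rfl

lemma K.continuous_left : Continuous (K.left : K p q → _) := continuous_fst

lemma K.continuous_right : Continuous (K.right : K p q → _) := continuous_snd

instance compactSpace_orthogonalGroup (n : ℕ) :
    CompactSpace (Matrix.orthogonalGroup (Fin n) ℝ) := by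
  apply isCompact_iff_compactSpace.1
  have hc : IsCompact (X := Matrix (Fin n) (Fin n) ℝ) (Set.pi Set.univ fun _ : Fin n =>
      Set.pi Set.univ fun _ : Fin n => Set.Icc (-1 : ℝ) 1) :=
    isCompact_univ_pi fun _ => isCompact_univ_pi fun _ => isCompact_Icc
  refine hc.of_isClosed_subset ?_ ?_
  · have h : ((Matrix.orthogonalGroup (Fin n) ℝ : Submonoid _) : Set (Matrix (Fin n) (Fin n) ℝ)) =
        {A | A * star A = 1} := by
      ext A
      exact Matrix.mem_unitaryGroup_iff
    rw [h]
    exact isClosed_eq (continuous_id.mul continuous_star) continuous_const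
  · intro A hA i _ j _
    have := entry_norm_bound_of_unitary hA i j
    rw [Real.norm_eq_abs, abs_le] at this
    exact this

instance : CompactSpace (K p q) := inferInstanceAs
  (CompactSpace (Matrix.orthogonalGroup (Fin p) ℝ × Matrix.orthogonalGroup (Fin q) ℝ))

instance secondCountable_matrix (n : ℕ) : SecondCountableTopology (Matrix (Fin n) (Fin n) ℝ) :=
  inferInstanceAs (SecondCountableTopology (Fin n → Fin n → ℝ))

instance secondCountable_orthogonalGroup (n : ℕ) :
    SecondCountableTopology (Matrix.orthogonalGroup (Fin n) ℝ) :=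
  TopologicalSpace.Subtype.secondCountableTopology _

instance : SecondCountableTopology (K p q) := inferInstanceAs
  (SecondCountableTopology (Matrix.orthogonalGroup (Fin p) ℝ × Matrix.orthogonalGroup (Fin q) ℝ))

instance : MeasurableSpace (K p q) := borel _

instance : BorelSpace (K p q) := ⟨rfl⟩

/-- The normalized Haar measure on `O(p) × O(q)`. -/
def haarK (p q : ℕ) : Measure (K p q) := Measure.haarMeasure ⊤

instance : (haarK p q).IsHaarMeasure := by unfold haarK; infer_instance

instance : IsProbabilityMeasure (haarK p q) := ⟨by
  have := Measure.haarMeasure_self (G := K p q) (K₀ := ⊤)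
  simpa [haarK] using this⟩

instance : (haarK p q).IsMulRightInvariant := ⟨fun g => by
  have h1 : (Measure.map (· * g) (haarK p q)).IsHaarMeasure := Measure.isHaarMeasure_map_mul_right _ g
  have h2 : IsProbabilityMeasure (Measure.map (· * g) (haarK p q)) :=
    Measure.isProbabilityMeasure_map (by fun_prop)
  exact Measure.isHaarMeasure_eq_of_isProbabilityMeasure _ _⟩

/-- The action of `O(p) × O(q)` on `ℝ^{p+q}`. -/
def kLin (k : K p q) : V p q ≃ₗ[ℝ] V p q :=
  LinearEquiv.prodCongr (Matrix.UnitaryGroup.toLinearEquiv k.left)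
    (Matrix.UnitaryGroup.toLinearEquiv k.right)

lemma kLin_apply (k : K p q) (w : V p q) :
    kLin k w = (k.left.1.mulVec w.1, k.right.1.mulVec w.2) := rfl

lemma dotProduct_mulVec_orthogonal {n : ℕ} (A : Matrix.orthogonalGroup (Fin n) ℝ)
    (x y : Fin n → ℝ) : A.1.mulVec x ⬝ᵥ A.1.mulVec y = x ⬝ᵥ y := by
  have h : A.1.transpose * A.1 = 1 := Matrix.UnitaryGroup.star_mul_self A
  rw [Matrix.dotProduct_mulVec, Matrix.vecMul_mulVec, ← Matrix.mulVec_transpose, h]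
  simp

lemma form_eq (w w' : V p q) : form w w' = w.1 ⬝ᵥ w'.1 - w.2 ⬝ᵥ w'.2 := rfl

lemma nx_eq (w : V p q) : nx w = w.1 ⬝ᵥ w.1 := by simp [nx, dotProduct, sq]

lemma ny_eq (w : V p q) : ny w = w.2 ⬝ᵥ w.2 := by simp [ny, dotProduct, sq]

/-- The embedding of `O(p) × O(q)` into `O(p,q)`. -/
def kO : K p q →* O p q where
  toFun k := ⟨kLin k, fun w w' => by
    simp only [kLin_apply, form_eq, dotProduct_mulVec_orthogonal]⟩
  map_one' := by
    ext w : 3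
    all_goals simp [kLin_apply, show ((1 : K p q).left.1) = 1 from rfl, show ((1 : K p q).right.1) = 1 from rfl]
  map_mul' k l := by
    apply Subtype.ext
    apply LinearEquiv.ext
    intro w
    change kLin (k * l) w = kLin k (kLin l w)
    simp only [kLin_apply, Matrix.mulVec_mulVec]
    rfl

lemma kO_apply (k : K p q) (w : V p q) :
    (kO k).1 w = (k.left.1.mulVec w.1, k.right.1.mulVec w.2) := rfl

lemma nx_kO (k : K p q) (w : V p q) : nx ((kO k).1 w) = nx w := by
  simp only [nx_eq, kO_apply, dotProduct_mulVec_orthogonal]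

lemma ny_kO (k : K p q) (w : V p q) : ny ((kO k).1 w) = ny w := by
  simp only [ny_eq, kO_apply, dotProduct_mulVec_orthogonal]

lemma move_mul (g h : O p q) (w : cone p q) : move (g * h) w = move g (move h w) := rfl

lemma move_one (w : cone p q) : move 1 w = w := rfl

lemma coe_move (g : O p q) (w : cone p q) : (move g w : V p q) = g.1 w := rfl

lemma move_inv_move (g : O p q) (w : cone p q) : move g⁻¹ (move g w) = w := by
  rw [← move_mul, inv_mul_cancel, move_one]

lemma rho_apply (g : O p q) (f : Fn p q) (w : cone p q) : rho g f w = f (move g⁻¹ w) := rfl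

lemma rho_mul (g h : O p q) (f : Fn p q) : rho (g * h) f = rho g (rho h f) := by
  funext w
  simp only [rho_apply, mul_inv_rev, move_mul]

lemma rho_one (f : Fn p q) : rho 1 f = f := by
  funext w
  rw [rho_apply, inv_one, move_one]

/-- Householder reflections: two vectors of the same length are exchanged by an orthogonal matrix
that fixes everything orthogonal to their difference. -/
lemma exists_orthogonal_mulVec {n : ℕ} (x y : Fin n → ℝ) (h : x ⬝ᵥ x = y ⬝ᵥ y) :
    ∃ A : Matrix.orthogonalGroup (Fin n) ℝ, A.1.mulVec x = y ∧
      ∀ z, (x - y) ⬝ᵥ z = 0 → A.1.mulVec z = z := by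
  by_cases hxy : x = y
  · exact ⟨1, by simp [hxy], fun z _ => by simp⟩
  set v := x - y with hv
  have hv0 : v ⬝ᵥ v ≠ 0 := by
    rw [Ne, dotProduct_self_eq_zero]
    exact sub_ne_zero.2 hxy
  have hvx : 2 * (v ⬝ᵥ x) = v ⬝ᵥ v := by
    simp only [hv, sub_dotProduct, dotProduct_sub]
    rw [dotProduct_comm x y]
    linarith
  let A : Matrix (Fin n) (Fin n) ℝ := 1 - (2 / (v ⬝ᵥ v)) • Matrix.vecMulVec v v
  have hA : ∀ z, A.mulVec z = z - (2 * (v ⬝ᵥ z) / (v ⬝ᵥ v)) • v := by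
    intro z
    simp only [A, Matrix.sub_mulVec, Matrix.one_mulVec, Matrix.smul_mulVec]
    congr 1
    ext i
    simp only [Matrix.mulVec, Matrix.vecMulVec, dotProduct, Pi.smul_apply, smul_eq_mul,
      Matrix.of_apply, Finset.mul_sum, Finset.sum_mul, Finset.sum_div]
    refine Finset.sum_congr rfl fun j _ => ?_
    ring
  have hAA : A * A = 1 := by
    apply Matrix.toLin'.injective
    ext1 i
    ext1
    simp only [Matrix.toLin'_mul, LinearMap.comp_apply, Matrix.toLin'_apply, hA,
      Matrix.toLin'_one, LinearMap.id_apply, LinearMap.coe_single, dotProduct_sub,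
      dotProduct_smul, smul_eq_mul]
    rw [div_mul_cancel₀ _ hv0, sub_sub, ← add_smul]
    rw [show ∀ c : ℝ, 2 * c / (v ⬝ᵥ v) + 2 * (c - 2 * c) / (v ⬝ᵥ v) = 0 from fun c => by ring]
    simp
  have hAt : star A = A := by
    ext i j
    simp [A, Matrix.vecMulVec_apply, Matrix.one_apply, eq_comm,
      mul_comm (v i)]
  refine ⟨⟨A, ?_⟩, ?_, ?_⟩
  · rw [Matrix.mem_unitaryGroup_iff, hAt, hAA]
  · change A.mulVec x = y
    rw [hA, hvx, div_self hv0, one_smul, hv]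
    abel
  · intro z hz
    change A.mulVec z = z
    rw [hA, hz]
    simp

lemma continuous_kO_apply : Continuous fun z : K p q × V p q => (kO z.1).1 z.2 := by
  simp only [kO_apply]
  have h1 : Continuous fun z : K p q × V p q => z.1.left.1 :=
    continuous_subtype_val.comp (K.continuous_left.comp continuous_fst)
  have h2 : Continuous fun z : K p q × V p q => z.1.right.1 :=
    continuous_subtype_val.comp (K.continuous_right.comp continuous_fst)
  exact (h1.matrix_mulVec (continuous_fst.comp continuous_snd)).prodMk
    (h2.matrix_mulVec (continuous_snd.comp continuous_snd))

lemma isCompact_spheres : IsCompact (spheres p q) := by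
  have hc : IsCompact ((Set.pi Set.univ fun _ : Fin p => Set.Icc (-1 : ℝ) 1) ×ˢ
      (Set.pi Set.univ fun _ : Fin q => Set.Icc (-1 : ℝ) 1)) :=
    (isCompact_univ_pi fun _ => isCompact_Icc).prod (isCompact_univ_pi fun _ => isCompact_Icc)
  refine hc.of_isClosed_subset ?_ ?_
  · have h1 : Continuous fun w : V p q => ∑ j, w.1 j ^ 2 := by fun_prop
    have h2 : Continuous fun w : V p q => ∑ j, w.2 j ^ 2 := by fun_prop
    exact (isClosed_eq h1 continuous_const).inter (isClosed_eq h2 continuous_const)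
  · rintro w ⟨h1, h2⟩
    refine ⟨fun i _ => ?_, fun i _ => ?_⟩
    · have := Finset.single_le_sum (f := fun j => w.1 j ^ 2) (fun _ _ => sq_nonneg _)
        (Finset.mem_univ i)
      rw [h1] at this
      exact ⟨by nlinarith, by nlinarith⟩
    · have := Finset.single_le_sum (f := fun j => w.2 j ^ 2) (fun _ _ => sq_nonneg _)
        (Finset.mem_univ i)
      rw [h2] at this
      exact ⟨by nlinarith, by nlinarith⟩

variable [NeZero p] [NeZero q]

/-- The base point `(e₀, e₀)` of the light cone. -/
def base (p q : ℕ) [NeZero p] [NeZero q] : V p q := (Pi.single 0 1, Pi.single 0 1)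

lemma base_mem_spheres : base p q ∈ spheres p q := by
  rw [mem_spheres, nx_eq, ny_eq]
  simp [base]

/-- The orbit map of the base point. -/
def pt (k : K p q) : cone p q := move (kO k) ⟨base p q, spheres_subset_cone base_mem_spheres⟩

lemma coe_pt (k : K p q) : (pt k : V p q) = (kO k).1 (base p q) := rfl

lemma pt_mul (k l : K p q) : pt (k * l) = move (kO k) (pt l) := by
  rw [pt, map_mul, move_mul]; rfl

lemma pt_mem_spheres (k : K p q) : (pt k : V p q) ∈ spheres p q := by
  rw [mem_spheres, coe_pt, nx_kO, ny_kO]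
  exact mem_spheres.1 base_mem_spheres

lemma exists_pt {w : V p q} (hw : w ∈ spheres p q) : ∃ k : K p q, (pt k : V p q) = w := by
  have h0 := mem_spheres.1 (base_mem_spheres (p := p) (q := q))
  have hw' := mem_spheres.1 hw
  rw [nx_eq, ny_eq] at h0 hw'
  obtain ⟨A, hA, -⟩ := exists_orthogonal_mulVec (base p q).1 w.1 (h0.1.trans hw'.1.symm)
  obtain ⟨B, hB, -⟩ := exists_orthogonal_mulVec (base p q).2 w.2 (h0.2.trans hw'.2.symm)
  exact ⟨K.mk A B, Prod.ext hA hB⟩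

lemma continuous_pt : Continuous (pt : K p q → cone p q) := by
  have h : Continuous fun k : K p q => (kO k).1 (base p q) :=
    Continuous.comp (g := fun z : K p q × V p q => (kO z.1).1 z.2)
      (f := fun k : K p q => (k, base p q)) continuous_kO_apply
      (continuous_id.prodMk continuous_const)
  exact continuous_induced_rng.2 h

end

section

variable {p q : ℕ}

/-! ### One-parameter subgroups -/

/-- A smooth one-parameter subgroup of `O(p,q)` and its infinitesimal generator. -/
structure Flow (p q : ℕ) where
  g : ℝ → O p q
  X : V p q →ₗ[ℝ] V p q
  add : ∀ s t, g (s + t) = g s * g t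
  smooth : ContDiff ℝ ∞ fun z : ℝ × V p q => (g z.1).1 z.2
  deriv_zero : ∀ w, HasDerivAt (fun t => (g t).1 w) (X w) 0

namespace Flow

lemma zero (φ : Flow p q) : φ.g 0 = 1 := by
  have := φ.add 0 0
  rw [add_zero] at this
  exact left_eq_mul.1 this

lemma neg (φ : Flow p q) (t : ℝ) : φ.g (-t) = (φ.g t)⁻¹ := by
  rw [eq_inv_iff_mul_eq_one, ← φ.add, neg_add_cancel, φ.zero]

lemma hasDerivAt (φ : Flow p q) (t : ℝ) (w : V p q) :
    HasDerivAt (fun t => (φ.g t).1 w) (φ.X ((φ.g t).1 w)) t := by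
  have h := φ.deriv_zero ((φ.g t).1 w)
  have h2 : HasDerivAt (fun s : ℝ => s - t) 1 t := (hasDerivAt_id t).sub_const t
  have h3 := HasDerivAt.scomp_of_eq t h h2 (sub_self t).symm
  rw [one_smul] at h3
  refine h3.congr_of_eventuallyEq (Filter.Eventually.of_forall fun s => ?_)
  have : φ.g s = φ.g (s - t) * φ.g t := by rw [← φ.add, sub_add_cancel]
  simp only [Function.comp, this]
  rfl

end Flow

section Rotation

variable {R : Type*} [Ring R] [Algebra ℝ R]

/-- The one-parameter group `exp (tA)` when `A ^ 3 = -A`. -/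
def rot (A : R) (t : ℝ) : R := 1 + Real.sin t • A + (1 - Real.cos t) • (A * A)

/-- The one-parameter group `exp (tA)` when `A ^ 3 = A`. -/
def hyp (A : R) (t : ℝ) : R := 1 + Real.sinh t • A + (Real.cosh t - 1) • (A * A)

lemma rot_zero (A : R) : rot A 0 = 1 := by simp [rot]

lemma hyp_zero (A : R) : hyp A 0 = 1 := by simp [hyp]

lemma rot_add {A : R} (hA : A * (A * A) = -A) (s t : ℝ) : rot A (s + t) = rot A s * rot A t := by
  have h2 : A * A * A = -A := by rw [mul_assoc, hA]
  have h4 : A * A * (A * A) = -(A * A) := by rw [mul_assoc, hA, mul_neg]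
  simp only [rot, mul_add, add_mul, one_mul, mul_one, mul_smul_comm,
    smul_mul_assoc, hA, h2, h4, Real.sin_add, Real.cos_add]
  module

lemma hyp_add {A : R} (hA : A * (A * A) = A) (s t : ℝ) : hyp A (s + t) = hyp A s * hyp A t := by
  have h2 : A * A * A = A := by rw [mul_assoc, hA]
  have h4 : A * A * (A * A) = A * A := by rw [mul_assoc, hA]
  simp only [hyp, mul_add, add_mul, one_mul, mul_one, mul_smul_comm,
    smul_mul_assoc, hA, h2, h4, Real.sinh_add, Real.cosh_add]
  module

end Rotation

/-- The generator of the rotations in the plane of the coordinates `k`, `l`. -/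
def rotGen {n : ℕ} (k l : Fin n) : Matrix (Fin n) (Fin n) ℝ :=
  Matrix.single l k 1 - Matrix.single k l 1

lemma rotGen_mulVec {n : ℕ} (k l : Fin n) (x : Fin n → ℝ) :
    (rotGen k l).mulVec x = x k • Pi.single l 1 - x l • Pi.single k 1 := by
  ext i
  simp [rotGen, Matrix.sub_mulVec, Matrix.single_mulVec, Function.update_apply, Pi.single_apply]

lemma rotGen_cube {n : ℕ} (k l : Fin n) :
    rotGen k l * (rotGen k l * rotGen k l) = -rotGen k l := by
  by_cases h : k = l
  · simp [rotGen, h]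
  · simp [rotGen, mul_sub, sub_mul, h, Ne.symm h]
    abel

lemma rotGen_transpose {n : ℕ} (k l : Fin n) : (rotGen k l).transpose = -rotGen k l := by
  simp [rotGen]

/-- Rotation by the angle `t` in the plane of the coordinates `k`, `l`. -/
def rotMat {n : ℕ} (k l : Fin n) (t : ℝ) : Matrix.orthogonalGroup (Fin n) ℝ :=
  ⟨rot (rotGen k l) t, by
    have h : star (rot (rotGen k l) t) = rot (rotGen k l) (-t) := by
      change (rot (rotGen k l) t).transpose = _
      simp [rot, Matrix.transpose_add, Matrix.transpose_smul, Matrix.transpose_mul,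
        rotGen_transpose]
    rw [Matrix.mem_unitaryGroup_iff, h, ← rot_add (rotGen_cube k l), add_neg_cancel, rot_zero]⟩

lemma rotMat_mulVec {n : ℕ} (k l : Fin n) (t : ℝ) (x : Fin n → ℝ) :
    (rotMat k l t).1.mulVec x = x + Real.sin t • (rotGen k l).mulVec x +
      (1 - Real.cos t) • (rotGen k l).mulVec ((rotGen k l).mulVec x) := by
  simp [rotMat, rot, Matrix.add_mulVec, Matrix.smul_mulVec]

lemma rotMat_add {n : ℕ} (k l : Fin n) (s t : ℝ) :
    rotMat k l (s + t) = rotMat k l s * rotMat k l t :=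
  Subtype.ext (rot_add (rotGen_cube k l) s t)

lemma hasDerivAt_rotMat {n : ℕ} (k l : Fin n) (x : Fin n → ℝ) :
    HasDerivAt (fun t => (rotMat k l t).1.mulVec x) ((rotGen k l).mulVec x) 0 := by
  simp only [rotMat_mulVec]
  have h := (((Real.hasDerivAt_sin 0).smul_const ((rotGen k l).mulVec x)).const_add x).add
    (((Real.hasDerivAt_cos 0).const_sub 1).smul_const
      ((rotGen k l).mulVec ((rotGen k l).mulVec x)))
  exact h.congr_deriv (by simp)

lemma contDiff_rotMat {n : ℕ} (k l : Fin n) :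
    ContDiff ℝ ∞ fun z : ℝ × (Fin n → ℝ) => (rotMat k l z.1).1.mulVec z.2 := by
  simp only [rotMat_mulVec]
  have hl : ContDiff ℝ ∞ fun x : Fin n → ℝ => (rotGen k l).mulVec x :=
    (Matrix.mulVecLin (rotGen k l)).toContinuousLinearMap.contDiff
  have hs : ContDiff ℝ ∞ fun z : ℝ × (Fin n → ℝ) => Real.sin z.1 := Real.contDiff_sin.comp contDiff_fst
  have hc : ContDiff ℝ ∞ fun z : ℝ × (Fin n → ℝ) => Real.cos z.1 := Real.contDiff_cos.comp contDiff_fst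
  exact (contDiff_snd.add (hs.smul (hl.comp contDiff_snd))).add
    ((contDiff_const.sub hc).smul (hl.comp (hl.comp contDiff_snd)))

/-- Rotations in the first factor. -/
def rotX (p q : ℕ) (k l : Fin p) : Flow p q where
  g t := kO (K.mk (rotMat k l t) 1)
  X := ((Matrix.mulVecLin (rotGen k l)).prodMap 0)
  add s t := by
    rw [← map_mul, rotMat_add, ← K.mk_mul, mul_one]
  smooth := by
    have h : (fun z : ℝ × V p q => (kO (K.mk (rotMat k l z.1) 1)).1 z.2) =
        fun z => ((rotMat k l z.1).1.mulVec z.2.1, z.2.2) := by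
      funext z
      simp [kO_apply]
    rw [h]
    refine ContDiff.prodMk ?_ (by fun_prop)
    exact ContDiff.comp (g := fun z : ℝ × (Fin p → ℝ) => (rotMat k l z.1).1.mulVec z.2)
      (f := fun z : ℝ × V p q => (z.1, z.2.1)) (contDiff_rotMat k l) (by fun_prop)
  deriv_zero w := by
    have h : (fun t : ℝ => (kO (K.mk (q := q) (rotMat k l t) 1)).1 w) =
        fun t => ((rotMat k l t).1.mulVec w.1, w.2) := by
      funext z
      simp [kO_apply]
    rw [h]
    exact HasDerivAt.prodMk (hasDerivAt_rotMat k l w.1) (hasDerivAt_const _ _)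

/-- Rotations in the second factor. -/
def rotY (p q : ℕ) (k l : Fin q) : Flow p q where
  g t := kO (K.mk 1 (rotMat k l t))
  X := (LinearMap.prodMap 0 (Matrix.mulVecLin (rotGen k l)))
  add s t := by
    rw [← map_mul, rotMat_add, ← K.mk_mul, mul_one]
  smooth := by
    have h : (fun z : ℝ × V p q => (kO (K.mk 1 (rotMat k l z.1))).1 z.2) =
        fun z => (z.2.1, (rotMat k l z.1).1.mulVec z.2.2) := by
      funext z
      simp [kO_apply]
    rw [h]
    refine ContDiff.prodMk (by fun_prop) ?_
    exact ContDiff.comp (g := fun z : ℝ × (Fin q → ℝ) => (rotMat k l z.1).1.mulVec z.2)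
      (f := fun z : ℝ × V p q => (z.1, z.2.2)) (contDiff_rotMat k l) (by fun_prop)
  deriv_zero w := by
    have h : (fun t : ℝ => (kO (K.mk (p := p) 1 (rotMat k l t))).1 w) =
        fun t => (w.1, (rotMat k l t).1.mulVec w.2) := by
      funext z
      simp [kO_apply]
    rw [h]
    exact HasDerivAt.prodMk (hasDerivAt_const _ _) (hasDerivAt_rotMat k l w.2)

lemma rotX_X (k l : Fin p) (w : V p q) :
    (rotX p q k l).X w = (w.1 k • Pi.single l 1 - w.1 l • Pi.single k 1, 0) := by
  simp [rotX, rotGen_mulVec]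

lemma rotY_X (k l : Fin q) (w : V p q) :
    (rotY p q k l).X w = (0, w.2 k • Pi.single l 1 - w.2 l • Pi.single k 1) := by
  simp [rotY, rotGen_mulVec]

/-- The generator of the boosts in the plane of the coordinates `x_i`, `y_j`. -/
def boostGen (i : Fin p) (j : Fin q) : Module.End ℝ (V p q) where
  toFun w := (Pi.single i (w.2 j), Pi.single j (w.1 i))
  map_add' u v := by ext <;> simp [Pi.single_add]
  map_smul' c v := by ext <;> simp [Pi.single_apply]

lemma boostGen_apply (i : Fin p) (j : Fin q) (w : V p q) :
    boostGen i j w = (Pi.single i (w.2 j), Pi.single j (w.1 i)) := rfl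

lemma boostGen_cube (i : Fin p) (j : Fin q) :
    boostGen i j * (boostGen i j * boostGen i j) = boostGen i j := by
  apply LinearMap.ext
  intro w
  simp [boostGen_apply]

/-- The boost with parameter `t` in the plane of the coordinates `x_i`, `y_j`. -/
def boostLin (i : Fin p) (j : Fin q) (t : ℝ) : V p q ≃ₗ[ℝ] V p q :=
  LinearEquiv.ofLinearMap (hyp (boostGen i j) t) (hyp (boostGen i j) (-t))
    (by rw [← Module.End.mul_eq_comp, ← hyp_add (boostGen_cube i j), add_neg_cancel, hyp_zero]; rfl)
    (by rw [← Module.End.mul_eq_comp, ← hyp_add (boostGen_cube i j), neg_add_cancel, hyp_zero]; rfl)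

lemma boostLin_apply (i : Fin p) (j : Fin q) (t : ℝ) (w : V p q) :
    boostLin i j t w = w + Real.sinh t • boostGen i j w +
      (Real.cosh t - 1) • boostGen i j (boostGen i j w) := by
  simp [boostLin, hyp]

lemma boostLin_apply' (i : Fin p) (j : Fin q) (t : ℝ) (w : V p q) :
    boostLin i j t w = (w.1 + Pi.single i (Real.sinh t * w.2 j + (Real.cosh t - 1) * w.1 i),
      w.2 + Pi.single j (Real.sinh t * w.1 i + (Real.cosh t - 1) * w.2 j)) := by
  rw [boostLin_apply]
  simp only [boostGen_apply, Pi.single_eq_same]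
  ext k
  · simp only [Prod.fst_add, Prod.smul_fst, Pi.add_apply, Pi.smul_apply, Pi.single_apply, smul_eq_mul]
    split_ifs <;> ring
  · simp only [Prod.snd_add, Prod.smul_snd, Pi.add_apply, Pi.smul_apply, Pi.single_apply, smul_eq_mul]
    split_ifs <;> ring

lemma form_boostLin (i : Fin p) (j : Fin q) (t : ℝ) (w w' : V p q) :
    form (boostLin i j t w) (boostLin i j t w') = form w w' := by
  rw [form_eq, form_eq, boostLin_apply', boostLin_apply']
  simp only [add_dotProduct, dotProduct_add, single_dotProduct, dotProduct_single, Pi.add_apply,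
    Pi.single_eq_same]
  have := Real.cosh_sq t
  linear_combination (w.1 i * w'.1 i - w.2 j * w'.2 j) * this

/-- The boosts in the plane of the coordinates `x_i`, `y_j`. -/
def boost (i : Fin p) (j : Fin q) : Flow p q where
  g t := ⟨boostLin i j t, form_boostLin i j t⟩
  X := boostGen i j
  add s t := by
    apply Subtype.ext
    apply LinearEquiv.ext
    intro w
    exact congrArg (fun f : Module.End ℝ (V p q) => f w) (hyp_add (boostGen_cube i j) s t)
  smooth := by
    simp only [boostLin_apply]
    have hl : ContDiff ℝ ∞ fun x : V p q => boostGen i j x :=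
      (LinearMap.toContinuousLinearMap (boostGen i j : V p q →ₗ[ℝ] V p q)).contDiff
    have hs : ContDiff ℝ ∞ fun z : ℝ × V p q => Real.sinh z.1 :=
      Real.contDiff_sinh.comp contDiff_fst
    have hc : ContDiff ℝ ∞ fun z : ℝ × V p q => Real.cosh z.1 :=
      Real.contDiff_cosh.comp contDiff_fst
    exact (contDiff_snd.add (hs.smul (hl.comp contDiff_snd))).add
      ((hc.sub contDiff_const).smul (hl.comp (hl.comp contDiff_snd)))
  deriv_zero w := by
    simp only [boostLin_apply]
    have h := (((Real.hasDerivAt_sinh 0).smul_const (boostGen i j w)).const_add w).add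
      (((Real.hasDerivAt_cosh 0).sub_const 1).smul_const (boostGen i j (boostGen i j w)))
    exact h.congr_deriv (by simp)

/-! ### The module `S^a(X⁰)` and operators on it -/

/-- The module `S^a(X⁰)` for real `a`, as a type. -/
def HS (p q : ℕ) (a : ℝ) : Type := S p q (a : ℂ)

variable {a : ℝ}

instance : AddCommGroup (HS p q a) := inferInstanceAs (AddCommGroup (S p q (a : ℂ)))

instance : Module ℂ (HS p q a) := inferInstanceAs (Module ℂ (S p q (a : ℂ)))

/-- The function on the light cone underlying an element of `S^a(X⁰)`. -/
def HS.fn (f : HS p q a) : Fn p q := (S p q (a : ℂ)).subtype f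

/-- An element of `S^a(X⁰)` from a function. -/
def HS.mk (f : Fn p q) (hf : f ∈ S p q (a : ℂ)) : HS p q a := (⟨f, hf⟩ : S p q (a : ℂ))

instance : CoeFun (HS p q a) fun _ => cone p q → ℂ := ⟨HS.fn⟩

/-- The inclusion of `S^a(X⁰)` in the space of all functions. -/
def toFn (p q : ℕ) (a : ℝ) : HS p q a →ₗ[ℂ] Fn p q := (S p q (a : ℂ)).subtype

lemma HS.mem (f : HS p q a) : f.fn ∈ S p q (a : ℂ) := Subtype.prop (p := (· ∈ S p q (a : ℂ))) f

lemma HS.fn_injective : Function.Injective (HS.fn : HS p q a → Fn p q) := Subtype.val_injective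

lemma HS.ext {f g : HS p q a} (h : ∀ w, f w = g w) : f = g := HS.fn_injective (funext h)

lemma HS.add_apply (f g : HS p q a) (w : cone p q) : (f + g) w = f w + g w := rfl

lemma HS.sub_apply (f g : HS p q a) (w : cone p q) : (f - g) w = f w - g w := rfl

lemma HS.neg_apply (f : HS p q a) (w : cone p q) : (-f) w = -f w := rfl

lemma HS.zero_apply (w : cone p q) : (0 : HS p q a) w = 0 := rfl

lemma HS.smul_apply (c : ℂ) (f : HS p q a) (w : cone p q) : (c • f) w = c * f w := rfl

lemma HS.sum_apply {ι : Type*} (s : Finset ι) (f : ι → HS p q a) (w : cone p q) :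
    (∑ i ∈ s, f i) w = ∑ i ∈ s, f i w := by
  have : (∑ i ∈ s, f i).fn = ∑ i ∈ s, (f i).fn := map_sum (toFn p q a) f s
  rw [this, Finset.sum_apply]

lemma HS.smooth (f : HS p q a) : Smooth f.fn := f.mem.1

lemma Smooth.continuous {f : Fn p q} (hf : Smooth f) : Continuous f := by
  obtain ⟨F, hF, h⟩ := hf
  have : f = fun w : cone p q => F w := funext fun w => (h w).symm
  rw [this]
  exact hF.continuousOn.comp_continuous continuous_subtype_val fun w => w.2.1

lemma HS.continuous (f : HS p q a) : Continuous f.fn := f.smooth.continuous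

lemma HS.homogeneous (f : HS p q a) {t : ℝ} {w w' : cone p q} (ht : 0 < t)
    (h : (w' : V p q) = t • (w : V p q)) : f w' = (t : ℂ) ^ (a : ℂ) * f w := f.mem.2 t w w' ht h

lemma isOpen_ne_zero : IsOpen ({0}ᶜ : Set (V p q)) := isOpen_compl_singleton

lemma Smooth.rho {f : Fn p q} (hf : Smooth f) (g : O p q) : Smooth (rho g f) := by
  obtain ⟨F, hF, h⟩ := hf
  refine ⟨fun w => F (g⁻¹.1 w), ?_, fun w => h (move g⁻¹ w)⟩
  refine hF.comp ((g⁻¹.1 : V p q →ₗ[ℝ] V p q).toContinuousLinearMap.contDiff.contDiffOn) ?_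
  intro w hw h0
  exact hw ((g⁻¹.1).map_eq_zero_iff.1 h0)

/-- The action of `O(p,q)` on `S^a(X⁰)`. -/
def rhoS (g : O p q) : HS p q a →ₗ[ℂ] HS p q a where
  toFun f := HS.mk (rho g f.fn) ⟨f.smooth.rho g, fun t w w' ht h => by
    refine f.homogeneous ht ?_
    rw [coe_move, coe_move, h, map_smul]⟩
  map_add' _ _ := rfl
  map_smul' _ _ := rfl

lemma rhoS_apply (g : O p q) (f : HS p q a) (w : cone p q) : rhoS g f w = f (move g⁻¹ w) := rfl

lemma rhoS_mul (g h : O p q) (f : HS p q a) : rhoS (g * h) f = rhoS g (rhoS h f) :=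
  HS.fn_injective (rho_mul g h f.fn)

lemma rhoS_one (f : HS p q a) : rhoS 1 f = f := HS.fn_injective (rho_one f.fn)

/-- The derivative of a function on the light cone along a one-parameter group. -/
def lieFn (φ : Flow p q) (f : Fn p q) : Fn p q := fun w => deriv (fun t => f (move (φ.g t) w)) 0

lemma hasDerivAt_flow_of_ext (φ : Flow p q) {f : Fn p q} {F : V p q → ℂ}
    (hF : ContDiffOn ℝ ∞ F {0}ᶜ) (h : ∀ w : cone p q, F w = f w) (w : cone p q) :
    HasDerivAt (fun t => f (move (φ.g t) w)) (fderiv ℝ F w (φ.X w)) 0 := by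
  have h1 : HasFDerivAt F (fderiv ℝ F w) ((φ.g 0).1 (w : V p q)) := by
    rw [φ.zero]
    exact ((hF.contDiffAt (isOpen_ne_zero.mem_nhds w.2.1)).differentiableAt (by simp)).hasFDerivAt
  have h2 := h1.comp_hasDerivAt (0 : ℝ) (φ.deriv_zero w)
  refine h2.congr_of_eventuallyEq (Filter.Eventually.of_forall fun t => ?_)
  exact (h _).symm

lemma lieFn_eq_of_ext (φ : Flow p q) {f : Fn p q} {F : V p q → ℂ}
    (hF : ContDiffOn ℝ ∞ F {0}ᶜ) (h : ∀ w : cone p q, F w = f w) (w : cone p q) :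
    lieFn φ f w = fderiv ℝ F w (φ.X w) := (hasDerivAt_flow_of_ext φ hF h w).deriv

lemma Smooth.hasDerivAt_flow_zero {f : Fn p q} (hf : Smooth f) (φ : Flow p q) (w : cone p q) :
    HasDerivAt (fun t => f (move (φ.g t) w)) (lieFn φ f w) 0 := by
  obtain ⟨F, hF, h⟩ := hf
  rw [lieFn_eq_of_ext φ hF h]
  exact hasDerivAt_flow_of_ext φ hF h w

lemma Smooth.hasDerivAt_flow {f : Fn p q} (hf : Smooth f) (φ : Flow p q) (w : cone p q) (t : ℝ) :
    HasDerivAt (fun t => f (move (φ.g t) w)) (lieFn φ f (move (φ.g t) w)) t := by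
  have h := hf.hasDerivAt_flow_zero φ (move (φ.g t) w)
  have h2 : HasDerivAt (fun s : ℝ => s - t) 1 t := (hasDerivAt_id t).sub_const t
  have h3 := HasDerivAt.scomp_of_eq t h h2 (sub_self t).symm
  rw [one_smul] at h3
  refine h3.congr_of_eventuallyEq (Filter.Eventually.of_forall fun s => ?_)
  simp only [Function.comp, ← move_mul, ← φ.add, sub_add_cancel]

lemma Smooth.lie {f : Fn p q} (hf : Smooth f) (φ : Flow p q) : Smooth (lieFn φ f) := by
  obtain ⟨F, hF, h⟩ := hf
  refine ⟨fun w => fderiv ℝ F w (φ.X w), ?_, fun w => (lieFn_eq_of_ext φ hF h w).symm⟩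
  have h1 : ContDiffOn ℝ ∞ (fderiv ℝ F) {0}ᶜ := hF.fderiv_of_isOpen isOpen_ne_zero (by simp)
  exact h1.clm_apply φ.X.toContinuousLinearMap.contDiff.contDiffOn

/-- The infinitesimal action of a one-parameter subgroup on `S^a(X⁰)`. -/
def lie (φ : Flow p q) : HS p q a →ₗ[ℂ] HS p q a where
  toFun f := HS.mk (lieFn φ f.fn) ⟨f.smooth.lie φ, fun t w w' ht h => by
    have h1 := (f.smooth.hasDerivAt_flow_zero φ w).const_mul ((t : ℂ) ^ (a : ℂ))
    refine HasDerivAt.deriv (h1.congr_of_eventuallyEq (Filter.Eventually.of_forall fun s => ?_))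
    refine f.homogeneous ht ?_
    rw [coe_move, coe_move, h, map_smul]⟩
  map_add' f g := HS.ext fun w =>
    ((f.smooth.hasDerivAt_flow_zero φ w).add (g.smooth.hasDerivAt_flow_zero φ w)).deriv
  map_smul' c f := HS.ext fun w => ((f.smooth.hasDerivAt_flow_zero φ w).const_mul c).deriv

lemma lie_apply (φ : Flow p q) (f : HS p q a) (w : cone p q) : lie φ f w = lieFn φ f.fn w := rfl

lemma hasDerivAt_flow (φ : Flow p q) (f : HS p q a) (w : cone p q) (t : ℝ) :
    HasDerivAt (fun t => f (move (φ.g t) w)) (lie φ f (move (φ.g t) w)) t :=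
  f.smooth.hasDerivAt_flow φ w t

lemma hasDerivAt_flow_zero (φ : Flow p q) (f : HS p q a) (w : cone p q) :
    HasDerivAt (fun t => f (move (φ.g t) w)) (lie φ f w) 0 := f.smooth.hasDerivAt_flow_zero φ w

/-- Multiplication by a smooth function on the light cone that is homogeneous of degree `0`. -/
def mulS (m : Fn p q) (hm : m ∈ S p q 0) : HS p q a →ₗ[ℂ] HS p q a where
  toFun f := HS.mk (fun w => m w * f w) ⟨by
    obtain ⟨G, hG, hGm⟩ := hm.1
    obtain ⟨F, hF, hFf⟩ := f.smooth
    exact ⟨fun w => G w * F w, hG.mul hF, fun w => congrArg₂ _ (hGm w) (hFf w)⟩,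
    fun t w w' ht h => by
      change m w' * f w' = _ * (m w * f w)
      rw [f.homogeneous ht h, hm.2 t w w' ht h, Complex.cpow_zero]
      ring⟩
  map_add' _ _ := HS.ext fun _ => mul_add _ _ _
  map_smul' _ _ := HS.ext fun _ => mul_left_comm _ _ _

lemma mulS_apply (m : Fn p q) (hm : m ∈ S p q 0) (f : HS p q a) (w : cone p q) :
    mulS m hm f w = m w * f w := rfl

lemma contDiff_nx : ContDiff ℝ ∞ (nx : V p q → ℝ) := by
  unfold nx
  fun_prop

lemma contDiff_ny : ContDiff ℝ ∞ (ny : V p q → ℝ) := by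
  unfold ny
  fun_prop

/-- The function `x_i / |x|` on the light cone. -/
def mx (q : ℕ) (i : Fin p) : Fn p q := fun w => ((w.1.1 i / √(nx w.1) : ℝ) : ℂ)

/-- The function `y_j / |y|` on the light cone. -/
def my (p : ℕ) (j : Fin q) : Fn p q := fun w => ((w.1.2 j / √(nx w.1) : ℝ) : ℂ)

lemma nx_smul (t : ℝ) (w : V p q) : nx (t • w) = t ^ 2 * nx w := by
  simp [nx, mul_pow, Finset.mul_sum]

lemma smooth_div_sqrt {ℓ : V p q → ℝ} (hℓ : ContDiff ℝ ∞ ℓ) :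
    Smooth (fun w : cone p q => ((ℓ w / √(nx w.1) : ℝ) : ℂ)) := by
  refine ⟨fun w => ((ℓ w / √((nx w + ny w) / 2) : ℝ) : ℂ), ?_, fun w => ?_⟩
  · refine Complex.ofRealCLM.contDiff.comp_contDiffOn ?_
    have h1 : ContDiffOn ℝ ∞ (fun w : V p q => √((nx w + ny w) / 2)) {0}ᶜ := by
      refine ContDiffOn.sqrt ?_ fun w hw => ?_
      · exact ((contDiff_nx.add contDiff_ny).div_const 2).contDiffOn
      · have := nx_add_ny_pos hw
        positivity
    refine hℓ.contDiffOn.div h1 fun w hw => ?_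
    have := nx_add_ny_pos hw
    positivity
  · simp only [← cone_eq w, add_self_div_two]

lemma mx_mem (i : Fin p) : mx q i ∈ S p q 0 := by
  refine ⟨smooth_div_sqrt (ℓ := fun w => w.1 i) (by fun_prop), fun t w w' ht h => ?_⟩
  simp only [mx, h, nx_smul, Complex.cpow_zero, one_mul]
  rw [Real.sqrt_mul (sq_nonneg t), Real.sqrt_sq ht.le]
  congr 1
  simp only [Prod.smul_fst, Pi.smul_apply, smul_eq_mul]
  rw [mul_div_mul_left _ _ ht.ne']

lemma my_mem (j : Fin q) : my p j ∈ S p q 0 := by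
  refine ⟨smooth_div_sqrt (ℓ := fun w => w.2 j) (by fun_prop), fun t w w' ht h => ?_⟩
  simp only [my, h, nx_smul, Complex.cpow_zero, one_mul]
  rw [Real.sqrt_mul (sq_nonneg t), Real.sqrt_sq ht.le]
  congr 1
  simp only [Prod.smul_snd, Pi.smul_apply, smul_eq_mul]
  rw [mul_div_mul_left _ _ ht.ne']

/-- Multiplication by `x_i / |x|`. -/
def Mx (i : Fin p) : Module.End ℂ (HS p q a) := mulS (mx q i) (mx_mem i)

/-- Multiplication by `y_j / |y|`. -/
def My (j : Fin q) : Module.End ℂ (HS p q a) := mulS (my p j) (my_mem j)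

/-- The infinitesimal rotations in the first factor. -/
def Lx (k l : Fin p) : Module.End ℂ (HS p q a) := lie (rotX p q k l)

/-- The infinitesimal rotations in the second factor. -/
def Ly (k l : Fin q) : Module.End ℂ (HS p q a) := lie (rotY p q k l)

/-- The infinitesimal boosts. -/
def Db (i : Fin p) (j : Fin q) : Module.End ℂ (HS p q a) := lie (boost i j)

end

section

variable {p q : ℕ} {a : ℝ}

/-! ### One-parameter groups of operators -/

lemma continuous_flow (φ : Flow p q) :
    Continuous fun z : ℝ × cone p q => move (φ.g z.1) z.2 := by
  have h : Continuous fun z : ℝ × cone p q => (φ.g z.1).1 (z.2 : V p q) :=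
    Continuous.comp (g := fun z : ℝ × V p q => (φ.g z.1).1 z.2)
      (f := fun z : ℝ × cone p q => (z.1, (z.2 : V p q))) φ.smooth.continuous
      (continuous_fst.prodMk (continuous_subtype_val.comp continuous_snd))
  exact continuous_induced_rng.2 h

/-- The action of a one-parameter group on `S^a(X⁰)`: `f ↦ f ∘ γ_t`. -/
def flowS (φ : Flow p q) (t : ℝ) : HS p q a →ₗ[ℂ] HS p q a := rhoS (φ.g (-t))

lemma flowS_apply (φ : Flow p q) (t : ℝ) (f : HS p q a) (w : cone p q) :
    flowS φ t f w = f (move (φ.g t) w) := by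
  rw [flowS, rhoS_apply, ← φ.neg, neg_neg]

lemma flowS_zero (φ : Flow p q) (f : HS p q a) : flowS φ 0 f = f :=
  HS.ext fun w => by rw [flowS_apply, φ.zero, move_one]

lemma flowS_add (φ : Flow p q) (s t : ℝ) (f : HS p q a) :
    flowS φ (s + t) f = flowS φ s (flowS φ t f) :=
  HS.ext fun w => by simp only [flowS_apply, ← move_mul, ← φ.add, add_comm s t]

lemma lie_flowS (φ : Flow p q) (t : ℝ) (f : HS p q a) :
    lie φ (flowS φ t f) = flowS φ t (lie φ f) := by
  refine HS.ext fun w => ?_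
  have h := hasDerivAt_flow_zero φ (flowS φ t f) w
  have h1 := hasDerivAt_flow φ f w t
  have h2 : HasDerivAt (fun s : ℝ => s + t) 1 0 := (hasDerivAt_id _).add_const t
  have h3 := HasDerivAt.scomp_of_eq 0 h1 h2 (zero_add t).symm
  rw [one_smul] at h3
  rw [flowS_apply]
  refine h.unique (h3.congr_of_eventuallyEq (Filter.Eventually.of_forall fun s => ?_))
  simp only [flowS_apply, ← move_mul, ← φ.add, Function.comp, add_comm s t]

/-! ### The `L²` inner product -/

lemma integrable_of_continuous {E : Type*} [NormedAddCommGroup E] {h : K p q → E}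
    (hh : Continuous h) : Integrable h (haarK p q) :=
  hh.integrable_of_hasCompactSupport (HasCompactSupport.of_compactSpace _)

variable [NeZero p] [NeZero q]

lemma exists_pt_smul (w : cone p q) :
    ∃ k : K p q, (w : V p q) = √(nx w.1) • (pt k : V p q) := by
  have h0 : 0 < √(nx w.1) := Real.sqrt_pos.2 (cone_pos w)
  have hs : (√(nx w.1))⁻¹ • (w : V p q) ∈ spheres p q := by
    have h1 : (√(nx w.1))⁻¹ ^ 2 * nx w.1 = 1 := by
      rw [inv_pow, Real.sq_sqrt (cone_pos w).le, inv_mul_cancel₀ (cone_pos w).ne']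
    rw [mem_spheres, nx_smul, h1]
    refine ⟨rfl, ?_⟩
    have : ny ((√(nx w.1))⁻¹ • (w : V p q)) = (√(nx w.1))⁻¹ ^ 2 * ny w.1 := by
      simp [ny, mul_pow, Finset.mul_sum]
    rw [this, ← cone_eq, h1]
  obtain ⟨k, hk⟩ := exists_pt hs
  exact ⟨k, by rw [hk, smul_smul, mul_inv_cancel₀ h0.ne', one_smul]⟩

lemma HS.ext_pt {f g : HS p q a} (h : ∀ k : K p q, f (pt k) = g (pt k)) : f = g := by
  refine HS.ext fun w => ?_
  obtain ⟨k, hk⟩ := exists_pt_smul w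
  have h0 : 0 < √(nx w.1) := Real.sqrt_pos.2 (cone_pos w)
  rw [f.homogeneous h0 hk, g.homogeneous h0 hk, h]

lemma HS.continuous_pt (f : HS p q a) : Continuous fun k : K p q => f (pt k) :=
  f.continuous.comp LightCone.continuous_pt

/-- The inner product `∫ conj f · g` over the orbit `S^{p-1} × S^{q-1}` of the base point. -/
@[reducible] def hsCore (p q : ℕ) (a : ℝ) [NeZero p] [NeZero q] : InnerProductSpace.Core ℂ (HS p q a) where
  inner f g := ∫ k, (starRingEnd ℂ) (f (pt k)) * g (pt k) ∂haarK p q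
  conj_inner_symm f g := by
    rw [← integral_conj]
    simp [mul_comm]
  re_inner_nonneg f := by
    have : ∀ k : K p q, (starRingEnd ℂ) (f (pt k)) * f (pt k) = ((‖f (pt k)‖ ^ 2 : ℝ) : ℂ) := by
      intro k
      rw [mul_comm, Complex.mul_conj, Complex.normSq_eq_norm_sq]
    simp only [this]
    rw [integral_complex_ofReal]
    simpa using integral_nonneg fun k => sq_nonneg _
  add_left f g h := by
    rw [← integral_add]
    · simp [HS.add_apply, add_mul]
    · exact integrable_of_continuous
        ((Complex.continuous_conj.comp f.continuous_pt).mul h.continuous_pt)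
    · exact integrable_of_continuous
        ((Complex.continuous_conj.comp g.continuous_pt).mul h.continuous_pt)
  smul_left f g c := by
    rw [← integral_const_mul]
    simp [HS.smul_apply, mul_assoc]
  definite f hf := by
    have : ∀ k : K p q, (starRingEnd ℂ) (f (pt k)) * f (pt k) = ((‖f (pt k)‖ ^ 2 : ℝ) : ℂ) := by
      intro k
      rw [mul_comm, Complex.mul_conj, Complex.normSq_eq_norm_sq]
    simp only [this] at hf
    rw [integral_complex_ofReal, Complex.ofReal_eq_zero] at hf
    have hc : Continuous fun k : K p q => ‖f (pt k)‖ ^ 2 := (f.continuous_pt.norm).pow 2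
    rw [integral_eq_zero_iff_of_nonneg (fun k => sq_nonneg _) (integrable_of_continuous hc)] at hf
    have h2 := (Continuous.ae_eq_iff_eq (haarK p q) hc continuous_const).1 hf
    refine HS.ext_pt fun k => ?_
    exact norm_eq_zero.1 ((pow_eq_zero_iff two_ne_zero).1 (congrFun h2 k))

instance : NormedAddCommGroup (HS p q a) := (hsCore p q a).toNormedAddCommGroup

instance : InnerProductSpace ℂ (HS p q a) := InnerProductSpace.ofCore (hsCore p q a).toCore

lemma inner_def (f g : HS p q a) :
    inner ℂ f g = ∫ k, (starRingEnd ℂ) (f (pt k)) * g (pt k) ∂haarK p q := rfl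

lemma norm_sq_eq_integral (f : HS p q a) : ‖f‖ ^ 2 = ∫ k, ‖f (pt k)‖ ^ 2 ∂haarK p q := by
  have : ((‖f‖ ^ 2 : ℝ) : ℂ) = inner ℂ f f := by
    rw [inner_self_eq_norm_sq_to_K]
    simp
  rw [← Complex.ofReal_inj, this, inner_def, ← integral_complex_ofReal]
  refine integral_congr_ae (Filter.Eventually.of_forall fun k => ?_)
  simp only
  rw [mul_comm, Complex.mul_conj, Complex.normSq_eq_norm_sq]

lemma norm_le_of_forall_pt {f : HS p q a} {M : ℝ} (hM : 0 ≤ M) (h : ∀ k, ‖f (pt k)‖ ≤ M) :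
    ‖f‖ ≤ M := by
  refine le_of_sq_le_sq ?_ hM
  rw [norm_sq_eq_integral]
  calc ∫ k, ‖f (pt k)‖ ^ 2 ∂haarK p q ≤ ∫ _k, M ^ 2 ∂haarK p q := by
        refine integral_mono (integrable_of_continuous (f.continuous_pt.norm.pow 2))
          (integrable_const _) fun k => ?_
        exact pow_le_pow_left₀ (norm_nonneg _) (h k) 2
    _ = M ^ 2 := by simp

lemma inner_rhoS_kO (k : K p q) (f g : HS p q a) :
    inner ℂ (rhoS (kO k) f) (rhoS (kO k) g) = inner ℂ f g := by
  rw [inner_def, inner_def]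
  simp only [rhoS_apply, ← map_inv, ← pt_mul]
  exact integral_mul_left_eq_self (fun l => (starRingEnd ℂ) (f (pt l)) * g (pt l)) k⁻¹

lemma norm_rhoS_kO (k : K p q) (f : HS p q a) : ‖rhoS (kO k) f‖ = ‖f‖ := by
  have h := inner_rhoS_kO k f f
  rw [inner_self_eq_norm_sq_to_K, inner_self_eq_norm_sq_to_K] at h
  have h2 : ‖rhoS (kO k) f‖ ^ 2 = ‖f‖ ^ 2 := by exact_mod_cast h
  exact (sq_eq_sq₀ (norm_nonneg _) (norm_nonneg _)).1 h2

/-! ### Differentiability of one-parameter groups in `L²` -/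

lemma exists_flow_bound (φ : Flow p q) (f : HS p q a) :
    ∃ C, 0 ≤ C ∧ ∀ t ∈ Set.Icc (-1 : ℝ) 1, ∀ k : K p q, ‖f (move (φ.g t) (pt k))‖ ≤ C := by
  have hc : Continuous fun z : ℝ × K p q => f (move (φ.g z.1) (pt z.2)) :=
    f.continuous.comp ((continuous_flow φ).comp
      (continuous_fst.prodMk (continuous_pt.comp continuous_snd)))
  obtain ⟨C, hC⟩ := (isCompact_Icc (a := (-1 : ℝ)) (b := 1)).prod
    (isCompact_univ (X := K p q)) |>.exists_bound_of_continuousOn hc.continuousOn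
  refine ⟨max C 0, le_max_right _ _, fun t ht k => (hC (t, k) ⟨ht, trivial⟩).trans (le_max_left _ _)⟩

lemma exists_flow_taylor (φ : Flow p q) (f : HS p q a) :
    ∃ C, 0 ≤ C ∧ ∀ t ∈ Set.Icc (-1 : ℝ) 1, ∀ k : K p q,
      ‖f (move (φ.g t) (pt k)) - f (pt k) - t * lie φ f (pt k)‖ ≤ C * t ^ 2 := by
  obtain ⟨C, hC0, hC⟩ := exists_flow_bound φ (lie φ (lie φ f))
  refine ⟨C, hC0, fun t ht k => ?_⟩
  have h1 : ∀ s ∈ Set.Icc (-1 : ℝ) 1,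
      ‖lie φ f (move (φ.g s) (pt k)) - lie φ f (pt k)‖ ≤ C * |s| := by
    intro s hs
    have := (convex_Icc (-1 : ℝ) 1).norm_image_sub_le_of_norm_hasDerivWithin_le
      (f := fun s => lie φ f (move (φ.g s) (pt k))) (x := 0) (y := s)
      (fun x _ => (hasDerivAt_flow φ (lie φ f) (pt k) x).hasDerivWithinAt)
      (fun x hx => hC x hx k) (by simp) hs
    simpa [φ.zero, move_one] using this
  have h2 := (convex_Icc (-|t|) |t|).norm_image_sub_le_of_norm_hasDerivWithin_le
      (f := fun s : ℝ => f (move (φ.g s) (pt k)) - s * lie φ f (pt k)) (x := 0) (y := t)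
      (f' := fun s => lie φ f (move (φ.g s) (pt k)) - lie φ f (pt k)) (C := C * |t|)
      (fun x _ => by
        have h3 : HasDerivAt (fun s : ℝ => (s : ℂ) * lie φ f (pt k)) (lie φ f (pt k)) x := by
          have := (Complex.ofRealCLM.hasDerivAt (x := x)).mul_const (lie φ f (pt k))
          simpa using this
        exact ((hasDerivAt_flow φ f (pt k) x).sub h3).hasDerivWithinAt)
      (fun x hx => by
        have hxt : |x| ≤ |t| := abs_le.2 hx
        have ht1 : |t| ≤ 1 := abs_le.2 ht
        exact (h1 x (abs_le.1 (hxt.trans ht1))).trans (mul_le_mul_of_nonneg_left hxt hC0))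
      (by simp) ⟨neg_abs_le t, le_abs_self t⟩
  simp only [φ.zero, move_one, Complex.ofReal_zero, zero_mul, sub_zero, Real.norm_eq_abs] at h2
  rw [mul_assoc, abs_mul_abs_self, ← sq] at h2
  rwa [sub_right_comm]

lemma hasDerivAt_flowS_zero (φ : Flow p q) (f : HS p q a) :
    HasDerivAt (fun t => flowS φ t f) (lie φ f) 0 := by
  obtain ⟨C, hC0, hC⟩ := exists_flow_taylor φ f
  have h1 : (fun t : ℝ => flowS φ t f - f - (t : ℂ) • lie φ f) =O[nhds 0]
      fun t : ℝ => ‖t - 0‖ ^ 2 := by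
    refine Asymptotics.IsBigO.of_bound C ?_
    filter_upwards [Icc_mem_nhds (show (-1 : ℝ) < 0 by norm_num) one_pos] with t ht
    rw [sub_zero, norm_pow, norm_norm, Real.norm_eq_abs, sq_abs]
    refine norm_le_of_forall_pt (by positivity) fun k => ?_
    simpa only [HS.sub_apply, HS.smul_apply, flowS_apply] using hC t ht k
  have h2 := (h1.hasFDerivAt (𝕜 := ℝ) one_lt_two).hasDerivAt
  have h3 : HasDerivAt (fun t : ℝ => (t : ℂ) • lie φ f) (lie φ f) 0 := by
    have := (Complex.ofRealCLM.hasDerivAt (x := (0 : ℝ))).smul_const (lie φ f)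
    simpa using this
  have h4 := (h2.add h3).add_const f
  refine (h4.congr_deriv (by simp)).congr_of_eventuallyEq (Filter.Eventually.of_forall fun t => ?_)
  simp

lemma hasDerivAt_flowS (φ : Flow p q) (f : HS p q a) (t : ℝ) :
    HasDerivAt (fun t => flowS φ t f) (flowS φ t (lie φ f)) t := by
  have h := hasDerivAt_flowS_zero φ (flowS φ t f)
  have h2 : HasDerivAt (fun s : ℝ => s - t) 1 t := (hasDerivAt_id t).sub_const t
  have h3 := HasDerivAt.scomp_of_eq t h h2 (sub_self t).symm
  rw [one_smul, lie_flowS] at h3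
  refine h3.congr_of_eventuallyEq (Filter.Eventually.of_forall fun s => ?_)
  simp only [Function.comp, ← flowS_add, sub_add_cancel]

/-- Infinitesimal rotations are skew-adjoint. -/
lemma inner_lie_of_kO {φ : Flow p q} (hφ : ∀ t, ∃ k, φ.g t = kO k) (f g : HS p q a) :
    inner ℂ (lie φ f) g = -inner ℂ f (lie φ g) := by
  have h := (hasDerivAt_flowS_zero φ f).inner ℂ (hasDerivAt_flowS_zero φ g)
  have hc : (fun t => inner ℂ (flowS φ t f) (flowS φ t g)) = fun _ => inner ℂ f g := by
    funext t
    obtain ⟨k, hk⟩ := hφ (-t)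
    simp only [flowS, hk]
    exact inner_rhoS_kO k f g
  rw [hc] at h
  have := h.unique (hasDerivAt_const _ _)
  rw [flowS_zero, flowS_zero] at this
  exact eq_neg_of_add_eq_zero_right this

lemma inner_Lx (k l : Fin p) (f g : HS p q a) :
    inner ℂ (Lx k l f) g = -inner ℂ f (Lx k l g) :=
  inner_lie_of_kO (fun t => ⟨K.mk (rotMat k l t) 1, rfl⟩) f g

lemma inner_Ly (k l : Fin q) (f g : HS p q a) :
    inner ℂ (Ly k l f) g = -inner ℂ f (Ly k l g) :=
  inner_lie_of_kO (fun t => ⟨K.mk 1 (rotMat k l t), rfl⟩) f g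

lemma inner_Mx (i : Fin p) (f g : HS p q a) : inner ℂ (Mx i f) g = inner ℂ f (Mx i g) := by
  simp only [inner_def, Mx, mulS_apply, mx, map_mul, Complex.conj_ofReal]
  congr 1
  funext k
  ring

lemma inner_My (j : Fin q) (f g : HS p q a) : inner ℂ (My j f) g = inner ℂ f (My j g) := by
  simp only [inner_def, My, mulS_apply, my, map_mul, Complex.conj_ofReal]
  congr 1
  funext k
  ring

end

section

variable {p q : ℕ} {a : ℝ}

/-! ### Commutation relations -/

lemma nx_rotX (k l : Fin p) (t : ℝ) (w : V p q) : nx (((rotX p q k l).g t).1 w) = nx w :=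
  nx_kO _ _

lemma nx_rotY (k l : Fin q) (t : ℝ) (w : V p q) : nx (((rotY p q k l).g t).1 w) = nx w :=
  nx_kO _ _

/-- The Leibniz rule for infinitesimal rotations and multiplication by `ℓ / |x|`. -/
lemma lie_mulS_div_sqrt {φ : Flow p q} (hφ : ∀ t w, nx ((φ.g t).1 w) = nx w)
    (ℓ : V p q →L[ℝ] ℝ) (f : HS p q a) (w : cone p q) {m : Fn p q} (hm : m ∈ S p q 0)
    (h : ∀ w : cone p q, m w = ((ℓ w / √(nx w.1) : ℝ) : ℂ)) :
    lie φ (mulS m hm f) w = m w * lie φ f w + ((ℓ (φ.X w) / √(nx w.1) : ℝ) : ℂ) * f w := by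
  have h1 : HasDerivAt (fun t => ((ℓ ((φ.g t).1 w) / √(nx w.1) : ℝ) : ℂ))
      ((ℓ (φ.X w) / √(nx w.1) : ℝ) : ℂ) 0 :=
    ((ℓ.hasFDerivAt.comp_hasDerivAt 0 (φ.deriv_zero w)).div_const _).ofReal_comp
  have h2 := h1.mul (hasDerivAt_flow_zero φ f w)
  simp only [φ.zero, move_one] at h2
  have h3 := hasDerivAt_flow_zero φ (mulS m hm f) w
  have h4 : (fun t => mulS m hm f (move (φ.g t) w)) =
      (fun t => ((ℓ ((φ.g t).1 w) / √(nx w.1) : ℝ) : ℂ)) * fun t => f (move (φ.g t) w) := by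
    funext t
    rw [mulS_apply, h, coe_move, hφ]
    rfl
  rw [h4] at h3
  rw [h3.unique h2, h, add_comm]
  rfl

lemma Lx_Mx (k l i : Fin p) (f : HS p q a) :
    Lx k l (Mx i f) = Mx i (Lx k l f) + (if l = i then Mx k f else 0) -
      (if k = i then Mx l f else 0) := by
  refine HS.ext fun w => ?_
  have h := lie_mulS_div_sqrt (φ := rotX p q k l) (nx_rotX k l)
    ((ContinuousLinearMap.proj i).comp (ContinuousLinearMap.fst ℝ _ _)) f w (mx_mem i)
    (fun w => rfl)
  rw [Lx, Mx, h, rotX_X]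
  simp only [HS.add_apply, HS.sub_apply, mulS_apply, add_sub_assoc]
  congr 1
  simp only [ContinuousLinearMap.comp_apply, ContinuousLinearMap.proj_apply,
    ContinuousLinearMap.coe_fst', Pi.sub_apply, Pi.smul_apply, smul_eq_mul, Pi.single_apply,
    eq_comm (a := i)]
  split_ifs <;> simp [Mx, mulS_apply, mx, HS.zero_apply, sub_mul, sub_div, neg_div]

lemma Ly_My (k l j : Fin q) (f : HS p q a) :
    Ly k l (My j f) = My j (Ly k l f) + (if l = j then My k f else 0) -
      (if k = j then My l f else 0) := by
  refine HS.ext fun w => ?_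
  have h := lie_mulS_div_sqrt (φ := rotY p q k l) (nx_rotY k l)
    ((ContinuousLinearMap.proj j).comp (ContinuousLinearMap.snd ℝ _ _)) f w (my_mem j)
    (fun w => rfl)
  rw [Ly, My, h, rotY_X]
  simp only [HS.add_apply, HS.sub_apply, mulS_apply, add_sub_assoc]
  congr 1
  simp only [ContinuousLinearMap.comp_apply, ContinuousLinearMap.proj_apply,
    ContinuousLinearMap.coe_snd', Pi.sub_apply, Pi.smul_apply, smul_eq_mul, Pi.single_apply,
    eq_comm (a := j)]
  split_ifs <;> simp [My, mulS_apply, my, HS.zero_apply, sub_mul, sub_div, neg_div]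

lemma Lx_My (k l : Fin p) (j : Fin q) (f : HS p q a) : Lx k l (My j f) = My j (Lx k l f) := by
  refine HS.ext fun w => ?_
  have h := lie_mulS_div_sqrt (φ := rotX p q k l) (nx_rotX k l)
    ((ContinuousLinearMap.proj j).comp (ContinuousLinearMap.snd ℝ _ _)) f w (my_mem j)
    (fun w => rfl)
  rw [Lx, My, h, rotX_X]
  simp [mulS_apply]

lemma Ly_Mx (k l : Fin q) (i : Fin p) (f : HS p q a) : Ly k l (Mx i f) = Mx i (Ly k l f) := by
  refine HS.ext fun w => ?_
  have h := lie_mulS_div_sqrt (φ := rotY p q k l) (nx_rotY k l)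
    ((ContinuousLinearMap.proj i).comp (ContinuousLinearMap.fst ℝ _ _)) f w (mx_mem i)
    (fun w => rfl)
  rw [Ly, Mx, h, rotY_X]
  simp [mulS_apply]

lemma Mx_My (i : Fin p) (j : Fin q) (f : HS p q a) : Mx i (My j f) = My j (Mx i f) :=
  HS.ext fun _ => mul_left_comm _ _ _

lemma rotX_symm (k l : Fin p) (w : V p q) : (rotX p q l k).X w = -(rotX p q k l).X w := by
  rw [rotX_X, rotX_X]
  ext <;> simp

lemma rotY_symm (k l : Fin q) (w : V p q) : (rotY p q l k).X w = -(rotY p q k l).X w := by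
  rw [rotY_X, rotY_X]
  ext <;> simp

lemma Lx_self (k : Fin p) (f : HS p q a) : Lx k k f = 0 := by
  refine HS.ext fun w => ?_
  obtain ⟨F, hF, h⟩ := f.smooth
  rw [HS.zero_apply, Lx, lie_apply, lieFn_eq_of_ext _ hF h, rotX_X, sub_self]
  exact map_zero _

lemma Lx_symm (k l : Fin p) (f : HS p q a) : Lx l k f = -Lx k l f := by
  refine HS.ext fun w => ?_
  obtain ⟨F, hF, h⟩ := f.smooth
  rw [HS.neg_apply, Lx, Lx, lie_apply, lie_apply, lieFn_eq_of_ext _ hF h, lieFn_eq_of_ext _ hF h,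
    rotX_symm, map_neg]

lemma Ly_self (k : Fin q) (f : HS p q a) : Ly k k f = 0 := by
  refine HS.ext fun w => ?_
  obtain ⟨F, hF, h⟩ := f.smooth
  rw [HS.zero_apply, Ly, lie_apply, lieFn_eq_of_ext _ hF h, rotY_X, sub_self]
  exact map_zero _

lemma Ly_symm (k l : Fin q) (f : HS p q a) : Ly l k f = -Ly k l f := by
  refine HS.ext fun w => ?_
  obtain ⟨F, hF, h⟩ := f.smooth
  rw [HS.neg_apply, Ly, Ly, lie_apply, lie_apply, lieFn_eq_of_ext _ hF h, lieFn_eq_of_ext _ hF h,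
    rotY_symm, map_neg]

/-- The Casimir operator `∑ L_{kl}²` of the first factor. -/
def Cx : Module.End ℂ (HS p q a) := ∑ k, ∑ l, Lx k l * Lx k l

/-- The Casimir operator `∑ L_{kl}²` of the second factor. -/
def Cy : Module.End ℂ (HS p q a) := ∑ k, ∑ l, Ly k l * Ly k l

lemma Cx_apply (f : HS p q a) : Cx f = ∑ k, ∑ l, Lx k l (Lx k l f) := by
  simp [Cx, LinearMap.sum_apply, Module.End.mul_apply]

lemma Cy_apply (f : HS p q a) : Cy f = ∑ k, ∑ l, Ly k l (Ly k l f) := by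
  simp [Cy, LinearMap.sum_apply, Module.End.mul_apply]

lemma Cx_Mx (i : Fin p) (f : HS p q a) :
    Cx (Mx i f) = Mx i (Cx f) + (4 : ℂ) • ∑ k, Mx k (Lx k i f) + (2 * (1 - p) : ℂ) • Mx i f := by
  rw [Cx_apply, Cx_apply]
  have h : ∀ k l, Lx k l (Lx k l (Mx i f)) = Mx i (Lx k l (Lx k l f)) +
      (if l = i then (2 : ℂ) • Mx k (Lx k l f) - Mx l f else 0) -
      (if k = i then (2 : ℂ) • Mx l (Lx k l f) + Mx k f else 0) +
      (if l = i then if k = i then (2 : ℂ) • Mx k f else 0 else 0) := by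
    intro k l
    rw [Lx_Mx, map_sub, map_add, Lx_Mx]
    by_cases h1 : l = i <;> by_cases h2 : k = i
    · subst h1 h2
      have h0 : Lx k k f = 0 := Lx_self k f
      simp [Lx_Mx, h0]
      module
    · subst h1
      simp [h2, Ne.symm h2, Lx_Mx]
      module
    · subst h2
      simp [h1, Ne.symm h1, Lx_Mx]
      module
    · simp [h1, h2]
  simp only [h, Finset.sum_add_distrib, Finset.sum_sub_distrib, map_sum]
  simp only [Finset.sum_ite_eq', Finset.mem_univ, if_true, Finset.sum_ite_irrel, Finset.sum_const_zero]
  have h3 : ∀ l, Mx l (Lx i l f) = -Mx l (Lx l i f) := fun l => by rw [Lx_symm l i, map_neg]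
  simp only [Finset.sum_sub_distrib, Finset.sum_add_distrib, ← Finset.smul_sum, h3,
    Finset.sum_const, Finset.card_univ, Fintype.card_fin, Finset.sum_neg_distrib,
    ← Nat.cast_smul_eq_nsmul ℂ p]
  module

lemma Cy_My (j : Fin q) (f : HS p q a) :
    Cy (My j f) = My j (Cy f) + (4 : ℂ) • ∑ k, My k (Ly k j f) + (2 * (1 - q) : ℂ) • My j f := by
  rw [Cy_apply, Cy_apply]
  have h : ∀ k l, Ly k l (Ly k l (My j f)) = My j (Ly k l (Ly k l f)) +
      (if l = j then (2 : ℂ) • My k (Ly k l f) - My l f else 0) -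
      (if k = j then (2 : ℂ) • My l (Ly k l f) + My k f else 0) +
      (if l = j then if k = j then (2 : ℂ) • My k f else 0 else 0) := by
    intro k l
    rw [Ly_My, map_sub, map_add, Ly_My]
    by_cases h1 : l = j <;> by_cases h2 : k = j
    · subst h1 h2
      have h0 : Ly k k f = 0 := Ly_self k f
      simp [Ly_My, h0]
      module
    · subst h1
      simp [h2, Ne.symm h2, Ly_My]
      module
    · subst h2
      simp [h1, Ne.symm h1, Ly_My]
      module
    · simp [h1, h2]
  simp only [h, Finset.sum_add_distrib, Finset.sum_sub_distrib, map_sum]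
  simp only [Finset.sum_ite_eq', Finset.mem_univ, if_true, Finset.sum_ite_irrel, Finset.sum_const_zero]
  have h3 : ∀ l, My l (Ly j l f) = -My l (Ly l j f) := fun l => by rw [Ly_symm l j, map_neg]
  simp only [Finset.sum_sub_distrib, Finset.sum_add_distrib, ← Finset.smul_sum, h3,
    Finset.sum_const, Finset.card_univ, Fintype.card_fin, Finset.sum_neg_distrib,
    ← Nat.cast_smul_eq_nsmul ℂ q]
  module

lemma Cx_My (j : Fin q) (f : HS p q a) : Cx (My j f) = My j (Cx f) := by
  simp only [Cx_apply, Lx_My, map_sum]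

lemma Cy_Mx (i : Fin p) (f : HS p q a) : Cy (Mx i f) = Mx i (Cy f) := by
  simp only [Cy_apply, Ly_Mx, map_sum]

/-! ### The infinitesimal boosts in terms of rotations and multiplications -/

/-- Euler's identity. -/
lemma fderiv_self_of_ext (f : HS p q a) {F : V p q → ℂ} (hF : ContDiffOn ℝ ∞ F {0}ᶜ)
    (h : ∀ w : cone p q, F w = f w) (w : cone p q) : fderiv ℝ F w w = a * f w := by
  have h1 : HasFDerivAt F (fderiv ℝ F w) ((1 : ℝ) • (w : V p q)) := by
    rw [one_smul]
    exact ((hF.contDiffAt (isOpen_ne_zero.mem_nhds w.2.1)).differentiableAt (by simp)).hasFDerivAt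
  have h2 := h1.comp_hasDerivAt (1 : ℝ) ((hasDerivAt_id (1 : ℝ)).smul_const (w : V p q))
  have h3 : HasDerivAt (fun t : ℝ => (t : ℂ) ^ (a : ℂ) * f w) (a * f w) 1 := by
    have h4 := (Real.hasDerivAt_rpow_const (x := 1) (p := a) (Or.inl one_ne_zero)).ofReal_comp
    have h5 := h4.mul_const (f w)
    simp only [Real.one_rpow, mul_one] at h5
    refine h5.congr_of_eventuallyEq ?_
    filter_upwards [lt_mem_nhds (one_pos : (0 : ℝ) < 1)] with t ht
    rw [Complex.ofReal_cpow ht.le]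
  rw [one_smul] at h2
  refine h2.unique (h3.congr_of_eventuallyEq ?_)
  filter_upwards [lt_mem_nhds (one_pos : (0 : ℝ) < 1)] with t ht
  have hm : t • (w : V p q) ∈ cone p q := by
    refine ⟨smul_ne_zero ht.ne' w.2.1, ?_⟩
    have : form (t • (w : V p q)) (t • (w : V p q)) = t ^ 2 * form (w : V p q) w := by
      simp only [form_eq, Prod.smul_fst, Prod.smul_snd, smul_dotProduct, dotProduct_smul, smul_eq_mul]
      ring
    rw [this, w.2.2, mul_zero]
  have h6 := f.homogeneous (w := w) (w' := ⟨_, hm⟩) ht rfl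
  rw [← h6, ← h]
  rfl

lemma smul_boostGen (i : Fin p) (j : Fin q) (w : cone p q) :
    nx w.1 • boostGen i j (w : V p q) = ∑ k, (w.1.1 k * w.1.2 j) • (rotX p q k i).X w +
      ∑ k, (w.1.1 i * w.1.2 k) • (rotY p q k j).X w + (w.1.1 i * w.1.2 j) • (w : V p q) := by
  have hx := nx_eq w.1
  have hy := (cone_eq w).trans (ny_eq w.1)
  simp only [rotX_X, rotY_X, boostGen_apply]
  ext m
  · simp only [Prod.smul_fst, Prod.fst_add, Prod.fst_sum, Pi.add_apply, Finset.sum_apply,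
      Pi.smul_apply, smul_eq_mul, Pi.sub_apply, mul_sub, Finset.sum_sub_distrib, Pi.single_apply,
      mul_ite, mul_one, mul_zero, Prod.smul_mk, smul_zero, Pi.zero_apply, Finset.sum_const_zero,
      Finset.sum_ite_eq, Finset.mem_univ, if_true]
    split_ifs with h
    · rw [hx, dotProduct, Finset.sum_mul]
      have : ∀ k, w.1.1 k * w.1.1 k * w.1.2 j = w.1.1 k * w.1.2 j * w.1.1 k := fun k => by ring
      simp only [this, h]
      ring
    · simp only [Finset.sum_const_zero]
      ring
  · simp only [Prod.smul_snd, Prod.snd_add, Prod.snd_sum, Pi.add_apply, Finset.sum_apply,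
      Pi.smul_apply, smul_eq_mul, Pi.sub_apply, mul_sub, Finset.sum_sub_distrib, Pi.single_apply,
      mul_ite, mul_one, mul_zero, Prod.smul_mk, smul_zero, Pi.zero_apply, Finset.sum_const_zero,
      Finset.sum_ite_eq, Finset.mem_univ, if_true]
    split_ifs with h
    · rw [hy, dotProduct, Finset.sum_mul]
      have : ∀ k, w.1.2 k * w.1.2 k * w.1.1 i = w.1.1 i * w.1.2 k * w.1.2 k := fun k => by ring
      simp only [this, h]
      ring
    · simp only [Finset.sum_const_zero]
      ring

lemma Db_eq (i : Fin p) (j : Fin q) (f : HS p q a) :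
    Db i j f = ∑ k, Mx k (My j (Lx k i f)) + ∑ k, Mx i (My k (Ly k j f)) +
      (a : ℂ) • Mx i (My j f) := by
  refine HS.ext fun w => ?_
  obtain ⟨F, hF, h⟩ := f.smooth
  have hn := cone_pos w
  have hs := Real.mul_self_sqrt hn.le
  have hs0 : ((√(nx w.1) : ℝ) : ℂ) ≠ 0 := by
    exact_mod_cast (Real.sqrt_pos.2 hn).ne'
  have hsC : ((√(nx w.1) : ℝ) : ℂ) * ((√(nx w.1) : ℝ) : ℂ) = (nx w.1 : ℂ) := by exact_mod_cast hs
  have hb := congrArg (fderiv ℝ F w) (smul_boostGen i j w)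
  simp only [map_add, map_sum, map_smul, fderiv_self_of_ext f hF h w] at hb
  simp only [HS.add_apply, HS.sum_apply, HS.smul_apply, Mx, My, Lx, Ly, Db, mulS_apply,
    lie_apply, lieFn_eq_of_ext _ hF h, mx, my]
  have hn0 : (nx w.1 : ℂ) ≠ 0 := by exact_mod_cast hn.ne'
  refine mul_left_cancel₀ hn0 ?_
  simp only [Complex.real_smul] at hb
  refine hb.trans ?_
  rw [← hsC]
  simp only [mul_add, Finset.mul_sum, Complex.ofReal_div, Complex.ofReal_mul]
  congr 1
  · congr 1
    · refine Finset.sum_congr rfl fun k _ => ?_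
      field_simp
    · refine Finset.sum_congr rfl fun k _ => ?_
      field_simp
  · field_simp

lemma Db_eq_commutator (i : Fin p) (j : Fin q) (f : HS p q a) :
    Db i j f = (1 / 4 : ℂ) • (Cx (Mx i (My j f)) + Cy (Mx i (My j f)) -
      Mx i (My j (Cx f + Cy f))) + (shift p q a : ℂ) • Mx i (My j f) := by
  have h1 : Cx (Mx i (My j f)) = Mx i (My j (Cx f)) + (4 : ℂ) • ∑ k, Mx k (My j (Lx k i f)) +
      (2 * (1 - p) : ℂ) • Mx i (My j f) := by
    rw [Cx_Mx, Cx_My]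
    simp only [Lx_My]
  have h2 : Cy (Mx i (My j f)) = Mx i (My j (Cy f)) + (4 : ℂ) • ∑ k, Mx i (My k (Ly k j f)) +
      (2 * (1 - q) : ℂ) • Mx i (My j f) := by
    rw [Cy_Mx, Cy_My]
    simp only [map_add, map_sum, map_smul]
  rw [Db_eq, h1, h2]
  simp only [map_add, shift]
  push_cast
  module

end

section

section Polynomial

variable {n m : ℕ}

/-! ### Harmonic polynomials -/

/-- Polynomials in `n` variables. -/
abbrev Pol (n : ℕ) : Type := MvPolynomial (Fin n) ℂ

/-- The value of a complex polynomial at a real point. -/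
def pe (h : Pol n) (x : Fin n → ℝ) : ℂ := MvPolynomial.eval (fun j => (x j : ℂ)) h

lemma pe_add (g h : Pol n) (x : Fin n → ℝ) : pe (g + h) x = pe g x + pe h x := by simp [pe]

lemma pe_sub (g h : Pol n) (x : Fin n → ℝ) : pe (g - h) x = pe g x - pe h x := by simp [pe]

lemma pe_mul (g h : Pol n) (x : Fin n → ℝ) : pe (g * h) x = pe g x * pe h x := by simp [pe]

lemma pe_X (i : Fin n) (x : Fin n → ℝ) : pe (X i) x = x i := by simp [pe]

lemma pe_C (c : ℂ) (x : Fin n → ℝ) : pe (C c) x = c := by simp [pe]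

lemma pe_sum {ι : Type*} (s : Finset ι) (h : ι → Pol n) (x : Fin n → ℝ) :
    pe (∑ i ∈ s, h i) x = ∑ i ∈ s, pe (h i) x := by simp [pe]

lemma pol_ext {g h : Pol n} (H : ∀ x, pe g x = pe h x) : g = h := by
  refine MvPolynomial.funext_set (fun _ => Set.range ((↑) : ℝ → ℂ))
    (fun _ => Set.infinite_range_of_injective Complex.ofReal_injective) fun x hx => ?_
  choose y hy using fun i => hx i trivial
  have : x = fun j => (y j : ℂ) := funext fun j => (hy j).symm
  rw [this]
  exact H y

lemma contDiff_pe (h : Pol n) : ContDiff ℝ ∞ (pe h) := by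
  induction h using MvPolynomial.induction_on with
  | C c => simpa only [funext (pe_C c)] using contDiff_const
  | add g h hg hh => simpa only [funext (pe_add g h)] using hg.add hh
  | mul_X h i hh =>
    have h1 : ContDiff ℝ ∞ fun x : Fin n → ℝ => (x i : ℂ) :=
      Complex.ofRealCLM.contDiff.comp (contDiff_apply ℝ ℝ i)
    simpa only [funext (pe_mul h (X i)), pe_X] using hh.mul h1

lemma hasDerivAt_pe (h : Pol n) {c : ℝ → Fin n → ℝ} {c' : Fin n → ℝ} {t : ℝ}
    (hc : HasDerivAt c c' t) :
    HasDerivAt (fun s => pe h (c s)) (∑ j, c' j * pe (pderiv j h) (c t)) t := by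
  induction h using MvPolynomial.induction_on with
  | C b =>
    have h1 : ∀ j, pe (pderiv j (C b : Pol n)) (c t) = 0 := fun j => by simp [pe]
    simpa only [pe_C, h1, mul_zero, Finset.sum_const_zero] using hasDerivAt_const t b
  | add g h hg hh =>
    simp only [pe_add, map_add, mul_add, Finset.sum_add_distrib]
    exact hg.add hh
  | mul_X h i hh =>
    have h1 : HasDerivAt (fun s => ((c s i : ℝ) : ℂ)) (c' i : ℂ) t :=
      ((hasDerivAt_pi.1 hc) i).ofReal_comp
    simp only [pe_mul, pe_X, MvPolynomial.pderiv_mul, pe_add, MvPolynomial.pderiv_X]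
    have h2 := hh.mul h1
    refine h2.congr_deriv ?_
    rw [Finset.sum_mul]
    have : ∀ j, (c' j : ℂ) * (pe (pderiv j h) (c t) * c t i +
        pe h (c t) * pe (Pi.single (M := fun _ => Pol n) j 1 i) (c t)) = c' j * pe (pderiv j h) (c t) * c t i +
        if j = i then c' i * pe h (c t) else 0 := by
      intro j
      split_ifs with hj
      · subst hj
        simp [pe]
        ring
      · simp [pe, Ne.symm hj]
        ring
    simp only [this, Finset.sum_add_distrib, Finset.sum_ite_eq', Finset.mem_univ, if_true]
    ring

lemma pe_smul {h : Pol n} (hh : h.IsHomogeneous m) (t : ℝ) (x : Fin n → ℝ) :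
    pe h (t • x) = (t : ℂ) ^ m * pe h x := by
  unfold pe
  rw [MvPolynomial.eval_eq, MvPolynomial.eval_eq, Finset.mul_sum]
  refine Finset.sum_congr rfl fun d hd => ?_
  have h1 : (∑ i, d i) = m := by
    have := hh.degree_eq_sum_deg_support hd
    rw [this]
    exact (Finset.sum_subset (Finset.subset_univ _) (by simp)).symm
  have h2 : ∀ y : Fin n → ℝ, ∏ i ∈ d.support, ((y i : ℝ) : ℂ) ^ d i = ∏ i, ((y i : ℝ) : ℂ) ^ d i :=
    fun y => Finset.prod_subset (Finset.subset_univ _) (by simp +contextual)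
  rw [h2, h2, ← h1, ← Finset.prod_pow_eq_pow_sum]
  simp only [Pi.smul_apply, smul_eq_mul, Complex.ofReal_mul, mul_pow, Finset.prod_mul_distrib]
  ring

/-- The Laplacian. -/
def lap (h : Pol n) : Pol n := ∑ j, pderiv j (pderiv j h)

/-- The polynomial `∑ x_j²`. -/
def rsq (n : ℕ) : Pol n := ∑ j, X j ^ 2

lemma isHarmonic_iff {h : Pol n} : IsHarmonic m h ↔ h.IsHomogeneous m ∧ lap h = 0 := Iff.rfl

lemma lap_add (g h : Pol n) : lap (g + h) = lap g + lap h := by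
  simp [lap, Finset.sum_add_distrib]

lemma lap_sub (g h : Pol n) : lap (g - h) = lap g - lap h := by
  simp [lap, Finset.sum_sub_distrib]

lemma lap_C_mul (c : ℂ) (h : Pol n) : lap (C c * h) = C c * lap h := by
  simp [lap, Finset.mul_sum]

lemma pderiv_comm (i j : Fin n) (h : Pol n) : pderiv i (pderiv j h) = pderiv j (pderiv i h) := by
  have : ⁅pderiv (R := ℂ) i, pderiv j⁆ = (0 : Derivation ℂ (Pol n) (Pol n)) := by
    refine MvPolynomial.derivation_ext fun k => ?_
    simp [Derivation.commutator_apply, MvPolynomial.pderiv_X, Pi.single_apply, apply_ite]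
  have h2 := congrArg (fun D : Derivation ℂ (Pol n) (Pol n) => D h) this
  simp only [Derivation.commutator_apply, Derivation.zero_apply] at h2
  exact sub_eq_zero.1 h2

lemma lap_pderiv (i : Fin n) (h : Pol n) : lap (pderiv i h) = pderiv i (lap h) := by
  simp only [lap, map_sum]
  exact Finset.sum_congr rfl fun j _ => by rw [pderiv_comm j i, pderiv_comm j i]

lemma pderiv_X_ite (i j : Fin n) : pderiv (R := ℂ) i (X j) = if j = i then 1 else 0 := by
  rw [MvPolynomial.pderiv_X, Pi.single_apply]

lemma lap_X_mul (i : Fin n) (h : Pol n) : lap (X i * h) = X i * lap h + 2 * pderiv i h := by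
  simp only [lap, MvPolynomial.pderiv_mul, pderiv_X_ite, map_add, Finset.sum_add_distrib,
    Finset.mul_sum, ite_mul, one_mul, zero_mul, apply_ite (pderiv _), map_zero]
  simp
  ring

lemma lap_X_sq_mul (i : Fin n) (h : Pol n) :
    lap (X i ^ 2 * h) = X i ^ 2 * lap h + 4 * (X i * pderiv i h) + 2 * h := by
  rw [sq, mul_assoc, lap_X_mul, lap_X_mul, MvPolynomial.pderiv_mul, pderiv_X_ite, if_pos rfl]
  ring

lemma lap_rsq_mul (h : Pol n) :
    lap (rsq n * h) = rsq n * lap h + 4 * ∑ i, X i * pderiv i h + 2 * n * h := by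
  have : lap (rsq n * h) = ∑ i, lap (X i ^ 2 * h) := by
    simp only [rsq, Finset.sum_mul]
    simp only [lap, map_sum]
    rw [Finset.sum_comm]
  rw [this]
  simp only [lap_X_sq_mul, Finset.sum_add_distrib, ← Finset.mul_sum, ← Finset.sum_mul, rsq]
  simp
  ring

lemma IsHarmonic.pderiv {h : Pol n} (hh : IsHarmonic m h) (i : Fin n) :
    IsHarmonic (m - 1) (MvPolynomial.pderiv i h) := by
  rw [isHarmonic_iff] at hh ⊢
  exact ⟨hh.1.pderiv, by rw [lap_pderiv, hh.2, map_zero]⟩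

lemma pderiv_eq_zero_of_homogeneous_zero {h : Pol n} (hh : h.IsHomogeneous 0) (i : Fin n) :
    pderiv i h = 0 := by
  rw [← MvPolynomial.totalDegree_zero_iff_isHomogeneous, MvPolynomial.totalDegree_eq_zero_iff_eq_C]
    at hh
  rw [hh, MvPolynomial.pderiv_C]

lemma IsHarmonic.add {g h : Pol n} (hg : IsHarmonic m g) (hh : IsHarmonic m h) :
    IsHarmonic m (g + h) := by
  rw [isHarmonic_iff] at hg hh ⊢
  exact ⟨hg.1.add hh.1, by rw [lap_add, hg.2, hh.2, add_zero]⟩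

lemma IsHarmonic.C_mul {h : Pol n} (hh : IsHarmonic m h) (c : ℂ) : IsHarmonic m (C c * h) := by
  rw [isHarmonic_iff] at hh ⊢
  exact ⟨hh.1.C_mul c, by rw [lap_C_mul, hh.2, mul_zero]⟩

lemma isHarmonic_zero : IsHarmonic m (0 : Pol n) :=
  isHarmonic_iff.2 ⟨MvPolynomial.isHomogeneous_zero _ _ _, by simp [lap]⟩

/-- The number `1 / (n + 2 m - 2)`. -/
def kap (n m : ℕ) : ℂ := 1 / (n + 2 * m - 2)

/-- The harmonic part of `x_i h` for `h` harmonic of degree `m`. -/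
def up (m : ℕ) (i : Fin n) (h : Pol n) : Pol n := X i * h - rsq n * (C (kap n m) * pderiv i h)

lemma rsq_isHomogeneous : (rsq n).IsHomogeneous 2 :=
  MvPolynomial.IsHomogeneous.sum _ _ _ fun i _ => MvPolynomial.isHomogeneous_X_pow i 2

lemma IsHarmonic.up {h : Pol n} (hh : IsHarmonic m h) (i : Fin n) :
    IsHarmonic (m + 1) (up m i h) := by
  rw [isHarmonic_iff] at hh ⊢
  rcases Nat.eq_zero_or_pos m with rfl | hm
  · have h0 := pderiv_eq_zero_of_homogeneous_zero hh.1 i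
    have h1 : LightCone.up 0 i h = X i * h := by simp [LightCone.up, h0]
    rw [h1, lap_X_mul, hh.2, h0]
    refine ⟨?_, by simp⟩
    rw [add_comm]
    exact (MvPolynomial.isHomogeneous_X _ i).mul hh.1
  · constructor
    · refine MvPolynomial.IsHomogeneous.sub ?_ ?_
      · rw [add_comm]
        exact (MvPolynomial.isHomogeneous_X _ i).mul hh.1
      · have := rsq_isHomogeneous.mul ((hh.1.pderiv (i := i)).C_mul (kap n m))
        rwa [show 2 + (m - 1) = m + 1 by omega] at this
    · have hE := (hh.1.pderiv (i := i)).sum_X_mul_pderiv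
      rw [LightCone.up, lap_sub, lap_X_mul, hh.2, show rsq n * (C (kap n m) * MvPolynomial.pderiv i h) =
        C (kap n m) * (rsq n * MvPolynomial.pderiv i h) by ring, lap_C_mul, lap_rsq_mul, lap_pderiv,
        hh.2, hE]
      have hn : 0 < n := i.pos
      have hk : kap n m * (2 * (n + 2 * m - 2)) = 2 := by
        have h3 : ((n : ℂ) + 2 * m - 2) ≠ 0 := by
          have h4 : (n : ℤ) + 2 * m - 2 ≠ 0 := by omega
          exact_mod_cast h4
        rw [kap]
        field_simp
      have hk2 : (C (kap n m) : Pol n) * (4 * (m - 1 : ℕ) + 2 * n) = 2 := by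
        have h5 : (4 * (m - 1 : ℕ) + 2 * n : Pol n) = C (2 * ((n : ℂ) + 2 * m - 2)) := by
          rw [Nat.cast_sub hm]
          simp only [map_mul, map_sub, map_add, map_natCast, map_ofNat]
          push_cast
          ring
        rw [h5, ← map_mul, hk, map_ofNat]
      rw [nsmul_eq_mul]
      simp only [mul_zero, map_zero, zero_add]
      linear_combination (-MvPolynomial.pderiv i h) * hk2

lemma X_mul_eq (m : ℕ) (i : Fin n) (h : Pol n) :
    X i * h = up m i h + rsq n * (C (kap n m) * pderiv i h) := by
  rw [up]
  ring

/-- The infinitesimal rotation `x_k ∂_l - x_l ∂_k`. -/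
def rotP (k l : Fin n) (h : Pol n) : Pol n := X k * pderiv l h - X l * pderiv k h

lemma IsHarmonic.rotP {h : Pol n} (hh : IsHarmonic m h) (k l : Fin n) :
    IsHarmonic m (rotP k l h) := by
  rw [isHarmonic_iff] at hh ⊢
  constructor
  · rcases Nat.eq_zero_or_pos m with rfl | hm
    · simp only [LightCone.rotP, pderiv_eq_zero_of_homogeneous_zero hh.1, mul_zero, sub_zero]
      exact MvPolynomial.isHomogeneous_zero _ _ _
    · have h1 : ∀ i j : Fin n, (X i * MvPolynomial.pderiv j h).IsHomogeneous m := by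
        intro i j
        have := (MvPolynomial.isHomogeneous_X ℂ i).mul (hh.1.pderiv (i := j))
        rwa [show 1 + (m - 1) = m by omega] at this
      exact (h1 k l).sub (h1 l k)
  · rw [LightCone.rotP, lap_sub, lap_X_mul, lap_X_mul, lap_pderiv, lap_pderiv, hh.2, pderiv_comm k l]
    simp

lemma sum_rotP_rotP {h : Pol n} (hh : h.IsHomogeneous m) :
    ∑ k, ∑ l, rotP k l (rotP k l h) = 2 * (rsq n * lap h) - 2 * m * (m + n - 2) * h := by
  have hE := hh.sum_X_mul_pderiv
  have hE2 : ∀ k, ∑ l, X l * pderiv l (pderiv k h) = ((m - 1 : ℕ) : Pol n) * pderiv k h := fun k => by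
    rw [(hh.pderiv (i := k)).sum_X_mul_pderiv, nsmul_eq_mul]
  rw [nsmul_eq_mul] at hE
  have h1 : ∀ k l, rotP k l (rotP k l h) =
      (if l = k then 2 * (X k * pderiv k h) else 0) - X k * pderiv k h - X l * pderiv l h +
      (X k ^ 2 * pderiv l (pderiv l h) + X l ^ 2 * pderiv k (pderiv k h)) -
      2 * (X k * (X l * pderiv l (pderiv k h))) := by
    intro k l
    simp only [rotP, map_sub, MvPolynomial.pderiv_mul, pderiv_X_ite]
    rw [pderiv_comm k l]
    by_cases hkl : l = k
    · subst hkl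
      simp
      ring
    · simp [hkl, Ne.symm hkl]
      ring
  simp only [h1, Finset.sum_add_distrib, Finset.sum_sub_distrib, ← Finset.mul_sum, hE2,
    ← Finset.sum_mul, Finset.sum_const, Finset.card_univ, Fintype.card_fin, nsmul_eq_mul,
    Finset.sum_ite_eq', Finset.mem_univ, if_true, hE]
  have h2 : ∑ k, X k * (((m - 1 : ℕ) : Pol n) * pderiv k h) = ((m - 1 : ℕ) : Pol n) * (m * h) := by
    rw [← hE, Finset.mul_sum]
    exact Finset.sum_congr rfl fun k _ => by ring
  have h3 : (((m - 1 : ℕ) : Pol n) * (m * h)) = (m - 1) * (m * h) := by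
    rcases Nat.eq_zero_or_pos m with rfl | hm
    · simp
    · rw [Nat.cast_sub hm, Nat.cast_one]
  have h4 : ∑ x, X x * ((n : Pol n) * pderiv x h) = n * (m * h) := by
    rw [← hE, Finset.mul_sum]
    exact Finset.sum_congr rfl fun k _ => by ring
  rw [h2, h3, h4, lap, rsq]
  ring

/-- Substitution of a linear map, given by a matrix, in a polynomial. -/
def subst (A : Matrix (Fin n) (Fin n) ℝ) : Pol n →ₐ[ℂ] Pol n :=
  MvPolynomial.aeval fun i => ∑ j, C (A i j : ℂ) * X j

lemma pe_subst (A : Matrix (Fin n) (Fin n) ℝ) (h : Pol n) (x : Fin n → ℝ) :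
    pe (subst A h) x = pe h (A.mulVec x) := by
  induction h using MvPolynomial.induction_on with
  | C c => simp [subst, pe]
  | add g h hg hh => rw [map_add, pe_add, hg, hh, pe_add]
  | mul_X h i hh =>
    rw [map_mul, pe_mul, hh, pe_mul, pe_X]
    simp [subst, pe, Matrix.mulVec, dotProduct]

lemma pderiv_subst (A : Matrix (Fin n) (Fin n) ℝ) (h : Pol n) (k : Fin n) :
    pderiv k (subst A h) = ∑ i, C (A i k : ℂ) * subst A (pderiv i h) := by
  induction h using MvPolynomial.induction_on with
  | C c => simp [subst]
  | add g h hg hh => simp only [map_add, hg, hh, mul_add, Finset.sum_add_distrib]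
  | mul_X h i hh =>
    have h1 : pderiv k (subst A (X i)) = C (A i k : ℂ) := by
      simp [subst, Pi.single_apply]
    simp only [map_mul, MvPolynomial.pderiv_mul, hh, h1, map_add, mul_add, Finset.sum_add_distrib,
      pderiv_X_ite, apply_ite (subst A), map_zero, mul_ite, mul_one, mul_zero]
    simp only [Finset.sum_ite_eq, Finset.mem_univ, if_true, Finset.sum_mul]
    congr 1
    · exact Finset.sum_congr rfl fun j _ => by ring
    · ring

lemma IsHarmonic.subst {h : Pol n} (hh : IsHarmonic m h) (A : Matrix.orthogonalGroup (Fin n) ℝ) :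
    IsHarmonic m (subst A.1 h) := by
  rw [isHarmonic_iff] at hh ⊢
  constructor
  · have h1 : ∀ i, (∑ j, C (A.1 i j : ℂ) * X j : Pol n).IsHomogeneous 1 := fun i =>
      MvPolynomial.IsHomogeneous.sum _ _ _ fun j _ => MvPolynomial.isHomogeneous_C_mul_X _ _
    have := hh.1.aeval (fun i => (∑ j, C (A.1 i j : ℂ) * X j : Pol n)) h1
    rwa [one_mul] at this
  · have hA : ∀ i i', ∑ k, A.1 i k * A.1 i' k = if i = i' then 1 else 0 := by
      intro i i'
      have h1 : A.1 * A.1.transpose = 1 := Matrix.mem_unitaryGroup_iff.1 A.2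
      have := congrFun (congrFun h1 i) i'
      rw [Matrix.mul_apply, Matrix.one_apply] at this
      exact this
    have h2 : lap (LightCone.subst A.1 h) = ∑ i, ∑ i', C ((∑ k, A.1 i k * A.1 i' k : ℝ) : ℂ) *
        LightCone.subst A.1 (MvPolynomial.pderiv i' (MvPolynomial.pderiv i h)) := by
      simp only [lap, pderiv_subst, map_sum, MvPolynomial.pderiv_C_mul, Finset.mul_sum]
      rw [Finset.sum_comm]
      refine Finset.sum_congr rfl fun i _ => ?_
      rw [Finset.sum_comm]
      refine Finset.sum_congr rfl fun i' _ => ?_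
      simp only [Complex.ofReal_sum, map_sum, Finset.sum_mul, Complex.ofReal_mul, map_mul, mul_assoc]
    rw [h2]
    simp only [hA]
    simp only [apply_ite (fun x : ℝ => (x : ℂ)), Complex.ofReal_one, Complex.ofReal_zero,
      apply_ite (C : ℂ → Pol n), map_one, map_zero, ite_mul, one_mul, zero_mul,
      Finset.sum_ite_eq, Finset.mem_univ, if_true]
    rw [← map_sum]
    have : ∑ i, MvPolynomial.pderiv i (MvPolynomial.pderiv i h) = lap h := rfl
    rw [this, hh.2, map_zero]

/-! ### Uniqueness of zonal harmonics -/

lemma pe_eq_of_pderiv_eq_zero {h : Pol n} {i : Fin n} (hd : pderiv i h = 0) (x : Fin n → ℝ) (t : ℝ) :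
    pe h (x + t • Pi.single i 1) = pe h x := by
  have h1 : ∀ s, HasDerivAt (fun s : ℝ => pe h (x + s • Pi.single i 1)) 0 s := by
    intro s
    have h2 := hasDerivAt_pe h (((hasDerivAt_id s).smul_const (Pi.single i (1 : ℝ))).const_add x)
    refine h2.congr_deriv (Finset.sum_eq_zero fun j _ => ?_)
    by_cases hj : j = i
    · rw [hj, hd]
      simp [pe]
    · simp [hj]
  have h3 := is_const_of_deriv_eq_zero (fun s => (h1 s).differentiableAt) (fun s => (h1 s).deriv) t 0
  simpa using h3

lemma pe_zero_of_homogeneous {h : Pol n} (hh : h.IsHomogeneous m) (hm : m ≠ 0) : pe h 0 = 0 := by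
  have := pe_smul hh 0 0
  rw [smul_zero] at this
  rw [this]
  simp [hm]

/-- The polynomial `∑_{k ≠ 0} x_k²`. -/
def rsq' (n : ℕ) [NeZero n] : Pol n := ∑ k, if k = 0 then 0 else X k ^ 2

lemma pe_rsq' [NeZero n] (x : Fin n → ℝ) :
    pe (rsq' n) x = ((∑ k, if k = 0 then 0 else x k ^ 2 : ℝ) : ℂ) := by
  simp only [rsq', pe_sum, Complex.ofReal_sum]
  refine Finset.sum_congr rfl fun k _ => ?_
  split_ifs <;> simp [pe]

lemma pe_lap_rsq'_pow [NeZero n] (r : ℕ) {j : Fin n} (hj : j ≠ 0) (c : ℂ) :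
    pe (lap (C c * rsq' n ^ r)) (Pi.single j 1) = c * (2 * r * (2 * r + n - 3)) := by
  have h1 : ∀ k, pderiv k (rsq' n) = if k = 0 then 0 else C 2 * X k := by
    intro k
    simp only [rsq', map_sum, apply_ite (pderiv k), map_zero, MvPolynomial.pderiv_pow, pderiv_X_ite,
      mul_ite, mul_one, mul_zero]
    rw [Finset.sum_eq_single k]
    · simp [show (C 2 : Pol n) = 2 from map_ofNat C 2]
    · intro b _ hb
      simp [hb]
    · simp
  have hN : pe (rsq' n) (Pi.single j 1) = 1 := by
    rw [pe_rsq', Finset.sum_eq_single j]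
    · simp [hj]
    · intro b _ hb
      simp [hb]
    · simp
  have hpow : ∀ s, pe (rsq' n ^ s) (Pi.single j 1) = 1 := by
    intro s
    have : pe (rsq' n ^ s) (Pi.single j 1) = pe (rsq' n) (Pi.single j 1) ^ s := by simp [pe]
    rw [this, hN, one_pow]
  have h2 : ∀ k, pe (pderiv k (pderiv k (rsq' n ^ r))) (Pi.single j 1) =
      (if k = j then (4 * r * (r - 1) : ℂ) else 0) + if k = 0 then 0 else (2 * r : ℂ) := by
    intro k
    rw [MvPolynomial.pderiv_pow, h1]
    by_cases hk : k = 0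
    · subst hk
      simp [pe, Ne.symm hj]
    · rw [if_neg hk, if_neg hk]
      have h3 : (r : Pol n) * rsq' n ^ (r - 1) * (C 2 * X k) =
          C (2 * r : ℂ) * (rsq' n ^ (r - 1) * X k) := by
        simp only [map_mul, map_natCast]
        ring
      rw [h3, MvPolynomial.pderiv_C_mul, pe_mul, pe_C, MvPolynomial.pderiv_mul, pe_add, pe_mul, pe_mul,
        MvPolynomial.pderiv_X_self, hpow, pe_X, MvPolynomial.pderiv_pow, pe_mul, pe_mul, hpow, h1,
        if_neg hk, pe_mul, pe_C, pe_X]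
      have h4 : pe (((r - 1 : ℕ) : Pol n)) (Pi.single j 1) = ((r - 1 : ℕ) : ℂ) := by simp [pe]
      have h5 : pe (1 : Pol n) (Pi.single j 1) = 1 := by simp [pe]
      rw [h4, h5]
      rcases Nat.eq_zero_or_pos r with rfl | hr
      · simp
      · rw [Nat.cast_sub hr]
        by_cases hkj : k = j
        · subst hkj
          simp
          ring
        · simp [hkj]
  rw [lap_C_mul, pe_mul, pe_C, lap, pe_sum]
  simp only [h2, Finset.sum_add_distrib, Finset.sum_ite_eq', Finset.mem_univ, if_true]
  congr 1
  have h6 : ∑ k : Fin n, (if k = 0 then 0 else (2 * r : ℂ)) = 2 * r * (n - 1) := by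
    have h7 : ∀ k : Fin n, (if k = 0 then 0 else (2 * r : ℂ)) = 2 * r - if k = 0 then (2 * r : ℂ) else 0 := by
      intro k
      split_ifs <;> ring
    simp only [h7, Finset.sum_sub_distrib]
    simp
    ring
  rw [h6]
  ring

/-- A harmonic polynomial that is invariant under the stabilizer of a unit vector and vanishes
there is zero. -/
lemma eq_zero_of_zonal [NeZero n] (m : ℕ) : ∀ {h : Pol n}, IsHarmonic m h →
    (∀ A : Matrix.orthogonalGroup (Fin n) ℝ, A.1.mulVec (Pi.single 0 1) = Pi.single 0 1 →
      ∀ x, pe h (A.1.mulVec x) = pe h x) → pe h (Pi.single 0 1) = 0 → h = 0 := by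
  induction m with
  | zero =>
    intro h hh _ h0
    have h1 := hh.1
    rw [← MvPolynomial.totalDegree_zero_iff_isHomogeneous,
      MvPolynomial.totalDegree_eq_zero_iff_eq_C] at h1
    rw [h1, pe_C] at h0
    rw [h1, h0, map_zero]
  | succ m ih =>
    intro h hh hinv h0
    have hg : pderiv 0 h = 0 := by
      refine ih (hh.pderiv 0) (fun A hA x => ?_) ?_
      · have h1 : subst A.1 h = h := pol_ext fun y => by rw [pe_subst, hinv A hA]
        have h2 := pderiv_subst A.1 h 0
        have h3 : ∀ i, A.1 i 0 = (Pi.single 0 1 : Fin n → ℝ) i := by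
          intro i
          rw [← hA]
          simp
        rw [h1] at h2
        simp only [h3] at h2
        rw [Finset.sum_eq_single 0] at h2
        · rw [Pi.single_eq_same, Complex.ofReal_one, map_one, one_mul] at h2
          rw [← pe_subst, ← h2]
        · intro b _ hb
          simp [hb]
        · simp
      · have h1 := congrArg (fun g => pe g (Pi.single 0 1)) hh.1.sum_X_mul_pderiv
        simp only [pe_sum, pe_mul, pe_X, nsmul_eq_mul, h0, mul_zero] at h1
        rw [Finset.sum_eq_single 0] at h1
        · simpa using h1
        · intro b _ hb
          simp [hb]
        · simp
    have hx' : ∀ x : Fin n → ℝ, pe h x = pe h (x + (-x 0) • Pi.single 0 1) := fun x =>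
      (pe_eq_of_pderiv_eq_zero hg x _).symm
    by_cases hn : ∃ j : Fin n, j ≠ 0
    · obtain ⟨j, hj⟩ := hn
      have key : ∀ x y : Fin n → ℝ, x 0 = 0 → y 0 = 0 → x ⬝ᵥ x = y ⬝ᵥ y → pe h x = pe h y := by
        intro x y hx hy hxy
        obtain ⟨A, hA, hA'⟩ := exists_orthogonal_mulVec x y hxy
        rw [← hA, hinv A]
        refine hA' _ ?_
        simp [hx, hy]
      have hval : ∀ x, pe h x =
          ((√(∑ k, if k = 0 then 0 else x k ^ 2) : ℝ) : ℂ) ^ (m + 1) * pe h (Pi.single j 1) := by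
        intro x
        rw [hx', ← pe_smul hh.1]
        refine key _ _ (by simp) (by simp [Ne.symm hj]) ?_
        have h1 : 0 ≤ ∑ k, if k = 0 then 0 else x k ^ 2 := Finset.sum_nonneg fun k _ => by
          split_ifs
          · exact le_rfl
          · exact sq_nonneg _
        simp only [smul_dotProduct, dotProduct_smul, smul_eq_mul, single_dotProduct,
          Pi.single_eq_same, mul_one]
        rw [Real.mul_self_sqrt h1, dotProduct]
        refine Finset.sum_congr rfl fun k _ => ?_
        by_cases hk : k = 0
        · subst hk
          simp
        · simp [hk]
          ring
      have hc : pe h (Pi.single j 1) = 0 := by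
        rcases Nat.even_or_odd (m + 1) with ⟨r, hr⟩ | ho
        · have h1 : h = C (pe h (Pi.single j 1)) * rsq' n ^ r := by
            refine pol_ext fun x => ?_
            rw [hval x, pe_mul, pe_C]
            have h2 : pe (rsq' n ^ r) x = pe (rsq' n) x ^ r := by simp [pe]
            rw [h2, pe_rsq', hr, ← two_mul, pow_mul, mul_comm]
            congr 2
            rw [← Complex.ofReal_pow, Real.sq_sqrt]
            exact Finset.sum_nonneg fun k _ => by
              split_ifs
              · exact le_rfl
              · exact sq_nonneg _
          have h3 := pe_lap_rsq'_pow r hj (pe h (Pi.single j 1))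
          rw [← h1, (isHarmonic_iff.1 hh).2] at h3
          have h4 : (2 * r * (2 * r + n - 3) : ℂ) ≠ 0 := by
            have hn2 : 2 ≤ n := by
              have := j.2
              have : (j : ℕ) ≠ 0 := fun h => hj (Fin.ext (by simpa using h))
              omega
            have h5 : (2 * r * (2 * r + n - 3) : ℤ) ≠ 0 := by
              refine mul_ne_zero (by omega) (by omega)
            exact_mod_cast h5
          have h6 : pe (0 : Pol n) (Pi.single j 1) = 0 := by simp [pe]
          rw [h6] at h3
          exact (mul_eq_zero.1 h3.symm).resolve_right h4
        · have h1 := pe_smul hh.1 (-1) (Pi.single j 1)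
          rw [key ((-1 : ℝ) • Pi.single j 1) (Pi.single j 1) (by simp [Ne.symm hj])
            (by simp [Ne.symm hj]) (by simp)] at h1
          rw [Complex.ofReal_neg, Complex.ofReal_one, ho.neg_one_pow, neg_one_mul] at h1
          exact self_eq_neg.1 h1
      refine pol_ext fun x => ?_
      rw [hval x, hc, mul_zero]
      simp [pe]
    · push Not at hn
      refine pol_ext fun x => ?_
      rw [hx']
      have : x + (-x 0) • Pi.single 0 1 = 0 := by
        ext k
        rw [hn k]
        simp
      rw [this, pe_zero_of_homogeneous hh.1 (Nat.succ_ne_zero m)]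
      simp [pe]

end Polynomial

end

section

variable {p q : ℕ} {a : ℝ}

/-! ### `K`-types as subspaces of `S^a(X⁰)` -/

lemma jMap_apply (m n : ℕ) (h₁ : Pol p) (h₂ : Pol q) (w : cone p q) :
    jMap (a : ℂ) m n h₁ h₂ w = pe h₁ w.1.1 * pe h₂ w.1.2 * ((nx w.1 ^ ((a - m - n) / 2) : ℝ) : ℂ) := by
  rw [Complex.ofReal_cpow (nx_nonneg _)]
  push_cast
  rfl

lemma jMap_mem {m n : ℕ} {h₁ : Pol p} {h₂ : Pol q} (H₁ : h₁.IsHomogeneous m)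
    (H₂ : h₂.IsHomogeneous n) : jMap (a : ℂ) m n h₁ h₂ ∈ S p q (a : ℂ) := by
  refine ⟨⟨fun w => pe h₁ w.1 * pe h₂ w.2 *
    ((((nx w + ny w) / 2) ^ ((a - m - n) / 2) : ℝ) : ℂ), ?_, fun w => ?_⟩, fun t w w' ht h => ?_⟩
  · refine ContDiffOn.mul ?_ ?_
    · exact (((contDiff_pe h₁).comp contDiff_fst).mul ((contDiff_pe h₂).comp contDiff_snd)).contDiffOn
    · refine Complex.ofRealCLM.contDiff.comp_contDiffOn ?_
      refine ContDiffOn.rpow_const_of_ne ?_ fun w hw => ?_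
      · exact ((contDiff_nx.add contDiff_ny).div_const 2).contDiffOn
      · have := nx_add_ny_pos hw
        positivity
  · rw [jMap_apply]
    simp only [← cone_eq w, add_self_div_two]
  · rw [jMap_apply, jMap_apply, h, Prod.smul_fst, Prod.smul_snd, pe_smul H₁, pe_smul H₂, nx_smul,
      Real.mul_rpow (sq_nonneg t) (nx_nonneg _), ← Complex.ofReal_cpow ht.le]
    have h1 : t ^ a = t ^ m * t ^ n * (t ^ 2) ^ ((a - m - n) / 2) := by
      rw [← Real.rpow_natCast t m, ← Real.rpow_natCast t n, ← Real.rpow_natCast t 2,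
        ← Real.rpow_mul ht.le, ← Real.rpow_add ht, ← Real.rpow_add ht]
      congr 1
      push_cast
      ring
    rw [h1]
    push_cast
    ring

/-- The element `h₁(x) h₂(y) |x|^{a-m-n}` of `S^a(X⁰)`. -/
def jS (a : ℝ) {m n : ℕ} {h₁ : Pol p} {h₂ : Pol q} (H₁ : IsHarmonic m h₁) (H₂ : IsHarmonic n h₂) :
    HS p q a := HS.mk (jMap (a : ℂ) m n h₁ h₂) (jMap_mem H₁.1 H₂.1)

/-- The `K`-type `(m, n)` as a subspace of `S^a(X⁰)`. -/
def VT (p q : ℕ) (a : ℝ) (α : ℕ × ℕ) : Submodule ℂ (HS p q a) :=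
  (KType p q (a : ℂ) α.1 α.2).comap (toFn p q a)

lemma jS_mem {m n : ℕ} {h₁ : Pol p} {h₂ : Pol q} (H₁ : IsHarmonic m h₁) (H₂ : IsHarmonic n h₂) :
    jS a H₁ H₂ ∈ VT p q a (m, n) := Submodule.subset_span ⟨h₁, h₂, H₁, H₂, rfl⟩

lemma KType_le (m n : ℕ) : KType p q (a : ℂ) m n ≤ S p q (a : ℂ) := by
  refine Submodule.span_le.2 ?_
  rintro _ ⟨h₁, h₂, H₁, H₂, rfl⟩
  exact jMap_mem H₁.1 H₂.1

lemma map_VT (α : ℕ × ℕ) : (VT p q a α).map (toFn p q a) = KType p q (a : ℂ) α.1 α.2 := by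
  rw [VT, Submodule.map_comap_eq, inf_eq_right]
  intro f hf
  exact ⟨HS.mk f (KType_le _ _ hf), rfl⟩

@[elab_as_elim]
lemma VT_induction {α : ℕ × ℕ} {P : HS p q a → Prop} {v : HS p q a} (hv : v ∈ VT p q a α)
    (hj : ∀ (h₁ : Pol p) (h₂ : Pol q) (H₁ : IsHarmonic α.1 h₁) (H₂ : IsHarmonic α.2 h₂),
      P (jS a H₁ H₂)) (hadd : ∀ u v, P u → P v → P (u + v)) : P v := by
  have key : ∀ f ∈ KType p q (a : ℂ) α.1 α.2, ∃ v : HS p q a, v.fn = f ∧ P v := by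
    intro f hf
    refine Submodule.closure_induction (s := {f | ∃ h₁ h₂, IsHarmonic α.1 h₁ ∧ IsHarmonic α.2 h₂ ∧
      f = jMap (a : ℂ) α.1 α.2 h₁ h₂}) (p := fun f _ => ∃ v : HS p q a, v.fn = f ∧ P v) ?_ ?_ ?_ hf
    · refine ⟨_, ?_, hj 0 0 isHarmonic_zero isHarmonic_zero⟩
      funext w
      change jMap (a : ℂ) α.1 α.2 (0 : Pol p) (0 : Pol q) w = 0
      simp [jMap]
    · rintro _ _ _ _ ⟨u, rfl, hu⟩ ⟨v, rfl, hv⟩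
      exact ⟨u + v, rfl, hadd u v hu hv⟩
    · rintro c _ ⟨h₁, h₂, H₁, H₂, rfl⟩
      refine ⟨_, ?_, hj (C c * h₁) h₂ (H₁.C_mul c) H₂⟩
      funext w
      change jMap (a : ℂ) α.1 α.2 (C c * h₁) h₂ w = c * jMap (a : ℂ) α.1 α.2 h₁ h₂ w
      simp [jMap, mul_assoc]
  obtain ⟨u, hu, hP⟩ := key v.fn hv
  rwa [HS.fn_injective hu] at hP

lemma jS_apply {m n : ℕ} {h₁ : Pol p} {h₂ : Pol q} (H₁ : IsHarmonic m h₁) (H₂ : IsHarmonic n h₂)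
    (w : cone p q) : jS a H₁ H₂ w =
      pe h₁ w.1.1 * pe h₂ w.1.2 * ((nx w.1 ^ ((a - m - n) / 2) : ℝ) : ℂ) := jMap_apply m n h₁ h₂ w

lemma jS_apply_spheres {m n : ℕ} {h₁ : Pol p} {h₂ : Pol q} (H₁ : IsHarmonic m h₁)
    (H₂ : IsHarmonic n h₂) {w : cone p q} (hw : nx w.1 = 1) :
    jS a H₁ H₂ w = pe h₁ w.1.1 * pe h₂ w.1.2 := by
  rw [jS_apply, hw, Real.one_rpow, Complex.ofReal_one, mul_one]

lemma exists_unit_pe_ne_zero {n m : ℕ} [NeZero n] {h : Pol n} (hh : h.IsHomogeneous m) (h0 : h ≠ 0) :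
    ∃ x : Fin n → ℝ, x ⬝ᵥ x = 1 ∧ pe h x ≠ 0 := by
  by_contra hc
  push Not at hc
  have h1 : ∀ x : Fin n → ℝ, x ≠ 0 → pe h x = 0 := by
    intro x hx
    have hp : 0 < x ⬝ᵥ x := by
      refine lt_of_le_of_ne ?_ fun he => hx (dotProduct_self_eq_zero.1 he.symm)
      exact Finset.sum_nonneg fun _ _ => mul_self_nonneg _
    have h2 := hc ((√(x ⬝ᵥ x))⁻¹ • x) (by
      rw [smul_dotProduct, dotProduct_smul, smul_eq_mul, smul_eq_mul, ← mul_assoc, ← mul_inv,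
        Real.mul_self_sqrt hp.le, inv_mul_cancel₀ hp.ne'])
    rw [pe_smul hh] at h2
    refine (mul_eq_zero.1 h2).resolve_left (pow_ne_zero _ ?_)
    exact_mod_cast inv_ne_zero (Real.sqrt_pos.2 hp).ne'
  refine h0 (pol_ext fun x => ?_)
  have h3 : pe (0 : Pol n) x = 0 := by simp [pe]
  rw [h3]
  by_cases hx : x = 0
  · have h4 := pe_smul hh 0 (Pi.single 0 1)
    rw [zero_smul, h1 (Pi.single 0 1) (by simp), mul_zero] at h4
    rw [hx, h4]
  · exact h1 x hx

lemma jS_eq_zero [NeZero p] [NeZero q] {m n : ℕ} {h₁ : Pol p} {h₂ : Pol q} (H₁ : IsHarmonic m h₁)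
    (H₂ : IsHarmonic n h₂) (h : jS a H₁ H₂ = 0) : h₁ = 0 ∨ h₂ = 0 := by
  by_contra hc
  push Not at hc
  obtain ⟨x, hx, hx'⟩ := exists_unit_pe_ne_zero H₁.1 hc.1
  obtain ⟨y, hy, hy'⟩ := exists_unit_pe_ne_zero H₂.1 hc.2
  have hw : ((x, y) : V p q) ∈ spheres p q := by
    rw [mem_spheres, nx_eq, ny_eq]
    exact ⟨hx, hy⟩
  have h1 := jS_apply_spheres (a := a) H₁ H₂ (w := ⟨_, spheres_subset_cone hw⟩) hw.1
  rw [h, HS.zero_apply] at h1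
  exact mul_ne_zero hx' hy' h1.symm

variable [NeZero p] [NeZero q]

lemma jS_pt {m n : ℕ} {h₁ : Pol p} {h₂ : Pol q} (H₁ : IsHarmonic m h₁) (H₂ : IsHarmonic n h₂)
    (k : K p q) : jS a H₁ H₂ (pt k) = pe h₁ (pt k).1.1 * pe h₂ (pt k).1.2 :=
  jS_apply_spheres H₁ H₂ (pt_mem_spheres k).1

lemma Lx_jS {m n : ℕ} {h₁ : Pol p} {h₂ : Pol q} (H₁ : IsHarmonic m h₁) (H₂ : IsHarmonic n h₂)
    (k l : Fin p) : Lx k l (jS a H₁ H₂) = jS a (H₁.rotP k l) H₂ := by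
  refine HS.ext_pt fun g => ?_
  have h1 := hasDerivAt_flow_zero (rotX p q k l) (jS a H₁ H₂) (pt g)
  have h2 : (fun t => jS a H₁ H₂ (move ((rotX p q k l).g t) (pt g))) = fun t =>
      pe h₁ (((rotX p q k l).g t).1 (pt g)).1 * pe h₂ (pt g).1.2 := by
    funext t
    have hn : nx (move ((rotX p q k l).g t) (pt g)).1 = 1 :=
      (nx_rotX k l t _).trans (pt_mem_spheres g).1
    rw [jS_apply_spheres H₁ H₂ hn]
    congr 2
    exact Matrix.one_mulVec _
  rw [h2] at h1
  have h3 := (hasDerivAt_pe h₁ ((rotX p q k l).deriv_zero (pt g)).fst).mul_const (pe h₂ (pt g).1.2)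
  rw [Lx, h1.unique h3, jS_pt, (rotX p q k l).zero]
  congr 1
  have h4 : ((1 : O p q).1 (pt g)) = (pt g : V p q) := rfl
  rw [h4, rotX_X]
  simp only [Pi.sub_apply, Pi.smul_apply, smul_eq_mul, Complex.ofReal_sub, Complex.ofReal_mul,
    Pi.single_apply, sub_mul, Finset.sum_sub_distrib, rotP, pe_sub, pe_mul, pe_X]
  simp only [apply_ite (fun x : ℝ => (x : ℂ)), Complex.ofReal_one, Complex.ofReal_zero, mul_ite,
    ite_mul, mul_one, mul_zero, zero_mul, Finset.sum_ite_eq', Finset.mem_univ, if_true]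

lemma Ly_jS {m n : ℕ} {h₁ : Pol p} {h₂ : Pol q} (H₁ : IsHarmonic m h₁) (H₂ : IsHarmonic n h₂)
    (k l : Fin q) : Ly k l (jS a H₁ H₂) = jS a H₁ (H₂.rotP k l) := by
  refine HS.ext_pt fun g => ?_
  have h1 := hasDerivAt_flow_zero (rotY p q k l) (jS a H₁ H₂) (pt g)
  have h2 : (fun t => jS a H₁ H₂ (move ((rotY p q k l).g t) (pt g))) = fun t =>
      pe h₁ (pt g).1.1 * pe h₂ (((rotY p q k l).g t).1 (pt g)).2 := by
    funext t
    have hn : nx (move ((rotY p q k l).g t) (pt g)).1 = 1 :=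
      (nx_rotY k l t _).trans (pt_mem_spheres g).1
    rw [jS_apply_spheres H₁ H₂ hn]
    congr 2
    exact Matrix.one_mulVec _
  rw [h2] at h1
  have h3 := (hasDerivAt_pe h₂ ((rotY p q k l).deriv_zero (pt g)).snd).const_mul (pe h₁ (pt g).1.1)
  rw [Ly, h1.unique h3, jS_pt, (rotY p q k l).zero]
  congr 1
  have h4 : ((1 : O p q).1 (pt g)) = (pt g : V p q) := rfl
  rw [h4, rotY_X]
  simp only [Pi.sub_apply, Pi.smul_apply, smul_eq_mul, Complex.ofReal_sub, Complex.ofReal_mul,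
    Pi.single_apply, sub_mul, Finset.sum_sub_distrib, rotP, pe_sub, pe_mul, pe_X]
  simp only [apply_ite (fun x : ℝ => (x : ℂ)), Complex.ofReal_one, Complex.ofReal_zero, mul_ite,
    ite_mul, mul_one, mul_zero, zero_mul, Finset.sum_ite_eq', Finset.mem_univ, if_true]

lemma Mx_jS {m n : ℕ} {h₁ : Pol p} {h₂ : Pol q} (H₁ : IsHarmonic m h₁) (H₂ : IsHarmonic n h₂)
    (i : Fin p) : Mx i (jS a H₁ H₂) =
      jS a (H₁.up i) H₂ + jS a ((H₁.pderiv i).C_mul (kap p m)) H₂ := by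
  refine HS.ext_pt fun g => ?_
  have hn : nx (pt g).1 = 1 := (pt_mem_spheres g).1
  have h1 := congrArg (fun h => pe h (pt g).1.1) (X_mul_eq m i h₁)
  have h2 : pe (rsq p) (pt g).1.1 = 1 := by
    rw [← Complex.ofReal_one, ← hn]
    simp [rsq, pe, nx]
  simp only [pe_add, pe_mul, pe_X, h2, one_mul] at h1
  rw [HS.add_apply, jS_pt, jS_pt, Mx, mulS_apply, jS_pt, mx, hn, Real.sqrt_one, div_one, ← mul_assoc,
    h1, pe_mul, add_mul]

lemma My_jS {m n : ℕ} {h₁ : Pol p} {h₂ : Pol q} (H₁ : IsHarmonic m h₁) (H₂ : IsHarmonic n h₂)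
    (j : Fin q) : My j (jS a H₁ H₂) =
      jS a H₁ (H₂.up j) + jS a H₁ ((H₂.pderiv j).C_mul (kap q n)) := by
  refine HS.ext_pt fun g => ?_
  have hn : nx (pt g).1 = 1 := (pt_mem_spheres g).1
  have h1 := congrArg (fun h => pe h (pt g).1.2) (X_mul_eq n j h₂)
  have h2 : pe (rsq q) (pt g).1.2 = 1 := by
    have : ny (pt g).1 = 1 := (pt_mem_spheres g).2
    rw [← Complex.ofReal_one, ← this]
    simp [rsq, pe, ny]
  simp only [pe_add, pe_mul, pe_X, h2, one_mul] at h1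
  rw [HS.add_apply, jS_pt, jS_pt, My, mulS_apply, jS_pt, my, hn, Real.sqrt_one, div_one,
    mul_left_comm, h1, pe_mul, mul_add]

lemma rhoS_jS {m n : ℕ} {h₁ : Pol p} {h₂ : Pol q} (H₁ : IsHarmonic m h₁) (H₂ : IsHarmonic n h₂)
    (k : K p q) : rhoS (kO k) (jS a H₁ H₂) =
      jS a (H₁.subst k⁻¹.left) (H₂.subst k⁻¹.right) := by
  refine HS.ext_pt fun g => ?_
  rw [rhoS_apply, jS_pt, ← map_inv, ← pt_mul, jS_pt, pt_mul, coe_move, kO_apply, pe_subst, pe_subst]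

lemma jS_C_mul {m n : ℕ} {h₁ : Pol p} {h₂ : Pol q} (H₁ : IsHarmonic m h₁)
    (H₂ : IsHarmonic n h₂) (c : ℂ) : jS a (H₁.C_mul c) H₂ = c • jS a H₁ H₂ := by
  refine HS.ext_pt fun g => ?_
  rw [HS.smul_apply, jS_pt, jS_pt, pe_mul, pe_C, mul_assoc]

lemma jS_C_mul' {m n : ℕ} {h₁ : Pol p} {h₂ : Pol q} (H₁ : IsHarmonic m h₁)
    (H₂ : IsHarmonic n h₂) (c : ℂ) : jS a H₁ (H₂.C_mul c) = c • jS a H₁ H₂ := by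
  refine HS.ext_pt fun g => ?_
  rw [HS.smul_apply, jS_pt, jS_pt, pe_mul, pe_C, mul_left_comm]

lemma Lx_mem_VT {α : ℕ × ℕ} (k l : Fin p) {v : HS p q a} (hv : v ∈ VT p q a α) :
    Lx k l v ∈ VT p q a α := by
  refine VT_induction hv (fun h₁ h₂ H₁ H₂ => ?_) fun u v hu hv => ?_
  · rw [Lx_jS]
    exact jS_mem _ _
  · rw [map_add]
    exact add_mem hu hv

lemma Ly_mem_VT {α : ℕ × ℕ} (k l : Fin q) {v : HS p q a} (hv : v ∈ VT p q a α) :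
    Ly k l v ∈ VT p q a α := by
  refine VT_induction hv (fun h₁ h₂ H₁ H₂ => ?_) fun u v hu hv => ?_
  · rw [Ly_jS]
    exact jS_mem _ _
  · rw [map_add]
    exact add_mem hu hv

lemma rhoS_mem_VT {α : ℕ × ℕ} (k : K p q) {v : HS p q a} (hv : v ∈ VT p q a α) :
    rhoS (kO k) v ∈ VT p q a α := by
  refine VT_induction hv (fun h₁ h₂ H₁ H₂ => ?_) fun u v hu hv => ?_
  · rw [rhoS_jS]
    exact jS_mem _ _
  · rw [map_add]
    exact add_mem hu hv

/-- The eigenvalue of the spherical Laplacian on harmonics of degree `m` in `n` variables. -/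
def lam (n m : ℕ) : ℝ := m * (m + n - 2)

lemma Cx_VT {α : ℕ × ℕ} {v : HS p q a} (hv : v ∈ VT p q a α) :
    Cx v = (-2 * lam p α.1 : ℂ) • v := by
  refine VT_induction hv (fun h₁ h₂ H₁ H₂ => ?_) fun u v hu hv => ?_
  · rw [Cx_apply]
    simp only [Lx_jS]
    refine HS.ext_pt fun g => ?_
    have h1 := congrArg (fun h => pe h (pt g).1.1) (sum_rotP_rotP H₁.1)
    rw [(isHarmonic_iff.1 H₁).2] at h1
    simp only [pe_sum] at h1
    simp only [HS.sum_apply, jS_pt, HS.smul_apply, ← Finset.sum_mul, h1]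
    simp only [mul_zero, zero_sub, lam]
    have h2 : pe (-(2 * (α.1 : Pol p) * ((α.1 : Pol p) + (p : Pol p) - 2) * h₁)) (pt g).1.1 =
        -(2 * α.1 * (α.1 + p - 2) * pe h₁ (pt g).1.1) := by
      simp [pe]
    rw [h2]
    push_cast
    ring
  · rw [map_add, hu, hv, smul_add]

lemma Cy_VT {α : ℕ × ℕ} {v : HS p q a} (hv : v ∈ VT p q a α) :
    Cy v = (-2 * lam q α.2 : ℂ) • v := by
  refine VT_induction hv (fun h₁ h₂ H₁ H₂ => ?_) fun u v hu hv => ?_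
  · rw [Cy_apply]
    simp only [Ly_jS]
    refine HS.ext_pt fun g => ?_
    have h1 := congrArg (fun h => pe h (pt g).1.2) (sum_rotP_rotP H₂.1)
    rw [(isHarmonic_iff.1 H₂).2] at h1
    simp only [pe_sum] at h1
    simp only [HS.sum_apply, jS_pt, HS.smul_apply, ← Finset.mul_sum, h1]
    simp only [mul_zero, zero_sub, lam]
    have h2 : pe (-(2 * (α.2 : Pol q) * ((α.2 : Pol q) + (q : Pol q) - 2) * h₂)) (pt g).1.2 =
        -(2 * α.2 * (α.2 + q - 2) * pe h₂ (pt g).1.2) := by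
      simp [pe]
    rw [h2]
    push_cast
    ring
  · rw [map_add, hu, hv, smul_add]

/-- The element `(-1, 1)` of `O(p) × O(q)`. -/
def negX (p q : ℕ) : K p q := K.mk (-1) 1

/-- The element `(1, -1)` of `O(p) × O(q)`. -/
def negY (p q : ℕ) : K p q := K.mk 1 (-1)

lemma rhoS_negX {α : ℕ × ℕ} {v : HS p q a} (hv : v ∈ VT p q a α) :
    rhoS (kO (negX p q)) v = ((-1) ^ α.1 : ℂ) • v := by
  refine VT_induction hv (fun h₁ h₂ H₁ H₂ => ?_) fun u v hu hv => ?_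
  · refine HS.ext_pt fun g => ?_
    rw [rhoS_jS, jS_pt, HS.smul_apply, jS_pt, pe_subst, pe_subst]
    have e1 : ((negX p q)⁻¹.left).1 = -1 := by
      have : ((negX p q)⁻¹.left) = (-1 : Matrix.orthogonalGroup (Fin p) ℝ) := by
        change (-1 : Matrix.orthogonalGroup (Fin p) ℝ)⁻¹ = -1
        simp
      rw [this]; rfl
    have e2 : ((negX p q)⁻¹.right).1 = 1 := by
      change ((1 : Matrix.orthogonalGroup (Fin q) ℝ)⁻¹).1 = 1
      simp
    rw [e1, e2, Matrix.one_mulVec, Matrix.neg_mulVec, Matrix.one_mulVec]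
    have := pe_smul H₁.1 (-1) (pt g).1.1
    rw [neg_one_smul] at this
    rw [this]
    push_cast
    ring
  · rw [map_add, hu, hv, smul_add]

lemma rhoS_negY {α : ℕ × ℕ} {v : HS p q a} (hv : v ∈ VT p q a α) :
    rhoS (kO (negY p q)) v = ((-1) ^ α.2 : ℂ) • v := by
  refine VT_induction hv (fun h₁ h₂ H₁ H₂ => ?_) fun u v hu hv => ?_
  · refine HS.ext_pt fun g => ?_
    rw [rhoS_jS, jS_pt, HS.smul_apply, jS_pt, pe_subst, pe_subst]
    have e1 : ((negY p q)⁻¹.right).1 = -1 := by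
      have : ((negY p q)⁻¹.right) = (-1 : Matrix.orthogonalGroup (Fin q) ℝ) := by
        change (-1 : Matrix.orthogonalGroup (Fin q) ℝ)⁻¹ = -1
        simp
      rw [this]; rfl
    have e2 : ((negY p q)⁻¹.left).1 = 1 := by
      change ((1 : Matrix.orthogonalGroup (Fin p) ℝ)⁻¹).1 = 1
      simp
    rw [e1, e2, Matrix.one_mulVec, Matrix.neg_mulVec, Matrix.one_mulVec]
    have := pe_smul H₂.1 (-1) (pt g).1.2
    rw [neg_one_smul] at this
    rw [this]
    push_cast
    ring
  · rw [map_add, hu, hv, smul_add]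

lemma inner_Cx (f g : HS p q a) : inner ℂ (Cx f) g = inner ℂ f (Cx g) := by
  simp only [Cx_apply, sum_inner, inner_sum, inner_Lx, neg_neg]

lemma inner_Cy (f g : HS p q a) : inner ℂ (Cy f) g = inner ℂ f (Cy g) := by
  simp only [Cy_apply, sum_inner, inner_sum, inner_Ly, neg_neg]

/-- Degrees with the same Laplace eigenvalue have different parities. -/
lemma lam_inj {n m m' : ℕ} (hn : 1 ≤ n) (h : lam n m = lam n m') (hp : (-1 : ℝ) ^ m = (-1) ^ m') :
    m = m' := by
  unfold lam at h
  have h1 : ((m : ℤ) - m') * (m + m' + n - 2) = 0 := by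
    have : (((m : ℤ) - m') * (m + m' + n - 2) : ℝ) = 0 := by
      push_cast
      linarith
    exact_mod_cast this
  rcases mul_eq_zero.1 h1 with h2 | h2
  · omega
  · by_contra hne
    have : (m = 0 ∧ m' = 1) ∨ (m = 1 ∧ m' = 0) := by omega
    rcases this with ⟨rfl, rfl⟩ | ⟨rfl, rfl⟩ <;> norm_num at hp

/-- Forms for which rotations are skew and the central elements are unitary make distinct
`K`-types orthogonal. -/
lemma VT_orthogonal_of_form {α β : ℕ × ℕ} (hαβ : α ≠ β) (B : HS p q a → HS p q a → ℂ)
    {u v : HS p q a} (hu : u ∈ VT p q a α) (hv : v ∈ VT p q a β)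
    (hl : ∀ (c : ℝ) f g, B ((c : ℂ) • f) g = c * B f g)
    (hr : ∀ (c : ℝ) f g, B f ((c : ℂ) • g) = c * B f g)
    (hx : B (Cx u) v = B u (Cx v)) (hy : B (Cy u) v = B u (Cy v))
    (hX : B (rhoS (kO (negX p q)) u) (rhoS (kO (negX p q)) v) = B u v)
    (hY : B (rhoS (kO (negY p q)) u) (rhoS (kO (negY p q)) v) = B u v) : B u v = 0 := by
  by_contra h0
  refine hαβ ?_
  have key : ∀ c c' : ℝ, (c : ℂ) * B u v = c' * B u v → c = c' := fun c c' h => by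
    exact_mod_cast mul_right_cancel₀ h0 h
  have hpar : ∀ m m' : ℕ, ((-1) ^ m * (-1) ^ m' : ℝ) = 1 → (-1 : ℝ) ^ m = (-1) ^ m' := by
    intro m m' h
    rcases neg_one_pow_eq_or ℝ m with h1 | h1 <;> rcases neg_one_pow_eq_or ℝ m' with h2 | h2 <;>
      rw [h1, h2] at h ⊢ <;> norm_num at h
  refine Prod.ext (lam_inj (NeZero.one_le (n := p)) ?_ ?_) (lam_inj (NeZero.one_le (n := q)) ?_ ?_)
  · rw [Cx_VT hu, Cx_VT hv] at hx
    have e : ∀ m, (-2 * lam p m : ℂ) = ((-2 * lam p m : ℝ) : ℂ) := fun m => by push_cast; rfl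
    rw [e, e, hl, hr] at hx
    linarith [key _ _ hx]
  · rw [rhoS_negX hu, rhoS_negX hv] at hX
    have e : ∀ m : ℕ, ((-1) ^ m : ℂ) = (((-1) ^ m : ℝ) : ℂ) := fun m => by push_cast; rfl
    rw [e, e, hl, hr, ← mul_assoc, ← Complex.ofReal_mul] at hX
    exact hpar _ _ (key _ 1 (by rw [hX, Complex.ofReal_one, one_mul]))
  · rw [Cy_VT hu, Cy_VT hv] at hy
    have e : ∀ m, (-2 * lam q m : ℂ) = ((-2 * lam q m : ℝ) : ℂ) := fun m => by push_cast; rfl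
    rw [e, e, hl, hr] at hy
    linarith [key _ _ hy]
  · rw [rhoS_negY hu, rhoS_negY hv] at hY
    have e : ∀ m : ℕ, ((-1) ^ m : ℂ) = (((-1) ^ m : ℝ) : ℂ) := fun m => by push_cast; rfl
    rw [e, e, hl, hr, ← mul_assoc, ← Complex.ofReal_mul] at hY
    exact hpar _ _ (key _ 1 (by rw [hY, Complex.ofReal_one, one_mul]))

lemma VT_orthogonal {α β : ℕ × ℕ} (hαβ : α ≠ β) {u v : HS p q a} (hu : u ∈ VT p q a α)
    (hv : v ∈ VT p q a β) : inner ℂ u v = 0 :=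
  VT_orthogonal_of_form hαβ (fun u v => inner ℂ u v) hu hv
    (fun c f g => by simp) (fun c f g => by simp)
    (inner_Cx u v) (inner_Cy u v) (inner_rhoS_kO _ u v) (inner_rhoS_kO _ u v)

/-! ### Dimension of the `K`-types -/

lemma VT_finrank (α : ℕ × ℕ) : FiniteDimensional ℂ (VT p q a α) ∧
    Module.finrank ℂ (VT p q a α) ≤ (α.1 + 1) ^ p * (α.2 + 1) ^ q := by
  let res : HS p q a →ₗ[ℂ] K p q → ℂ :=
    { toFun := fun f k => f (pt k), map_add' := fun _ _ => rfl, map_smul' := fun _ _ => rfl }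
  let mon : ((Fin p → Fin (α.1 + 1)) × (Fin q → Fin (α.2 + 1))) → K p q → ℂ := fun e k =>
    (∏ i, ((pt k).1.1 i : ℂ) ^ (e.1 i : ℕ)) * ∏ j, ((pt k).1.2 j : ℂ) ^ (e.2 j : ℕ)
  have hpe : ∀ {n m : ℕ} {h : Pol n}, h.IsHomogeneous m → ∃ c : (Fin n → Fin (m + 1)) → ℂ,
      ∀ x : Fin n → ℝ, pe h x = ∑ e, c e * ∏ i, (x i : ℂ) ^ (e i : ℕ) := by
    intro n m h hh
    refine ⟨fun e => h.coeff (Finsupp.equivFunOnFinite.symm fun i => (e i : ℕ)), fun x => ?_⟩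
    unfold pe
    rw [MvPolynomial.eval_eq']
    let ι : (Fin n → Fin (m + 1)) ↪ (Fin n →₀ ℕ) :=
      ⟨fun e => Finsupp.equivFunOnFinite.symm fun i => (e i : ℕ), fun e e' he => by
        funext i
        exact Fin.ext (DFunLike.congr_fun he i)⟩
    have hs : h.support ⊆ Finset.univ.map ι := by
      intro d hd
      have h1 : (∑ i, d i) = m := by
        rw [hh.degree_eq_sum_deg_support hd]
        exact (Finset.sum_subset (Finset.subset_univ _) (by simp)).symm
      refine Finset.mem_map.2 ⟨fun i => ⟨d i, ?_⟩, Finset.mem_univ _, ?_⟩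
      · rw [Nat.lt_succ_iff, ← h1]
        exact Finset.single_le_sum (fun _ _ => Nat.zero_le _) (Finset.mem_univ i)
      · ext i
        rfl
    rw [Finset.sum_subset hs, Finset.sum_map]
    · rfl
    · intro d _ hd
      rw [MvPolynomial.notMem_support_iff.1 hd, zero_mul]
  have hinj : Function.Injective res := fun f g h => HS.ext_pt fun k => congrFun h k
  have hle : (VT p q a α).map res ≤ Submodule.span ℂ (Set.range mon) := by
    rintro _ ⟨v, hv, rfl⟩
    refine VT_induction hv (fun h₁ h₂ H₁ H₂ => ?_) fun u v hu hv => ?_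
    · obtain ⟨c, hc⟩ := hpe H₁.1
      obtain ⟨d, hd⟩ := hpe H₂.1
      have : res (jS a H₁ H₂) = ∑ e, ∑ e', (c e * d e') • mon (e, e') := by
        funext k
        change jS a H₁ H₂ (pt k) = _
        rw [jS_pt, hc, hd, Finset.sum_mul_sum, Finset.sum_apply]
        refine Finset.sum_congr rfl fun e _ => ?_
        rw [Finset.sum_apply]
        refine Finset.sum_congr rfl fun e' _ => ?_
        simp only [mon, Pi.smul_apply, smul_eq_mul]
        ring
      rw [this]
      exact Submodule.sum_mem _ fun e _ => Submodule.sum_mem _ fun e' _ =>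
        Submodule.smul_mem _ _ (Submodule.subset_span ⟨_, rfl⟩)
    · rw [map_add]
      exact add_mem hu hv
  have hfd : FiniteDimensional ℂ (Submodule.span ℂ (Set.range mon)) :=
    FiniteDimensional.span_of_finite ℂ (Set.finite_range mon)
  have e := Submodule.equivMapOfInjective res hinj (VT p q a α)
  have hfd' : FiniteDimensional ℂ ((VT p q a α).map res) := Submodule.finiteDimensional_of_le hle
  refine ⟨e.symm.finiteDimensional, ?_⟩
  rw [e.finrank_eq]
  refine (Submodule.finrank_mono hle).trans ((finrank_range_le_card mon).trans ?_)
  simp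

instance (α : ℕ × ℕ) : FiniteDimensional ℂ (VT p q a α) := (VT_finrank α).1

end

section

variable {p q : ℕ} {a : ℝ} [NeZero p] [NeZero q]

/-! ### Projections onto the `K`-types -/

/-- The orthogonal projection onto a `K`-type. -/
def PT (α : ℕ × ℕ) : HS p q a →L[ℂ] HS p q a := (VT p q a α).starProjection

lemma PT_mem (α : ℕ × ℕ) (f : HS p q a) : PT α f ∈ VT p q a α := Submodule.starProjection_apply_mem _ f

lemma PT_of_mem {α : ℕ × ℕ} {v : HS p q a} (hv : v ∈ VT p q a α) : PT α v = v :=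
  Submodule.starProjection_eq_self_iff.2 hv

lemma inner_PT (α : ℕ × ℕ) (f g : HS p q a) : inner ℂ (PT α f) g = inner ℂ f (PT α g) :=
  Submodule.inner_starProjection_left_eq_right _ f g

lemma inner_PT_right {α : ℕ × ℕ} {v : HS p q a} (hv : v ∈ VT p q a α) (f : HS p q a) :
    inner ℂ v (PT α f) = inner ℂ v f := by rw [← inner_PT, PT_of_mem hv]

lemma PT_eq {α : ℕ × ℕ} {f x : HS p q a} (hx : x ∈ VT p q a α)
    (h : ∀ v ∈ VT p q a α, inner ℂ v x = inner ℂ v f) : PT α f = x := by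
  refine Submodule.eq_starProjection_of_mem_of_inner_eq_zero hx fun w hw => ?_
  rw [inner_sub_left, ← inner_conj_symm, ← inner_conj_symm x, h w hw, sub_self]

lemma PT_of_mem_ne {α β : ℕ × ℕ} (hαβ : α ≠ β) {v : HS p q a} (hv : v ∈ VT p q a β) :
    PT α v = 0 :=
  PT_eq (zero_mem _) fun u hu => by rw [VT_orthogonal hαβ hu hv, inner_zero_right]

lemma norm_PT_le (α : ℕ × ℕ) (f : HS p q a) : ‖PT α f‖ ≤ ‖f‖ := by
  have := (PT (a := a) α).le_opNorm f
  exact this.trans (mul_le_of_le_one_left (norm_nonneg _) (Submodule.starProjection_norm_le _))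

/-- An operator that preserves the `K`-types together with its adjoint commutes with projections. -/
lemma PT_comm {α : ℕ × ℕ} (T : HS p q a →ₗ[ℂ] HS p q a) (T' : HS p q a → HS p q a)
    (h : ∀ v f, inner ℂ v (T f) = inner ℂ (T' v) f) (hT : ∀ v ∈ VT p q a α, T v ∈ VT p q a α)
    (hT' : ∀ v ∈ VT p q a α, T' v ∈ VT p q a α) (f : HS p q a) : PT α (T f) = T (PT α f) :=
  PT_eq (hT _ (PT_mem α f)) fun v hv => by rw [h, h, inner_PT_right (hT' v hv)]

lemma inner_rhoS_right (k : K p q) (f g : HS p q a) :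
    inner ℂ f (rhoS (kO k) g) = inner ℂ (rhoS (kO k⁻¹) f) g := by
  rw [← inner_rhoS_kO k (rhoS (kO k⁻¹) f), ← rhoS_mul, ← map_mul, mul_inv_cancel, map_one, rhoS_one]

lemma PT_rhoS (α : ℕ × ℕ) (k : K p q) (f : HS p q a) :
    PT α (rhoS (kO k) f) = rhoS (kO k) (PT α f) :=
  PT_comm (rhoS (kO k)) (rhoS (kO k⁻¹)) (inner_rhoS_right k) (fun _ hv => rhoS_mem_VT k hv)
    (fun _ hv => rhoS_mem_VT k⁻¹ hv) f

lemma PT_Lx (α : ℕ × ℕ) (k l : Fin p) (f : HS p q a) : PT α (Lx k l f) = Lx k l (PT α f) :=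
  PT_comm (Lx k l) (fun v => -Lx k l v) (fun v f => by rw [inner_neg_left, inner_Lx, neg_neg])
    (fun _ hv => Lx_mem_VT k l hv) (fun _ hv => neg_mem (Lx_mem_VT k l hv)) f

lemma PT_Ly (α : ℕ × ℕ) (k l : Fin q) (f : HS p q a) : PT α (Ly k l f) = Ly k l (PT α f) :=
  PT_comm (Ly k l) (fun v => -Ly k l v) (fun v f => by rw [inner_neg_left, inner_Ly, neg_neg])
    (fun _ hv => Ly_mem_VT k l hv) (fun _ hv => neg_mem (Ly_mem_VT k l hv)) f

/-- The elliptic operator `1 - (C_x + C_y) / 2`. -/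
def Lam : Module.End ℂ (HS p q a) := 1 - (1 / 2 : ℂ) • (Cx + Cy)

lemma Lam_apply (f : HS p q a) : Lam f = f - (1 / 2 : ℂ) • (Cx f + Cy f) := rfl

/-- The sum of the two Laplace eigenvalues. -/
def lamT (p q : ℕ) (α : ℕ × ℕ) : ℝ := lam p α.1 + lam q α.2

/-- The eigenvalue of `Lam` on a `K`-type. -/
def mu (p q : ℕ) (α : ℕ × ℕ) : ℝ := 1 + lamT p q α

lemma Lam_VT {α : ℕ × ℕ} {v : HS p q a} (hv : v ∈ VT p q a α) : Lam v = (mu p q α : ℂ) • v := by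
  rw [Lam_apply, Cx_VT hv, Cy_VT hv, mu, lamT]
  push_cast
  module

lemma inner_Lam (f g : HS p q a) : inner ℂ (Lam f) g = inner ℂ f (Lam g) := by
  have h : (starRingEnd ℂ) (1 / 2 : ℂ) = 1 / 2 := by
    rw [map_div₀, map_one, map_ofNat]
  simp only [Lam_apply, inner_sub_left, inner_sub_right, inner_smul_left, inner_smul_right,
    inner_add_left, inner_add_right, inner_Cx, inner_Cy, h]

lemma inner_Lam_pow (k : ℕ) (f g : HS p q a) : inner ℂ ((Lam ^ k) f) g = inner ℂ f ((Lam ^ k) g) := by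
  induction k generalizing f g with
  | zero => rfl
  | succ k ih =>
    rw [pow_succ, Module.End.mul_apply, ih, inner_Lam, ← Module.End.mul_apply, ← pow_succ', pow_succ]

lemma PT_Lam (α : ℕ × ℕ) (f : HS p q a) : PT α (Lam f) = (mu p q α : ℂ) • PT α f := by
  rw [← Lam_VT (PT_mem α f)]
  refine PT_comm Lam Lam (fun v f => (inner_Lam v f).symm) ?_ ?_ f <;>
  · intro v hv
    rw [Lam_VT hv]
    exact Submodule.smul_mem _ _ hv

lemma PT_Lam_pow (α : ℕ × ℕ) (k : ℕ) (f : HS p q a) :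
    PT α ((Lam ^ k) f) = ((mu p q α ^ k : ℝ) : ℂ) • PT α f := by
  induction k with
  | zero => simp
  | succ k ih =>
    rw [pow_succ', Module.End.mul_apply, PT_Lam, ih, smul_smul, pow_succ']
    push_cast
    rfl

lemma lam_nonneg {n : ℕ} (hn : 1 ≤ n) (m : ℕ) : ((m : ℝ) ^ 2 - 1) / 2 ≤ lam n m ∧ 0 ≤ lam n m := by
  have h1 : (1 : ℝ) ≤ n := by exact_mod_cast hn
  have h2 : (m : ℝ) * (m - 1) ≤ lam n m := by
    unfold lam
    exact mul_le_mul_of_nonneg_left (by linarith) (Nat.cast_nonneg m)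
  have h3 : (0 : ℝ) ≤ m * (m - 1) := by
    rcases Nat.eq_zero_or_pos m with rfl | hm
    · simp
    · have : (1 : ℝ) ≤ m := by exact_mod_cast hm
      exact mul_nonneg (by linarith) (by linarith)
  exact ⟨by nlinarith [sq_nonneg ((m : ℝ) - 1)], by linarith⟩

lemma one_le_mu (α : ℕ × ℕ) : 1 ≤ mu p q α := by
  have h1 := (lam_nonneg (NeZero.one_le (n := p)) α.1).2
  have h2 := (lam_nonneg (NeZero.one_le (n := q)) α.2).2
  unfold mu lamT
  linarith

lemma mul_le_mu (α : ℕ × ℕ) : ((α.1 : ℝ) + 1) * (α.2 + 1) ≤ 4 * mu p q α := by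
  have h1 := (lam_nonneg (NeZero.one_le (n := p)) α.1).1
  have h2 := (lam_nonneg (NeZero.one_le (n := q)) α.2).1
  have h3 := one_le_mu (p := p) (q := q) α
  unfold mu lamT at *
  nlinarith [sq_nonneg ((α.1 : ℝ) - 1), sq_nonneg ((α.2 : ℝ) - 1), sq_nonneg ((α.1 : ℝ) - α.2)]

lemma summable_mu : Summable fun α : ℕ × ℕ => (mu p q α ^ 2)⁻¹ := by
  have h1 : Summable fun n : ℕ => (((n : ℝ) + 1) ^ 2)⁻¹ := by
    have := (summable_nat_add_iff 1).2 (Real.summable_nat_pow_inv.2 one_lt_two)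
    simpa using this
  have h2 := (h1.mul_of_nonneg h1 (fun n => by positivity) (fun n => by positivity)).mul_left 16
  refine Summable.of_nonneg_of_le (fun α => by positivity) (fun α => ?_) h2
  have h3 := mul_le_mu (p := p) (q := q) α
  have h4 := one_le_mu (p := p) (q := q) α
  rw [← mul_inv, ← mul_pow, ← div_eq_mul_inv, inv_le_comm₀ (by positivity) (by positivity), inv_div]
  have h5 : (((α.1 : ℝ) + 1) * (α.2 + 1)) ^ 2 ≤ (4 * mu p q α) ^ 2 :=
    pow_le_pow_left₀ (by positivity) h3 2
  linarith

/-! ### Multiplication operators on `K`-types -/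

/-- Multiplication by `x_i y_j / (|x| |y|)`. -/
def MM (i : Fin p) (j : Fin q) : Module.End ℂ (HS p q a) := Mx i * My j

lemma MM_apply (i : Fin p) (j : Fin q) (f : HS p q a) : MM i j f = Mx i (My j f) := rfl

lemma inner_MM (i : Fin p) (j : Fin q) (f g : HS p q a) :
    inner ℂ (MM i j f) g = inner ℂ f (MM i j g) := by
  rw [MM_apply, MM_apply, inner_Mx, inner_My, Mx_My]

/-- The candidates for the neighbours of a `K`-type. -/
def nbF (α : ℕ × ℕ) : Finset (ℕ × ℕ) := {α.1 + 1, α.1 - 1} ×ˢ {α.2 + 1, α.2 - 1}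

lemma card_nbF (α : ℕ × ℕ) : (nbF α).card ≤ 4 := by
  rw [nbF, Finset.card_product]
  exact Nat.mul_le_mul Finset.card_le_two Finset.card_le_two

/-- The relation of being neighbours. -/
def Nb (α β : ℕ × ℕ) : Prop :=
  (β.1 = α.1 + 1 ∨ α.1 = β.1 + 1) ∧ (β.2 = α.2 + 1 ∨ α.2 = β.2 + 1)

lemma Nb.symm {α β : ℕ × ℕ} (h : Nb α β) : Nb β α := ⟨h.1.symm, h.2.symm⟩

lemma Nb.ne {α β : ℕ × ℕ} (h : Nb α β) : α ≠ β := by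
  rintro rfl
  have := h.1
  omega

lemma Nb.mem {α β : ℕ × ℕ} (h : Nb α β) : β ∈ nbF α := by
  have h1 := h.1
  have h2 := h.2
  simp only [nbF, Finset.mem_product, Finset.mem_insert, Finset.mem_singleton]
  omega

lemma jS_pderiv_zero {m n : ℕ} {h₁ : Pol p} {h₂ : Pol q} (H₁ : IsHarmonic m h₁)
    (H₂ : IsHarmonic n h₂) (i : Fin p) (hm : m = 0) :
    jS a ((H₁.pderiv i).C_mul (kap p m)) H₂ = 0 := by
  refine HS.ext_pt fun g => ?_
  rw [jS_pt]
  subst hm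
  rw [pderiv_eq_zero_of_homogeneous_zero H₁.1]
  simp [pe, HS.zero_apply]

lemma jS_pderiv_zero' {m n : ℕ} {h₁ : Pol p} {h₂ : Pol q} (H₁ : IsHarmonic m h₁)
    (H₂ : IsHarmonic n h₂) (i : Fin q) (hn : n = 0) :
    jS a H₁ ((H₂.pderiv i).C_mul (kap q n)) = 0 := by
  refine HS.ext_pt fun g => ?_
  rw [jS_pt]
  subst hn
  rw [pderiv_eq_zero_of_homogeneous_zero H₂.1]
  simp [pe, HS.zero_apply]

lemma MM_jS {m n : ℕ} {h₁ : Pol p} {h₂ : Pol q} (H₁ : IsHarmonic m h₁) (H₂ : IsHarmonic n h₂)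
    (i : Fin p) (j : Fin q) : MM i j (jS a H₁ H₂) =
      jS a (H₁.up i) (H₂.up j) + jS a ((H₁.pderiv i).C_mul (kap p m)) (H₂.up j) +
      (jS a (H₁.up i) ((H₂.pderiv j).C_mul (kap q n)) +
        jS a ((H₁.pderiv i).C_mul (kap p m)) ((H₂.pderiv j).C_mul (kap q n))) := by
  rw [MM_apply, My_jS, map_add, Mx_jS, Mx_jS]

lemma Mx_mem_iSup (i : Fin p) {v : HS p q a} (hv : v ∈ ⨆ α, VT p q a α) :
    Mx i v ∈ ⨆ α, VT p q a α := by
  have hle : ∀ {β : ℕ × ℕ} {u : HS p q a}, u ∈ VT p q a β → u ∈ ⨆ α, VT p q a α :=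
    fun {β} {u} hu => Submodule.mem_iSup_of_mem β hu
  refine Submodule.iSup_induction _ (motive := fun v => Mx i v ∈ ⨆ α, VT p q a α) hv
    (fun α u hu => ?_) (by simp) fun u v hu hv => by rw [map_add]; exact add_mem hu hv
  refine VT_induction hu (fun h₁ h₂ H₁ H₂ => ?_) fun u v hu hv => by rw [map_add]; exact add_mem hu hv
  rw [Mx_jS]
  exact add_mem (hle (jS_mem _ _)) (hle (jS_mem _ _))

lemma My_mem_iSup (i : Fin q) {v : HS p q a} (hv : v ∈ ⨆ α, VT p q a α) :
    My i v ∈ ⨆ α, VT p q a α := by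
  have hle : ∀ {β : ℕ × ℕ} {u : HS p q a}, u ∈ VT p q a β → u ∈ ⨆ α, VT p q a α :=
    fun {β} {u} hu => Submodule.mem_iSup_of_mem β hu
  refine Submodule.iSup_induction _ (motive := fun v => My i v ∈ ⨆ α, VT p q a α) hv
    (fun α u hu => ?_) (by simp) fun u v hu hv => by rw [map_add]; exact add_mem hu hv
  refine VT_induction hu (fun h₁ h₂ H₁ H₂ => ?_) fun u v hu hv => by rw [map_add]; exact add_mem hu hv
  rw [My_jS]
  exact add_mem (hle (jS_mem _ _)) (hle (jS_mem _ _))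

lemma MM_mem {α : ℕ × ℕ} (i : Fin p) (j : Fin q) {v : HS p q a} (hv : v ∈ VT p q a α) :
    MM i j v ∈ ⨆ γ ∈ nbF α, VT p q a γ := by
  have hle : ∀ {β : ℕ × ℕ} {u : HS p q a}, β ∈ nbF α → u ∈ VT p q a β →
      u ∈ ⨆ γ ∈ nbF α, VT p q a γ :=
    fun {β} {u} hβ hu => Submodule.mem_iSup_of_mem β (Submodule.mem_iSup_of_mem hβ hu)
  refine VT_induction hv (fun h₁ h₂ H₁ H₂ => ?_) fun u v hu hv => by rw [map_add]; exact add_mem hu hv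
  rw [MM_jS]
  refine add_mem (add_mem (hle ?_ (jS_mem _ _)) (hle ?_ (jS_mem _ _)))
    (add_mem (hle ?_ (jS_mem _ _)) (hle ?_ (jS_mem _ _))) <;> simp [nbF]

lemma PT_MM_eq_zero {α β : ℕ × ℕ} (h : ¬ Nb α β) (i : Fin p) (j : Fin q) {v : HS p q a}
    (hv : v ∈ VT p q a α) : PT β (MM i j v) = 0 := by
  refine VT_induction hv (fun h₁ h₂ H₁ H₂ => ?_) fun u v hu hv => by
    rw [map_add, map_add, hu, hv, add_zero]
  rw [MM_jS]
  have key : ∀ {γ : ℕ × ℕ} {u : HS p q a}, u ∈ VT p q a γ → (γ = β → u = 0) → PT β u = 0 := by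
    intro γ u hu h0
    by_cases hγ : γ = β
    · rw [h0 hγ, map_zero]
    · exact PT_of_mem_ne (Ne.symm hγ) hu
  simp only [map_add]
  rw [key (jS_mem _ _), key (jS_mem _ _), key (jS_mem _ _), key (jS_mem _ _)]
  · simp
  · rintro rfl
    rcases Nat.eq_zero_or_pos α.1 with h1 | h1
    · exact jS_pderiv_zero H₁ _ i h1
    · rcases Nat.eq_zero_or_pos α.2 with h2 | h2
      · exact jS_pderiv_zero' _ H₂ j h2
      · exact absurd ⟨Or.inr (by simp; omega), Or.inr (by simp; omega)⟩ h
  · rintro rfl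
    rcases Nat.eq_zero_or_pos α.2 with h2 | h2
    · exact jS_pderiv_zero' _ H₂ j h2
    · exact absurd ⟨Or.inl rfl, Or.inr (by simp; omega)⟩ h
  · rintro rfl
    rcases Nat.eq_zero_or_pos α.1 with h1 | h1
    · exact jS_pderiv_zero H₁ _ i h1
    · exact absurd ⟨Or.inr (by simp; omega), Or.inl rfl⟩ h
  · rintro rfl
    exact absurd ⟨Or.inl rfl, Or.inl rfl⟩ h

lemma eq_sum_PT {F : Finset (ℕ × ℕ)} {v : HS p q a} (hv : v ∈ ⨆ γ ∈ F, VT p q a γ) :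
    ∑ γ ∈ F, PT γ v = v := by
  have key : ⨆ γ ∈ F, VT p q a γ ≤ LinearMap.eqLocus (∑ γ ∈ F, PT (a := a) γ).toLinearMap
      (LinearMap.id : HS p q a →ₗ[ℂ] HS p q a) := by
    refine iSup₂_le fun β hβ u hu => ?_
    rw [LinearMap.mem_eqLocus]
    simp only [ContinuousLinearMap.coe_coe, _root_.sum_apply, LinearMap.id_apply]
    rw [Finset.sum_eq_single β (fun γ _ hγ => PT_of_mem_ne hγ hu) (fun h => absurd hβ h),
      PT_of_mem hu]
  have := key hv
  rw [LinearMap.mem_eqLocus] at this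
  simpa [_root_.sum_apply] using this

lemma MM_eq_sum {α : ℕ × ℕ} (i : Fin p) (j : Fin q) {v : HS p q a} (hv : v ∈ VT p q a α) :
    ∑ γ ∈ nbF α, PT γ (MM i j v) = MM i j v := eq_sum_PT (MM_mem i j hv)

/-! ### Density of the `K`-finite functions -/

lemma exists_uniform_approx (f : HS p q a) {ε : ℝ} (hε : 0 < ε) :
    ∃ g ∈ ⨆ α, VT p q a α, ∀ k : K p q, ‖f (pt k) - g (pt k)‖ ≤ ε := by
  have hX : CompactSpace (spheres p q) := isCompact_iff_compactSpace.1 isCompact_spheres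
  let crd : Fin p ⊕ Fin q → C(spheres p q, ℝ) := Sum.elim
    (fun i => ⟨fun w => w.1.1 i, by fun_prop⟩) (fun j => ⟨fun w => w.1.2 j, by fun_prop⟩)
  let φ : MvPolynomial (Fin p ⊕ Fin q) ℝ →ₐ[ℝ] C(spheres p q, ℝ) := MvPolynomial.aeval crd
  let sp : K p q → spheres p q := fun k => ⟨pt k, pt_mem_spheres k⟩
  have hφl : ∀ i k, φ (X (Sum.inl i)) (sp k) = (pt k).1.1 i := fun i k => by
    rw [MvPolynomial.aeval_X]
    rfl
  have hφr : ∀ j k, φ (X (Sum.inr j)) (sp k) = (pt k).1.2 j := fun i k => by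
    rw [MvPolynomial.aeval_X]
    rfl
  have hφ : ∀ P, ∃ g ∈ ⨆ α, VT p q a α, ∀ k : K p q, g (pt k) = ((φ P (sp k) : ℝ) : ℂ) := by
    intro P
    induction P using MvPolynomial.induction_on with
    | C c =>
      have H₁ : IsHarmonic 0 (1 : Pol p) :=
        isHarmonic_iff.2 ⟨MvPolynomial.isHomogeneous_one _ _, by simp [lap]⟩
      have H₂ : IsHarmonic 0 (1 : Pol q) :=
        isHarmonic_iff.2 ⟨MvPolynomial.isHomogeneous_one _ _, by simp [lap]⟩
      refine ⟨(c : ℂ) • jS a H₁ H₂, Submodule.smul_mem _ _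
        (Submodule.mem_iSup_of_mem (0, 0) (jS_mem _ _)), fun k => ?_⟩
      rw [HS.smul_apply, jS_pt]
      simp [φ, pe]
    | add P Q hP hQ =>
      obtain ⟨g, hg, hg'⟩ := hP
      obtain ⟨h, hh, hh'⟩ := hQ
      refine ⟨g + h, add_mem hg hh, fun k => ?_⟩
      rw [HS.add_apply, hg', hh', map_add, ContinuousMap.add_apply, Complex.ofReal_add]
    | mul_X P i hP =>
      obtain ⟨g, hg, hg'⟩ := hP
      rcases i with i | j
      · refine ⟨Mx i g, Mx_mem_iSup i hg, fun k => ?_⟩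
        have hn : nx (pt k).1 = 1 := (pt_mem_spheres k).1
        rw [Mx, mulS_apply, hg', mx, hn, map_mul, ContinuousMap.mul_apply, hφl, Real.sqrt_one,
          div_one, mul_comm, Complex.ofReal_mul]
      · refine ⟨My j g, My_mem_iSup j hg, fun k => ?_⟩
        have hn : nx (pt k).1 = 1 := (pt_mem_spheres k).1
        rw [My, mulS_apply, hg', my, hn, map_mul, ContinuousMap.mul_apply, hφr, Real.sqrt_one,
          div_one, mul_comm, Complex.ofReal_mul]
  have hsep : φ.range.SeparatesPoints := by
    intro u v huv
    by_contra hc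
    push Not at hc
    refine huv (Subtype.ext (Prod.ext (funext fun i => ?_) (funext fun j => ?_)))
    · have := hc (crd (Sum.inl i)) ⟨crd (Sum.inl i), ⟨X (Sum.inl i), MvPolynomial.aeval_X _ _⟩, rfl⟩
      exact this
    · have := hc (crd (Sum.inr j)) ⟨crd (Sum.inr j), ⟨X (Sum.inr j), MvPolynomial.aeval_X _ _⟩, rfl⟩
      exact this
  have happ : ∀ h : C(spheres p q, ℝ), ∃ g ∈ ⨆ α, VT p q a α, ∀ k : K p q,
      ‖((h (sp k) : ℝ) : ℂ) - g (pt k)‖ ≤ ε / 2 := by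
    intro h
    obtain ⟨⟨_, P, rfl⟩, hg⟩ := ContinuousMap.exists_mem_subalgebra_near_continuousMap_of_separatesPoints
      φ.range hsep h (ε / 2) (half_pos hε)
    obtain ⟨g, hg', hgk⟩ := hφ P
    refine ⟨g, hg', fun k => ?_⟩
    rw [hgk, ← Complex.ofReal_sub, Complex.norm_real, norm_sub_rev]
    have := (ContinuousMap.norm_coe_le_norm _ (sp k)).trans hg.le
    exact this
  have hfc : Continuous fun w : spheres p q => f (⟨w.1, spheres_subset_cone w.2⟩ : cone p q) :=
    f.continuous.comp (by fun_prop)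
  obtain ⟨g₁, hg₁, h₁⟩ := happ ⟨_, Complex.continuous_re.comp hfc⟩
  obtain ⟨g₂, hg₂, h₂⟩ := happ ⟨_, Complex.continuous_im.comp hfc⟩
  refine ⟨g₁ + Complex.I • g₂, add_mem hg₁ (Submodule.smul_mem _ _ hg₂), fun k => ?_⟩
  have e1 := h₁ k
  have e2 := h₂ k
  have e3 : f (pt k) - (g₁ + Complex.I • g₂) (pt k) = (((f (pt k)).re : ℂ) - g₁ (pt k)) +
      Complex.I * (((f (pt k)).im : ℂ) - g₂ (pt k)) := by
    rw [HS.add_apply, HS.smul_apply]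
    nth_rewrite 1 [← Complex.re_add_im (f (pt k))]
    ring
  rw [e3]
  refine (norm_add_le _ _).trans ?_
  rw [norm_mul, Complex.norm_I, one_mul]
  exact (add_le_add e1 e2).trans_eq (add_halves ε)

lemma hasSum_PT (f : HS p q a) : HasSum (fun α => PT α f) f := by
  rw [HasSum, SummationFilter.unconditional_filter, Metric.tendsto_atTop]
  intro ε hε
  obtain ⟨g, hg, hfg⟩ := exists_uniform_approx f (half_pos hε)
  have hfg' : ‖f - g‖ ≤ ε / 2 := norm_le_of_forall_pt (half_pos hε).le fun k => hfg k
  obtain ⟨F, hF⟩ := Submodule.mem_iSup_iff_exists_finset.1 hg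
  refine ⟨F, fun G hFG => ?_⟩
  have hgG : g ∈ ⨆ γ ∈ G, VT p q a γ :=
    (biSup_mono fun γ hγ => hFG hγ : (⨆ γ ∈ F, VT p q a γ) ≤ _) hF
  set s := ∑ γ ∈ G, PT γ f with hs
  have horth : inner ℂ (f - s) (s - g) = 0 := by
    have h1 : ∀ u : HS p q a, u ∈ ⨆ γ ∈ G, VT p q a γ → inner ℂ (f - s) u = 0 := by
      intro u hu
      rw [← eq_sum_PT hu, inner_sum]
      refine Finset.sum_eq_zero fun γ hγ => ?_
      rw [inner_sub_left, ← inner_PT, hs, ← inner_PT, map_sum,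
        Finset.sum_eq_single γ (fun β _ hβ => PT_of_mem_ne (Ne.symm hβ) (PT_mem β f))
          (fun h => absurd hγ h), PT_of_mem (PT_mem γ f), sub_self]
    refine h1 _ (sub_mem ?_ hgG)
    exact Submodule.sum_mem _ fun γ hγ =>
      Submodule.mem_iSup_of_mem γ (Submodule.mem_iSup_of_mem hγ (PT_mem γ f))
  have h2 := norm_add_sq_eq_norm_sq_add_norm_sq_of_inner_eq_zero (f - s) (s - g) horth
  rw [sub_add_sub_cancel] at h2
  have h3 : ‖f - s‖ ≤ ‖f - g‖ := by nlinarith [norm_nonneg (f - g), norm_nonneg (f - s), norm_nonneg (s - g)]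
  rw [dist_comm, dist_eq_norm]
  linarith

lemma ext_PT {f g : HS p q a} (h : ∀ α, PT α f = PT α g) : f = g := by
  have h1 := hasSum_PT f
  simp only [h] at h1
  exact h1.unique (hasSum_PT g)

lemma Lam_Lx (k l : Fin p) (f : HS p q a) : Lam (Lx k l f) = Lx k l (Lam f) :=
  ext_PT fun α => by rw [PT_Lam, PT_Lx, PT_Lx, PT_Lam, map_smul]

lemma Lam_Ly (k l : Fin q) (f : HS p q a) : Lam (Ly k l f) = Ly k l (Lam f) :=
  ext_PT fun α => by rw [PT_Lam, PT_Ly, PT_Ly, PT_Lam, map_smul]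

lemma Lam_rhoS (k : K p q) (f : HS p q a) : Lam (rhoS (kO k) f) = rhoS (kO k) (Lam f) :=
  ext_PT fun α => by rw [PT_Lam, PT_rhoS, PT_rhoS, PT_Lam, map_smul]

lemma pow_comm_of_comm {T : Module.End ℂ (HS p q a)} (h : ∀ f, Lam (T f) = T (Lam f)) (j : ℕ)
    (f : HS p q a) : (Lam ^ j) (T f) = T ((Lam ^ j) f) := by
  induction j generalizing f with
  | zero => rfl
  | succ j ih => rw [pow_succ, Module.End.mul_apply, h, ih, Module.End.mul_apply]

lemma inner_Lam_self (f : HS p q a) : (inner ℂ (Lam f) f).re = ‖f‖ ^ 2 +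
    1 / 2 * (∑ k, ∑ l, ‖Lx k l f‖ ^ 2 + ∑ k, ∑ l, ‖Ly k l f‖ ^ 2) := by
  have h0 : ∀ g : HS p q a, inner ℂ g g = ((‖g‖ ^ 2 : ℝ) : ℂ) := fun g => by
    rw [inner_self_eq_norm_sq_to_K]
    simp
  have h1 : inner ℂ (Cx f) f = ((-∑ k, ∑ l, ‖Lx k l f‖ ^ 2 : ℝ) : ℂ) := by
    rw [Cx_apply]
    simp only [sum_inner, inner_Lx _ _ (Lx _ _ f), h0]
    push_cast
    simp
  have h2 : inner ℂ (Cy f) f = ((-∑ k, ∑ l, ‖Ly k l f‖ ^ 2 : ℝ) : ℂ) := by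
    rw [Cy_apply]
    simp only [sum_inner, inner_Ly _ _ (Ly _ _ f), h0]
    push_cast
    simp
  rw [Lam_apply, inner_sub_left, inner_smul_left, inner_add_left, h0, h1, h2, ← Complex.ofReal_add]
  have h3 : (starRingEnd ℂ) (1 / 2 : ℂ) = ((1 / 2 : ℝ) : ℂ) := by
    rw [map_div₀, map_one, map_ofNat]
    push_cast
    rfl
  rw [h3, ← Complex.ofReal_mul, ← Complex.ofReal_sub, Complex.ofReal_re]
  ring

lemma norm_le_Lam (f : HS p q a) : ‖f‖ ≤ ‖Lam f‖ ∧ (∀ k l, ‖Lx k l f‖ ≤ 2 * ‖Lam f‖) ∧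
    ∀ k l, ‖Ly k l f‖ ≤ 2 * ‖Lam f‖ := by
  have h1 := inner_Lam_self f
  have h2 : (inner ℂ (Lam f) f).re ≤ ‖Lam f‖ * ‖f‖ :=
    (Complex.re_le_norm _).trans (norm_inner_le_norm _ _)
  have hX : 0 ≤ ∑ k, ∑ l, ‖Lx k l f‖ ^ 2 :=
    Finset.sum_nonneg fun _ _ => Finset.sum_nonneg fun _ _ => sq_nonneg _
  have hY : 0 ≤ ∑ k, ∑ l, ‖Ly k l f‖ ^ 2 :=
    Finset.sum_nonneg fun _ _ => Finset.sum_nonneg fun _ _ => sq_nonneg _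
  have h3 : ‖f‖ ≤ ‖Lam f‖ := by
    by_contra hc
    push Not at hc
    nlinarith [norm_nonneg f, norm_nonneg (Lam f)]
  have h4 : ∀ x : ℝ, 0 ≤ x → x ^ 2 ≤ ∑ k, ∑ l, ‖Lx k l f‖ ^ 2 + ∑ k, ∑ l, ‖Ly k l f‖ ^ 2 →
      x ≤ 2 * ‖Lam f‖ := by
    intro x hx h
    refine le_of_sq_le_sq ?_ (by positivity)
    nlinarith [norm_nonneg f, norm_nonneg (Lam f)]
  refine ⟨h3, fun k l => h4 _ (norm_nonneg _) ?_, fun k l => h4 _ (norm_nonneg _) ?_⟩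
  · have e1 := Finset.single_le_sum (f := fun k => ∑ l, ‖Lx k l f‖ ^ 2)
      (fun _ _ => Finset.sum_nonneg fun _ _ => sq_nonneg _) (Finset.mem_univ k)
    have e2 := Finset.single_le_sum (f := fun l => ‖Lx k l f‖ ^ 2)
      (fun _ _ => sq_nonneg _) (Finset.mem_univ l)
    linarith
  · have e1 := Finset.single_le_sum (f := fun k => ∑ l, ‖Ly k l f‖ ^ 2)
      (fun _ _ => Finset.sum_nonneg fun _ _ => sq_nonneg _) (Finset.mem_univ k)
    have e2 := Finset.single_le_sum (f := fun l => ‖Ly k l f‖ ^ 2)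
      (fun _ _ => sq_nonneg _) (Finset.mem_univ l)
    linarith

lemma norm_Lam_pow_le {j k : ℕ} (hjk : j ≤ k) (f : HS p q a) : ‖(Lam ^ j) f‖ ≤ ‖(Lam ^ k) f‖ := by
  induction k, hjk using Nat.le_induction with
  | base => exact le_rfl
  | succ k _ ih =>
    rw [pow_succ', Module.End.mul_apply]
    exact ih.trans (norm_le_Lam _).1

end

section

variable {p q : ℕ} {a : ℝ} [NeZero p] [NeZero q]

/-! ### Reproducing kernels -/

lemma exists_kernel (a : ℝ) (α : ℕ × ℕ) (k : K p q) :
    ∃ Z ∈ VT p q a α, ∀ v ∈ VT p q a α, inner ℂ Z v = v (pt k) := by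
  let ev : VT p q a α →ₗ[ℂ] ℂ :=
    { toFun := fun v => (v : HS p q a) (pt k), map_add' := fun _ _ => rfl, map_smul' := fun _ _ => rfl }
  have : CompleteSpace (VT p q a α) := FiniteDimensional.complete ℂ _
  let Z := (InnerProductSpace.toDual ℂ (VT p q a α)).symm ev.toContinuousLinearMap
  refine ⟨Z, Z.2, fun v hv => ?_⟩
  have h : inner ℂ Z (⟨v, hv⟩ : VT p q a α) = ev.toContinuousLinearMap ⟨v, hv⟩ :=
    InnerProductSpace.toDual_symm_apply
  exact h

/-- The reproducing kernel of a `K`-type. -/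
def Zk (a : ℝ) (α : ℕ × ℕ) (k : K p q) : HS p q a := (exists_kernel a α k).choose

lemma Zk_mem (α : ℕ × ℕ) (k : K p q) : Zk a α k ∈ VT p q a α := (exists_kernel a α k).choose_spec.1

lemma inner_Zk_of_mem {α : ℕ × ℕ} (k : K p q) {v : HS p q a} (hv : v ∈ VT p q a α) :
    inner ℂ (Zk a α k) v = v (pt k) := (exists_kernel a α k).choose_spec.2 v hv

lemma inner_Zk (α : ℕ × ℕ) (k : K p q) (f : HS p q a) : inner ℂ (Zk a α k) f = PT α f (pt k) := by
  rw [← inner_Zk_of_mem k (PT_mem α f), inner_PT_right (Zk_mem α k)]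

lemma rhoS_Zk (α : ℕ × ℕ) (k l : K p q) : rhoS (kO l) (Zk a α k) = Zk a α (l * k) := by
  rw [← PT_of_mem (Zk_mem α (l * k))]
  refine (PT_eq (rhoS_mem_VT l (Zk_mem α k)) fun v hv => ?_).symm
  rw [inner_rhoS_right, ← inner_conj_symm, inner_Zk_of_mem k (rhoS_mem_VT _ hv), rhoS_apply,
    ← inner_conj_symm, inner_Zk_of_mem _ hv, ← map_inv, inv_inv, ← pt_mul]

lemma norm_Zk_sq (α : ℕ × ℕ) (k : K p q) :
    ‖Zk a α k‖ ^ 2 = Module.finrank ℂ (VT p q a α) := by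
  let b := stdOrthonormalBasis ℂ (VT p q a α)
  have h1 : ∀ l : K p q, ‖Zk a α l‖ ^ 2 = ‖Zk a α k‖ ^ 2 := fun l => by
    have := rhoS_Zk (a := a) α k (l * k⁻¹)
    rw [inv_mul_cancel_right] at this
    rw [← this, norm_rhoS_kO]
  have h2 : ∀ l : K p q, ‖Zk a α l‖ ^ 2 = ∑ i, ‖(b i : HS p q a) (pt l)‖ ^ 2 := fun l => by
    have := b.sum_sq_norm_inner_right ⟨Zk a α l, Zk_mem α l⟩
    rw [Submodule.coe_norm] at this
    rw [← this]
    refine Finset.sum_congr rfl fun i _ => ?_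
    rw [← inner_Zk_of_mem l (b i).2, ← inner_conj_symm, RCLike.norm_conj]
    rfl
  have h3 : ‖Zk a α k‖ ^ 2 = ∫ l, ‖Zk a α l‖ ^ 2 ∂haarK p q := by
    simp [h1]
  rw [h3]
  simp only [h2]
  have h4 : ∀ i, Integrable (fun l => ‖(b i : HS p q a) (pt l)‖ ^ 2) (haarK p q) := fun i =>
    integrable_of_continuous ((b i : HS p q a).continuous_pt.norm.pow 2)
  rw [integral_finsetSum _ fun i _ => h4 i]
  simp only [← norm_sq_eq_integral, ← Submodule.coe_norm, b.norm_eq_one]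
  simp

lemma norm_PT_pt_le (α : ℕ × ℕ) (f : HS p q a) (k : K p q) :
    ‖PT α f (pt k)‖ ≤ 4 ^ (p + q) * (mu p q α ^ 2)⁻¹ * ‖(Lam ^ (p + q + 2)) f‖ := by
  have hmu := one_le_mu (p := p) (q := q) α
  have hd : ‖Zk a α k‖ ≤ (4 * mu p q α) ^ (p + q) := by
    have h1 : (Module.finrank ℂ (VT p q a α) : ℝ) ≤ (4 * mu p q α) ^ (p + q) := by
      have h2 : (Module.finrank ℂ (VT p q a α) : ℝ) ≤ ((α.1 : ℝ) + 1) ^ p * ((α.2 : ℝ) + 1) ^ q := by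
        exact_mod_cast (VT_finrank (a := a) α).2
      have h3 := mul_le_mu (p := p) (q := q) α
      have e1 : (0 : ℝ) ≤ α.1 := Nat.cast_nonneg _
      have e2 : (0 : ℝ) ≤ α.2 := Nat.cast_nonneg _
      have h4 : (α.1 : ℝ) + 1 ≤ 4 * mu p q α := by nlinarith
      have h5 : (α.2 : ℝ) + 1 ≤ 4 * mu p q α := by nlinarith
      rw [pow_add]
      exact h2.trans (mul_le_mul (pow_le_pow_left₀ (by positivity) h4 p)
        (pow_le_pow_left₀ (by positivity) h5 q) (by positivity) (by positivity))
    have h6 : (1 : ℝ) ≤ (4 * mu p q α) ^ (p + q) := one_le_pow₀ (by linarith)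
    refine le_of_sq_le_sq ?_ (by linarith)
    rw [norm_Zk_sq]
    nlinarith
  have h1 : ‖PT α f (pt k)‖ ≤ ‖Zk a α k‖ * ‖PT α f‖ := by
    rw [← inner_Zk_of_mem k (PT_mem α f)]
    exact norm_inner_le_norm _ _
  have h2 : mu p q α ^ (p + q + 2) * ‖PT α f‖ ≤ ‖(Lam ^ (p + q + 2)) f‖ := by
    have := norm_PT_le α ((Lam ^ (p + q + 2)) f)
    rw [PT_Lam_pow, norm_smul, Complex.norm_real, Real.norm_of_nonneg (by positivity)] at this
    exact this
  have hp : 0 < mu p q α ^ (p + q + 2) := by positivity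
  calc ‖PT α f (pt k)‖ ≤ (4 * mu p q α) ^ (p + q) * ‖PT α f‖ :=
        h1.trans (mul_le_mul_of_nonneg_right hd (norm_nonneg _))
    _ = 4 ^ (p + q) * (mu p q α ^ 2)⁻¹ * (mu p q α ^ (p + q + 2) * ‖PT α f‖) := by
        rw [mul_pow, pow_add _ (p + q) 2]
        field_simp
    _ ≤ _ := mul_le_mul_of_nonneg_left h2 (by positivity)

/-- A Sobolev inequality. -/
lemma exists_norm_pt_le (p q : ℕ) (a : ℝ) [NeZero p] [NeZero q] : ∃ C, 0 ≤ C ∧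
    ∀ (f : HS p q a) (k : K p q), ‖f (pt k)‖ ≤ C * ‖(Lam ^ (p + q + 2)) f‖ := by
  set s := ∑' α : ℕ × ℕ, (mu p q α ^ 2)⁻¹ with hs
  have hs0 : 0 ≤ s := tsum_nonneg fun α => by positivity
  refine ⟨4 ^ (p + q) * s, by positivity, fun f k₀ => ?_⟩
  set A := 4 ^ (p + q) * s * ‖(Lam ^ (p + q + 2)) f‖ with hA
  by_contra hc
  push Not at hc
  set δ := (‖f (pt k₀)‖ - A) / 2 with hδ
  have hδ0 : 0 < δ := by rw [hδ]; linarith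
  let U : Set (K p q) := {k | A + δ < ‖f (pt k)‖}
  have hU : IsOpen U := isOpen_lt continuous_const f.continuous_pt.norm
  have hUne : U.Nonempty := ⟨k₀, by change A + δ < _; rw [hδ]; linarith⟩
  have hUpos : 0 < (haarK p q).real U :=
    ENNReal.toReal_pos (hU.measure_pos _ hUne).ne' (measure_ne_top _ _)
  have hpart : ∀ (F : Finset (ℕ × ℕ)) (k : K p q), ‖(∑ α ∈ F, PT α f) (pt k)‖ ≤ A := by
    intro F k
    rw [HS.sum_apply]
    refine (norm_sum_le _ _).trans ((Finset.sum_le_sum fun α _ => norm_PT_pt_le α f k).trans ?_)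
    rw [← Finset.sum_mul, ← Finset.mul_sum, hA]
    gcongr
    exact summable_mu.sum_le_tsum F fun α _ => by positivity
  have hlow : ∀ F : Finset (ℕ × ℕ), (haarK p q).real U * δ ^ 2 ≤ ‖f - ∑ α ∈ F, PT α f‖ ^ 2 := by
    intro F
    have h1 : ∫ k, U.indicator (fun _ => δ ^ 2) k ∂haarK p q = (haarK p q).real U * δ ^ 2 := by
      rw [integral_indicator hU.measurableSet, setIntegral_const, smul_eq_mul]
    rw [← h1, norm_sq_eq_integral]
    refine integral_mono ((integrable_const _).indicator hU.measurableSet)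
      (integrable_of_continuous ((HS.continuous_pt _).norm.pow 2)) fun k => ?_
    by_cases hk : k ∈ U
    · rw [Set.indicator_of_mem hk]
      refine pow_le_pow_left₀ hδ0.le ?_ 2
      have h2 : A + δ < ‖f (pt k)‖ := hk
      have h3 := norm_sub_norm_le (f (pt k)) ((∑ α ∈ F, PT α f) (pt k))
      rw [HS.sub_apply]
      linarith [hpart F k]
    · rw [Set.indicator_of_notMem hk]
      positivity
  have hlim := (hasSum_PT f)
  rw [HasSum, SummationFilter.unconditional_filter] at hlim
  have hlim2 := ((tendsto_const_nhds (x := f)).sub hlim).norm.pow 2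
  rw [sub_self, norm_zero] at hlim2
  have h0 := ge_of_tendsto' hlim2 hlow
  have : 0 < (haarK p q).real U * δ ^ 2 := by positivity
  norm_num at h0
  linarith

/-! ### Comparison of norms -/

/-- The set where both components are nonzero. -/
def reg (p q : ℕ) : Set (V p q) := {w | w.1 ≠ 0 ∧ w.2 ≠ 0}

lemma isOpen_reg : IsOpen (reg p q) :=
  (isOpen_ne.preimage continuous_fst).inter (isOpen_ne.preimage continuous_snd)

lemma nx_pos_of_reg {w : V p q} (hw : w ∈ reg p q) : 0 < nx w :=
  lt_of_le_of_ne (nx_nonneg w) fun h => hw.1 (nx_eq_zero.1 h.symm)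

lemma ny_pos_of_reg {w : V p q} (hw : w ∈ reg p q) : 0 < ny w :=
  lt_of_le_of_ne (ny_nonneg w) fun h => hw.2 (ny_eq_zero.1 h.symm)

lemma spheres_subset_reg : spheres p q ⊆ reg p q := fun w hw => by
  have h := mem_spheres.1 hw
  refine ⟨fun h0 => ?_, fun h0 => ?_⟩
  · rw [nx_eq_zero.2 h0] at h
    norm_num at h
  · rw [ny_eq_zero.2 h0] at h
    norm_num at h

lemma toSpheres_eq (w : V p q) : toSpheres w = ((√(nx w))⁻¹ • w.1, (√(ny w))⁻¹ • w.2) := rfl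

lemma toSpheres_mem {w : V p q} (hw : w ∈ reg p q) : toSpheres w ∈ spheres p q := by
  have hx := nx_pos_of_reg hw
  have hy := ny_pos_of_reg hw
  rw [mem_spheres, nx_eq, ny_eq, toSpheres_eq]
  simp only [smul_dotProduct, dotProduct_smul, smul_eq_mul, ← nx_eq, ← ny_eq]
  rw [← mul_assoc, ← mul_inv, Real.mul_self_sqrt hx.le, ← mul_assoc, ← mul_inv,
    Real.mul_self_sqrt hy.le, inv_mul_cancel₀ hx.ne', inv_mul_cancel₀ hy.ne']
  exact ⟨rfl, rfl⟩

lemma toSpheres_of_mem {w : V p q} (hw : w ∈ spheres p q) : toSpheres w = w := by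
  rw [toSpheres_eq, (mem_spheres.1 hw).1, (mem_spheres.1 hw).2]
  simp

lemma angular_apply (f : Fn p q) {w : V p q} (hw : w ∈ reg p q) :
    angular f w = f ⟨toSpheres w, spheres_subset_cone (toSpheres_mem hw)⟩ :=
  Subtype.val_injective.extend_apply f 0 ⟨toSpheres w, _⟩

lemma angular_of_spheres (f : Fn p q) {w : V p q} (hw : w ∈ spheres p q) :
    angular f w = f ⟨w, spheres_subset_cone hw⟩ := by
  rw [angular_apply f (spheres_subset_reg hw)]
  congr 1
  exact Subtype.ext (toSpheres_of_mem hw)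

lemma contDiffOn_toSpheres : ContDiffOn ℝ ∞ (toSpheres : V p q → V p q) (reg p q) := by
  have h1 : ContDiffOn ℝ ∞ (fun w : V p q => (√(nx w))⁻¹) (reg p q) :=
    (contDiff_nx.contDiffOn.sqrt fun w hw => (nx_pos_of_reg hw).ne').inv fun w hw =>
      (Real.sqrt_pos.2 (nx_pos_of_reg hw)).ne'
  have h2 : ContDiffOn ℝ ∞ (fun w : V p q => (√(ny w))⁻¹) (reg p q) :=
    (contDiff_ny.contDiffOn.sqrt fun w hw => (ny_pos_of_reg hw).ne').inv fun w hw =>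
      (Real.sqrt_pos.2 (ny_pos_of_reg hw)).ne'
  exact (h1.smul contDiff_fst.contDiffOn).prodMk (h2.smul contDiff_snd.contDiffOn)

lemma contDiffOn_angular (f : HS p q a) : ContDiffOn ℝ ∞ (angular f.fn) (reg p q) := by
  obtain ⟨F, hF, h⟩ := f.smooth
  have h1 : ContDiffOn ℝ ∞ (F ∘ toSpheres) (reg p q) :=
    hF.comp contDiffOn_toSpheres fun w hw => (spheres_subset_cone (toSpheres_mem hw)).1
  refine h1.congr fun w hw => ?_
  rw [angular_apply _ hw]
  exact (h _).symm

lemma hasFDerivAt_angular (f : HS p q a) {w : V p q} (hw : w ∈ reg p q) :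
    HasFDerivAt (angular f.fn) (fderiv ℝ (angular f.fn) w) w :=
  (((contDiffOn_angular f).contDiffAt (isOpen_reg.mem_nhds hw)).differentiableAt
    (by simp)).hasFDerivAt

lemma toSpheres_kO (k : K p q) (w : V p q) : toSpheres ((kO k).1 w) = (kO k).1 (toSpheres w) := by
  rw [toSpheres_eq, toSpheres_eq, nx_kO, ny_kO, kO_apply, kO_apply, Matrix.mulVec_smul,
    Matrix.mulVec_smul]

lemma reg_kO (k : K p q) {w : V p q} (hw : w ∈ reg p q) : (kO k).1 w ∈ reg p q := by
  have hx := nx_pos_of_reg hw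
  have hy := ny_pos_of_reg hw
  rw [← nx_kO k] at hx
  rw [← ny_kO k] at hy
  exact ⟨fun h => hx.ne' (nx_eq_zero.2 h), fun h => hy.ne' (ny_eq_zero.2 h)⟩

lemma fderiv_angular_flow {φ : Flow p q} (hφ : ∀ t, ∃ k, φ.g t = kO k) (f : HS p q a) {w : V p q}
    (hw : w ∈ reg p q) :
    fderiv ℝ (angular f.fn) w (φ.X w) = angular (lie φ f).fn w := by
  have h0 : (φ.g 0).1 w = w := by rw [φ.zero]; rfl
  have h1 : HasFDerivAt (angular f.fn) (fderiv ℝ (angular f.fn) w) ((φ.g 0).1 w) := by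
    rw [h0]
    exact hasFDerivAt_angular f hw
  have h2 := h1.comp_hasDerivAt (0 : ℝ) (φ.deriv_zero w)
  rw [angular_apply _ hw]
  refine h2.unique ((hasDerivAt_flow_zero φ f _).congr_of_eventuallyEq
    (Filter.Eventually.of_forall fun t => ?_))
  obtain ⟨k, hk⟩ := hφ t
  simp only [Function.comp, hk]
  rw [angular_apply _ (reg_kO k hw)]
  congr 1
  exact Subtype.ext (toSpheres_kO k w)

lemma rotX_kO (k l : Fin p) (t : ℝ) : ∃ g, (rotX p q k l).g t = kO g := ⟨_, rfl⟩

lemma rotY_kO (k l : Fin q) (t : ℝ) : ∃ g, (rotY p q k l).g t = kO g := ⟨_, rfl⟩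

lemma fderiv_angular_radial (f : HS p q a) {w : V p q} (hw : w ∈ reg p q) :
    fderiv ℝ (angular f.fn) w (w.1, 0) = 0 ∧ fderiv ℝ (angular f.fn) w (0, w.2) = 0 := by
  have key : ∀ u : V p q, (∀ t : ℝ, 0 < t → ∃ c d : ℝ, 0 < c ∧ 0 < d ∧
      w + (t - 1) • u = (c • w.1, d • w.2)) → fderiv ℝ (angular f.fn) w u = 0 := by
    intro u hu
    have h1 : HasDerivAt (fun t : ℝ => w + (t - 1) • u) u 1 := by
      have := (((hasDerivAt_id (1 : ℝ)).sub_const 1).smul_const u).const_add w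
      simpa using this
    have h2 : HasFDerivAt (angular f.fn) (fderiv ℝ (angular f.fn) w) (w + ((1 : ℝ) - 1) • u) := by
      rw [sub_self, zero_smul, add_zero]
      exact hasFDerivAt_angular f hw
    refine (h2.comp_hasDerivAt (1 : ℝ) h1).unique
      ((hasDerivAt_const (1 : ℝ) (angular f.fn w)).congr_of_eventuallyEq ?_)
    filter_upwards [lt_mem_nhds (one_pos : (0 : ℝ) < 1)] with t ht
    obtain ⟨c, d, hc, hd, he⟩ := hu t ht
    simp only [Function.comp, he, angular]
    congr 1
    have e1 : nx ((c • w.1, d • w.2) : V p q) = c ^ 2 * nx w := by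
      simp [nx, mul_pow, Finset.mul_sum]
    have e2 : ny ((c • w.1, d • w.2) : V p q) = d ^ 2 * ny w := by
      simp [ny, mul_pow, Finset.mul_sum]
    rw [toSpheres_eq, toSpheres_eq, e1, e2, Real.sqrt_mul (sq_nonneg c), Real.sqrt_mul (sq_nonneg d),
      Real.sqrt_sq hc.le, Real.sqrt_sq hd.le]
    simp only [smul_smul]
    rw [mul_inv, mul_inv, mul_right_comm, mul_right_comm d⁻¹, inv_mul_cancel₀ hc.ne',
      inv_mul_cancel₀ hd.ne', one_mul, one_mul]
  constructor
  · refine key _ fun t ht => ⟨t, 1, ht, one_pos, ?_⟩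
    ext <;> simp
    ring
  · refine key _ fun t ht => ⟨1, t, one_pos, ht, ?_⟩
    ext <;> simp
    ring

/-- The coefficient of `L_{kl}` in the derivative of an angular function. -/
def cX (k l : Fin p) (w : V p q) : V p q →L[ℝ] ℂ :=
  (w.1 k / nx w) • (Complex.ofRealCLM.comp ((ContinuousLinearMap.proj l).comp
    (ContinuousLinearMap.fst ℝ (Fin p → ℝ) (Fin q → ℝ))))

/-- The coefficient of `L_{kl}` in the derivative of an angular function. -/
def cY (k l : Fin q) (w : V p q) : V p q →L[ℝ] ℂ :=
  (w.2 k / ny w) • (Complex.ofRealCLM.comp ((ContinuousLinearMap.proj l).comp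
    (ContinuousLinearMap.snd ℝ (Fin p → ℝ) (Fin q → ℝ))))

lemma contDiffOn_cX (k l : Fin p) : ContDiffOn ℝ ∞ (cX (q := q) k l) (reg p q) := by
  refine ContDiffOn.smul (ContDiffOn.div ?_ contDiff_nx.contDiffOn fun w hw =>
    (nx_pos_of_reg hw).ne') contDiffOn_const
  have : ContDiff ℝ ∞ fun w : V p q => w.1 k := by fun_prop
  exact this.contDiffOn

lemma contDiffOn_cY (k l : Fin q) : ContDiffOn ℝ ∞ (cY (p := p) k l) (reg p q) := by
  refine ContDiffOn.smul (ContDiffOn.div ?_ contDiff_ny.contDiffOn fun w hw =>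
    (ny_pos_of_reg hw).ne') contDiffOn_const
  have : ContDiff ℝ ∞ fun w : V p q => w.2 k := by fun_prop
  exact this.contDiffOn

lemma fderiv_angular (f : HS p q a) {w : V p q} (hw : w ∈ reg p q) :
    fderiv ℝ (angular f.fn) w = ∑ k, ∑ l, angular (Lx k l f).fn w • cX k l w +
      ∑ k, ∑ l, angular (Ly k l f).fn w • cY k l w := by
  have hx := nx_pos_of_reg hw
  have hy := ny_pos_of_reg hw
  obtain ⟨hr1, hr2⟩ := fderiv_angular_radial f hw
  refine ContinuousLinearMap.ext fun v => ?_
  have hv : v = ∑ k, ∑ l, (w.1 k / nx w * v.1 l) • (rotX p q k l).X w +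
      ∑ k, ∑ l, (w.2 k / ny w * v.2 l) • (rotY p q k l).X w +
      ((w.1 ⬝ᵥ v.1) / nx w) • (w.1, 0) + ((w.2 ⬝ᵥ v.2) / ny w) • (0, w.2) := by
    simp only [rotX_X, rotY_X]
    ext m
    · simp only [Prod.fst_add, Prod.fst_sum, Prod.smul_mk, Pi.add_apply, Finset.sum_apply,
        smul_zero, Pi.zero_apply, Finset.sum_const_zero, add_zero, Pi.smul_apply, Pi.sub_apply,
        smul_eq_mul, Pi.single_apply, mul_ite, mul_one, mul_zero, mul_sub, Finset.sum_sub_distrib]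
      have e1 : ∀ k, (∑ l, if m = l then w.1 k / nx w * v.1 l * w.1 k else 0) =
          w.1 k ^ 2 * (v.1 m / nx w) := fun k => by
        rw [Finset.sum_ite_eq, if_pos (Finset.mem_univ _)]
        ring
      have e2 : (∑ k, ∑ l, if m = k then w.1 k / nx w * v.1 l * w.1 l else 0) =
          w.1 m / nx w * (w.1 ⬝ᵥ v.1) := by
        rw [Finset.sum_comm, dotProduct, Finset.mul_sum]
        refine Finset.sum_congr rfl fun l _ => ?_
        rw [Finset.sum_ite_eq, if_pos (Finset.mem_univ _)]
        ring
      have e3 : ∑ k, w.1 k ^ 2 = nx w := rfl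
      simp only [e1, e2]
      rw [← Finset.sum_mul, e3]
      field_simp
      ring
    · simp only [Prod.snd_add, Prod.snd_sum, Prod.smul_mk, Pi.add_apply, Finset.sum_apply,
        smul_zero, Finset.sum_const_zero, add_zero, zero_add, Pi.smul_apply,
        Pi.sub_apply, smul_eq_mul, Pi.single_apply, mul_ite, mul_one, mul_zero, mul_sub,
        Finset.sum_sub_distrib]
      have e1 : ∀ k, (∑ l, if m = l then w.2 k / ny w * v.2 l * w.2 k else 0) =
          w.2 k ^ 2 * (v.2 m / ny w) := fun k => by
        rw [Finset.sum_ite_eq, if_pos (Finset.mem_univ _)]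
        ring
      have e2 : (∑ k, ∑ l, if m = k then w.2 k / ny w * v.2 l * w.2 l else 0) =
          w.2 m / ny w * (w.2 ⬝ᵥ v.2) := by
        rw [Finset.sum_comm, dotProduct, Finset.mul_sum]
        refine Finset.sum_congr rfl fun l _ => ?_
        rw [Finset.sum_ite_eq, if_pos (Finset.mem_univ _)]
        ring
      have e3 : ∑ k, w.2 k ^ 2 = ny w := rfl
      simp only [e1, e2]
      rw [← Finset.sum_mul, e3]
      field_simp
      ring
  have h1 := congrArg (fderiv ℝ (angular f.fn) w) hv
  rw [h1]
  simp only [map_add, map_sum, map_smul, hr1, hr2, fderiv_angular_flow (rotX_kO _ _) f hw,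
    fderiv_angular_flow (rotY_kO _ _) f hw, smul_zero, add_zero]
  simp only [_root_.add_apply, _root_.sum_apply, _root_.smul_apply,
    cX, cY, ContinuousLinearMap.comp_apply, Complex.ofRealCLM_apply, ContinuousLinearMap.proj_apply,
    ContinuousLinearMap.coe_fst', ContinuousLinearMap.coe_snd', Complex.real_smul, smul_eq_mul,
    Complex.ofReal_mul]
  congr 1 <;>
  · refine Finset.sum_congr rfl fun k _ => Finset.sum_congr rfl fun l _ => ?_
    simp only [Lx, Ly]
    ring

end

section

variable {p q : ℕ} {a : ℝ} [NeZero p] [NeZero q]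

section Bounds

variable {E F G : Type*} [NormedAddCommGroup E] [NormedSpace ℝ E] [NormedAddCommGroup F]
  [NormedSpace ℝ F] [NormedAddCommGroup G] [NormedSpace ℝ G]

/-- A smooth function near the product of spheres whose derivatives up to order `N` are bounded
by `M` there. -/
def BD (N : ℕ) (g : V p q → E) (M : ℝ) : Prop :=
  ContDiffOn ℝ ∞ g (reg p q) ∧
    ∀ k ≤ N, ∀ w ∈ spheres p q, ‖iteratedFDerivWithin ℝ k g (reg p q) w‖ ≤ M

lemma BD.mono {N N' : ℕ} {g : V p q → E} {M M' : ℝ} (h : BD N g M) (hN : N' ≤ N) (hM : M ≤ M') :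
    BD N' g M' := ⟨h.1, fun k hk w hw => (h.2 k (hk.trans hN) w hw).trans hM⟩

lemma BD.congr {N : ℕ} {g g' : V p q → E} {M : ℝ} (h : BD N g M) (hg : Set.EqOn g' g (reg p q)) :
    BD N g' M := ⟨h.1.congr hg, fun k hk w hw => by
  rw [iteratedFDerivWithin_congr hg (spheres_subset_reg hw)]
  exact h.2 k hk w hw⟩

lemma BD.add {N : ℕ} {g g' : V p q → E} {M M' : ℝ} (h : BD N g M) (h' : BD N g' M') :
    BD N (g + g') (M + M') := by
  refine ⟨h.1.add h'.1, fun k hk w hw => ?_⟩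
  have hr := spheres_subset_reg hw
  rw [iteratedFDerivWithin_add_apply ((h.1 w hr).of_le (by exact_mod_cast le_top))
    ((h'.1 w hr).of_le (by exact_mod_cast le_top)) isOpen_reg.uniqueDiffOn hr]
  exact (norm_add_le _ _).trans (add_le_add (h.2 k hk w hw) (h'.2 k hk w hw))

lemma BD.zero (N : ℕ) : BD N (0 : V p q → E) 0 := by
  refine ⟨contDiffOn_const, fun k _ w _ => ?_⟩
  have : iteratedFDerivWithin ℝ k (0 : V p q → E) (reg p q) = 0 := iteratedFDerivWithin_fun_zero
  rw [this]
  simp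

lemma BD.sum {ι : Type*} (s : Finset ι) {N : ℕ} {g : ι → V p q → E} {M : ι → ℝ}
    (h : ∀ i ∈ s, BD N (g i) (M i)) : BD N (∑ i ∈ s, g i) (∑ i ∈ s, M i) := by
  classical
  induction s using Finset.induction_on with
  | empty => simpa using BD.zero N
  | insert i s hi ih =>
    rw [Finset.sum_insert hi, Finset.sum_insert hi]
    exact (h i (Finset.mem_insert_self _ _)).add
      (ih fun j hj => h j (Finset.mem_insert_of_mem hj))

lemma exists_BD (N : ℕ) {c : V p q → F} (hc : ContDiffOn ℝ ∞ c (reg p q)) :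
    ∃ D, 0 ≤ D ∧ BD N c D := by
  have h : ∀ k : ℕ, ∃ D, ∀ w ∈ spheres p q, ‖iteratedFDerivWithin ℝ k c (reg p q) w‖ ≤ D :=
    fun k => isCompact_spheres.exists_bound_of_continuousOn
      ((hc.continuousOn_iteratedFDerivWithin (by exact_mod_cast le_top)
        isOpen_reg.uniqueDiffOn).mono spheres_subset_reg)
  choose D hD using h
  refine ⟨∑ k ∈ Finset.range (N + 1), |D k|, Finset.sum_nonneg fun _ _ => abs_nonneg _, hc,
    fun k hk w hw => (hD k w hw).trans ((le_abs_self _).trans ?_)⟩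
  exact Finset.single_le_sum (f := fun k => |D k|) (fun _ _ => abs_nonneg _)
    (Finset.mem_range.2 (Nat.lt_succ_of_le hk))

lemma exists_BD_bilin (N : ℕ) (B : E →L[ℝ] F →L[ℝ] G) {c : V p q → F}
    (hc : ContDiffOn ℝ ∞ c (reg p q)) :
    ∃ C, 0 ≤ C ∧ ∀ (g : V p q → E) (M : ℝ), BD N g M → BD N (fun w => B (g w) (c w)) (C * M) := by
  obtain ⟨D, hD0, hD⟩ := exists_BD N hc
  refine ⟨‖B‖ * (2 ^ N * D), by positivity, fun g M hg => ⟨?_, fun k hk w hw => ?_⟩⟩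
  · exact B.isBoundedBilinearMap.contDiff.comp_contDiffOn (hg.1.prodMk hc)
  have hr := spheres_subset_reg hw
  have hM : 0 ≤ M := (norm_nonneg _).trans (hg.2 0 (Nat.zero_le _) w hw)
  refine (B.norm_iteratedFDerivWithin_le_of_bilinear hg.1 hc isOpen_reg.uniqueDiffOn hr
    (n := k) (by exact_mod_cast le_top)).trans ?_
  rw [mul_assoc]
  refine mul_le_mul_of_nonneg_left ?_ (ContinuousLinearMap.opNorm_nonneg B)
  calc _ ≤ ∑ i ∈ Finset.range (k + 1), (k.choose i : ℝ) * (M * D) := by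
        refine Finset.sum_le_sum fun i hi => ?_
        rw [mul_assoc]
        refine mul_le_mul_of_nonneg_left ?_ (Nat.cast_nonneg _)
        have hi' : i ≤ k := Nat.lt_succ_iff.1 (Finset.mem_range.1 hi)
        exact mul_le_mul (hg.2 i (hi'.trans hk) w hw) (hD.2 _ ((Nat.sub_le _ _).trans hk) w hw)
          (norm_nonneg _) hM
    _ = 2 ^ k * (M * D) := by
        rw [← Finset.sum_mul, ← Nat.cast_sum, Nat.sum_range_choose]
        push_cast
        ring
    _ ≤ 2 ^ N * D * M := by
        rw [mul_comm M D, mul_assoc]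
        exact mul_le_mul_of_nonneg_right (pow_le_pow_right₀ one_le_two hk) (mul_nonneg hD0 hM)

lemma BD.fderiv {N : ℕ} {g : V p q → E} {M : ℝ} (h : BD (N + 1) g M) :
    BD N (fderiv ℝ g) M := by
  refine ⟨h.1.fderiv_of_isOpen isOpen_reg (by simp), fun k hk w hw => ?_⟩
  have := h.2 (k + 1) (by omega) w hw
  rw [iteratedFDerivWithin_of_isOpen _ isOpen_reg (spheres_subset_reg hw)] at this ⊢
  rwa [norm_iteratedFDeriv_fderiv]

lemma BD.of_fderiv {N : ℕ} {g : V p q → E} {M M' : ℝ} (h0 : BD 0 g M)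
    (h : BD N (_root_.fderiv ℝ g) M') : BD (N + 1) g (max M M') := by
  refine ⟨h0.1, fun k hk w hw => ?_⟩
  rcases k with - | k
  · exact (h0.2 0 le_rfl w hw).trans (le_max_left _ _)
  · have := h.2 k (by omega) w hw
    rw [iteratedFDerivWithin_of_isOpen _ isOpen_reg (spheres_subset_reg hw)] at this ⊢
    rw [norm_iteratedFDeriv_fderiv] at this
    exact this.trans (le_max_right _ _)

end Bounds

lemma normLE_iff {N : ℕ} {f : HS p q a} {M : ℝ} : NormLE N f.fn M ↔ BD N (angular f.fn) M := by
  constructor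
  · intro h
    refine ⟨contDiffOn_angular f, fun k hk w hw => ?_⟩
    rw [iteratedFDerivWithin_of_isOpen _ isOpen_reg (spheres_subset_reg hw)]
    exact h k hk w hw
  · intro h k hk w hw
    rw [← iteratedFDerivWithin_of_isOpen _ isOpen_reg (spheres_subset_reg hw)]
    exact h.2 k hk w hw

lemma NormLE.mono {N N' : ℕ} {f : Fn p q} {M M' : ℝ} (h : NormLE N f M) (hN : N' ≤ N)
    (hM : M ≤ M') : NormLE N' f M' := fun k hk w hw => (h k (hk.trans hN) w hw).trans hM

lemma NormLE.norm_pt_le {N : ℕ} {f : HS p q a} {M : ℝ} (h : NormLE N f.fn M) (k : K p q) :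
    ‖f (pt k)‖ ≤ M := by
  have := h 0 (Nat.zero_le _) _ (pt_mem_spheres k)
  rwa [norm_iteratedFDeriv_zero, angular_of_spheres _ (pt_mem_spheres k)] at this

lemma NormLE.norm_le {N : ℕ} {f : HS p q a} {M : ℝ} (h : NormLE N f.fn M) : ‖f‖ ≤ M :=
  norm_le_of_forall_pt ((norm_nonneg _).trans (h.norm_pt_le 1)) h.norm_pt_le

lemma normLE_zero_of_pt {f : HS p q a} {M : ℝ} (h : ∀ k, ‖f (pt k)‖ ≤ M) : NormLE 0 f.fn M := by
  intro k hk w hw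
  obtain ⟨g, rfl⟩ := exists_pt hw
  obtain rfl : k = 0 := by omega
  rw [norm_iteratedFDeriv_zero, angular_of_spheres _ (pt_mem_spheres g)]
  exact h g

lemma angular_add (f g : HS p q a) :
    Set.EqOn (angular (f + g).fn) (angular f.fn + angular g.fn) (reg p q) := fun w hw => by
  rw [Pi.add_apply, angular_apply _ hw, angular_apply _ hw, angular_apply _ hw]
  rfl

lemma angular_smul (c : ℂ) (f : HS p q a) :
    Set.EqOn (angular (c • f).fn) (fun w => c * angular f.fn w) (reg p q) := fun w hw => by
  simp only
  rw [angular_apply _ hw, angular_apply _ hw]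
  rfl

lemma NormLE.add {N : ℕ} {f g : HS p q a} {M M' : ℝ} (h : NormLE N f.fn M) (h' : NormLE N g.fn M') :
    NormLE N (f + g).fn (M + M') := by
  rw [normLE_iff] at h h' ⊢
  exact (h.add h').congr (angular_add f g)

lemma NormLE.smul {N : ℕ} {f : HS p q a} {M : ℝ} (h : NormLE N f.fn M) (c : ℂ) :
    NormLE N (c • f).fn (‖c‖ * M) := by
  have h' := normLE_iff.1 h
  refine normLE_iff.2 (BD.congr ⟨contDiffOn_const.mul h'.1, fun k hk w hw => ?_⟩ (angular_smul c f))
  have hr := spheres_subset_reg hw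
  have hk' : ContDiffWithinAt ℝ (k : WithTop ℕ∞) (angular f.fn) (reg p q) w :=
    (h'.1 w hr).of_le (by exact_mod_cast le_top)
  have := iteratedFDerivWithin_const_smul_apply (a := c) hk' isOpen_reg.uniqueDiffOn hr
  have h2 : (c • angular f.fn) = fun w => c * angular f.fn w := rfl
  rw [h2] at this
  rw [this, norm_smul]
  exact mul_le_mul_of_nonneg_left (h'.2 k hk w hw) (norm_nonneg _)

lemma normLE_zero (N : ℕ) : NormLE N (0 : HS p q a).fn 0 := by
  refine normLE_iff.2 ((BD.zero N).congr fun w hw => ?_)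
  rw [angular_apply _ hw]
  rfl

lemma NormLE.sum {ι : Type*} (s : Finset ι) {N : ℕ} {f : ι → HS p q a} {M : ι → ℝ}
    (h : ∀ i ∈ s, NormLE N (f i).fn (M i)) : NormLE N (∑ i ∈ s, f i).fn (∑ i ∈ s, M i) := by
  classical
  induction s using Finset.induction_on with
  | empty => simpa using normLE_zero N
  | insert i s hi ih =>
    rw [Finset.sum_insert hi, Finset.sum_insert hi]
    exact (h i (Finset.mem_insert_self _ _)).add
      (ih fun j hj => h j (Finset.mem_insert_of_mem hj))

lemma exists_normLE_lie {φ : Flow p q} (hφ : ∀ t, ∃ k, φ.g t = kO k) (a : ℝ) (N : ℕ) :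
    ∃ C, 0 ≤ C ∧ ∀ (f : HS p q a) (M : ℝ), NormLE (N + 1) f.fn M →
      NormLE N (lie φ f).fn (C * M) := by
  obtain ⟨C, hC0, hC⟩ := exists_BD_bilin N (ContinuousLinearMap.id ℝ (V p q →L[ℝ] ℂ))
    (c := fun w => φ.X w) (φ.X.toContinuousLinearMap.contDiff.contDiffOn)
  refine ⟨C, hC0, fun f M h => ?_⟩
  rw [normLE_iff] at h ⊢
  exact (hC _ M h.fderiv).congr fun w hw => (fderiv_angular_flow hφ f hw).symm

lemma exists_normLE_Lam (p q : ℕ) [NeZero p] [NeZero q] (a : ℝ) (N : ℕ) :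
    ∃ C, 0 ≤ C ∧ ∀ (f : HS p q a) (M : ℝ), NormLE (N + 2) f.fn M → NormLE N (Lam f).fn (C * M) := by
  have h2 : ∀ {φ : Flow p q}, (∀ t, ∃ k, φ.g t = kO k) → ∃ C, 0 ≤ C ∧ ∀ (f : HS p q a) (M : ℝ),
      NormLE (N + 2) f.fn M → NormLE N (lie φ (lie φ f)).fn (C * M) := by
    intro φ hφ
    obtain ⟨C, hC0, hC⟩ := exists_normLE_lie hφ a (N + 1)
    obtain ⟨D, hD0, hD⟩ := exists_normLE_lie hφ a N
    exact ⟨D * C, mul_nonneg hD0 hC0, fun f M h => by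
      rw [mul_assoc]
      exact hD _ _ (hC _ _ h)⟩
  choose CX hCX0 hCX using fun k l : _ => h2 (rotX_kO (q := q) k l)
  choose CY hCY0 hCY using fun k l : _ => h2 (rotY_kO (p := p) k l)
  refine ⟨1 + ‖(-(1 / 2) : ℂ)‖ * (∑ k, ∑ l, CX k l + ∑ k, ∑ l, CY k l), ?_, fun f M h => ?_⟩
  · have e1 : 0 ≤ ∑ k, ∑ l, CX k l :=
      Finset.sum_nonneg fun k _ => Finset.sum_nonneg fun l _ => hCX0 k l
    have e2 : 0 ≤ ∑ k, ∑ l, CY k l :=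
      Finset.sum_nonneg fun k _ => Finset.sum_nonneg fun l _ => hCY0 k l
    positivity
  · have e1 : NormLE N (Cx f).fn (∑ k, ∑ l, CX k l * M) := by
      rw [Cx_apply]
      exact NormLE.sum _ fun k _ => NormLE.sum _ fun l _ => hCX k l f M h
    have e2 : NormLE N (Cy f).fn (∑ k, ∑ l, CY k l * M) := by
      rw [Cy_apply]
      exact NormLE.sum _ fun k _ => NormLE.sum _ fun l _ => hCY k l f M h
    have e3 := (h.mono (Nat.le_add_right N 2) le_rfl).add ((e1.add e2).smul (-(1 / 2)))
    have e4 : Lam f = f + (-(1 / 2) : ℂ) • (Cx f + Cy f) := by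
      rw [Lam_apply, neg_smul, sub_eq_add_neg]
    rw [e4]
    refine e3.mono le_rfl (le_of_eq ?_)
    simp only [← Finset.sum_mul]
    ring

/-- The norms `‖Λ^j f‖` are continuous for the topology of `S^a(X⁰)`. -/
lemma exists_norm_Lam_pow_le (p q : ℕ) [NeZero p] [NeZero q] (a : ℝ) (j : ℕ) :
    ∃ C, 0 ≤ C ∧ ∀ (f : HS p q a) (M : ℝ), NormLE (2 * j) f.fn M → ‖(Lam ^ j) f‖ ≤ C * M := by
  suffices h : ∀ N, ∃ C, 0 ≤ C ∧ ∀ (f : HS p q a) (M : ℝ), NormLE (N + 2 * j) f.fn M →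
      NormLE N ((Lam ^ j) f).fn (C * M) by
    obtain ⟨C, hC0, hC⟩ := h 0
    refine ⟨C, hC0, fun f M hf => (hC f M ?_).norm_le⟩
    rwa [zero_add]
  induction j with
  | zero => exact fun N => ⟨1, zero_le_one, fun f M h => by simpa using h⟩
  | succ j ih =>
    intro N
    obtain ⟨C, hC0, hC⟩ := ih N
    obtain ⟨D, hD0, hD⟩ := exists_normLE_Lam p q a (N + 2 * j)
    refine ⟨C * D, mul_nonneg hC0 hD0, fun f M h => ?_⟩
    rw [pow_succ, Module.End.mul_apply, mul_assoc]
    exact hC _ _ (hD f M h)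

/-- The topology of `S^a(X⁰)` is defined by the norms `‖Λ^j f‖`. -/
lemma exists_normLE_le (p q : ℕ) [NeZero p] [NeZero q] (a : ℝ) (N : ℕ) :
    ∃ (C : ℝ) (j : ℕ), 0 ≤ C ∧ ∀ f : HS p q a, NormLE N f.fn (C * ‖(Lam ^ j) f‖) := by
  obtain ⟨C₀, hC₀, h₀⟩ := exists_norm_pt_le p q a
  have hbase : ∀ f : HS p q a, NormLE 0 f.fn (C₀ * ‖(Lam ^ (p + q + 2)) f‖) := fun f =>
    normLE_zero_of_pt (h₀ f)
  induction N with
  | zero => exact ⟨C₀, p + q + 2, hC₀, hbase⟩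
  | succ N ih =>
    obtain ⟨C, j, hC0, hC⟩ := ih
    have hb : ∀ {c : V p q → V p q →L[ℝ] ℂ}, ContDiffOn ℝ ∞ c (reg p q) → ∃ D, 0 ≤ D ∧
        ∀ (g : V p q → ℂ) (M : ℝ), BD N g M → BD N (fun w => g w • c w) (D * M) := fun hc =>
      exists_BD_bilin N (ContinuousLinearMap.lsmul ℝ ℂ) hc
    choose DX hDX0 hDX using fun k l => hb (contDiffOn_cX (q := q) k l)
    choose DY hDY0 hDY using fun k l => hb (contDiffOn_cY (p := p) k l)
    set D := ∑ k, ∑ l, DX k l * (C * 2) + ∑ k, ∑ l, DY k l * (C * 2) with hD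
    have hDn : 0 ≤ D := by
      have e1 : 0 ≤ ∑ k, ∑ l, DX k l * (C * 2) :=
        Finset.sum_nonneg fun k _ => Finset.sum_nonneg fun l _ => mul_nonneg (hDX0 k l) (by positivity)
      have e2 : 0 ≤ ∑ k, ∑ l, DY k l * (C * 2) :=
        Finset.sum_nonneg fun k _ => Finset.sum_nonneg fun l _ => mul_nonneg (hDY0 k l) (by positivity)
      exact add_nonneg e1 e2
    refine ⟨C₀ + D, p + q + 2 + (j + 1), add_nonneg hC₀ hDn, fun f => ?_⟩
    have h1 : BD N (fderiv ℝ (angular f.fn)) (D * ‖(Lam ^ (j + 1)) f‖) := by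
      have hX : ∀ k l, BD N (angular (Lx k l f).fn) (C * 2 * ‖(Lam ^ (j + 1)) f‖) := fun k l => by
        refine (normLE_iff.1 (hC (Lx k l f))).mono le_rfl ?_
        rw [pow_comm_of_comm (Lam_Lx k l), mul_assoc, pow_succ', Module.End.mul_apply]
        exact mul_le_mul_of_nonneg_left ((norm_le_Lam _).2.1 k l) hC0
      have hY : ∀ k l, BD N (angular (Ly k l f).fn) (C * 2 * ‖(Lam ^ (j + 1)) f‖) := fun k l => by
        refine (normLE_iff.1 (hC (Ly k l f))).mono le_rfl ?_
        rw [pow_comm_of_comm (Lam_Ly k l), mul_assoc, pow_succ', Module.End.mul_apply]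
        exact mul_le_mul_of_nonneg_left ((norm_le_Lam _).2.2 k l) hC0
      have h2 := (BD.sum Finset.univ fun k _ => BD.sum Finset.univ fun l _ =>
          hDX k l _ _ (hX k l)).add (BD.sum Finset.univ fun k _ => BD.sum Finset.univ fun l _ =>
          hDY k l _ _ (hY k l))
      have h3 : Set.EqOn (fderiv ℝ (angular f.fn)) (∑ k, ∑ l, (fun w => angular (Lx k l f).fn w • cX k l w) +
        ∑ k, ∑ l, fun w => angular (Ly k l f).fn w • cY k l w) (reg p q) := fun w hw => by
        rw [fderiv_angular f hw]
        simp only [Pi.add_apply, Finset.sum_apply]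
      refine (h2.congr h3).mono le_rfl (le_of_eq ?_)
      rw [hD, add_mul, Finset.sum_mul, Finset.sum_mul]
      simp only [Finset.sum_mul, mul_assoc]
    refine normLE_iff.2 ((BD.of_fderiv (normLE_iff.1 (hbase f)) h1).mono le_rfl ?_)
    have e1 : C₀ * ‖(Lam ^ (p + q + 2)) f‖ ≤ C₀ * ‖(Lam ^ (p + q + 2 + (j + 1))) f‖ :=
      mul_le_mul_of_nonneg_left (norm_Lam_pow_le (by omega) f) hC₀
    have e2 : D * ‖(Lam ^ (j + 1)) f‖ ≤ D * ‖(Lam ^ (p + q + 2 + (j + 1))) f‖ :=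
      mul_le_mul_of_nonneg_left (norm_Lam_pow_le (by omega) f) hDn
    have e3 : 0 ≤ C₀ * ‖(Lam ^ (p + q + 2)) f‖ := by positivity
    have e4 : 0 ≤ D * ‖(Lam ^ (j + 1)) f‖ := by positivity
    rw [add_mul]
    exact max_le (by linarith) (by linarith)

end

section

variable {p q : ℕ} {a : ℝ} [NeZero p] [NeZero q]

/-! ### Boosts on `K`-types -/

/-- The coefficient of the transition from `γ` to `α` under a boost. -/
def AA (p q : ℕ) (a : ℝ) (γ α : ℕ × ℕ) : ℝ := shift p q a - (lamT p q α - lamT p q γ) / 2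

lemma inner_Db {α : ℕ × ℕ} (i : Fin p) (j : Fin q) {v : HS p q a} (hv : v ∈ VT p q a α)
    (f : HS p q a) : inner ℂ v (Db i j f) =
      ∑ γ ∈ nbF α, (AA p q a γ α : ℂ) * inner ℂ (PT γ (MM i j v)) f := by
  have hC : inner ℂ (Cx (MM i j v) + Cy (MM i j v)) f =
      ∑ γ ∈ nbF α, (-2 * lamT p q γ : ℂ) * inner ℂ (PT γ (MM i j v)) f := by
    have h1 : Cx (MM i j v) + Cy (MM i j v) =
        ∑ γ ∈ nbF α, (-2 * lamT p q γ : ℂ) • PT γ (MM i j v) := by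
      rw [← MM_eq_sum i j hv, map_sum, map_sum, ← Finset.sum_add_distrib]
      refine Finset.sum_congr rfl fun γ _ => ?_
      rw [MM_eq_sum i j hv, Cx_VT (PT_mem _ _), Cy_VT (PT_mem _ _), ← add_smul, lamT]
      push_cast
      ring_nf
    rw [h1, sum_inner]
    refine Finset.sum_congr rfl fun γ _ => ?_
    rw [inner_smul_left]
    congr 1
    rw [map_mul, map_neg, map_ofNat, Complex.conj_ofReal]
  have hM : inner ℂ (MM i j v) f = ∑ γ ∈ nbF α, inner ℂ (PT γ (MM i j v)) f := by
    rw [← sum_inner, MM_eq_sum i j hv]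
  have e1 : ∀ g : HS p q a, inner ℂ v (Cx g) = (-2 * lam p α.1 : ℂ) * inner ℂ v g := fun g => by
    rw [← inner_Cx, Cx_VT hv, inner_smul_left, map_mul, map_neg, map_ofNat, Complex.conj_ofReal]
  have e2 : ∀ g : HS p q a, inner ℂ v (Cy g) = (-2 * lam q α.2 : ℂ) * inner ℂ v g := fun g => by
    rw [← inner_Cy, Cy_VT hv, inner_smul_left, map_mul, map_neg, map_ofNat, Complex.conj_ofReal]
  rw [Db_eq_commutator, inner_add_right, inner_smul_right, inner_smul_right, inner_sub_right,
    inner_add_right]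
  simp only [← MM_apply]
  rw [e1, e2, ← inner_MM, ← inner_MM, inner_add_right, ← inner_Cx, ← inner_Cy, ← inner_add_left, hC,
    hM]
  simp only [Finset.mul_sum, ← Finset.sum_add_distrib, ← Finset.sum_sub_distrib]
  refine Finset.sum_congr rfl fun γ _ => ?_
  simp only [AA, lamT]
  push_cast
  ring

lemma PT_Db {α β : ℕ × ℕ} (i : Fin p) (j : Fin q) {u : HS p q a} (hu : u ∈ VT p q a α) :
    PT β (Db i j u) = (AA p q a α β : ℂ) • PT β (MM i j u) := by
  refine PT_eq (Submodule.smul_mem _ _ (PT_mem _ _)) fun v hv => ?_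
  rw [inner_Db i j hv, inner_smul_right, inner_PT_right hv, ← inner_MM]
  have h : ∀ γ, inner ℂ (PT γ (MM i j v)) u = if γ = α then inner ℂ (MM i j v) u else 0 := by
    intro γ
    split_ifs with hγ
    · rw [hγ, inner_PT, PT_of_mem hu]
    · rw [inner_PT, PT_of_mem_ne hγ hu, inner_zero_right]
  simp only [h, mul_ite, mul_zero, Finset.sum_ite_eq']
  split_ifs with hα
  · rfl
  · have : ¬ Nb β α := fun hn => hα hn.mem
    rw [← PT_of_mem hu, ← inner_PT, PT_MM_eq_zero this i j hv, inner_zero_left, mul_zero]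

/-! ### Uniform bounds along one-parameter groups -/

/-- A family of elements of `S^a(X⁰)` that depends smoothly on a parameter. -/
def SmoothFamily (u : ℝ → HS p q a) : Prop :=
  ∃ F : ℝ × V p q → ℂ, ContDiffOn ℝ ∞ F (Set.univ ×ˢ {0}ᶜ) ∧ ∀ (t : ℝ) (w : cone p q),
    F (t, w) = u t w

lemma isOpen_univ_prod : IsOpen ((Set.univ : Set ℝ) ×ˢ ({0}ᶜ : Set (V p q))) :=
  isOpen_univ.prod isOpen_ne_zero

lemma SmoothFamily.flowS (φ : Flow p q) (f : HS p q a) : SmoothFamily fun t => flowS φ t f := by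
  obtain ⟨F, hF, h⟩ := f.smooth
  refine ⟨fun z => F ((φ.g z.1).1 z.2), ?_, fun t w => ?_⟩
  · refine hF.comp φ.smooth.contDiffOn ?_
    rintro ⟨t, w⟩ ⟨-, hw⟩ h0
    exact hw ((φ.g t).1.map_eq_zero_iff.1 h0)
  · rw [flowS_apply]
    exact h (move (φ.g t) w)

lemma SmoothFamily.lie {u : ℝ → HS p q a} (hu : SmoothFamily u) (ψ : Flow p q) :
    SmoothFamily fun t => lie ψ (u t) := by
  obtain ⟨F, hF, h⟩ := hu
  refine ⟨fun z => fderiv ℝ F z (0, ψ.X z.2), ?_, fun t w => ?_⟩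
  · have h1 : ContDiffOn ℝ ∞ (fderiv ℝ F) (Set.univ ×ˢ {0}ᶜ) :=
      hF.fderiv_of_isOpen isOpen_univ_prod (by simp)
    refine h1.clm_apply (ContDiff.contDiffOn ?_)
    exact contDiff_const.prodMk (ψ.X.toContinuousLinearMap.contDiff.comp contDiff_snd)
  · have hFt : ContDiffOn ℝ ∞ (fun w => F (t, w)) {0}ᶜ :=
      hF.comp (contDiff_const.prodMk contDiff_id).contDiffOn fun w hw => ⟨trivial, hw⟩
    rw [lie_apply, lieFn_eq_of_ext ψ hFt (h t)]
    have h2 : HasFDerivAt F (fderiv ℝ F (t, w)) (t, (w : V p q)) :=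
      ((hF.contDiffAt (isOpen_univ_prod.mem_nhds (show (t, (w : V p q)) ∈ _ from
        ⟨trivial, w.2.1⟩))).differentiableAt
        (by simp)).hasFDerivAt
    have h3 := h2.comp (w : V p q) (hasFDerivAt_prodMk_right t (w : V p q))
    have h4 : (fun w : V p q => F (t, w)) = F ∘ fun w => (t, w) := rfl
    rw [h4, h3.fderiv]
    rfl

lemma SmoothFamily.add {u v : ℝ → HS p q a} (hu : SmoothFamily u) (hv : SmoothFamily v) :
    SmoothFamily fun t => u t + v t := by
  obtain ⟨F, hF, h⟩ := hu
  obtain ⟨G, hG, h'⟩ := hv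
  exact ⟨F + G, hF.add hG, fun t w => by rw [HS.add_apply, ← h, ← h']; rfl⟩

lemma SmoothFamily.smul {u : ℝ → HS p q a} (hu : SmoothFamily u) (c : ℂ) :
    SmoothFamily fun t => c • u t := by
  obtain ⟨F, hF, h⟩ := hu
  exact ⟨fun z => c * F z, contDiffOn_const.mul hF, fun t w => by rw [HS.smul_apply, ← h]⟩

lemma SmoothFamily.zero : SmoothFamily fun _ => (0 : HS p q a) :=
  ⟨0, contDiffOn_const, fun _ _ => rfl⟩

lemma SmoothFamily.sum {ι : Type*} (s : Finset ι) {u : ι → ℝ → HS p q a}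
    (h : ∀ i ∈ s, SmoothFamily (u i)) : SmoothFamily fun t => ∑ i ∈ s, u i t := by
  classical
  induction s using Finset.induction_on with
  | empty => simpa using SmoothFamily.zero
  | insert i s hi ih =>
    simp only [Finset.sum_insert hi]
    exact (h i (Finset.mem_insert_self _ _)).add
      (ih fun j hj => h j (Finset.mem_insert_of_mem hj))

lemma SmoothFamily.Lam_pow {u : ℝ → HS p q a} (hu : SmoothFamily u) (j : ℕ) :
    SmoothFamily fun t => (Lam ^ j) (u t) := by
  induction j with
  | zero => simpa using hu
  | succ j ih =>
    simp only [pow_succ', Module.End.mul_apply]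
    have e : ∀ f : HS p q a, Lam f = f + (-(1 / 2) : ℂ) •
        (∑ k, ∑ l, Lx k l (Lx k l f) + ∑ k, ∑ l, Ly k l (Ly k l f)) := fun f => by
      rw [Lam_apply, neg_smul, sub_eq_add_neg, Cx_apply, Cy_apply]
    simp only [e]
    refine ih.add (SmoothFamily.smul (SmoothFamily.add ?_ ?_) _)
    · exact SmoothFamily.sum _ fun k _ => SmoothFamily.sum _ fun l _ => (ih.lie _).lie _
    · exact SmoothFamily.sum _ fun k _ => SmoothFamily.sum _ fun l _ => (ih.lie _).lie _

lemma SmoothFamily.exists_bound {u : ℝ → HS p q a} (hu : SmoothFamily u) (T : ℝ) :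
    ∃ C, 0 ≤ C ∧ ∀ t ∈ Set.Icc (-T) T, ‖u t‖ ≤ C := by
  obtain ⟨F, hF, h⟩ := hu
  have hc : ContinuousOn F (Set.Icc (-T) T ×ˢ spheres p q) :=
    hF.continuousOn.mono (Set.prod_mono (Set.subset_univ _) fun w hw => (spheres_subset_cone hw).1)
  obtain ⟨C, hC⟩ := (isCompact_Icc.prod isCompact_spheres).exists_bound_of_continuousOn hc
  refine ⟨max C 0, le_max_right _ _, fun t ht => norm_le_of_forall_pt (le_max_right _ _) fun k => ?_⟩
  rw [← h]
  exact (hC _ ⟨ht, pt_mem_spheres k⟩).trans (le_max_left _ _)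

lemma exists_Lam_flowS_bound (φ : Flow p q) (f : HS p q a) (j : ℕ) (T : ℝ) :
    ∃ C, 0 ≤ C ∧ ∀ t ∈ Set.Icc (-T) T, ‖(Lam ^ j) (flowS φ t f)‖ ≤ C :=
  ((SmoothFamily.flowS φ f).Lam_pow j).exists_bound T

lemma hasDerivAt_inner_flowS (φ : Flow p q) (ψ f : HS p q a) (t : ℝ) :
    HasDerivAt (fun t => inner ℂ ψ (flowS φ t f)) (inner ℂ ψ (flowS φ t (lie φ f))) t := by
  have := (hasDerivAt_const t ψ).inner ℂ (hasDerivAt_flowS φ f t)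
  simpa using this

lemma norm_le_of_inner_le {x : HS p q a} {c : ℝ} (hc : 0 ≤ c)
    (h : ∀ ψ : HS p q a, ‖inner ℂ ψ x‖ ≤ c * ‖ψ‖) : ‖x‖ ≤ c := by
  have h1 := h x
  rw [inner_self_eq_norm_sq_to_K] at h1
  simp only [norm_pow, RCLike.norm_ofReal, abs_norm] at h1
  by_contra hlt
  push Not at hlt
  nlinarith [norm_nonneg x]

lemma exists_Lam_taylor (φ : Flow p q) (f : HS p q a) (j : ℕ) :
    ∃ C, 0 ≤ C ∧ ∀ t ∈ Set.Icc (-1 : ℝ) 1,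
      ‖(Lam ^ j) (flowS φ t f - f - (t : ℂ) • lie φ f)‖ ≤ C * t ^ 2 := by
  obtain ⟨C, hC0, hC⟩ := exists_Lam_flowS_bound φ (lie φ (lie φ f)) j 1
  refine ⟨C, hC0, fun t ht => norm_le_of_inner_le (by positivity) fun ψ => ?_⟩
  rw [← inner_Lam_pow]
  set χ := (Lam ^ j) ψ with hχ
  have h1 : ∀ s ∈ Set.Icc (-1 : ℝ) 1,
      ‖inner ℂ χ (flowS φ s (lie φ f)) - inner ℂ χ (lie φ f)‖ ≤ C * ‖ψ‖ * |s| := by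
    intro s hs
    have := (convex_Icc (-1 : ℝ) 1).norm_image_sub_le_of_norm_hasDerivWithin_le
      (f := fun s => inner ℂ χ (flowS φ s (lie φ f))) (x := 0) (y := s) (C := C * ‖ψ‖)
      (fun x _ => (hasDerivAt_inner_flowS φ χ (lie φ f) x).hasDerivWithinAt)
      (fun x hx => by
        rw [hχ, inner_Lam_pow, mul_comm]
        exact (norm_inner_le_norm _ _).trans
          (mul_le_mul_of_nonneg_left (hC x hx) (norm_nonneg _))) (by simp) hs
    simpa [flowS_zero] using this
  have h2 := (convex_Icc (-|t|) |t|).norm_image_sub_le_of_norm_hasDerivWithin_le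
      (f := fun s : ℝ => inner ℂ χ (flowS φ s f) - s * inner ℂ χ (lie φ f)) (x := 0) (y := t)
      (f' := fun s => inner ℂ χ (flowS φ s (lie φ f)) - inner ℂ χ (lie φ f)) (C := C * ‖ψ‖ * |t|)
      (fun x _ => by
        have h3 : HasDerivAt (fun s : ℝ => (s : ℂ) * inner ℂ χ (lie φ f)) (inner ℂ χ (lie φ f)) x := by
          have := (Complex.ofRealCLM.hasDerivAt (x := x)).mul_const (inner ℂ χ (lie φ f))
          simpa using this
        exact ((hasDerivAt_inner_flowS φ χ f x).sub h3).hasDerivWithinAt)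
      (fun x hx => by
        have hxt : |x| ≤ |t| := abs_le.2 hx
        have ht1 : |t| ≤ 1 := abs_le.2 ht
        exact (h1 x (abs_le.1 (hxt.trans ht1))).trans
          (mul_le_mul_of_nonneg_left hxt (by positivity)))
      (by simp) ⟨neg_abs_le t, le_abs_self t⟩
  simp only [flowS_zero, Complex.ofReal_zero, zero_mul, sub_zero, Real.norm_eq_abs] at h2
  rw [mul_assoc, abs_mul_abs_self, ← sq] at h2
  rw [inner_sub_right, inner_sub_right, inner_smul_right, sub_right_comm]
  linarith

/-! ### Submodules -/

lemma IsSubmodule.mem_of_approx {W : Submodule ℂ (Fn p q)} (hW : IsSubmodule p q (a : ℂ) W)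
    (f : HS p q a) (h : ∀ (j : ℕ) (ε : ℝ), 0 < ε → ∃ g : HS p q a, g.fn ∈ W ∧ ‖(Lam ^ j) (f - g)‖ ≤ ε) :
    f.fn ∈ W := by
  refine hW.closed f.fn f.mem fun N ε hε => ?_
  obtain ⟨C, j, hC0, hC⟩ := exists_normLE_le p q a N
  obtain ⟨g, hg, hgf⟩ := h j (ε / (C + 1)) (by positivity)
  refine ⟨g.fn, hg, (hC (f - g)).mono le_rfl ?_⟩
  calc C * ‖(Lam ^ j) (f - g)‖ ≤ (C + 1) * (ε / (C + 1)) :=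
        mul_le_mul (by linarith) hgf (norm_nonneg _) (by linarith)
    _ = ε := by field_simp

lemma IsSubmodule.rhoS_mem {W : Submodule ℂ (Fn p q)} (hW : IsSubmodule p q (a : ℂ) W)
    {f : HS p q a} (hf : f.fn ∈ W) (g : O p q) : (rhoS g f).fn ∈ W := hW.invariant g _ hf

lemma IsSubmodule.lie_mem {W : Submodule ℂ (Fn p q)} (hW : IsSubmodule p q (a : ℂ) W)
    {f : HS p q a} (hf : f.fn ∈ W) (φ : Flow p q) : (lie φ f).fn ∈ W := by
  refine hW.mem_of_approx _ fun j ε hε => ?_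
  obtain ⟨C, hC0, hC⟩ := exists_Lam_taylor φ f j
  set t := min 1 (ε / (C + 1)) with ht
  have ht0 : 0 < t := lt_min one_pos (by positivity)
  have ht1 : t ≤ 1 := min_le_left _ _
  refine ⟨(t⁻¹ : ℂ) • (flowS φ t f - f), ?_, ?_⟩
  · exact W.smul_mem _ (W.sub_mem (hW.rhoS_mem hf _) hf)
  · have htc : (t : ℂ) ≠ 0 := by exact_mod_cast ht0.ne'
    have e : lie φ f - (t⁻¹ : ℂ) • (flowS φ t f - f) =
        (-(t⁻¹ : ℂ)) • (flowS φ t f - f - (t : ℂ) • lie φ f) := by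
      rw [smul_sub _ _ ((t : ℂ) • lie φ f), smul_smul, neg_mul, inv_mul_cancel₀ htc]
      module
    rw [e, map_smul, norm_smul, norm_neg, norm_inv, Complex.norm_real, Real.norm_of_nonneg ht0.le]
    have h1 := hC t ⟨by linarith, ht1⟩
    calc t⁻¹ * _ ≤ t⁻¹ * (C * t ^ 2) := mul_le_mul_of_nonneg_left h1 (by positivity)
      _ = C * t := by field_simp
      _ ≤ (C + 1) * (ε / (C + 1)) :=
          mul_le_mul (by linarith) (min_le_right _ _) ht0.le (by linarith)
      _ = ε := by field_simp

end

section

variable {p q : ℕ} {a : ℝ} [NeZero p] [NeZero q]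

/-! ### Zonal functions -/

lemma eq_zero_of_pe_unit {n m : ℕ} [NeZero n] {h : Pol n} (hh : h.IsHomogeneous m)
    (h0 : ∀ x : Fin n → ℝ, x ⬝ᵥ x = 1 → pe h x = 0) : h = 0 := by
  by_contra hne
  obtain ⟨x, hx, hx'⟩ := exists_unit_pe_ne_zero hh hne
  exact hx' (h0 x hx)

lemma zonal_unit {n m : ℕ} [NeZero n] {h : Pol n} (hh : IsHarmonic m h)
    (hinv : ∀ A : Matrix.orthogonalGroup (Fin n) ℝ, A.1.mulVec (Pi.single 0 1) = Pi.single 0 1 →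
      ∀ x, x ⬝ᵥ x = 1 → pe h (A.1.mulVec x) = pe h x) (h0 : pe h (Pi.single 0 1) = 0) : h = 0 := by
  refine eq_zero_of_zonal m hh (fun A hA x => ?_) h0
  have h1 : subst A.1 h - h = 0 := by
    refine eq_zero_of_pe_unit ((hh.subst A).1.sub hh.1) fun x hx => ?_
    rw [pe_sub, pe_subst, hinv A hA x hx, sub_self]
  rw [← pe_subst, sub_eq_zero.1 h1]

/-- The point of the light cone with given unit components. -/
def cpt (x : Fin p → ℝ) (y : Fin q → ℝ) (hx : x ⬝ᵥ x = 1) (hy : y ⬝ᵥ y = 1) : cone p q :=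
  ⟨(x, y), spheres_subset_cone (mem_spheres.2 ⟨(nx_eq _).trans hx, (ny_eq _).trans hy⟩)⟩

lemma move_cpt (k : K p q) {x : Fin p → ℝ} {y : Fin q → ℝ} (hx : x ⬝ᵥ x = 1) (hy : y ⬝ᵥ y = 1) :
    move (kO k) (cpt x y hx hy) = cpt (k.left.1.mulVec x) (k.right.1.mulVec y)
      ((dotProduct_mulVec_orthogonal _ _ _).trans hx)
      ((dotProduct_mulVec_orthogonal _ _ _).trans hy) := rfl

lemma pt_eq_cpt (k : K p q) : ∃ hx hy, pt k = cpt (pt k).1.1 (pt k).1.2 hx hy := by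
  have h := mem_spheres.1 (pt_mem_spheres k)
  rw [nx_eq, ny_eq] at h
  exact ⟨h.1, h.2, rfl⟩

lemma exists_pe_left {α : ℕ × ℕ} {v : HS p q a} (hv : v ∈ VT p q a α) {y : Fin q → ℝ}
    (hy : y ⬝ᵥ y = 1) : ∃ h : Pol p, IsHarmonic α.1 h ∧ ∀ x (hx : x ⬝ᵥ x = 1),
      v (cpt x y hx hy) = pe h x := by
  refine VT_induction hv (fun h₁ h₂ H₁ H₂ => ?_) ?_
  · refine ⟨_, H₁.C_mul (pe h₂ y), fun x hx => ?_⟩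
    rw [jS_apply_spheres H₁ H₂ ((nx_eq _).trans hx), pe_mul, pe_C, mul_comm]
    rfl
  · rintro u v ⟨h, hh, hu⟩ ⟨h', hh', hv⟩
    exact ⟨h + h', hh.add hh', fun x hx => by rw [HS.add_apply, hu, hv, pe_add]⟩

lemma exists_pe_right {α : ℕ × ℕ} {v : HS p q a} (hv : v ∈ VT p q a α) {x : Fin p → ℝ}
    (hx : x ⬝ᵥ x = 1) : ∃ h : Pol q, IsHarmonic α.2 h ∧ ∀ y (hy : y ⬝ᵥ y = 1),
      v (cpt x y hx hy) = pe h y := by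
  refine VT_induction hv (fun h₁ h₂ H₁ H₂ => ?_) ?_
  · refine ⟨_, H₂.C_mul (pe h₁ x), fun y hy => ?_⟩
    rw [jS_apply_spheres H₁ H₂ ((nx_eq _).trans hx), pe_mul, pe_C]
    rfl
  · rintro u v ⟨h, hh, hu⟩ ⟨h', hh', hv⟩
    exact ⟨h + h', hh.add hh', fun x hx => by rw [HS.add_apply, hu, hv, pe_add]⟩

lemma single_dot_single {n : ℕ} [NeZero n] :
    (Pi.single 0 1 : Fin n → ℝ) ⬝ᵥ (Pi.single 0 1 : Fin n → ℝ) = 1 := by simp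

lemma pt_one : pt (1 : K p q) =
    cpt (Pi.single 0 1) (Pi.single 0 1) single_dot_single single_dot_single := by
  rw [pt, map_one, move_one]
  rfl

/-- A function in a `K`-type that is invariant under the stabilizer of the base point and vanishes
there is zero. -/
lemma VT_eq_zero_of_zonal {α : ℕ × ℕ} {v : HS p q a} (hv : v ∈ VT p q a α)
    (hinv : ∀ k : K p q, pt k = pt 1 → ∀ w, v (move (kO k) w) = v w) (h0 : v (pt 1) = 0) :
    v = 0 := by
  have hst : ∀ A B, A.1.mulVec (Pi.single 0 1) = Pi.single 0 1 →
      B.1.mulVec (Pi.single 0 1) = Pi.single 0 1 → pt (K.mk A B : K p q) = pt 1 := by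
    intro A B hA hB
    refine Subtype.ext ?_
    rw [coe_pt, coe_pt, kO_apply, map_one, base, K.left_mk, K.right_mk, hA, hB]
    rfl
  have h1 : ∀ x (hx : x ⬝ᵥ x = 1), v (cpt x (Pi.single 0 1) hx single_dot_single) = 0 := by
    obtain ⟨h, hh, hvh⟩ := exists_pe_left hv (single_dot_single (n := q))
    have hz : h = 0 := by
      refine zonal_unit hh (fun A hA x hx => ?_) ?_
      · have := hinv (K.mk A 1) (hst A 1 hA (Matrix.one_mulVec _)) (cpt x (Pi.single 0 1) hx single_dot_single)
        rw [move_cpt] at this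
        simp only [K.left_mk, K.right_mk, OneMemClass.coe_one, Matrix.one_mulVec] at this
        rwa [hvh, hvh] at this
      · rw [← hvh _ single_dot_single, ← pt_one, h0]
    intro x hx
    rw [hvh x hx, hz]
    simp [pe]
  refine HS.ext_pt fun k => ?_
  obtain ⟨hx, hy, hk⟩ := pt_eq_cpt k
  rw [hk, HS.zero_apply]
  obtain ⟨h, hh, hvh⟩ := exists_pe_right hv hx
  have hz : h = 0 := by
    refine zonal_unit hh (fun A hA x hx' => ?_) ?_
    · have := hinv (K.mk 1 A) (hst 1 A (Matrix.one_mulVec _) hA) (cpt _ x hx hx')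
      rw [move_cpt] at this
      simp only [K.left_mk, K.right_mk, OneMemClass.coe_one, Matrix.one_mulVec] at this
      rwa [hvh, hvh] at this
    · rw [← hvh _ single_dot_single, h1]
  rw [hvh, hz]
  simp [pe]

lemma Zk_congr (α : ℕ × ℕ) {k l : K p q} (h : pt k = pt l) : Zk a α k = Zk a α l := by
  rw [← PT_of_mem (Zk_mem α l)]
  refine (PT_eq (Zk_mem α k) fun v hv => ?_).symm
  rw [← inner_conj_symm, inner_Zk_of_mem _ hv, ← inner_conj_symm v, inner_Zk_of_mem _ hv, h]

lemma Zk_apply_symm (α : ℕ × ℕ) (k l : K p q) :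
    (starRingEnd ℂ) (Zk a α k (pt l)) = Zk a α l (pt k) := by
  rw [← inner_Zk_of_mem l (Zk_mem α k), inner_conj_symm, inner_Zk_of_mem k (Zk_mem α l)]

lemma Zk_apply_mul (α : ℕ × ℕ) (k l m : K p q) :
    Zk a α (m * k) (pt (m * l)) = Zk a α k (pt l) := by
  rw [← rhoS_Zk, rhoS_apply, pt_mul, move_inv_move]

lemma Zk_apply_self (α : ℕ × ℕ) (k : K p q) : Zk a α k (pt k) = ((‖Zk a α k‖ ^ 2 : ℝ) : ℂ) := by
  rw [← inner_Zk_of_mem k (Zk_mem α k), inner_self_eq_norm_sq_to_K]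
  simp

/-- Convolution with the reproducing kernel. -/
lemma integral_Zk_mul (α : ℕ × ℕ) (hZ : Zk a α (1 : K p q) ≠ 0) (g : HS p q a) (l : K p q) :
    ∫ k, (starRingEnd ℂ) (Zk a α 1 (pt k)) * g (pt (k * l)) ∂haarK p q =
      PT α g (pt 1) / (‖Zk a α (1 : K p q)‖ ^ 2 : ℝ) * Zk a α 1 (pt l) := by
  set T : K p q → ℂ := fun l => ∫ k, (starRingEnd ℂ) (Zk a α 1 (pt k)) * g (pt (k * l)) ∂haarK p q
    with hT
  let b := stdOrthonormalBasis ℂ (VT p q a α)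
  let G : HS p q a := ∑ i, (∫ k, (starRingEnd ℂ) (g (pt k)) *
    (starRingEnd ℂ) ((b i : HS p q a) (pt k⁻¹)) ∂haarK p q) • (b i : HS p q a)
  have hGm : G ∈ VT p q a α := Submodule.sum_mem _ fun i _ => Submodule.smul_mem _ _ (b i).2
  have hexp : ∀ k m : K p q, Zk a α k (pt m) =
      ∑ i, (starRingEnd ℂ) ((b i : HS p q a) (pt k)) * (b i : HS p q a) (pt m) := by
    intro k m
    have h1 := b.sum_repr' ⟨Zk a α k, Zk_mem α k⟩
    have h2 := congrArg (fun v : VT p q a α => (v : HS p q a) (pt m)) h1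
    simp only [Submodule.coe_sum, Submodule.coe_smul, HS.sum_apply, HS.smul_apply] at h2
    rw [← h2]
    refine Finset.sum_congr rfl fun i _ => ?_
    rw [← inner_Zk_of_mem k (b i).2, inner_conj_symm]
    rfl
  have hTG : ∀ l, (starRingEnd ℂ) (T l) = G (pt l⁻¹) := by
    intro l
    have h1 : T l = ∫ k, (starRingEnd ℂ) (Zk a α 1 (pt (k * l⁻¹))) * g (pt k) ∂haarK p q := by
      have := integral_mul_right_eq_self (μ := haarK p q)
        (fun k => (starRingEnd ℂ) (Zk a α 1 (pt (k * l⁻¹))) * g (pt k)) l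
      rw [← this]
      simp only [mul_inv_cancel_right, hT]
    have h2 : ∀ k, Zk a α 1 (pt (k * l⁻¹)) = Zk a α k⁻¹ (pt l⁻¹) := fun k => by
      rw [← Zk_apply_mul α k⁻¹ l⁻¹ k, mul_inv_cancel]
    rw [h1, ← integral_conj]
    simp only [h2, hexp, map_mul, map_sum, Complex.conj_conj, Finset.sum_mul]
    have hci : ∀ i, Integrable (fun k => (starRingEnd ℂ) ((b i : HS p q a) (pt k⁻¹)) *
        (b i : HS p q a) (pt l⁻¹) * (starRingEnd ℂ) (g (pt k))) (haarK p q) := fun i =>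
      integrable_of_continuous (((Complex.continuous_conj.comp
        ((b i : HS p q a).continuous_pt.comp continuous_inv)).mul continuous_const).mul
        (Complex.continuous_conj.comp g.continuous_pt))
    rw [integral_finsetSum _ fun i _ => hci i]
    simp only [G, HS.sum_apply, HS.smul_apply]
    refine Finset.sum_congr rfl fun i _ => ?_
    rw [← integral_mul_const]
    congr 1
    funext k
    ring
  have hTr : ∀ l s : K p q, pt s = pt 1 → T (l * s) = T l := by
    intro l s hs
    have : ∀ k, pt (k * (l * s)) = pt (k * l) := fun k => by
      rw [← mul_assoc, pt_mul, hs, ← pt_mul, mul_one]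
    simp only [hT, this]
  have hinvpt : ∀ s : K p q, pt s = pt 1 → pt s⁻¹ = pt 1 := by
    intro s hs
    rw [← mul_one s⁻¹, pt_mul, ← hs, ← pt_mul, inv_mul_cancel, hs]
  have hext : ∀ {v v' : HS p q a}, v ∈ VT p q a α → v' ∈ VT p q a α →
      (∀ k : K p q, pt k = pt 1 → ∀ l, v (pt (k * l)) = v (pt l)) →
      (∀ k : K p q, pt k = pt 1 → ∀ l, v' (pt (k * l)) = v' (pt l)) → v (pt 1) = v' (pt 1) →
      v = v' := by
    intro v v' hv hv' h h' he
    refine sub_eq_zero.1 (VT_eq_zero_of_zonal (sub_mem hv hv') (fun k hk w => ?_)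
      (by rw [HS.sub_apply, he, sub_self]))
    have : rhoS (kO k⁻¹) (v - v') = v - v' := HS.ext_pt fun l => by
      rw [rhoS_apply, ← map_inv, inv_inv, ← pt_mul, HS.sub_apply, HS.sub_apply, h k hk, h' k hk]
    have h2 := congrArg (fun f : HS p q a => f w) this
    simp only [rhoS_apply, ← map_inv, inv_inv] at h2
    exact h2
  have hZ0 : ((‖Zk a α (1 : K p q)‖ ^ 2 : ℝ) : ℂ) ≠ 0 := by
    exact_mod_cast pow_ne_zero 2 (norm_ne_zero_iff.2 hZ)
  have hT1 : T 1 = PT α g (pt 1) := by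
    rw [← inner_Zk, inner_def]
    simp only [hT, mul_one]
  have hGZ : G = ((starRingEnd ℂ) (PT α g (pt 1)) / (‖Zk a α (1 : K p q)‖ ^ 2 : ℝ)) • Zk a α 1 := by
    refine hext hGm (Submodule.smul_mem _ _ (Zk_mem α 1)) (fun k hk l => ?_) (fun k hk l => ?_) ?_
    · have e1 := hTG (l⁻¹ * k⁻¹)
      have e2 := hTG l⁻¹
      rw [hTr _ _ (hinvpt k hk), e2, mul_inv_rev, inv_inv, inv_inv] at e1
      exact e1.symm
    · rw [HS.smul_apply, HS.smul_apply]
      congr 1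
      have := Zk_apply_mul (a := a) α k⁻¹ l k
      rw [mul_inv_cancel] at this
      rw [this, Zk_congr α (hinvpt k hk)]
    · have e := hTG 1
      rw [inv_one, hT1] at e
      rw [← e, HS.smul_apply, Zk_apply_self]
      field_simp
  have h3 := congrArg (starRingEnd ℂ) (hTG l)
  rw [Complex.conj_conj, hGZ, HS.smul_apply] at h3
  have h4 : (starRingEnd ℂ) (Zk a α 1 (pt l⁻¹)) = Zk a α 1 (pt l) := by
    rw [Zk_apply_symm]
    have := Zk_apply_mul (a := a) α l⁻¹ 1 l
    rw [mul_inv_cancel, mul_one] at this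
    exact this.symm
  rw [map_mul, h4, map_div₀, Complex.conj_conj, Complex.conj_ofReal] at h3
  exact h3

/-! ### `K`-types of submodules -/

lemma IsSubmodule.Zk_mem_of_pt {W : Submodule ℂ (Fn p q)} (hW : IsSubmodule p q (a : ℂ) W)
    {f : HS p q a} (hf : f.fn ∈ W) {α : ℕ × ℕ} (h : PT α f (pt 1) ≠ 0) : (Zk a α 1).fn ∈ W := by
  have hZ : Zk a α (1 : K p q) ≠ 0 := by
    intro h0
    rw [← inner_Zk, h0, inner_zero_left] at h
    exact h rfl
  set c : ℂ := PT α f (pt 1) / (‖Zk a α (1 : K p q)‖ ^ 2 : ℝ) with hc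
  have hc0 : c ≠ 0 := div_ne_zero h (by exact_mod_cast pow_ne_zero 2 (norm_ne_zero_iff.2 hZ))
  suffices hcZ : (c • Zk a α 1).fn ∈ W by
    have := W.smul_mem c⁻¹ hcZ
    have e : c⁻¹ • (c • Zk a α (1 : K p q)).fn = (Zk a α 1).fn := by
      change (c⁻¹ • (c • Zk a α (1 : K p q))).fn = _
      rw [smul_smul, inv_mul_cancel₀ hc0, one_smul]
    rwa [e] at this
  refine hW.mem_of_approx _ fun j ε hε => ?_
  let res : HS p q a →ₗ[ℂ] C(K p q, ℂ) :=
    { toFun := fun g => ⟨fun k => g (pt k), g.continuous_pt⟩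
      map_add' := fun _ _ => rfl
      map_smul' := fun _ _ => rfl }
  let D : Submodule ℂ C(K p q, ℂ) := (W.comap (toFn p q a)).map (res ∘ₗ (Lam ^ j))
  have hcont : Continuous fun z : K p q × K p q => ((Lam ^ j) f) (pt (z.1 * z.2)) :=
    ((Lam ^ j) f).continuous_pt.comp continuous_mul
  let cur : C(K p q, C(K p q, ℂ)) := ContinuousMap.curry ⟨_, hcont⟩
  let Fk : K p q → C(K p q, ℂ) := fun k => (starRingEnd ℂ) (Zk a α 1 (pt k)) • cur k
  have hFc : Continuous Fk :=
    (Complex.continuous_conj.comp (Zk a α 1).continuous_pt).smul cur.continuous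
  have hFD : ∀ k, Fk k ∈ D := by
    intro k
    refine Submodule.smul_mem _ _ ⟨rhoS (kO k⁻¹) f, hW.rhoS_mem hf _, ?_⟩
    refine ContinuousMap.ext fun l => ?_
    change ((Lam ^ j) (rhoS (kO k⁻¹) f)) (pt l) = ((Lam ^ j) f) (pt (k * l))
    rw [pow_comm_of_comm (Lam_rhoS k⁻¹), rhoS_apply, ← map_inv, inv_inv, ← pt_mul]
  have hint : Integrable Fk (haarK p q) := integrable_of_continuous hFc
  have hmem : ∫ k, Fk k ∂haarK p q ∈ closure (D : Set C(K p q, ℂ)) := by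
    have hconv : Convex ℝ (closure (D : Set C(K p q, ℂ))) :=
      (D.restrictScalars ℝ).convex.closure
    exact hconv.integral_mem isClosed_closure
      (Filter.Eventually.of_forall fun k => subset_closure (hFD k)) hint
  have hval : ∫ k, Fk k ∂haarK p q = res ((Lam ^ j) (c • Zk a α 1)) := by
    refine ContinuousMap.ext fun l => ?_
    rw [ContinuousMap.integral_apply hint]
    change ∫ k, (starRingEnd ℂ) (Zk a α 1 (pt k)) * ((Lam ^ j) f) (pt (k * l)) ∂haarK p q =
      ((Lam ^ j) (c • Zk a α 1)) (pt l)
    have e : (Lam ^ j) (Zk a α (1 : K p q)) = ((mu p q α ^ j : ℝ) : ℂ) • Zk a α 1 := by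
      rw [← PT_of_mem (Zk_mem α 1)]
      have h1 : (Lam ^ j) (PT α (Zk a α (1 : K p q))) = PT α ((Lam ^ j) (PT α (Zk a α 1))) := by
        refine ext_PT fun β => ?_
        by_cases hβ : β = α
        · rw [hβ, PT_of_mem (PT_mem α ((Lam ^ j) _))]
        · rw [PT_Lam_pow, PT_of_mem_ne hβ (PT_mem α _), smul_zero, PT_of_mem_ne hβ (PT_mem α _)]
      rw [h1, PT_Lam_pow, PT_of_mem (PT_mem α _)]
    rw [integral_Zk_mul α hZ, PT_Lam_pow, HS.smul_apply, map_smul, e, HS.smul_apply, HS.smul_apply,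
      hc]
    ring
  rw [hval] at hmem
  obtain ⟨_, ⟨g, hg, rfl⟩, hgε⟩ := Metric.mem_closure_iff.1 hmem ε hε
  refine ⟨g, hg, norm_le_of_forall_pt hε.le fun k => ?_⟩
  have h1 := ContinuousMap.norm_coe_le_norm
    (res ((Lam ^ j) (c • Zk a α 1)) - (res ∘ₗ (Lam ^ j)) g) k
  rw [← dist_eq_norm] at h1
  have h2 : ((Lam ^ j) (c • Zk a α 1 - g)) (pt k) =
      (res ((Lam ^ j) (c • Zk a α 1)) - (res ∘ₗ (Lam ^ j)) g) k := by
    rw [map_sub]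
    rfl
  rw [h2]
  exact h1.trans hgε.le

/-- A submodule contains every `K`-type onto which one of its elements projects nontrivially. -/
lemma IsSubmodule.VT_mem {W : Submodule ℂ (Fn p q)} (hW : IsSubmodule p q (a : ℂ) W)
    {f : HS p q a} (hf : f.fn ∈ W) {α : ℕ × ℕ} (h : PT α f ≠ 0) {v : HS p q a}
    (hv : v ∈ VT p q a α) : v.fn ∈ W := by
  obtain ⟨k, hk⟩ : ∃ k : K p q, PT α f (pt k) ≠ 0 := by
    by_contra hc
    push Not at hc
    exact h (HS.ext_pt hc)
  have h1 : (Zk a α 1).fn ∈ W := by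
    refine hW.Zk_mem_of_pt (hW.rhoS_mem hf (kO k⁻¹)) ?_
    rw [PT_rhoS, rhoS_apply, ← map_inv, inv_inv, ← pt_mul, mul_one]
    exact hk
  have h2 : ∀ l : K p q, (Zk a α l).fn ∈ W := fun l => by
    have := hW.rhoS_mem h1 (kO l)
    rwa [rhoS_Zk, mul_one] at this
  let U : Submodule ℂ (HS p q a) := Submodule.span ℂ (Set.range (Zk a α))
  have hUV : U ≤ VT p q a α := Submodule.span_le.2 (by rintro _ ⟨l, rfl⟩; exact Zk_mem α l)
  have hUW : U ≤ W.comap (toFn p q a) := Submodule.span_le.2 (by rintro _ ⟨l, rfl⟩; exact h2 l)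
  have hfd : FiniteDimensional ℂ U := Submodule.finiteDimensional_of_le hUV
  have h3 : v - U.starProjection v = 0 := by
    refine HS.ext_pt fun l => ?_
    have hm := hUV (U.starProjection_apply_mem v)
    rw [HS.zero_apply, ← inner_Zk_of_mem l (sub_mem hv hm), ← inner_conj_symm,
      Submodule.starProjection_inner_eq_zero v _ (Submodule.subset_span (Set.mem_range_self l)), map_zero]
  rw [sub_eq_zero.1 h3]
  exact hUW (U.starProjection_apply_mem v)

lemma Lam_pow_sum_PT (j : ℕ) (F : Finset (ℕ × ℕ)) (f : HS p q a) :
    (Lam ^ j) (∑ α ∈ F, PT α f) = ∑ α ∈ F, PT α ((Lam ^ j) f) := by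
  rw [map_sum]
  refine Finset.sum_congr rfl fun α _ => ext_PT fun β => ?_
  by_cases hβ : β = α
  · rw [hβ, PT_Lam_pow, PT_of_mem (PT_mem α f), PT_of_mem (PT_mem α _), PT_Lam_pow]
  · rw [PT_Lam_pow, PT_of_mem_ne hβ (PT_mem α _), smul_zero, PT_of_mem_ne hβ (PT_mem α _)]

lemma IsSubmodule.mem_iff {W : Submodule ℂ (Fn p q)} (hW : IsSubmodule p q (a : ℂ) W)
    {f : HS p q a} : f.fn ∈ W ↔ ∀ α, PT α f ≠ 0 → ∀ v ∈ VT p q a α, v.fn ∈ W := by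
  refine ⟨fun hf α h v hv => hW.VT_mem hf h hv, fun h => hW.mem_of_approx f fun j ε hε => ?_⟩
  have h1 := hasSum_PT ((Lam ^ j) f)
  rw [HasSum, SummationFilter.unconditional_filter, Metric.tendsto_atTop] at h1
  obtain ⟨F, hF⟩ := h1 ε hε
  refine ⟨∑ α ∈ F, PT α f, ?_, ?_⟩
  · refine (W.comap (toFn p q a)).sum_mem fun α _ => ?_
    by_cases hα : PT α f = 0
    · rw [hα]
      exact zero_mem _
    · exact h α hα _ (PT_mem α f)
  · have h2 := (hF F (le_refl _)).le
    rwa [map_sub, Lam_pow_sum_PT, ← dist_eq_norm, dist_comm]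

end

section

variable {p q : ℕ} {a : ℝ} [NeZero p] [NeZero q]

/-! ### Generators of `O(p,q)` -/

lemma kO_of_fix {g : O p q} (hg : ∀ i : Fin p, g.1 (Pi.single i 1, 0) = (Pi.single i 1, 0)) :
    ∃ k : K p q, kO k = g := by
  have h1 : ∀ x : Fin p → ℝ, g.1 (x, 0) = (x, 0) := by
    intro x
    have hx : (x, (0 : Fin q → ℝ)) = ∑ i, x i • ((Pi.single i 1 : Fin p → ℝ), (0 : Fin q → ℝ)) := by
      refine Prod.ext ?_ ?_
      · rw [Prod.fst_sum]
        ext k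
        simp [Pi.single_apply]
      · rw [Prod.snd_sum]
        simp
    rw [hx, map_sum]
    simp only [map_smul, hg]
  have h2 : ∀ y : Fin q → ℝ, (g.1 (0, y)).1 = 0 := by
    intro y
    ext i
    have := g.2 (0, y) (Pi.single i 1, 0)
    rw [hg, form_eq, form_eq] at this
    simpa using this
  let B : (Fin q → ℝ) →ₗ[ℝ] (Fin q → ℝ) :=
    (LinearMap.snd ℝ _ _ ∘ₗ g.1.toLinearMap) ∘ₗ LinearMap.inr ℝ _ _
  have hB : ∀ y, B y = (g.1 (0, y)).2 := fun y => rfl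
  have hBB : ∀ y y', B y ⬝ᵥ B y' = y ⬝ᵥ y' := by
    intro y y'
    have := g.2 (0, y) (0, y')
    rw [form_eq, form_eq, h2, h2] at this
    rw [hB, hB]
    simpa using this
  have hM : B.toMatrix' ∈ Matrix.orthogonalGroup (Fin q) ℝ := by
    rw [Matrix.mem_unitaryGroup_iff']
    ext i j
    have := hBB (Pi.single i 1) (Pi.single j 1)
    rw [Matrix.mul_apply, Matrix.one_apply]
    simpa [LinearMap.toMatrix'_apply, dotProduct, Pi.single_apply, eq_comm] using this
  refine ⟨K.mk 1 ⟨_, hM⟩, Subtype.ext (LinearEquiv.ext fun w => ?_)⟩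
  have hw : w = (w.1, 0) + (0, w.2) := by simp
  rw [kO_apply]
  conv_rhs => rw [hw, map_add, h1]
  refine Prod.ext ?_ ?_
  · rw [Prod.fst_add, h2]
    simp [K.left_mk]
  · rw [Prod.snd_add, ← hB]
    simp only [K.right_mk, zero_add]
    rw [LinearMap.toMatrix'_mulVec]

lemma exists_mul_fix {H : Subgroup (O p q)} (hk : ∀ k, kO k ∈ H) (hb : ∀ i j t, (boost i j).g t ∈ H)
    (g : O p q) (n : ℕ) : ∃ h ∈ H, ∀ i : Fin p, (i : ℕ) < n →
      (h * g).1 (Pi.single i 1, 0) = (Pi.single i 1, 0) := by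
  induction n with
  | zero => exact ⟨1, H.one_mem, fun i hi => absurd hi (Nat.not_lt_zero _)⟩
  | succ n ih =>
    obtain ⟨h, hH, hfix⟩ := ih
    by_cases hn : n < p
    swap
    · exact ⟨h, hH, fun i _ => hfix i (by have := i.2; omega)⟩
    set m : Fin p := ⟨n, hn⟩ with hm
    set w := (h * g).1 (Pi.single m 1, 0) with hw
    have hw0 : ∀ i : Fin p, (i : ℕ) < n → w.1 i = 0 := by
      intro i hi
      have := (h * g).2 (Pi.single m 1, 0) (Pi.single i 1, 0)
      rw [hfix i hi, ← hw, form_eq, form_eq] at this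
      have hne : i ≠ m := fun h => by rw [h] at hi; exact lt_irrefl _ hi
      simpa [hne, hne.symm] using this
    have hw1 : w.1 ⬝ᵥ w.1 - w.2 ⬝ᵥ w.2 = 1 := by
      have := (h * g).2 (Pi.single m 1, 0) (Pi.single m 1, 0)
      rw [← hw, form_eq, form_eq] at this
      simpa using this
    have hyy : 0 ≤ w.2 ⬝ᵥ w.2 := Finset.sum_nonneg fun _ _ => mul_self_nonneg _
    set s := √(w.2 ⬝ᵥ w.2) with hs
    have hs2 : s * s = w.2 ⬝ᵥ w.2 := Real.mul_self_sqrt hyy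
    set t := Real.arsinh s with ht
    have hsinh : Real.sinh t = s := Real.sinh_arsinh s
    have hcosh : Real.cosh t * Real.cosh t = w.1 ⬝ᵥ w.1 := by
      have := Real.cosh_sq t
      rw [hsinh] at this
      nlinarith
    obtain ⟨A, hA, hAf⟩ := exists_orthogonal_mulVec w.1 (Pi.single m (Real.cosh t))
      (by simp [hcosh])
    obtain ⟨B, hB, -⟩ := exists_orthogonal_mulVec w.2 (Pi.single 0 s) (by simp [hs2])
    refine ⟨(boost m 0).g (-t) * (kO (K.mk A B) * h),
      H.mul_mem (hb _ _ _) (H.mul_mem (hk _) hH), fun i hi => ?_⟩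
    change (boostLin m 0 (-t)) ((kO (K.mk A B)).1 ((h * g).1 (Pi.single i 1, 0))) = _
    rcases Nat.lt_succ_iff_lt_or_eq.1 hi with hi | hi
    · have hne : i ≠ m := fun h => by rw [h] at hi; exact lt_irrefl _ hi
      rw [hfix i hi, kO_apply, K.left_mk, K.right_mk, hAf, boostLin_apply']
      · simp [hne.symm]
      · simp [hw0 i hi, hne]
    · have him : i = m := Fin.ext hi
      rw [him, ← hw, kO_apply, K.left_mk, K.right_mk, hA, hB, boostLin_apply']
      have hc := Real.cosh_sq t
      rw [← hsinh]
      simp only [Pi.single_eq_same, Real.sinh_neg, Real.cosh_neg, ← Pi.single_add]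
      refine Prod.ext ?_ ?_
      · simp only
        congr 1
        linear_combination hc
      · simp only [Pi.single_eq_zero_iff]
        ring

/-- `O(p,q)` is generated by `O(p) × O(q)` and boosts. -/
lemma O_induction {P : O p q → Prop} (hk : ∀ k, P (kO k)) (hb : ∀ i j t, P ((boost i j).g t))
    (hm : ∀ g h, P g → P h → P (g * h)) (g : O p q) : P g := by
  let H : Subgroup (O p q) :=
    { carrier := {g | P g ∧ P g⁻¹}
      one_mem' := by
        have h1 : P 1 := by simpa using hk 1
        exact ⟨h1, by simpa using h1⟩
      mul_mem' := fun {g h} hg hh => ⟨hm _ _ hg.1 hh.1, by rw [mul_inv_rev]; exact hm _ _ hh.2 hg.2⟩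
      inv_mem' := fun {g} hg => ⟨hg.2, by rw [inv_inv]; exact hg.1⟩ }
  have hkH : ∀ k, kO k ∈ H := fun k => ⟨hk k, by rw [← map_inv]; exact hk _⟩
  have hbH : ∀ i j t, (boost i j).g t ∈ H := fun i j t =>
    ⟨hb i j t, by rw [← Flow.neg]; exact hb i j _⟩
  obtain ⟨h, hH, hfix⟩ := exists_mul_fix hkH hbH g p
  obtain ⟨k, hk'⟩ := kO_of_fix fun i => hfix i i.2
  have : g = h⁻¹ * kO k := by rw [hk', inv_mul_cancel_left]
  have hg : g ∈ H := this ▸ H.mul_mem (H.inv_mem hH) (hkH k)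
  exact hg.1

end

section

variable {p q : ℕ} {a : ℝ} [NeZero p] [NeZero q]

/-! ### Transition-closed sets of `K`-types -/

lemma Nb_cases {P : ℕ × ℕ → ℕ × ℕ → Prop} (h1 : ∀ m n, P (m, n) (m + 1, n + 1))
    (h2 : ∀ m n, P (m, n + 1) (m + 1, n)) (h3 : ∀ m n, P (m + 1, n) (m, n + 1))
    (h4 : ∀ m n, P (m + 1, n + 1) (m, n)) {α β : ℕ × ℕ} (h : Nb α β) : P α β := by
  obtain ⟨m, n⟩ := α
  obtain ⟨m', n'⟩ := β
  obtain ⟨hm | hm, hn | hn⟩ := h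
  · simp only at hm hn
    subst hm hn
    exact h1 m n
  · simp only at hm hn
    subst hm hn
    exact h2 m n'
  · simp only at hm hn
    subst hm hn
    exact h3 m' n
  · simp only at hm hn
    subst hm hn
    exact h4 m' n'

lemma AA_pp {p q : ℕ} {a : ℝ} (m n : ℕ) : AA p q a (m, n) (m + 1, n + 1) = App p q a m n := by
  simp only [AA, lamT, lam, shift, App]
  push_cast
  ring

lemma AA_pm {p q : ℕ} {a : ℝ} (m n : ℕ) : AA p q a (m, n + 1) (m + 1, n) = Apm p q a m (n + 1) := by
  simp only [AA, lamT, lam, shift, Apm]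
  push_cast
  ring

lemma AA_mp {p q : ℕ} {a : ℝ} (m n : ℕ) : AA p q a (m + 1, n) (m, n + 1) = Amp p q a (m + 1) n := by
  simp only [AA, lamT, lam, shift, Amp]
  push_cast
  ring

lemma AA_mm {p q : ℕ} {a : ℝ} (m n : ℕ) : AA p q a (m + 1, n + 1) (m, n) = Amm p q a (m + 1) (n + 1) := by
  simp only [AA, lamT, lam, shift, Amm]
  push_cast
  ring

lemma exists_abs_AA_le (p q : ℕ) (a : ℝ) : ∃ c : ℕ, ∀ α β : ℕ × ℕ, Nb α β →
    |AA p q a α β| ≤ 2 * ((max β.1 β.2 + c : ℕ) : ℝ) := by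
  obtain ⟨c, hc⟩ := exists_nat_ge (|a| + p + q + 4)
  refine ⟨c, fun α β h => ?_⟩
  have ha := neg_abs_le a
  have ha' := le_abs_self a
  have hp : (0 : ℝ) ≤ p := p.cast_nonneg
  have hq : (0 : ℝ) ≤ q := q.cast_nonneg
  refine Nb_cases (P := fun α β => |AA p q a α β| ≤ 2 * ((max β.1 β.2 + c : ℕ) : ℝ))
    ?_ ?_ ?_ ?_ h <;> intro m n <;> push_cast <;>
    [rw [AA_pp, App]; rw [AA_pm, Apm]; rw [AA_mp, Amp]; rw [AA_mm, Amm]] <;> push_cast <;>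
    rw [abs_le]
  · have h1 := le_max_left ((m : ℝ) + 1) ((n : ℝ) + 1)
    have h2 := le_max_right ((m : ℝ) + 1) ((n : ℝ) + 1)
    have hm : (0 : ℝ) ≤ m := m.cast_nonneg
    have hn : (0 : ℝ) ≤ n := n.cast_nonneg
    constructor <;> linarith
  · have h1 := le_max_left ((m : ℝ) + 1) (n : ℝ)
    have h2 := le_max_right ((m : ℝ) + 1) (n : ℝ)
    have hm : (0 : ℝ) ≤ m := m.cast_nonneg
    have hn : (0 : ℝ) ≤ n := n.cast_nonneg
    constructor <;> linarith
  · have h1 := le_max_left (m : ℝ) ((n : ℝ) + 1)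
    have h2 := le_max_right (m : ℝ) ((n : ℝ) + 1)
    have hm : (0 : ℝ) ≤ m := m.cast_nonneg
    have hn : (0 : ℝ) ≤ n := n.cast_nonneg
    constructor <;> linarith
  · have h1 := le_max_left (m : ℝ) (n : ℝ)
    have h2 := le_max_right (m : ℝ) (n : ℝ)
    have hm : (0 : ℝ) ≤ m := m.cast_nonneg
    have hn : (0 : ℝ) ≤ n := n.cast_nonneg
    constructor <;> linarith

lemma Nb.max_le {α β : ℕ × ℕ} (h : Nb α β) : max β.1 β.2 ≤ max α.1 α.2 + 1 := by
  have h1 := h.1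
  have h2 := h.2
  omega

lemma norm_Mx_le (i : Fin p) (f : HS p q a) : ‖Mx i f‖ ≤ ‖f‖ := by
  refine le_of_sq_le_sq ?_ (norm_nonneg _)
  rw [norm_sq_eq_integral, norm_sq_eq_integral]
  refine integral_mono (integrable_of_continuous ((Mx i f).continuous_pt.norm.pow 2))
    (integrable_of_continuous (f.continuous_pt.norm.pow 2)) fun k => ?_
  have h1 : ‖mx q i (pt k)‖ ≤ 1 := by
    have h := mem_spheres.1 (pt_mem_spheres k)
    rw [mx, h.1, Real.sqrt_one, div_one, Complex.norm_real, Real.norm_eq_abs, ← sq_le_one_iff_abs_le_one, ← h.1, nx]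
    exact Finset.single_le_sum (f := fun j => (pt k).1.1 j ^ 2) (fun _ _ => sq_nonneg _)
      (Finset.mem_univ i)
  change ‖mx q i (pt k) * f (pt k)‖ ^ 2 ≤ ‖f (pt k)‖ ^ 2
  rw [norm_mul, mul_pow]
  exact mul_le_of_le_one_left (by positivity) (pow_le_one₀ (norm_nonneg _) h1)

lemma norm_My_le (i : Fin q) (f : HS p q a) : ‖My i f‖ ≤ ‖f‖ := by
  refine le_of_sq_le_sq ?_ (norm_nonneg _)
  rw [norm_sq_eq_integral, norm_sq_eq_integral]
  refine integral_mono (integrable_of_continuous ((My i f).continuous_pt.norm.pow 2))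
    (integrable_of_continuous (f.continuous_pt.norm.pow 2)) fun k => ?_
  have h1 : ‖my p i (pt k)‖ ≤ 1 := by
    have h := mem_spheres.1 (pt_mem_spheres k)
    rw [my, h.1, Real.sqrt_one, div_one, Complex.norm_real, Real.norm_eq_abs, ← sq_le_one_iff_abs_le_one, ← h.2, ny]
    exact Finset.single_le_sum (f := fun j => (pt k).1.2 j ^ 2) (fun _ _ => sq_nonneg _)
      (Finset.mem_univ i)
  change ‖my p i (pt k) * f (pt k)‖ ^ 2 ≤ ‖f (pt k)‖ ^ 2
  rw [norm_mul, mul_pow]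
  exact mul_le_of_le_one_left (by positivity) (pow_le_one₀ (norm_nonneg _) h1)

lemma norm_MM_le (i : Fin p) (j : Fin q) (f : HS p q a) : ‖MM i j f‖ ≤ ‖f‖ := by
  rw [MM_apply]
  exact (norm_Mx_le i _).trans (norm_My_le j f)

/-- A set of `K`-types that no transition leaves. -/
def TransClosed (p q : ℕ) (a : ℝ) (Ω : Set (ℕ × ℕ)) : Prop :=
  ∀ α β, α ∈ Ω → Nb α β → AA p q a α β ≠ 0 → VT p q a β ≠ ⊥ → β ∈ Ω

lemma TransClosed.inner_flowS_bound {Ω : Set (ℕ × ℕ)} (hΩ : TransClosed p q a Ω) {f : HS p q a}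
    (hf : ∀ α ∉ Ω, PT α f = 0) (i : Fin p) (j : Fin q) {c : ℕ}
    (hc : ∀ α β : ℕ × ℕ, Nb α β → |AA p q a α β| ≤ 2 * ((max β.1 β.2 + c : ℕ) : ℝ))
    {M : ℝ} (hM0 : 0 ≤ M) {σ : ℝ} (hσ : |σ| = 1)
    (hM : ∀ t ∈ Set.Icc (0 : ℝ) 1, ‖flowS (boost i j) (σ * t) f‖ ≤ M) (k : ℕ) :
    ∀ α ∉ Ω, ∀ v ∈ VT p q a α, ∀ t ∈ Set.Icc (0 : ℝ) 1,
      ‖inner ℂ v (flowS (boost i j) (σ * t) f)‖ ≤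
        M * ‖v‖ * ((8 * t) ^ k * ((max α.1 α.2 + c + k).choose k : ℕ)) := by
  induction k with
  | zero =>
    intro α _ v _ t ht
    rw [pow_zero, Nat.choose_zero_right, Nat.cast_one, mul_one, mul_one, mul_comm M]
    exact (norm_inner_le_norm _ _).trans (mul_le_mul_of_nonneg_left (hM t ht) (norm_nonneg _))
  | succ k ih =>
    intro α hα v hv t ht
    set r := max α.1 α.2 + c with hr
    have hd : ∀ x, HasDerivAt (fun t => inner ℂ v (flowS (boost i j) (σ * t) f))
        (σ • inner ℂ v (flowS (boost i j) (σ * x) (Db i j f))) x := fun x =>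
      (hasDerivAt_inner_flowS (boost i j) v f (σ * x)).scomp x
        ((hasDerivAt_id x).const_mul σ |>.congr_deriv (mul_one σ))
    have hbd : ∀ x ∈ Set.Icc (0 : ℝ) 1, ‖σ • inner ℂ v (flowS (boost i j) (σ * x) (Db i j f))‖ ≤
        4 * (2 * (r : ℝ) * (M * ‖v‖ * ((8 * x) ^ k * ((r + 1 + k).choose k : ℕ)))) := by
      intro x hx
      rw [norm_smul, Real.norm_eq_abs, hσ, one_mul, Db, ← lie_flowS, ← Db, inner_Db i j hv]
      refine (norm_sum_le_of_le (n := fun _ =>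
        2 * (r : ℝ) * (M * ‖v‖ * ((8 * x) ^ k * ((r + 1 + k).choose k : ℕ)))) _
        (fun γ hγ => ?_)).trans ?_
      · have hx0 := hx.1
        by_cases hn : Nb α γ
        swap
        · rw [PT_MM_eq_zero hn i j hv, inner_zero_left, mul_zero, norm_zero]
          positivity
        rw [norm_mul, Complex.norm_real, Real.norm_eq_abs]
        by_cases hγΩ : γ ∈ Ω
        · have : AA p q a γ α = 0 ∨ VT p q a α = ⊥ := by
            by_contra hne
            push Not at hne
            exact hα (hΩ γ α hγΩ hn.symm hne.1 hne.2)
          rcases this with h0 | h0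
          · rw [h0, abs_zero, zero_mul]
            positivity
          · rw [h0, Submodule.mem_bot] at hv
            rw [hv, map_zero, map_zero, inner_zero_left, norm_zero, mul_zero]
            positivity
        · refine mul_le_mul (hc γ α hn.symm) ?_ (norm_nonneg _) (by positivity)
          refine (ih γ hγΩ _ (PT_mem γ _) x hx).trans ?_
          have e1 : ‖PT γ (MM i j v)‖ ≤ ‖v‖ := (norm_PT_le _ _).trans (norm_MM_le i j v)
          have e2 : (max γ.1 γ.2 + c + k).choose k ≤ (r + 1 + k).choose k :=
            Nat.choose_le_choose _ (by have := hn.max_le; omega)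
          gcongr
      · rw [Finset.sum_const, nsmul_eq_mul]
        have hx0 := hx.1
        refine mul_le_mul_of_nonneg_right ?_ (by positivity)
        exact_mod_cast card_nbF α
    refine image_norm_le_of_norm_deriv_right_le_deriv_boundary (a := 0) (b := 1)
      (f' := fun x => σ • inner ℂ v (flowS (boost i j) (σ * x) (Db i j f)))
      (B := fun t => M * ‖v‖ * ((8 * t) ^ (k + 1) * ((r + (k + 1)).choose (k + 1) : ℕ)))
      (B' := fun t => M * ‖v‖ * ((((k + 1 : ℕ) : ℝ) * (8 * t) ^ k * 8) *
        ((r + (k + 1)).choose (k + 1) : ℕ)))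
      (fun x _ => (hd x).continuousAt.continuousWithinAt) (fun x _ => (hd x).hasDerivWithinAt) ?_ ?_
      (fun x hx => ?_) ht
    · simp only [mul_zero, flowS_zero]
      rw [← PT_of_mem hv, inner_PT, hf α hα, inner_zero_right, norm_zero]
      positivity
    · intro x
      have h1 := ((hasDerivAt_id x).const_mul 8).pow (k + 1)
      refine ((h1.mul_const _).const_mul (M * ‖v‖)).congr_deriv ?_
      simp
    · refine (hbd x ⟨hx.1, hx.2.le⟩).trans ?_
      have hch : (r + 1 + k).choose k * (r + 1) = (r + (k + 1)).choose (k + 1) * (k + 1) := by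
        have := Nat.choose_succ_right_eq (r + 1 + k) k
        rw [show r + 1 + k - k = r + 1 by omega] at this
        rw [← this]
        congr 2
        ring
      have hch' : (((r + 1 + k).choose k : ℕ) : ℝ) * (r : ℝ) ≤
          ((r + (k + 1)).choose (k + 1) : ℕ) * ((k + 1 : ℕ) : ℝ) := by
        have : (r + 1 + k).choose k * r ≤ (r + (k + 1)).choose (k + 1) * (k + 1) := by
          rw [← hch]
          exact Nat.mul_le_mul_left _ (Nat.le_succ r)
        exact_mod_cast this
      have hx0 := hx.1
      calc 4 * (2 * (r : ℝ) * (M * ‖v‖ * ((8 * x) ^ k * ((r + 1 + k).choose k : ℕ))))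
          = 8 * (M * ‖v‖) * (8 * x) ^ k * (((r + 1 + k).choose k : ℕ) * (r : ℝ)) := by ring
        _ ≤ 8 * (M * ‖v‖) * (8 * x) ^ k *
            (((r + (k + 1)).choose (k + 1) : ℕ) * ((k + 1 : ℕ) : ℝ)) :=
          mul_le_mul_of_nonneg_left hch' (by positivity)
        _ = _ := by ring

lemma TransClosed.PT_flowS_small {Ω : Set (ℕ × ℕ)} (hΩ : TransClosed p q a Ω) {f : HS p q a}
    (hf : ∀ α ∉ Ω, PT α f = 0) (i : Fin p) (j : Fin q) {t : ℝ} (ht : |t| ≤ 1 / 32) {α : ℕ × ℕ}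
    (hα : α ∉ Ω) : PT α (flowS (boost i j) t f) = 0 := by
  obtain ⟨c, hc⟩ := exists_abs_AA_le p q a
  obtain ⟨M, hM0, hM⟩ := exists_Lam_flowS_bound (boost i j) f 0 1
  obtain ⟨σ, hσ, hσt⟩ : ∃ σ : ℝ, |σ| = 1 ∧ t = σ * |t| := by
    rcases le_total 0 t with h | h
    · exact ⟨1, abs_one, by rw [abs_of_nonneg h, one_mul]⟩
    · exact ⟨-1, by simp, by rw [abs_of_nonpos h]; ring⟩
  have hb := hΩ.inner_flowS_bound hf i j hc hM0 hσ (fun s hs => by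
    have := hM (σ * s) (abs_le.1 (by rw [abs_mul, hσ, one_mul, abs_of_nonneg hs.1]; exact hs.2))
    simpa using this)
  set v := PT α (flowS (boost i j) t f) with hv
  have h1 : ∀ k : ℕ, ‖inner ℂ v (flowS (boost i j) t f)‖ ≤
      M * ‖v‖ * 2 ^ (max α.1 α.2 + c) * (1 / 2) ^ k := by
    intro k
    have h2 := hb k α hα v (PT_mem _ _) |t| ⟨abs_nonneg t, ht.trans (by norm_num)⟩
    rw [← hσt] at h2
    refine h2.trans ?_
    have h3 : (8 * |t|) ^ k ≤ (1 / 4) ^ k := pow_le_pow_left₀ (by positivity) (by linarith) k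
    have h4 : (((max α.1 α.2 + c + k).choose k : ℕ) : ℝ) ≤ 2 ^ (max α.1 α.2 + c + k) := by
      exact_mod_cast Nat.choose_le_two_pow _ _
    calc M * ‖v‖ * ((8 * |t|) ^ k * ((max α.1 α.2 + c + k).choose k : ℕ))
        ≤ M * ‖v‖ * ((1 / 4) ^ k * 2 ^ (max α.1 α.2 + c + k)) := by gcongr
      _ = M * ‖v‖ * 2 ^ (max α.1 α.2 + c) * ((1 / 4) ^ k * 2 ^ k) := by rw [pow_add]; ring
      _ = _ := by rw [← mul_pow]; norm_num
  have h5 : ‖inner ℂ v (flowS (boost i j) t f)‖ ≤ 0 := by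
    refine ge_of_tendsto' (x := Filter.atTop) ?_ h1
    have := (tendsto_pow_atTop_nhds_zero_of_lt_one (r := (1 / 2 : ℝ)) (by norm_num)
      (by norm_num)).const_mul (M * ‖v‖ * 2 ^ (max α.1 α.2 + c))
    rwa [mul_zero] at this
  have h6 : inner ℂ v v = 0 := by
    rw [hv, inner_PT_right (PT_mem _ _), ← hv]
    exact norm_le_zero_iff.1 h5
  exact inner_self_eq_zero.1 h6

/-- The subspace of functions with components only in the `K`-types of a given set. -/
def NS (p q : ℕ) [NeZero p] [NeZero q] (a : ℝ) (Ω : Set (ℕ × ℕ)) : Submodule ℂ (HS p q a) where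
  carrier := {f | ∀ α ∉ Ω, PT α f = 0}
  zero_mem' := fun α _ => map_zero _
  add_mem' := fun {f g} hf hg α hα => by rw [map_add, hf α hα, hg α hα, add_zero]
  smul_mem' := fun c f hf α hα => by rw [map_smul, hf α hα, smul_zero]

lemma TransClosed.flowS_mem {Ω : Set (ℕ × ℕ)} (hΩ : TransClosed p q a Ω) {f : HS p q a}
    (hf : f ∈ NS p q a Ω) (i : Fin p) (j : Fin q) (t : ℝ) :
    flowS (boost i j) t f ∈ NS p q a Ω := by
  obtain ⟨n, hn⟩ := exists_nat_ge (32 * |t|)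
  have h1 : |t / (n + 1)| ≤ 1 / 32 := by
    rw [abs_div, abs_of_nonneg (by positivity : (0 : ℝ) ≤ n + 1), div_le_iff₀ (by positivity)]
    linarith
  have h2 : ∀ m : ℕ, flowS (boost i j) (m * (t / (n + 1))) f ∈ NS p q a Ω := by
    intro m
    induction m with
    | zero => simpa [flowS_zero] using hf
    | succ m ih =>
      rw [Nat.cast_succ, add_mul, one_mul, add_comm, flowS_add]
      exact fun α hα => hΩ.PT_flowS_small ih i j h1 hα
  have h3 := h2 (n + 1)
  rwa [Nat.cast_succ, mul_div_cancel₀ _ (by positivity)] at h3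

lemma TransClosed.rhoS_mem {Ω : Set (ℕ × ℕ)} (hΩ : TransClosed p q a Ω) (g : O p q) :
    ∀ {f : HS p q a}, f ∈ NS p q a Ω → rhoS g f ∈ NS p q a Ω := by
  refine O_induction (P := fun g => ∀ {f : HS p q a}, f ∈ NS p q a Ω → rhoS g f ∈ NS p q a Ω)
    (fun k f hf α hα => ?_) (fun i j t f hf => ?_) (fun g h hg hh f hf => ?_) g
  · rw [PT_rhoS, hf α hα, map_zero]
  · have := hΩ.flowS_mem hf i j (-t)
    rwa [flowS, neg_neg] at this
  · rw [rhoS_mul]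
    exact hg (hh hf)

lemma TransClosed.isSubmodule {Ω : Set (ℕ × ℕ)} (hΩ : TransClosed p q a Ω) :
    IsSubmodule p q (a : ℂ) ((NS p q a Ω).map (toFn p q a)) where
  le := by
    rintro _ ⟨f, -, rfl⟩
    exact f.mem
  invariant := by
    rintro g _ ⟨f, hf, rfl⟩
    exact ⟨rhoS g f, hΩ.rhoS_mem g hf, rfl⟩
  closed := by
    intro f hf h
    refine ⟨HS.mk f hf, fun α hα => ?_, rfl⟩
    by_contra hne
    obtain ⟨_, ⟨g, hg, rfl⟩, hgf⟩ := h 0 (‖PT α (HS.mk f hf)‖ / 2)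
      (half_pos (norm_pos_iff.2 hne))
    have h1 : ‖HS.mk f hf - g‖ ≤ ‖PT α (HS.mk f hf)‖ / 2 := NormLE.norm_le (f := HS.mk f hf - g) hgf
    have h2 : PT α (HS.mk f hf) = PT α (HS.mk f hf - g) := by rw [map_sub, hg α hα, sub_zero]
    have h3 := norm_PT_le α (HS.mk f hf - g)
    rw [← h2] at h3
    have h4 := norm_pos_iff.2 hne
    linarith

lemma VT_le_NS {Ω : Set (ℕ × ℕ)} {α : ℕ × ℕ} (hα : α ∈ Ω) : VT p q a α ≤ NS p q a Ω := by
  intro v hv β hβ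
  exact PT_of_mem_ne (fun h => hβ (by rwa [h])) hv

lemma VT_le_NS_iff {Ω : Set (ℕ × ℕ)} {α : ℕ × ℕ} (h0 : VT p q a α ≠ ⊥) :
    VT p q a α ≤ NS p q a Ω ↔ α ∈ Ω := by
  refine ⟨fun h => ?_, VT_le_NS⟩
  by_contra hα
  refine h0 (Submodule.eq_bot_iff _ |>.2 fun v hv => ?_)
  rw [← PT_of_mem hv]
  exact h hv α hα

end

section

variable {p q : ℕ} {a : ℝ} [NeZero p] [NeZero q]

/-! ### Transitions between neighbouring `K`-types do occur -/

/-- There are nonzero harmonic polynomials of degree `m` in `n` variables. -/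
def HarmonicNonzero (n m : ℕ) : Prop := ∃ h : Pol n, IsHarmonic m h ∧ h ≠ 0

lemma VT_ne_bot_iff {m n : ℕ} :
    VT p q a (m, n) ≠ ⊥ ↔ HarmonicNonzero p m ∧ HarmonicNonzero q n := by
  constructor
  · intro h
    by_contra hc
    refine h ((Submodule.eq_bot_iff _).2 fun v hv => ?_)
    refine VT_induction hv (fun h₁ h₂ H₁ H₂ => ?_) fun u v hu hv => by rw [hu, hv, add_zero]
    have h0 : h₁ = 0 ∨ h₂ = 0 := by
      by_contra hne
      push Not at hne
      exact hc ⟨⟨h₁, H₁, hne.1⟩, ⟨h₂, H₂, hne.2⟩⟩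
    refine HS.ext_pt fun k => ?_
    rw [jS_pt, HS.zero_apply]
    rcases h0 with rfl | rfl <;> simp [pe]
  · rintro ⟨⟨h₁, H₁, h10⟩, ⟨h₂, H₂, h20⟩⟩ h
    have := jS_mem (a := a) H₁ H₂
    rw [h, Submodule.mem_bot] at this
    rcases jS_eq_zero H₁ H₂ this with h | h
    · exact h10 h
    · exact h20 h

lemma kap_succ_ne_zero (n m : ℕ) [NeZero n] : kap n (m + 1) ≠ 0 := by
  have hn : 1 ≤ n := NeZero.one_le
  rw [kap, one_div, Ne, inv_eq_zero]
  intro h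
  have : ((n + 2 * m : ℕ) : ℂ) = 0 := by
    push_cast at h ⊢
    linear_combination h
  rw [Nat.cast_eq_zero] at this
  omega

lemma HarmonicNonzero.down {n m : ℕ} (h : HarmonicNonzero n (m + 1)) :
    ∃ g : Pol n, IsHarmonic (m + 1) g ∧ ∃ i, pderiv i g ≠ 0 := by
  obtain ⟨g, hg, hg0⟩ := h
  refine ⟨g, hg, ?_⟩
  by_contra hc
  push Not at hc
  have h1 := hg.1.sum_X_mul_pderiv
  simp only [hc, mul_zero, Finset.sum_const_zero] at h1
  rw [nsmul_eq_mul] at h1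
  rcases mul_eq_zero.1 h1.symm with h2 | h2
  · exact absurd h2 (by exact_mod_cast Nat.succ_ne_zero m)
  · exact hg0 h2

lemma HarmonicNonzero.up {n m : ℕ} (h : HarmonicNonzero n (m + 1)) :
    ∃ g : Pol n, IsHarmonic m g ∧ ∃ i, LightCone.up m i g ≠ 0 := by
  obtain ⟨g, hg, hg0⟩ := h
  by_contra hc
  push Not at hc
  have h1 : ∀ i, LightCone.up m i (pderiv i g) = 0 := fun i => by
    have := hg.pderiv i
    rw [Nat.add_sub_cancel] at this
    exact hc _ this i
  have h2 : ∑ i, LightCone.up m i (pderiv i g) = ((m + 1 : ℕ) : Pol n) * g := by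
    simp only [LightCone.up, Finset.sum_sub_distrib, ← Finset.mul_sum]
    rw [hg.1.sum_X_mul_pderiv, hg.2, mul_zero, mul_zero, sub_zero, nsmul_eq_mul]
  simp only [h1, Finset.sum_const_zero] at h2
  rcases mul_eq_zero.1 h2.symm with h3 | h3
  · exact absurd h3 (by exact_mod_cast Nat.succ_ne_zero m)
  · exact hg0 h3

lemma PT_ne_zero_mm {m n : ℕ} (h₁ : HarmonicNonzero p (m + 1)) (h₂ : HarmonicNonzero q (n + 1)) :
    ∃ i j, ∃ u ∈ VT p q a (m + 1, n + 1), PT (m, n) (MM i j u) ≠ 0 := by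
  obtain ⟨g₁, G₁, i, hi⟩ := h₁.down
  obtain ⟨g₂, G₂, j, hj⟩ := h₂.down
  refine ⟨i, j, jS a G₁ G₂, jS_mem _ _, ?_⟩
  rw [MM_jS, map_add, map_add, map_add, PT_of_mem_ne (by intro h; have := Prod.mk.inj h; omega) (jS_mem (G₁.up i) (G₂.up j)),
    PT_of_mem_ne (by intro h; have := Prod.mk.inj h; omega) (jS_mem ((G₁.pderiv i).C_mul (kap p (m + 1))) (G₂.up j)),
    PT_of_mem_ne (by intro h; have := Prod.mk.inj h; omega) (jS_mem (G₁.up i) ((G₂.pderiv j).C_mul (kap q (n + 1)))),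
    zero_add, zero_add, zero_add, PT_of_mem (jS_mem _ _), jS_C_mul (G₁.pderiv i),
    jS_C_mul' (G₁.pderiv i) (G₂.pderiv j)]
  · intro h
    rw [smul_smul, smul_eq_zero] at h
    rcases h with h | h
    · exact mul_ne_zero (kap_succ_ne_zero p m) (kap_succ_ne_zero q n) h
    · rcases jS_eq_zero (G₁.pderiv i) (G₂.pderiv j) h with h | h
      · exact hi h
      · exact hj h

lemma PT_ne_zero_pm {m n : ℕ} (h₁ : HarmonicNonzero p (m + 1)) (h₂ : HarmonicNonzero q (n + 1)) :
    ∃ i j, ∃ u ∈ VT p q a (m, n + 1), PT (m + 1, n) (MM i j u) ≠ 0 := by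
  obtain ⟨g₁, G₁, i, hi⟩ := h₁.up
  obtain ⟨g₂, G₂, j, hj⟩ := h₂.down
  refine ⟨i, j, jS a G₁ G₂, jS_mem _ _, ?_⟩
  rw [MM_jS, map_add, map_add, map_add, PT_of_mem_ne (by intro h; have := Prod.mk.inj h; omega) (jS_mem (G₁.up i) (G₂.up j)),
    PT_of_mem_ne (by intro h; have := Prod.mk.inj h; omega) (jS_mem ((G₁.pderiv i).C_mul (kap p m)) (G₂.up j)),
    PT_of_mem_ne (by intro h; have := Prod.mk.inj h; omega)
      (jS_mem ((G₁.pderiv i).C_mul (kap p m)) ((G₂.pderiv j).C_mul (kap q (n + 1)))),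
    zero_add, zero_add, add_zero, PT_of_mem (α := (m + 1, n)) (jS_mem (G₁.up i) ((G₂.pderiv j).C_mul _)),
    jS_C_mul' (G₁.up i) (G₂.pderiv j)]
  · intro h
    rw [smul_eq_zero] at h
    rcases h with h | h
    · exact kap_succ_ne_zero q n h
    · rcases jS_eq_zero (G₁.up i) (G₂.pderiv j) h with h | h
      · exact hi h
      · exact hj h

lemma exists_PT_MM_ne_zero_symm {α β : ℕ × ℕ}
    (h : ∃ i j, ∃ u ∈ VT p q a α, PT β (MM i j u) ≠ 0) :
    ∃ i j, ∃ u ∈ VT p q a β, PT α (MM i j u) ≠ 0 := by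
  obtain ⟨i, j, u, hu, h0⟩ := h
  refine ⟨i, j, PT β (MM i j u), PT_mem _ _, fun hc => h0 ?_⟩
  have : inner ℂ (PT β (MM i j u)) (PT β (MM i j u)) = 0 := by
    rw [inner_PT_right (PT_mem _ _), ← inner_MM, ← PT_of_mem hu, ← inner_PT, PT_of_mem hu, hc,
      inner_zero_left]
  exact inner_self_eq_zero.1 this

lemma exists_PT_MM_ne_zero {α β : ℕ × ℕ} (h : Nb α β) (hα : VT p q a α ≠ ⊥)
    (hβ : VT p q a β ≠ ⊥) : ∃ i j, ∃ u ∈ VT p q a α, PT β (MM i j u) ≠ 0 := by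
  refine Nb_cases (P := fun α β => VT p q a α ≠ ⊥ → VT p q a β ≠ ⊥ →
    ∃ i j, ∃ u ∈ VT p q a α, PT β (MM i j u) ≠ 0) ?_ ?_ ?_ ?_ h hα hβ <;> intro m n h1 h2 <;>
    rw [VT_ne_bot_iff] at h1 h2
  · exact exists_PT_MM_ne_zero_symm (PT_ne_zero_mm h2.1 h2.2)
  · exact PT_ne_zero_pm h2.1 h1.2
  · exact exists_PT_MM_ne_zero_symm (PT_ne_zero_pm h1.1 h2.2)
  · exact PT_ne_zero_mm h1.1 h1.2

/-! ### The `K`-types of a submodule -/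

/-- The elements of `S^a(X⁰)` lying in a space of functions. -/
abbrev pull {p q : ℕ} (a : ℝ) (W : Submodule ℂ (Fn p q)) : Submodule ℂ (HS p q a) := W.comap (toFn p q a)

lemma KType_le_iff {α : ℕ × ℕ} {W : Submodule ℂ (Fn p q)} :
    KType p q (a : ℂ) α.1 α.2 ≤ W ↔ VT p q a α ≤ pull a W := by
  rw [← map_VT, Submodule.map_le_iff_le_comap]

lemma mem_kTypes {α : ℕ × ℕ} {W₁ W₂ : Submodule ℂ (Fn p q)} :
    α ∈ kTypes (a : ℂ) W₁ W₂ ↔ VT p q a α ≤ pull a W₁ ∧ ¬ VT p q a α ≤ pull a W₂ := by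
  rw [kTypes, Set.mem_ofPred_eq, KType_le_iff, KType_le_iff]

/-- The nonzero `K`-types contained in a submodule. -/
def types (a : ℝ) (W : Submodule ℂ (Fn p q)) : Set (ℕ × ℕ) :=
  {α | VT p q a α ≠ ⊥ ∧ VT p q a α ≤ pull a W}

lemma IsSubmodule.VT_le {W : Submodule ℂ (Fn p q)} (hW : IsSubmodule p q (a : ℂ) W)
    {f : HS p q a} (hf : f ∈ pull a W) {α : ℕ × ℕ} (h : PT α f ≠ 0) : VT p q a α ≤ pull a W :=
  fun _ hv => hW.VT_mem hf h hv

lemma IsSubmodule.PT_mem_pull {W : Submodule ℂ (Fn p q)} (hW : IsSubmodule p q (a : ℂ) W)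
    {f : HS p q a} (hf : f ∈ pull a W) (α : ℕ × ℕ) : PT α f ∈ pull a W := by
  by_cases h : PT α f = 0
  · rw [h]
    exact zero_mem _
  · exact hW.VT_le hf h (PT_mem α f)

lemma IsSubmodule.transClosed {W : Submodule ℂ (Fn p q)} (hW : IsSubmodule p q (a : ℂ) W) :
    TransClosed p q a (types a W) := by
  intro α β hα hn hA hβ
  obtain ⟨i, j, u, hu, h0⟩ := exists_PT_MM_ne_zero hn hα.1 hβ
  refine ⟨hβ, hW.VT_le (hW.lie_mem (hα.2 hu) (boost i j)) (α := β) ?_⟩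
  change PT β (Db i j u) ≠ 0
  rw [PT_Db i j hu, smul_ne_zero_iff]
  exact ⟨by exact_mod_cast hA, h0⟩

lemma IsSubmodule.pull_eq {W : Submodule ℂ (Fn p q)} (hW : IsSubmodule p q (a : ℂ) W) :
    pull a W = NS p q a (types a W) := by
  ext f
  refine (hW.mem_iff (f := f)).trans ⟨fun h α hα => ?_, fun h α h0 v hv => ?_⟩
  · by_contra h0
    refine hα ⟨fun hb => h0 ?_, h α h0⟩
    have := PT_mem α f
    rwa [hb, Submodule.mem_bot] at this
  · by_contra hc
    exact h0 (h α fun hα => hc (hα.2 hv))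

lemma IsSubmodule.map_pull {W : Submodule ℂ (Fn p q)} (hW : IsSubmodule p q (a : ℂ) W) :
    (pull a W).map (toFn p q a) = W := by
  rw [Submodule.map_comap_eq, inf_eq_right]
  intro f hf
  exact ⟨HS.mk f (hW.le hf), rfl⟩

lemma pull_map (N : Submodule ℂ (HS p q a)) : pull a (Submodule.map (toFn p q a) N) = N :=
  Submodule.comap_map_eq_of_injective (f := toFn p q a) HS.fn_injective N

lemma types_NS {Ω : Set (ℕ × ℕ)} (hΩ : ∀ α ∈ Ω, VT p q a α ≠ ⊥) :
    types a ((NS p q a Ω).map (toFn p q a)) = Ω := by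
  ext α
  rw [types, Set.mem_ofPred_eq, pull_map]
  exact ⟨fun h => (VT_le_NS_iff h.1).1 h.2, fun h => ⟨hΩ α h, VT_le_NS h⟩⟩

lemma mem_kTypes_iff {α : ℕ × ℕ} {W₁ W₂ : Submodule ℂ (Fn p q)} :
    α ∈ kTypes (a : ℂ) W₁ W₂ ↔ α ∈ types a W₁ ∧ α ∉ types a W₂ := by
  rw [mem_kTypes]
  constructor
  · rintro ⟨h1, h2⟩
    exact ⟨⟨fun h => h2 (h ▸ bot_le), h1⟩, fun h => h2 h.2⟩
  · rintro ⟨h1, h2⟩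
    exact ⟨h1.2, fun h => h2 ⟨h1.1, h⟩⟩

end

section

variable {p q : ℕ} {a : ℝ} [NeZero p] [NeZero q]

/-! ### Invariant Hermitian forms -/

/-- A continuous invariant sesquilinear form on a subspace of `S^a(X⁰)`, extended to `S^a(X⁰)`. -/
structure IsInvForm (N : Submodule ℂ (HS p q a)) (B : HS p q a →ₗ⋆[ℂ] HS p q a →ₗ[ℂ] ℂ) : Prop where
  inv : ∀ g : O p q, ∀ u ∈ N, ∀ v ∈ N, B (rhoS g u) (rhoS g v) = B u v
  cont : ∃ (j : ℕ) (C : ℝ), 0 ≤ C ∧ ∀ u ∈ N, ∀ v ∈ N, ‖B u v‖ ≤ C * ‖(Lam ^ j) u‖ * ‖(Lam ^ j) v‖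

lemma IsUnitary.exists_form {W₁ W₂ : Submodule ℂ (Fn p q)} (h : IsUnitary W₁ W₂)
    (hW : IsSubmodule p q (a : ℂ) W₁) : ∃ B : HS p q a →ₗ⋆[ℂ] HS p q a →ₗ[ℂ] ℂ,
      IsInvForm (pull a W₁) B ∧ ∀ u ∈ pull a W₁, u ∉ pull a W₂ → 0 < (B u u).re := by
  obtain ⟨B₀, -, -, hpos, hinv, N, C, hC⟩ := h
  let ι : W₁ →ₗ[ℂ] HS p q a :=
    { toFun := fun w => HS.mk w.1 (hW.le w.2), map_add' := fun _ _ => rfl, map_smul' := fun _ _ => rfl }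
  have hι : Function.Injective ι := fun u v huv => Subtype.ext (congrArg HS.fn huv)
  obtain ⟨π, hπ⟩ := ι.exists_leftInverse_of_injective (LinearMap.ker_eq_bot.2 hι)
  have hπ' : ∀ u (hu : u ∈ pull a W₁), π u = ⟨u.fn, hu⟩ := fun u hu =>
    congrArg (fun f : W₁ →ₗ[ℂ] W₁ => f ⟨u.fn, hu⟩) hπ
  let B : HS p q a →ₗ⋆[ℂ] HS p q a →ₗ[ℂ] ℂ := LinearMap.mk₂'ₛₗ (starRingEnd ℂ) (RingHom.id ℂ)
    (fun u v => B₀ (π u) (π v)) (fun u u' v => by simp) (fun c u v => by simp)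
    (fun u v v' => by simp) (fun c u v => by simp)
  have hB : ∀ u v, B u v = B₀ (π u) (π v) := fun _ _ => rfl
  refine ⟨B, ⟨fun g u hu v hv => ?_, ?_⟩, fun u hu hu' => ?_⟩
  · rw [hB, hB, hπ' u hu, hπ' v hv, hπ' _ (hW.rhoS_mem hu g), hπ' _ (hW.rhoS_mem hv g)]
    exact hinv g ⟨u.fn, hu⟩ ⟨v.fn, hv⟩ ⟨(rhoS g u).fn, hW.rhoS_mem hu g⟩
      ⟨(rhoS g v).fn, hW.rhoS_mem hv g⟩ rfl rfl
  · obtain ⟨D, j, hD0, hD⟩ := exists_normLE_le p q a N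
    refine ⟨j, |C| * D * D, by positivity, fun u hu v hv => ?_⟩
    rw [hB, hπ' u hu, hπ' v hv]
    refine (hC ⟨u.fn, hu⟩ ⟨v.fn, hv⟩ _ _ (hD u) (hD v)).trans ?_
    calc C * (D * ‖(Lam ^ j) u‖) * (D * ‖(Lam ^ j) v‖)
        ≤ |C| * (D * ‖(Lam ^ j) u‖) * (D * ‖(Lam ^ j) v‖) := by gcongr; exact le_abs_self C
      _ = _ := by ring
  · rw [hB, hπ' u hu]
    exact hpos _ hu'

lemma exists_form_taylor {N : Submodule ℂ (HS p q a)} {B : HS p q a →ₗ⋆[ℂ] HS p q a →ₗ[ℂ] ℂ}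
    {j : ℕ} {C : ℝ} (hC0 : 0 ≤ C)
    (hC : ∀ u ∈ N, ∀ v ∈ N, ‖B u v‖ ≤ C * ‖(Lam ^ j) u‖ * ‖(Lam ^ j) v‖) (φ : Flow p q)
    (hflow : ∀ t, ∀ u ∈ N, flowS φ t u ∈ N) (hlie : ∀ u ∈ N, lie φ u ∈ N)
    {u v : HS p q a} (hu : u ∈ N) (hv : v ∈ N) :
    ∃ Q, 0 ≤ Q ∧ ∀ t ∈ Set.Icc (-1 : ℝ) 1, ‖B (flowS φ t u) (flowS φ t v) - B u v -
      t * (B (lie φ u) v + B u (lie φ v))‖ ≤ Q * t ^ 2 := by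
  obtain ⟨Ru, hRu0, hRu⟩ := exists_Lam_taylor φ u j
  obtain ⟨Rv, hRv0, hRv⟩ := exists_Lam_taylor φ v j
  obtain ⟨Tv, hTv0, hTv⟩ := exists_Lam_flowS_bound φ v j 1
  set Du := lie φ u with hDu
  set Dv := lie φ v with hDv
  have hDum : Du ∈ N := hlie u hu
  have hDvm : Dv ∈ N := hlie v hv
  refine ⟨‖B Du Dv‖ + C * Ru * Tv + C * (‖(Lam ^ j) u‖ + ‖(Lam ^ j) Du‖) * Rv, by positivity,
    fun t htI => ?_⟩
  have ht1 : |t| ≤ 1 := abs_le.2 htI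
  set ut := flowS φ t u with hut
  set vt := flowS φ t v with hvt
  set r := ut - u - (t : ℂ) • Du with hr
  set s := vt - v - (t : ℂ) • Dv with hs
  have hutm : ut ∈ N := hflow t u hu
  have hvtm : vt ∈ N := hflow t v hv
  have hrm : r ∈ N := sub_mem (sub_mem hutm hu) (Submodule.smul_mem _ _ hDum)
  have hsm : s ∈ N := sub_mem (sub_mem hvtm hv) (Submodule.smul_mem _ _ hDvm)
  have e1 : ut = u + (t : ℂ) • Du + r := by rw [hr]; abel
  have e2 : vt = v + (t : ℂ) • Dv + s := by rw [hs]; abel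
  have h2 : B ut vt - B u v - t * (B Du v + B u Dv) =
      (t : ℂ) * t * B Du Dv + B r vt + B (u + (t : ℂ) • Du) s := by
    have h3 : B ut vt = B (u + (t : ℂ) • Du) (v + (t : ℂ) • Dv) +
        B (u + (t : ℂ) • Du) s + B r vt := by
      conv_lhs => rw [e1, map_add, LinearMap.add_apply]
      congr 1
      rw [e2, map_add]
    rw [h3]
    simp only [map_add, LinearMap.add_apply, LinearMap.map_smulₛₗ, LinearMap.smul_apply,
      map_smul, smul_eq_mul, Complex.conj_ofReal]
    ring
  have h3 : ‖B r vt‖ ≤ C * (Ru * t ^ 2) * Tv := by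
    refine (hC r hrm vt hvtm).trans ?_
    have := hRu t htI
    have := hTv t htI
    gcongr
  have h4 : ‖B (u + (t : ℂ) • Du) s‖ ≤ C * (‖(Lam ^ j) u‖ + ‖(Lam ^ j) Du‖) * (Rv * t ^ 2) := by
    refine (hC _ (add_mem hu (Submodule.smul_mem _ _ hDum)) s hsm).trans ?_
    have h5 := hRv t htI
    have h6 : ‖(Lam ^ j) (u + (t : ℂ) • Du)‖ ≤ ‖(Lam ^ j) u‖ + ‖(Lam ^ j) Du‖ := by
      rw [map_add, map_smul]
      refine (norm_add_le _ _).trans ?_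
      rw [norm_smul, Complex.norm_real, Real.norm_eq_abs]
      have := mul_le_of_le_one_left (norm_nonneg ((Lam ^ j) Du)) ht1
      linarith
    gcongr
  rw [h2]
  refine (norm_add₃_le).trans ?_
  rw [norm_mul, norm_mul, Complex.norm_real, Real.norm_eq_abs, abs_mul_abs_self]
  calc _ ≤ t * t * ‖B Du Dv‖ + C * (Ru * t ^ 2) * Tv +
        C * (‖(Lam ^ j) u‖ + ‖(Lam ^ j) Du‖) * (Rv * t ^ 2) := by gcongr
    _ = _ := by ring

lemma IsInvForm.lie {W : Submodule ℂ (Fn p q)} (hW : IsSubmodule p q (a : ℂ) W)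
    {B : HS p q a →ₗ⋆[ℂ] HS p q a →ₗ[ℂ] ℂ} (hB : IsInvForm (pull a W) B) (φ : Flow p q)
    {u v : HS p q a} (hu : u ∈ pull a W) (hv : v ∈ pull a W) :
    B (LightCone.lie φ u) v + B u (LightCone.lie φ v) = 0 := by
  obtain ⟨j, C, hC0, hC⟩ := hB.cont
  obtain ⟨Q, hQ0, hQ⟩ := exists_form_taylor hC0 hC φ (fun t u hu => hW.rhoS_mem hu _)
    (fun u hu => hW.lie_mem hu φ) hu hv
  set E := B (LightCone.lie φ u) v + B u (LightCone.lie φ v) with hE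
  have key : ∀ t : ℝ, 0 < t → t ≤ 1 → ‖E‖ ≤ Q * t := by
    intro t ht0 ht1
    have h1 := hQ t ⟨by linarith, ht1⟩
    have h2 : B (flowS φ t u) (flowS φ t v) = B u v := hB.inv _ u hu v hv
    rw [h2, sub_self, zero_sub, norm_neg, norm_mul, Complex.norm_real,
      Real.norm_of_nonneg ht0.le] at h1
    refine le_of_mul_le_mul_left (h1.trans_eq ?_) ht0
    ring
  by_contra hne
  have hpos : 0 < ‖E‖ := norm_pos_iff.2 hne
  have h1 := key (min 1 (‖E‖ / (2 * (Q + 1)))) (lt_min one_pos (by positivity)) (min_le_left _ _)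
  have h2 : Q * min 1 (‖E‖ / (2 * (Q + 1))) ≤ (Q + 1) * (‖E‖ / (2 * (Q + 1))) :=
    mul_le_mul (by linarith) (min_le_right _ _) (by positivity) (by positivity)
  have h3 : (Q + 1) * (‖E‖ / (2 * (Q + 1))) = ‖E‖ / 2 := by field_simp
  linarith

lemma IsInvForm.orthogonal {W : Submodule ℂ (Fn p q)} (hW : IsSubmodule p q (a : ℂ) W)
    {B : HS p q a →ₗ⋆[ℂ] HS p q a →ₗ[ℂ] ℂ} (hB : IsInvForm (pull a W) B) {α β : ℕ × ℕ}
    (hαβ : α ≠ β) {u v : HS p q a} (hu : u ∈ VT p q a α) (hv : v ∈ VT p q a β)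
    (huW : u ∈ pull a W) (hvW : v ∈ pull a W) : B u v = 0 := by
  have hL : ∀ φ : Flow p q, B (LightCone.lie φ (LightCone.lie φ u)) v =
      B u (LightCone.lie φ (LightCone.lie φ v)) := by
    intro φ
    have h1 := hB.lie hW φ (hW.lie_mem huW φ) hvW
    have h2 := hB.lie hW φ huW (hW.lie_mem hvW φ)
    exact (eq_neg_of_add_eq_zero_left h1).trans (eq_neg_of_add_eq_zero_right h2).symm
  refine VT_orthogonal_of_form hαβ (fun u v => B u v) hu hv
    (fun c f g => by
      rw [LinearMap.map_smulₛₗ, LinearMap.smul_apply, Complex.conj_ofReal, smul_eq_mul])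
    (fun c f g => by rw [map_smul, smul_eq_mul]) ?_ ?_ (hB.inv _ u huW v hvW) (hB.inv _ u huW v hvW)
  · simp only [Cx_apply, map_sum, LinearMap.sum_apply]
    exact Finset.sum_congr rfl fun k _ => Finset.sum_congr rfl fun l _ => hL _
  · simp only [Cy_apply, map_sum, LinearMap.sum_apply]
    exact Finset.sum_congr rfl fun k _ => Finset.sum_congr rfl fun l _ => hL _

lemma Db_eq_sum {α : ℕ × ℕ} (i : Fin p) (j : Fin q) {u : HS p q a} (hu : u ∈ VT p q a α) :
    ∑ γ ∈ nbF α, PT γ (Db i j u) = Db i j u := by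
  refine ext_PT fun β => ?_
  rw [map_sum]
  by_cases hβ : β ∈ nbF α
  · rw [Finset.sum_eq_single β (fun γ _ hγ => PT_of_mem_ne hγ.symm (PT_mem γ _))
      (fun h => absurd hβ h), PT_of_mem (PT_mem β _)]
  · rw [PT_Db i j hu, PT_MM_eq_zero (fun h => hβ h.mem) i j hu, smul_zero]
    refine Finset.sum_eq_zero fun γ hγ => PT_of_mem_ne (fun h => hβ (by rwa [h])) (PT_mem γ _)

lemma IsInvForm.Db_left {W : Submodule ℂ (Fn p q)} (hW : IsSubmodule p q (a : ℂ) W)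
    {B : HS p q a →ₗ⋆[ℂ] HS p q a →ₗ[ℂ] ℂ} (hB : IsInvForm (pull a W) B) {α β : ℕ × ℕ}
    (h : Nb α β) (i : Fin p) (j : Fin q) {u v : HS p q a} (hu : u ∈ VT p q a α)
    (hv : v ∈ VT p q a β) (huW : u ∈ pull a W) (hvW : v ∈ pull a W) :
    B (Db i j u) v = AA p q a α β * B (PT β (MM i j u)) v ∧
      B v (Db i j u) = AA p q a α β * B v (PT β (MM i j u)) := by
  have hm : ∀ γ, PT γ (Db i j u) ∈ pull a W := hW.PT_mem_pull (hW.lie_mem huW _)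
  have e1 : B (PT β (Db i j u)) v = AA p q a α β * B (PT β (MM i j u)) v := by
    rw [PT_Db i j hu, LinearMap.map_smulₛₗ, LinearMap.smul_apply, Complex.conj_ofReal, smul_eq_mul]
  have e2 : B v (PT β (Db i j u)) = AA p q a α β * B v (PT β (MM i j u)) := by
    rw [PT_Db i j hu, map_smul, smul_eq_mul]
  rw [← e1, ← e2]
  constructor
  · conv_lhs => rw [← Db_eq_sum i j hu, map_sum, LinearMap.sum_apply]
    exact Finset.sum_eq_single β
      (fun γ _ hγ => hB.orthogonal hW hγ (PT_mem γ _) hv (hm γ) hvW) (fun hc => absurd h.mem hc)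
  · conv_lhs => rw [← Db_eq_sum i j hu, map_sum]
    exact Finset.sum_eq_single β
      (fun γ _ hγ => hB.orthogonal hW hγ.symm hv (PT_mem γ _) hvW (hm γ)) (fun hc => absurd h.mem hc)

/-- Two reals are both zero or have opposite signs. -/
def OppSign (x y : ℝ) : Prop := ∃ P Q : ℝ, 0 < P ∧ 0 < Q ∧ x * P + y * Q = 0

lemma exists_eigenvector {α β : ℕ × ℕ} (h : Nb α β) (hα : VT p q a α ≠ ⊥) (hβ : VT p q a β ≠ ⊥) :
    ∃ u ∈ VT p q a α, u ≠ 0 ∧ (∃ i j, PT β (MM i j u) ≠ 0) ∧ ∃ c : ℝ, 0 < c ∧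
      ∑ i, ∑ j, PT α (MM i j (PT β (MM i j u))) = (c : ℂ) • u := by
  let T : HS p q a →ₗ[ℂ] HS p q a :=
    ∑ i, ∑ j, (PT α).toLinearMap ∘ₗ (MM i j ∘ₗ ((PT β).toLinearMap ∘ₗ MM i j))
  have hT : ∀ u, T u = ∑ i, ∑ j, PT α (MM i j (PT β (MM i j u))) := fun u => by
    simp [T, LinearMap.sum_apply]
  have hTm : ∀ u ∈ VT p q a α, T u ∈ VT p q a α := fun u _ => by
    rw [hT]
    exact Submodule.sum_mem _ fun i _ => Submodule.sum_mem _ fun j _ => PT_mem α _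
  have hin : ∀ u ∈ VT p q a α, ∀ v ∈ VT p q a α,
      inner ℂ v (T u) = ∑ i, ∑ j, inner ℂ (PT β (MM i j v)) (PT β (MM i j u)) := by
    intro u _ v hv
    rw [hT, inner_sum]
    refine Finset.sum_congr rfl fun i _ => ?_
    rw [inner_sum]
    refine Finset.sum_congr rfl fun j _ => ?_
    rw [inner_PT_right hv, ← inner_MM, inner_PT, PT_of_mem (PT_mem β _)]
  let S : VT p q a α →ₗ[ℂ] VT p q a α := T.restrict hTm
  have hS : S.IsSymmetric := by
    intro u v
    change inner ℂ (T u) (v : HS p q a) = inner ℂ (u : HS p q a) (T v)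
    rw [hin v v.2 u u.2, ← inner_conj_symm, hin u u.2 v v.2, map_sum]
    refine Finset.sum_congr rfl fun i _ => ?_
    rw [map_sum]
    exact Finset.sum_congr rfl fun j _ => inner_conj_symm _ _
  have hS0 : S ≠ 0 := by
    intro h0
    obtain ⟨i, j, u, hu, hne⟩ := exists_PT_MM_ne_zero h hα hβ
    have h1 : T u = 0 := congrArg (fun f : VT p q a α →ₗ[ℂ] VT p q a α => (f ⟨u, hu⟩ : HS p q a)) h0
    have h2 := hin u hu u hu
    rw [h1, inner_zero_right] at h2
    have h3 : ∑ i, ∑ j, ‖PT β (MM i j u)‖ ^ 2 = 0 := by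
      have h4 := congrArg Complex.re h2
      simp only [Complex.re_sum, Complex.zero_re, inner_self_eq_norm_sq_to_K] at h4
      rw [h4]
      refine Finset.sum_congr rfl fun i _ => Finset.sum_congr rfl fun j _ => ?_
      norm_cast
    have h5 := (Finset.sum_eq_zero_iff_of_nonneg
      (fun i _ => Finset.sum_nonneg fun j _ => sq_nonneg _)).1 h3 i (Finset.mem_univ i)
    have h6 := (Finset.sum_eq_zero_iff_of_nonneg (fun j _ => sq_nonneg _)).1 h5 j (Finset.mem_univ j)
    exact hne (norm_eq_zero.1 (pow_eq_zero_iff two_ne_zero |>.1 h6))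
  have hfd := (VT_finrank (p := p) (q := q) (a := a) α).1
  let b := hS.eigenvectorBasis rfl
  obtain ⟨k, hk⟩ : ∃ k, S (b k) ≠ 0 := by
    by_contra hc
    push Not at hc
    exact hS0 (b.toBasis.ext fun k => by simpa using hc k)
  have hev : S (b k) = ((hS.eigenvalues rfl k : ℝ) : ℂ) • b k := hS.apply_eigenvectorBasis rfl k
  set c := hS.eigenvalues rfl k with hc
  set u : HS p q a := Subtype.val (b k) with hu
  have hum : u ∈ VT p q a α := (b k).2
  have hTu : T u = (c : ℂ) • u := congrArg Subtype.val hev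
  have hc0 : c ≠ 0 := by
    intro h0
    rw [hev, h0] at hk
    simp at hk
  have hu1 : ‖u‖ = 1 := b.orthonormal.1 k
  have hsum : c = ∑ i, ∑ j, ‖PT β (MM i j u)‖ ^ 2 := by
    have h2 := hin u hum u hum
    rw [hTu, inner_smul_right, inner_self_eq_norm_sq_to_K, hu1] at h2
    have h4 := congrArg Complex.re h2
    simp only [Complex.re_sum, inner_self_eq_norm_sq_to_K] at h4
    have h5 : ((c : ℂ) * ((1 : ℝ) : ℂ) ^ 2).re = c := by simp
    rw [← h5]
    refine h4.trans ?_
    refine Finset.sum_congr rfl fun i _ => Finset.sum_congr rfl fun j _ => ?_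
    norm_cast
  refine ⟨u, hum, fun h0 => by rw [h0, norm_zero] at hu1; exact zero_ne_one hu1, ?_, c,
    lt_of_le_of_ne (hsum ▸ Finset.sum_nonneg fun i _ => Finset.sum_nonneg fun j _ => sq_nonneg _)
      hc0.symm, (hT u).symm.trans hTu⟩
  by_contra hall
  push Not at hall
  refine hc0 (hsum.trans ?_)
  simp [hall]

/-- In a unitary subquotient, the two coefficients between neighbouring `K`-types have opposite
signs. -/
lemma IsUnitary.oppSign {W₁ W₂ : Submodule ℂ (Fn p q)} (hU : IsUnitary W₁ W₂)
    (h₁ : IsSubmodule p q (a : ℂ) W₁) (h₂ : IsSubmodule p q (a : ℂ) W₂) {α β : ℕ × ℕ} (h : Nb α β)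
    (hα : α ∈ kTypes (a : ℂ) W₁ W₂) (hβ : β ∈ kTypes (a : ℂ) W₁ W₂) :
    OppSign (AA p q a α β) (AA p q a β α) := by
  obtain ⟨B, hB, hpos⟩ := hU.exists_form h₁
  rw [mem_kTypes_iff] at hα hβ
  have hpos' : ∀ {γ : ℕ × ℕ}, γ ∈ types a W₁ ∧ γ ∉ types a W₂ → ∀ w ∈ VT p q a γ, w ≠ 0 →
      0 < (B w w).re := by
    intro γ hγ w hw hw0
    refine hpos w (hγ.1.2 hw) fun hw2 => hγ.2 ⟨hγ.1.1, h₂.VT_le hw2 ?_⟩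
    rwa [PT_of_mem hw]
  obtain ⟨u, hu, hu0, ⟨i₀, j₀, hne⟩, c, hc, hsum⟩ := exists_eigenvector h hα.1.1 hβ.1.1
  have huW := hα.1.2 hu
  have key : ∀ i j, AA p q a α β * B (PT β (MM i j u)) (PT β (MM i j u)) +
      AA p q a β α * B u (PT α (MM i j (PT β (MM i j u)))) = 0 := by
    intro i j
    have hvm := PT_mem β (MM i j u)
    rw [← (hB.Db_left h₁ h i j hu hvm huW (hβ.1.2 hvm)).1,
      ← (hB.Db_left h₁ h.symm i j hvm hu (hβ.1.2 hvm) huW).2]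
    exact hB.lie h₁ (boost i j) huW (hβ.1.2 hvm)
  refine ⟨∑ i, ∑ j, (B (PT β (MM i j u)) (PT β (MM i j u))).re, c * (B u u).re, ?_,
    mul_pos hc (hpos' hα u hu hu0), ?_⟩
  · have hnn : ∀ i j, 0 ≤ (B (PT β (MM i j u)) (PT β (MM i j u))).re := by
      intro i j
      by_cases h0 : PT β (MM i j u) = 0
      · rw [h0]
        simp
      · exact (hpos' hβ _ (PT_mem _ _) h0).le
    refine Finset.sum_pos' (fun i _ => Finset.sum_nonneg fun j _ => hnn i j)
      ⟨i₀, Finset.mem_univ _, Finset.sum_pos' (fun j _ => hnn i₀ j)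
        ⟨j₀, Finset.mem_univ _, hpos' hβ _ (PT_mem _ _) hne⟩⟩
  · have h1 : (c : ℂ) * B u u = ∑ i, ∑ j, B u (PT α (MM i j (PT β (MM i j u)))) := by
      rw [← smul_eq_mul, ← map_smul, ← hsum]
      simp only [map_sum]
    have h2 := congrArg Complex.re h1
    rw [Complex.re_ofReal_mul] at h2
    rw [h2, Complex.re_sum, Finset.mul_sum, Finset.mul_sum, ← Finset.sum_add_distrib]
    refine Finset.sum_eq_zero fun i _ => ?_
    rw [Complex.re_sum, Finset.mul_sum, Finset.mul_sum, ← Finset.sum_add_distrib]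
    refine Finset.sum_eq_zero fun j _ => ?_
    have := congrArg Complex.re (key i j)
    simpa only [Complex.add_re, Complex.re_ofReal_mul, Complex.zero_re] using this

end

section

/-! ### Weights -/

lemma exists_dist_int (b : ℝ) : ∃ δ : ℝ, 0 < δ ∧ ∀ d : ℤ, b - d ≠ 0 → δ ≤ |b - d| := by
  have h1 := Int.floor_le b
  have h2 := Int.lt_floor_add_one b
  by_cases hb : b = ⌊b⌋
  · refine ⟨1, one_pos, fun d hd => ?_⟩
    rw [hb] at hd ⊢
    have h : ⌊b⌋ - d ≠ 0 := by exact_mod_cast hd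
    exact_mod_cast Int.one_le_abs h
  · have h3 : (⌊b⌋ : ℝ) < b := lt_of_le_of_ne h1 (Ne.symm hb)
    refine ⟨min (b - ⌊b⌋) (⌊b⌋ + 1 - b), lt_min (by linarith) (by linarith), fun d _ => ?_⟩
    rcases le_or_gt d ⌊b⌋ with h | h
    · have h4 : (d : ℝ) ≤ ⌊b⌋ := by exact_mod_cast h
      exact (min_le_left _ _).trans (by rw [abs_of_nonneg] <;> linarith)
    · have h4 : (⌊b⌋ : ℝ) + 1 ≤ d := by exact_mod_cast h
      exact (min_le_right _ _).trans (by rw [abs_of_nonpos] <;> linarith)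

lemma exists_int_le_mul (b : ℝ) :
    ∃ L : ℝ, 0 ≤ L ∧ ∀ d : ℤ, b - d ≠ 0 → |(d : ℝ)| + 1 ≤ L * |b - d| := by
  obtain ⟨δ, hδ, h⟩ := exists_dist_int b
  refine ⟨1 + (|b| + 1) / δ, by positivity, fun d hd => ?_⟩
  have h1 := h d hd
  have h2 : |(d : ℝ)| ≤ |b| + |b - d| := by
    have := abs_sub b (b - d)
    rwa [sub_sub_cancel] at this
  have h3 : |b| + 1 ≤ (|b| + 1) / δ * |b - d| := by
    rw [div_mul_eq_mul_div, le_div_iff₀ hδ]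
    exact mul_le_mul_of_nonneg_left h1 (by positivity)
  linarith

lemma prod_range_le_pow {r : ℕ → ℝ} {N : ℕ} (h0 : ∀ k, 0 < r k)
    (h : ∀ k, r k ≤ 1 + N / ((k : ℝ) + 1)) (k : ℕ) :
    ∏ j ∈ Finset.range k, r j ≤ ((k : ℝ) + 1) ^ N := by
  induction k with
  | zero => simp
  | succ k ih =>
    rw [Finset.prod_range_succ]
    have h1 : r k ≤ (1 + 1 / ((k : ℝ) + 1)) ^ N := by
      refine (h k).trans ?_
      have := one_add_mul_le_pow (a := 1 / ((k : ℝ) + 1))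
        ((by norm_num : (-2 : ℝ) ≤ 0).trans (by positivity)) N
      rwa [mul_one_div] at this
    calc (∏ j ∈ Finset.range k, r j) * r k
        ≤ ((k : ℝ) + 1) ^ N * (1 + 1 / ((k : ℝ) + 1)) ^ N :=
          mul_le_mul ih h1 (h0 k).le (by positivity)
      _ = (((k + 1 : ℕ) : ℝ) + 1) ^ N := by
          rw [← mul_pow]
          congr 1
          push_cast
          field_simp

lemma exists_recursion {R : ℤ → ℝ} {L : ℝ} (h0 : ∀ k, 0 < R k)
    (h1 : ∀ k, R k ≤ 1 + L / (|(k : ℝ)| + 1)) (h2 : ∀ k, (R k)⁻¹ ≤ 1 + L / (|(k : ℝ)| + 1)) :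
    ∃ w : ℤ → ℝ, (∀ k, 0 < w k) ∧ (∀ k, w (k + 1) = R k * w k) ∧
      ∃ N : ℕ, ∀ k, w k ≤ (|(k : ℝ)| + 1) ^ N := by
  obtain ⟨N, hN⟩ := exists_nat_ge (2 * |L|)
  have hL : L ≤ N := by
    have := le_abs_self L
    have := abs_nonneg L
    linarith
  let w : ℤ → ℝ := fun k => (∏ j ∈ Finset.range k.toNat, R j) *
    ∏ j ∈ Finset.range (-k).toNat, (R (-(j : ℤ) - 1))⁻¹
  have hw : ∀ k, w k = (∏ j ∈ Finset.range k.toNat, R j) *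
    ∏ j ∈ Finset.range (-k).toNat, (R (-(j : ℤ) - 1))⁻¹ := fun _ => rfl
  refine ⟨w, fun k => mul_pos (Finset.prod_pos fun j _ => h0 _)
    (Finset.prod_pos fun j _ => inv_pos.2 (h0 _)), fun k => ?_, N, fun k => ?_⟩
  · obtain ⟨n, rfl | rfl⟩ : ∃ n : ℕ, k = n ∨ k = -n - 1 := by
      rcases le_or_gt 0 k with h | h
      · exact ⟨k.toNat, Or.inl (by omega)⟩
      · exact ⟨(-k - 1).toNat, Or.inr (by omega)⟩
    · rw [hw, hw, show ((n : ℤ) + 1).toNat = n + 1 by omega, show ((n : ℤ)).toNat = n by omega,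
        show (-((n : ℤ) + 1)).toNat = 0 by omega, show (-(n : ℤ)).toNat = 0 by omega,
        Finset.prod_range_succ]
      simp only [Finset.range_zero, Finset.prod_empty]
      ring
    · rw [hw, hw, show (-(n : ℤ) - 1 + 1).toNat = 0 by omega,
        show (-(n : ℤ) - 1).toNat = 0 by omega, show (-(-(n : ℤ) - 1)).toNat = n + 1 by omega,
        show (-(-(n : ℤ) - 1 + 1)).toNat = n by omega, Finset.prod_range_succ]
      have := (h0 (-(n : ℤ) - 1)).ne'
      field_simp
  · obtain ⟨n, rfl | rfl⟩ : ∃ n : ℕ, k = n ∨ k = -n := by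
      rcases le_or_gt 0 k with h | h
      · exact ⟨k.toNat, Or.inl (by omega)⟩
      · exact ⟨(-k).toNat, Or.inr (by omega)⟩
    · rw [hw, show ((n : ℤ)).toNat = n by omega, show (-(n : ℤ)).toNat = 0 by omega]
      simp only [Finset.range_zero, Finset.prod_empty, mul_one]
      have := prod_range_le_pow (r := fun j : ℕ => R j) (N := N) (fun _ => h0 _) (fun k => by
        refine (h1 k).trans ?_
        rw [Int.cast_natCast, abs_of_nonneg (by positivity : (0 : ℝ) ≤ k)]
        gcongr) n
      rwa [Int.cast_natCast, abs_of_nonneg (by positivity : (0 : ℝ) ≤ n)]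
    · rw [hw, show (-(n : ℤ)).toNat = 0 by omega, show (-(-(n : ℤ))).toNat = n by omega]
      simp only [Finset.range_zero, Finset.prod_empty, one_mul]
      have := prod_range_le_pow (r := fun j : ℕ => (R (-(j : ℤ) - 1))⁻¹) (N := N)
        (fun _ => inv_pos.2 (h0 _)) (fun k => by
          refine (h2 _).trans ?_
          have e : |((-(k : ℤ) - 1 : ℤ) : ℝ)| = k + 1 := by
            push_cast
            rw [← neg_add', abs_neg, abs_of_nonneg (by positivity)]
          rw [e]
          have h3 : L / ((k : ℝ) + 1 + 1) ≤ |L| / ((k : ℝ) + 1) := by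
            refine (div_le_div_of_nonneg_right (le_abs_self L) (by positivity)).trans ?_
            gcongr
            linarith
          have h4 : |L| ≤ N := by
            have := abs_nonneg L
            linarith
          have h5 : |L| / ((k : ℝ) + 1) ≤ N / ((k : ℝ) + 1) := by gcongr
          linarith) n
      rwa [Int.cast_neg, abs_neg, Int.cast_natCast, abs_of_nonneg (by positivity : (0 : ℝ) ≤ n)]

lemma OppSign.ne_zero_iff {x y : ℝ} (h : OppSign x y) : x ≠ 0 ↔ y ≠ 0 := by
  obtain ⟨P, Q, hP, hQ, h⟩ := h
  constructor
  · rintro hx rfl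
    rw [zero_mul, add_zero] at h
    exact (mul_ne_zero hx hP.ne') h
  · rintro hy rfl
    rw [zero_mul, zero_add] at h
    exact (mul_ne_zero hy hQ.ne') h

lemma OppSign.mul_neg {x y : ℝ} (h : OppSign x y) (hx : x ≠ 0) : x * y < 0 := by
  obtain ⟨P, Q, hP, hQ, h⟩ := h
  have h1 : x * y * Q = -(x * x * P) := by linear_combination x * h
  have h2 : 0 < x * x * P := mul_pos (mul_self_pos.2 hx) hP
  by_contra hc
  push Not at hc
  have := mul_nonneg hc hQ.le
  linarith

lemma oppSign_of_div_neg {x y : ℝ} (h : x / y < 0) : OppSign x y := by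
  rcases div_neg_iff.1 h with ⟨hx, hy⟩ | ⟨hx, hy⟩
  · exact ⟨-y, x, by linarith, hx, by ring⟩
  · exact ⟨y, -x, hy, by linarith, by ring⟩

lemma OppSign.symm {x y : ℝ} (h : OppSign x y) : OppSign y x := by
  obtain ⟨P, Q, hP, hQ, h⟩ := h
  exact ⟨Q, P, hQ, hP, by linarith⟩

lemma exists_weight (b c : ℝ) : ∃ w : ℤ → ℝ, (∀ d, 0 < w d) ∧
    (∀ d : ℤ, OppSign (b - d) (c + d) → w (d + 2) * (b - d) + w d * (c + d) = 0) ∧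
    ∃ N : ℕ, ∀ d, w d ≤ (|(d : ℝ)| + 1) ^ N := by
  classical
  obtain ⟨L₁, hL₁, h₁⟩ := exists_int_le_mul b
  obtain ⟨L₂, hL₂, h₂⟩ := exists_int_le_mul (-c)
  let r : ℤ → ℝ := fun d => if b - d ≠ 0 ∧ c + d ≠ 0 then |c + d| / |b - d| else 1
  have hr0 : ∀ d, 0 < r d := by
    intro d
    simp only [r]
    split_ifs with h
    · exact div_pos (abs_pos.2 h.2) (abs_pos.2 h.1)
    · exact one_pos
  set L := |b + c| * (L₁ + L₂) with hL
  have hquot : ∀ (x y l : ℝ) (d : ℤ), 0 < |y| → |x| ≤ |b + c| + |y| → 0 ≤ l → l ≤ L₁ + L₂ →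
      |(d : ℝ)| + 1 ≤ l * |y| → |x| / |y| ≤ 1 + L / (|(d : ℝ)| + 1) := by
    intro x y l d hy hx hl hl' hd
    rw [div_le_iff₀ hy, add_mul, one_mul]
    have h1 : |b + c| ≤ L / (|(d : ℝ)| + 1) * |y| := by
      rw [div_mul_eq_mul_div, le_div_iff₀ (by positivity), hL, mul_assoc]
      refine mul_le_mul_of_nonneg_left (hd.trans ?_) (abs_nonneg _)
      exact mul_le_mul_of_nonneg_right hl' (abs_nonneg _)
    linarith
  have hL0 : 0 ≤ L := by positivity
  have hr1 : ∀ d : ℤ, r d ≤ 1 + L / (|(d : ℝ)| + 1) := by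
    intro d
    simp only [r]
    split_ifs with h
    · refine hquot _ _ L₁ d (abs_pos.2 h.1) ?_ hL₁ (by linarith) (h₁ d h.1)
      have := abs_sub (b + c) (b - d)
      rwa [show b + c - (b - d) = c + d by ring] at this
    · have : 0 ≤ L / (|(d : ℝ)| + 1) := by positivity
      linarith
  have hr2 : ∀ d : ℤ, (r d)⁻¹ ≤ 1 + L / (|(d : ℝ)| + 1) := by
    intro d
    simp only [r]
    split_ifs with h
    · rw [inv_div]
      have h3 : -c - (d : ℝ) ≠ 0 := fun h0 => h.2 (by linarith)
      have h4 : |c + d| = |-c - (d : ℝ)| := by rw [← abs_neg]; congr 1; ring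
      refine hquot _ _ L₂ d (abs_pos.2 h.2) ?_ hL₂ (by linarith) (by rw [h4]; exact h₂ d h3)
      have := abs_sub (b + c) (c + d)
      rwa [show b + c - (c + d) = b - d by ring] at this
    · rw [inv_one]
      have : 0 ≤ L / (|(d : ℝ)| + 1) := by positivity
      linarith
  have habs : ∀ (ε : ℤ) (k : ℤ), 0 ≤ ε → ε ≤ 1 → |(k : ℝ)| ≤ |((2 * k + ε : ℤ) : ℝ)| := by
    intro ε k h0 h1
    have : |k| ≤ |2 * k + ε| := by
      rcases abs_cases k with h | h <;> rcases abs_cases (2 * k + ε) with h' | h' <;> omega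
    exact_mod_cast this
  have hex : ∀ ε : ℤ, 0 ≤ ε → ε ≤ 1 → ∃ w : ℤ → ℝ, (∀ k, 0 < w k) ∧
      (∀ k, w (k + 1) = r (2 * k + ε) * w k) ∧ ∃ N : ℕ, ∀ k, w k ≤ (|(k : ℝ)| + 1) ^ N := by
    intro ε h0 h1
    have hb : ∀ k : ℤ, L / (|((2 * k + ε : ℤ) : ℝ)| + 1) ≤ L / (|(k : ℝ)| + 1) := fun k => by
      have := habs ε k h0 h1
      gcongr
    refine exists_recursion (L := L) (fun k => hr0 _) (fun k => (hr1 _).trans ?_)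
      (fun k => (hr2 _).trans ?_)
    · have := hb k
      linarith
    · have := hb k
      linarith
  obtain ⟨w₀, hw₀, hrec₀, N₀, hN₀⟩ := hex 0 le_rfl zero_le_one
  obtain ⟨w₁, hw₁, hrec₁, N₁, hN₁⟩ := hex 1 zero_le_one le_rfl
  let w : ℤ → ℝ := fun d => if d % 2 = 0 then w₀ (d / 2) else w₁ (d / 2)
  have hstep : ∀ d, w (d + 2) = r d * w d := by
    intro d
    have e1 : (d + 2) / 2 = d / 2 + 1 := by omega
    have e2 : (d + 2) % 2 = d % 2 := by omega
    simp only [w, e1, e2]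
    split_ifs with h
    · rw [hrec₀, show 2 * (d / 2) + 0 = d by omega]
    · rw [hrec₁, show 2 * (d / 2) + 1 = d by omega]
  refine ⟨w, fun d => ?_, fun d hd => ?_, N₀ + N₁, fun d => ?_⟩
  · simp only [w]
    split_ifs
    · exact hw₀ _
    · exact hw₁ _
  · rw [hstep]
    by_cases hx : b - (d : ℝ) = 0
    · have hy : c + (d : ℝ) = 0 := by
        by_contra hy
        exact (hd.ne_zero_iff.2 hy) hx
      rw [hx, hy, mul_zero, mul_zero, add_zero]
    · have hy := hd.ne_zero_iff.1 hx
      have hr : r d = |c + d| / |b - d| := if_pos ⟨hx, hy⟩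
      have hneg := hd.mul_neg hx
      have hq : |c + d| / |b - d| * (b - d) = -(c + d) := by
        rcases lt_or_gt_of_ne hx with h | h
        · have h' : 0 < c + d := by nlinarith
          rw [abs_of_pos h', abs_of_neg h]
          field_simp
        · have h' : c + d < 0 := by nlinarith
          rw [abs_of_neg h', abs_of_pos h]
          field_simp
      rw [hr]
      linear_combination w d * hq
  · have h1 : |((d / 2 : ℤ) : ℝ)| ≤ |(d : ℝ)| := by
      have : |d / 2| ≤ |d| := by
        rcases abs_cases (d / 2) with h | h <;> rcases abs_cases d with h' | h' <;> omega
      exact_mod_cast this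
    have h2 : (1 : ℝ) ≤ |(d : ℝ)| + 1 := by
      have := abs_nonneg (d : ℝ)
      linarith
    have h3 : ∀ N ≤ N₀ + N₁, (|((d / 2 : ℤ) : ℝ)| + 1) ^ N ≤ (|(d : ℝ)| + 1) ^ (N₀ + N₁) :=
      fun N hN => (pow_le_pow_left₀ (by positivity) (by linarith) N).trans
        (pow_le_pow_right₀ h2 hN)
    simp only [w]
    split_ifs
    · exact (hN₀ _).trans (h3 _ (by omega))
    · exact (hN₁ _).trans (h3 _ (by omega))

end

section

variable {p q : ℕ} {a : ℝ} [NeZero p] [NeZero q]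

/-! ### Forms given by weights on the `K`-types -/

lemma mu_pow_mul_norm_PT_le (α : ℕ × ℕ) (k : ℕ) (f : HS p q a) :
    mu p q α ^ k * ‖PT α f‖ ≤ ‖(Lam ^ k) f‖ := by
  have h1 := norm_PT_le α ((Lam ^ k) f)
  have h2 : 0 ≤ mu p q α ^ k := pow_nonneg (zero_le_one.trans (one_le_mu α)) k
  rwa [PT_Lam_pow, norm_smul, Complex.norm_real, Real.norm_of_nonneg h2] at h1

/-- Weights on the `K`-types that grow at most polynomially. -/
def PolyBounded (p q : ℕ) (κ : ℕ × ℕ → ℝ) (A : ℝ) (M : ℕ) : Prop :=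
  0 ≤ A ∧ ∀ α, |κ α| ≤ A * mu p q α ^ M

variable {κ : ℕ × ℕ → ℝ} {A : ℝ} {M : ℕ}

lemma PolyBounded.norm_mul_PT_le (hκ : PolyBounded p q κ A M) (α : ℕ × ℕ) (k : ℕ) (u : HS p q a) :
    mu p q α ^ k * (|κ α| * ‖PT α u‖) ≤ A * (mu p q α ^ 2)⁻¹ * ‖(Lam ^ (M + k + 2)) u‖ := by
  have h0 : 0 < mu p q α := zero_lt_one.trans_le (one_le_mu α)
  have h1 := mu_pow_mul_norm_PT_le α (M + k + 2) u
  calc mu p q α ^ k * (|κ α| * ‖PT α u‖)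
      ≤ mu p q α ^ k * (A * mu p q α ^ M * ‖PT α u‖) := by
        have := hκ.2 α
        gcongr
    _ = A * (mu p q α ^ 2)⁻¹ * (mu p q α ^ (M + k + 2) * ‖PT α u‖) := by
        rw [pow_add, pow_add]
        field_simp
    _ ≤ _ := mul_le_mul_of_nonneg_left h1 (mul_nonneg hκ.1 (by positivity))

lemma PolyBounded.norm_term_le (hκ : PolyBounded p q κ A M) (u v : HS p q a) (α : ℕ × ℕ) :
    ‖(κ α : ℂ) * inner ℂ (PT α u) v‖ ≤ A * (mu p q α ^ 2)⁻¹ * ‖(Lam ^ (M + 2)) u‖ * ‖v‖ := by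
  rw [norm_mul, Complex.norm_real, Real.norm_eq_abs]
  have h1 := hκ.norm_mul_PT_le α 0 u
  rw [pow_zero, one_mul, add_zero] at h1
  calc |κ α| * ‖inner ℂ (PT α u) v‖ ≤ |κ α| * (‖PT α u‖ * ‖v‖) := by
        gcongr
        exact norm_inner_le_norm _ _
    _ = |κ α| * ‖PT α u‖ * ‖v‖ := by ring
    _ ≤ _ := by gcongr

lemma PolyBounded.summable (hκ : PolyBounded p q κ A M) (u v : HS p q a) :
    Summable fun α => (κ α : ℂ) * inner ℂ (PT α u) v :=
  Summable.of_norm_bounded (((summable_mu.mul_left A).mul_right _).mul_right _)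
    (hκ.norm_term_le u v)

/-- The sesquilinear form `∑_α κ(α) ⟨u_α, v_α⟩`. -/
def wform (a : ℝ) (hκ : PolyBounded p q κ A M) : HS p q a →ₗ⋆[ℂ] HS p q a →ₗ[ℂ] ℂ :=
  LinearMap.mk₂'ₛₗ (starRingEnd ℂ) (RingHom.id ℂ) (fun u v => ∑' α, (κ α : ℂ) * inner ℂ (PT α u) v)
    (fun u u' v => by
      rw [← (hκ.summable u v).tsum_add (hκ.summable u' v)]
      simp only [map_add, inner_add_left, mul_add])
    (fun c u v => by
      rw [smul_eq_mul, ← tsum_mul_left]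
      simp only [map_smul, inner_smul_left, mul_left_comm])
    (fun u v v' => by
      rw [← (hκ.summable u v).tsum_add (hκ.summable u v')]
      simp only [inner_add_right, mul_add])
    (fun c u v => by
      rw [RingHom.id_apply, smul_eq_mul, ← tsum_mul_left]
      simp only [inner_smul_right, mul_left_comm])

lemma wform_apply (hκ : PolyBounded p q κ A M) (u v : HS p q a) :
    wform a hκ u v = ∑' α, (κ α : ℂ) * inner ℂ (PT α u) v := rfl

lemma wform_conj (hκ : PolyBounded p q κ A M) (u v : HS p q a) :
    wform a hκ v u = (starRingEnd ℂ) (wform a hκ u v) := by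
  rw [wform_apply, wform_apply, Complex.conj_tsum]
  refine tsum_congr fun α => ?_
  rw [map_mul, Complex.conj_ofReal, inner_conj_symm, inner_PT]

lemma norm_wform_le (hκ : PolyBounded p q κ A M) (u v : HS p q a) :
    ‖wform a hκ u v‖ ≤ A * (∑' α, (mu p q α ^ 2)⁻¹) * ‖(Lam ^ (M + 2)) u‖ * ‖(Lam ^ (M + 2)) v‖ := by
  have h1 : ‖wform a hκ u v‖ ≤ ∑' α, A * (mu p q α ^ 2)⁻¹ * ‖(Lam ^ (M + 2)) u‖ * ‖v‖ :=
    tsum_of_norm_bounded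
      (((summable_mu.mul_left A).mul_right _).mul_right _).hasSum (hκ.norm_term_le u v)
  rw [tsum_mul_right, tsum_mul_right, tsum_mul_left] at h1
  refine h1.trans (mul_le_mul_of_nonneg_left ?_ ?_)
  · have := norm_Lam_pow_le (Nat.zero_le (M + 2)) v
    simpa using this
  · exact mul_nonneg (mul_nonneg hκ.1 (tsum_nonneg fun α => by positivity)) (norm_nonneg _)

lemma PT_Db_eq_sum (α : ℕ × ℕ) (i : Fin p) (j : Fin q) (f : HS p q a) :
    PT α (Db i j f) = ∑ γ ∈ nbF α, (AA p q a γ α : ℂ) • PT α (MM i j (PT γ f)) := by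
  refine PT_eq (Submodule.sum_mem _ fun γ _ => Submodule.smul_mem _ _ (PT_mem _ _)) fun v hv => ?_
  rw [inner_Db i j hv, inner_sum]
  refine Finset.sum_congr rfl fun γ _ => ?_
  rw [inner_smul_right, inner_PT_right hv, ← inner_MM, inner_PT]

lemma summable_nb : Summable fun z : (ℕ × ℕ) × (ℕ × ℕ) =>
    if z.2 ∈ nbF z.1 then (mu p q z.1 ^ 2)⁻¹ else 0 := by
  have h0 : ∀ z : (ℕ × ℕ) × (ℕ × ℕ), 0 ≤ if z.2 ∈ nbF z.1 then (mu p q z.1 ^ 2)⁻¹ else 0 := by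
    intro z
    split_ifs <;> positivity
  refine (summable_prod_of_nonneg h0).2 ⟨fun α => ?_, ?_⟩
  · refine summable_of_ne_finset_zero (s := nbF α) fun γ hγ => if_neg hγ
  · refine Summable.of_nonneg_of_le (fun α => tsum_nonneg fun γ => h0 (α, γ)) (fun α => ?_)
      (summable_mu (p := p) (q := q) |>.mul_left 4)
    rw [tsum_eq_sum (s := nbF α) fun γ hγ => if_neg hγ]
    refine (Finset.sum_le_card_nsmul _ _ ((mu p q α ^ 2)⁻¹) fun γ hγ => ?_).trans ?_
    · rw [if_pos hγ]
    · rw [nsmul_eq_mul]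
      refine mul_le_mul_of_nonneg_right ?_ (by positivity)
      exact_mod_cast card_nbF α

lemma exists_abs_AA_le_mu (p q : ℕ) [NeZero p] [NeZero q] (a : ℝ) :
    ∃ D : ℝ, 0 ≤ D ∧ ∀ α β : ℕ × ℕ, Nb α β → |AA p q a α β| ≤ D * mu p q β := by
  obtain ⟨c, hc⟩ := exists_abs_AA_le p q a
  refine ⟨8 * (c + 1), by positivity, fun α β h => (hc α β h).trans ?_⟩
  have h1 := mul_le_mu (p := p) (q := q) β
  have hx : (0 : ℝ) ≤ β.1 := Nat.cast_nonneg _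
  have hy : (0 : ℝ) ≤ β.2 := Nat.cast_nonneg _
  have hc0 : (0 : ℝ) ≤ c := Nat.cast_nonneg _
  have h2 : ((max β.1 β.2 : ℕ) : ℝ) + 1 ≤ 4 * mu p q β := by
    rw [Nat.cast_max]
    rcases max_cases (β.1 : ℝ) β.2 with ⟨h, -⟩ | ⟨h, -⟩ <;> rw [h] <;> nlinarith
  have h3 : (0 : ℝ) ≤ ((max β.1 β.2 : ℕ) : ℝ) := Nat.cast_nonneg _
  rw [Nat.cast_add]
  nlinarith

/-- The form given by weights is infinitesimally invariant under boosts if the weights are matched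
to the transition coefficients. -/
lemma wform_Db (hκ : PolyBounded p q κ A M) (i : Fin p) (j : Fin q) {u v : HS p q a}
    (h : ∀ α γ, Nb α γ → PT α u ≠ 0 → PT γ v ≠ 0 →
      κ α * AA p q a γ α + κ γ * AA p q a α γ = 0) :
    wform a hκ (Db i j u) v + wform a hκ u (Db i j v) = 0 := by
  let x : ℕ × ℕ → ℕ × ℕ → ℂ := fun α γ =>
    (κ α * AA p q a γ α : ℂ) * inner ℂ (PT γ (MM i j (PT α u))) v
  have hx0 : ∀ α γ, ¬ Nb α γ → x α γ = 0 := fun α γ hn => by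
    simp only [x]
    rw [PT_MM_eq_zero hn i j (PT_mem α u), inner_zero_left, mul_zero]
  obtain ⟨D, hD0, hD⟩ := exists_abs_AA_le_mu p q a
  have hxs : Summable fun z : (ℕ × ℕ) × (ℕ × ℕ) => x z.1 z.2 := by
    refine Summable.of_norm_bounded
      ((summable_nb (p := p) (q := q)).mul_left (D * A * ‖(Lam ^ (M + 1 + 2)) u‖ * ‖v‖)) ?_
    rintro ⟨α, γ⟩
    by_cases hn : Nb α γ
    · rw [if_pos hn.mem]
      simp only [x, norm_mul, Complex.norm_real, Real.norm_eq_abs]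
      have h1 := hκ.norm_mul_PT_le α 1 u
      have h2 : ‖inner ℂ (PT γ (MM i j (PT α u))) v‖ ≤ ‖PT α u‖ * ‖v‖ :=
        (norm_inner_le_norm _ _).trans (mul_le_mul_of_nonneg_right
          ((norm_PT_le _ _).trans (norm_MM_le i j _)) (norm_nonneg _))
      have h3 := hD γ α hn.symm
      calc |κ α| * |AA p q a γ α| * ‖inner ℂ (PT γ (MM i j (PT α u))) v‖
          ≤ |κ α| * (D * mu p q α) * (‖PT α u‖ * ‖v‖) := by
            have h4 : 0 ≤ D * mu p q α := (abs_nonneg _).trans h3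
            gcongr
        _ = D * (mu p q α ^ 1 * (|κ α| * ‖PT α u‖)) * ‖v‖ := by ring
        _ ≤ D * (A * (mu p q α ^ 2)⁻¹ * ‖(Lam ^ (M + 1 + 2)) u‖) * ‖v‖ := by gcongr
        _ = _ := by ring
    · rw [hx0 α γ hn, norm_zero]
      have : 0 ≤ if γ ∈ nbF α then (mu p q α ^ 2)⁻¹ else 0 := by split_ifs <;> positivity
      have hA := hκ.1
      positivity
  have hu : wform a hκ u (Db i j v) = ∑' α, ∑' γ, x α γ := by
    rw [wform_apply]
    refine tsum_congr fun α => ?_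
    rw [tsum_eq_sum (s := nbF α) fun γ hγ => hx0 α γ fun hn => hγ hn.mem,
      inner_Db i j (PT_mem α u), Finset.mul_sum]
    refine Finset.sum_congr rfl fun γ _ => ?_
    simp only [x]
    ring
  have hv : wform a hκ (Db i j u) v = ∑' α, ∑' γ, -x γ α := by
    rw [wform_apply]
    refine tsum_congr fun α => ?_
    rw [tsum_eq_sum (s := nbF α) fun γ hγ => by
        rw [hx0 γ α fun hn => hγ hn.symm.mem, neg_zero],
      PT_Db_eq_sum, sum_inner, Finset.mul_sum]
    refine Finset.sum_congr rfl fun γ _ => ?_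
    rw [inner_smul_left, Complex.conj_ofReal]
    simp only [x]
    by_cases hn : Nb γ α
    swap
    · rw [PT_MM_eq_zero hn i j (PT_mem γ u)]
      simp
    by_cases h1 : PT γ u = 0
    · rw [h1]
      simp
    by_cases h2 : PT α v = 0
    · rw [inner_PT, h2]
      simp
    have h3 := h γ α hn h1 h2
    have h4 : (κ γ : ℂ) * AA p q a α γ + κ α * AA p q a γ α = 0 := by exact_mod_cast h3
    linear_combination (inner ℂ (PT α (MM i j (PT γ u))) v) * h4
  rw [hu, hv]
  have hxs' : Summable (Function.uncurry fun α γ => x α γ) := hxs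
  simp only [tsum_neg]
  rw [hxs'.tsum_comm, neg_add_cancel]

lemma hasDerivAt_zero_of_sq {G : ℝ → ℂ} {t Q : ℝ}
    (h : ∀ s ∈ Set.Icc (-1 : ℝ) 1, ‖G (t + s) - G t‖ ≤ Q * s ^ 2) : HasDerivAt G 0 t := by
  rw [hasDerivAt_iff_isLittleO_nhds_zero]
  simp only [smul_zero, sub_zero]
  have h1 : (fun s => G (t + s) - G t) =O[nhds 0] fun s : ℝ => s ^ 2 := by
    refine Asymptotics.IsBigO.of_bound Q ?_
    filter_upwards [Icc_mem_nhds (by norm_num : (-1 : ℝ) < 0) (by norm_num : (0 : ℝ) < 1)] with s hs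
    rw [Real.norm_of_nonneg (sq_nonneg s)]
    exact h s hs
  exact h1.trans_isLittleO (Asymptotics.isLittleO_pow_id one_lt_two)

lemma wform_inv (hκ : PolyBounded p q κ A M) {W : Submodule ℂ (Fn p q)}
    (hW : IsSubmodule p q (a : ℂ) W)
    (h : ∀ u ∈ pull a W, ∀ v ∈ pull a W, ∀ α γ, Nb α γ → PT α u ≠ 0 → PT γ v ≠ 0 →
      κ α * AA p q a γ α + κ γ * AA p q a α γ = 0) (g : O p q) :
    ∀ u ∈ pull a W, ∀ v ∈ pull a W, wform a hκ (rhoS g u) (rhoS g v) = wform a hκ u v := by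
  refine O_induction (P := fun g => ∀ u ∈ pull a W, ∀ v ∈ pull a W,
    wform a hκ (rhoS g u) (rhoS g v) = wform a hκ u v) (fun k u _ v _ => ?_)
    (fun i j t u hu v hv => ?_) (fun g h hg hh u hu v hv => ?_) g
  · rw [wform_apply, wform_apply]
    refine tsum_congr fun α => ?_
    rw [PT_rhoS, inner_rhoS_kO]
  · have hmem : ∀ t, ∀ u ∈ pull a W, flowS (boost i j) t u ∈ pull a W :=
      fun t u hu => hW.rhoS_mem hu _
    have hd : ∀ t, HasDerivAt
        (fun t => wform a hκ (flowS (boost i j) t u) (flowS (boost i j) t v)) 0 t := by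
      intro t
      obtain ⟨Q, -, hQ⟩ := exists_form_taylor (B := wform a hκ) (N := pull a W)
        (mul_nonneg hκ.1 (tsum_nonneg fun α => by positivity))
        (fun u _ v _ => norm_wform_le hκ u v) (boost i j) hmem (fun u hu => hW.lie_mem hu _)
        (hmem t u hu) (hmem t v hv)
      refine hasDerivAt_zero_of_sq (Q := Q) fun s hs => ?_
      have h1 := hQ s hs
      have h2 := wform_Db hκ i j (h _ (hmem t u hu) _ (hmem t v hv))
      rw [Db] at h2
      rwa [h2, mul_zero, sub_zero, ← flowS_add, ← flowS_add, add_comm s t] at h1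
    have h1 := is_const_of_deriv_eq_zero (fun t => (hd t).differentiableAt)
      (fun t => (hd t).deriv) (-t) 0
    simp only [flowS_zero] at h1
    rw [flowS, neg_neg] at h1
    exact h1
  · rw [rhoS_mul, rhoS_mul, hg _ (hW.rhoS_mem hu h) _ (hW.rhoS_mem hv h), hh u hu v hv]

lemma exists_matched_weights (p q : ℕ) [NeZero p] [NeZero q] (a : ℝ) :
    ∃ (κ : ℕ × ℕ → ℝ) (A : ℝ) (M : ℕ), (∀ α, 0 < κ α) ∧ PolyBounded p q κ A M ∧
      ∀ α γ, Nb α γ → OppSign (AA p q a γ α) (AA p q a α γ) →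
        κ α * AA p q a γ α + κ γ * AA p q a α γ = 0 := by
  obtain ⟨φ, hφ, hφr, N, hN⟩ := exists_weight a (a + p + q - 2)
  obtain ⟨ψ, hψ, hψr, N', hN'⟩ := exists_weight (a + q - 2) (a + p)
  have hpp : ∀ m n : ℕ, OppSign (AA p q a (m + 1, n + 1) (m, n)) (AA p q a (m, n) (m + 1, n + 1)) →
      φ (m + n) * AA p q a (m + 1, n + 1) (m, n) +
        φ (m + n + 2) * AA p q a (m, n) (m + 1, n + 1) = 0 := by
    intro m n h
    have e1 : AA p q a (m + 1, n + 1) (m, n) = a + p + q - 2 + ((m + n : ℤ) : ℝ) := by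
      rw [AA_mm, Amm]
      push_cast
      ring
    have e2 : AA p q a (m, n) (m + 1, n + 1) = a - ((m + n : ℤ) : ℝ) := by
      rw [AA_pp, App]
      push_cast
      ring
    rw [e1, e2] at h ⊢
    have := hφr _ h.symm
    linarith
  have hpm : ∀ m n : ℕ, OppSign (AA p q a (m + 1, n) (m, n + 1)) (AA p q a (m, n + 1) (m + 1, n)) →
      ψ (m - n - 1) * AA p q a (m + 1, n) (m, n + 1) +
        ψ (m - n + 1) * AA p q a (m, n + 1) (m + 1, n) = 0 := by
    intro m n h
    have e1 : AA p q a (m + 1, n) (m, n + 1) = a + p + ((m - n - 1 : ℤ) : ℝ) := by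
      rw [AA_mp, Amp]
      push_cast
      ring
    have e2 : AA p q a (m, n + 1) (m + 1, n) = a + q - 2 - ((m - n - 1 : ℤ) : ℝ) := by
      rw [AA_pm, Apm]
      push_cast
      ring
    rw [e1, e2] at h ⊢
    have := hψr _ h.symm
    rw [show (m : ℤ) - n - 1 + 2 = m - n + 1 by ring] at this
    linarith
  refine ⟨fun α => φ (α.1 + α.2) * ψ (α.1 - α.2), 4 ^ (N + N'), N + N', fun α =>
    mul_pos (hφ _) (hψ _), ⟨by positivity, fun α => ?_⟩, fun α γ hn => ?_⟩
  · rw [abs_of_pos (mul_pos (hφ _) (hψ _)), ← mul_pow, pow_add]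
    have h1 := mul_le_mu (p := p) (q := q) α
    have hx : (0 : ℝ) ≤ α.1 := Nat.cast_nonneg _
    have hy : (0 : ℝ) ≤ α.2 := Nat.cast_nonneg _
    have h2 : |(((α.1 : ℤ) + α.2 : ℤ) : ℝ)| + 1 ≤ 4 * mu p q α := by
      push_cast
      rw [abs_of_nonneg (by positivity)]
      nlinarith
    have h3 : |(((α.1 : ℤ) - α.2 : ℤ) : ℝ)| + 1 ≤ 4 * mu p q α := by
      push_cast
      have : |(α.1 : ℝ) - α.2| ≤ α.1 + α.2 := abs_le.2 ⟨by linarith, by linarith⟩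
      nlinarith
    exact mul_le_mul ((hN _).trans (pow_le_pow_left₀ (by positivity) h2 N))
      ((hN' _).trans (pow_le_pow_left₀ (by positivity) h3 N')) (hψ _).le
      (pow_nonneg ((by positivity : (0 : ℝ) ≤ |(((α.1 : ℤ) + α.2 : ℤ) : ℝ)| + 1).trans h2) N)
  · refine Nb_cases (P := fun α γ => OppSign (AA p q a γ α) (AA p q a α γ) →
      φ (α.1 + α.2) * ψ (α.1 - α.2) * AA p q a γ α +
        φ (γ.1 + γ.2) * ψ (γ.1 - γ.2) * AA p q a α γ = 0) ?_ ?_ ?_ ?_ hn <;> intro m n h <;>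
      push_cast
    · have := hpp m n h
      rw [show (m : ℤ) + 1 + (n + 1) = m + n + 2 by ring,
        show (m : ℤ) + 1 - (n + 1) = m - n by ring]
      linear_combination ψ (m - n) * this
    · have := hpm m n h
      rw [show (m : ℤ) + (n + 1) = m + n + 1 by ring, show (m : ℤ) + 1 + n = m + n + 1 by ring,
        show (m : ℤ) - (n + 1) = m - n - 1 by ring, show (m : ℤ) + 1 - n = m - n + 1 by ring]
      linear_combination φ (m + n + 1) * this
    · have := hpm m n h.symm
      rw [show (m : ℤ) + (n + 1) = m + n + 1 by ring, show (m : ℤ) + 1 + n = m + n + 1 by ring,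
        show (m : ℤ) - (n + 1) = m - n - 1 by ring, show (m : ℤ) + 1 - n = m - n + 1 by ring]
      linear_combination φ (m + n + 1) * this
    · have := hpp m n h.symm
      rw [show (m : ℤ) + 1 + (n + 1) = m + n + 2 by ring,
        show (m : ℤ) + 1 - (n + 1) = m - n by ring]
      linear_combination ψ (m - n) * this

/-- A subquotient is unitary if the two coefficients between any two neighbouring `K`-types have
opposite signs. -/
lemma isUnitary_of_oppSign {W₁ W₂ : Submodule ℂ (Fn p q)} (h₁ : IsSubmodule p q (a : ℂ) W₁)
    (h₂ : IsSubmodule p q (a : ℂ) W₂)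
    (h : ∀ α β, Nb α β → α ∈ kTypes (a : ℂ) W₁ W₂ → β ∈ kTypes (a : ℂ) W₁ W₂ →
      OppSign (AA p q a α β) (AA p q a β α)) : IsUnitary W₁ W₂ := by
  classical
  obtain ⟨κ₀, A, M, hκ₀, hbd, hmatch⟩ := exists_matched_weights p q a
  let κ : ℕ × ℕ → ℝ := fun α => if α ∈ kTypes (a : ℂ) W₁ W₂ then κ₀ α else 0
  have hκ : PolyBounded p q κ A M := ⟨hbd.1, fun α => by
    simp only [κ]
    split_ifs
    · exact hbd.2 α
    · rw [abs_zero]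
      exact (abs_nonneg _).trans (hbd.2 α)⟩
  have htypes : ∀ {u : HS p q a}, u ∈ pull a W₁ → ∀ {α}, PT α u ≠ 0 → α ∈ types a W₁ := by
    intro u hu α h0
    refine ⟨fun hb => h0 ?_, h₁.VT_le hu h0⟩
    have := PT_mem α u
    rwa [hb, Submodule.mem_bot] at this
  have hinv := wform_inv hκ h₁ (fun u hu v hv α γ hn hα hγ => by
    have hα1 := htypes hu hα
    have hγ1 := htypes hv hγ
    by_cases hα2 : α ∈ types a W₂ <;> by_cases hγ2 : γ ∈ types a W₂
    · simp [κ, mem_kTypes_iff, hα2, hγ2]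
    · have : AA p q a α γ = 0 := by
        by_contra hA
        exact hγ2 (h₂.transClosed α γ hα2 hn hA hγ1.1)
      simp [κ, mem_kTypes_iff, hα2, this]
    · have : AA p q a γ α = 0 := by
        by_contra hA
        exact hα2 (h₂.transClosed γ α hγ2 hn.symm hA hα1.1)
      simp [κ, mem_kTypes_iff, hγ2, this]
    · have h3 : α ∈ kTypes (a : ℂ) W₁ W₂ := mem_kTypes_iff.2 ⟨hα1, hα2⟩
      have h4 : γ ∈ kTypes (a : ℂ) W₁ W₂ := mem_kTypes_iff.2 ⟨hγ1, hγ2⟩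
      simp only [κ, if_pos h3, if_pos h4]
      exact hmatch α γ hn (h γ α hn.symm h4 h3))
  let ι : W₁ →ₗ[ℂ] HS p q a :=
    { toFun := fun w => HS.mk w.1 (h₁.le w.2), map_add' := fun _ _ => rfl,
      map_smul' := fun _ _ => rfl }
  have hι : ∀ w, ι w ∈ pull a W₁ := fun w => w.2
  let B : W₁ →ₗ⋆[ℂ] W₁ →ₗ[ℂ] ℂ := LinearMap.mk₂'ₛₗ (starRingEnd ℂ) (RingHom.id ℂ)
    (fun u v => wform a hκ (ι u) (ι v)) (fun u u' v => by rw [map_add, map_add]; rfl)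
    (fun c u v => by rw [map_smul, LinearMap.map_smulₛₗ]; rfl)
    (fun u v v' => by rw [map_add, map_add]) (fun c u v => by rw [map_smul, map_smul]; rfl)
  have hB : ∀ u v, B u v = wform a hκ (ι u) (ι v) := fun _ _ => rfl
  refine ⟨B, fun u v => ?_, fun u v hu => ?_, fun u hu => ?_, fun g u v u' v' hu' hv' => ?_, ?_⟩
  · rw [hB, hB, wform_conj]
    rfl
  · rw [hB, wform_apply]
    refine (tsum_congr fun α => ?_).trans tsum_zero
    by_cases h0 : PT α (ι u) = 0
    · rw [h0, inner_zero_left, mul_zero]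
    · have h3 : α ∉ kTypes (a : ℂ) W₁ W₂ := fun hα =>
        (mem_kTypes_iff.1 hα).2 ⟨(htypes (hι u) h0).1, h₂.VT_le (f := ι u) hu h0⟩
      simp [κ, h3]
  · obtain ⟨α, hα, h0⟩ : ∃ α ∉ types a W₂, PT α (ι u) ≠ 0 := by
      by_contra hc
      push Not at hc
      refine hu ?_
      have : ι u ∈ pull a W₂ := by
        rw [h₂.pull_eq]
        exact hc
      exact this
    have hαk : α ∈ kTypes (a : ℂ) W₁ W₂ := mem_kTypes_iff.2 ⟨htypes (hι u) h0, hα⟩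
    have hterm : ∀ β, ((κ β : ℂ) * inner ℂ (PT β (ι u)) (ι u)).re = κ β * ‖PT β (ι u)‖ ^ 2 := by
      intro β
      rw [← inner_PT_right (PT_mem β _), inner_self_eq_norm_sq_to_K, Complex.re_ofReal_mul]
      norm_cast
    have hnn : ∀ β, 0 ≤ κ β := fun β => by
      simp only [κ]
      split_ifs
      · exact (hκ₀ β).le
      · exact le_rfl
    have hs := Complex.hasSum_re (hκ.summable (ι u) (ι u)).hasSum
    simp only [hterm] at hs
    rw [hB, wform_apply, ← hs.tsum_eq]
    refine hs.summable.tsum_pos (fun β => mul_nonneg (hnn β) (sq_nonneg _)) α ?_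
    simp only [κ, if_pos hαk]
    exact mul_pos (hκ₀ α) (pow_pos (norm_pos_iff.2 h0) 2)
  · have e1 : ι u' = rhoS g (ι u) := HS.fn_injective hu'
    have e2 : ι v' = rhoS g (ι v) := HS.fn_injective hv'
    rw [hB, hB, e1, e2]
    exact hinv g _ (hι u) _ (hι v)
  · obtain ⟨D, hD0, hD⟩ := exists_norm_Lam_pow_le p q a (M + 2)
    refine ⟨2 * (M + 2), A * (∑' α, (mu p q α ^ 2)⁻¹) * D * D, fun u v m m' hu hv => ?_⟩
    rw [hB]
    refine (norm_wform_le hκ _ _).trans ?_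
    have hu' := hD (ι u) m hu
    have hv' := hD (ι v) m' hv
    have hA := hκ.1
    have hS : 0 ≤ ∑' α : ℕ × ℕ, (mu p q α ^ 2)⁻¹ := tsum_nonneg fun α => by positivity
    calc _ ≤ A * (∑' α, (mu p q α ^ 2)⁻¹) * (D * m) * (D * m') := by
          have h5 : 0 ≤ D * m := (norm_nonneg _).trans hu'
          gcongr
      _ = _ := by ring

end

section

/-! ### Strong components of the transition graph -/

/-- The indices of the nonzero `K`-types. -/
def index (p q : ℕ) : Set (ℕ × ℕ) := {α | HarmonicNonzero p α.1 ∧ HarmonicNonzero q α.2}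

/-- There is a nonzero transition from `α` to `β`. -/
def Step (p q : ℕ) (a : ℝ) (α β : ℕ × ℕ) : Prop := Nb α β ∧ AA p q a α β ≠ 0 ∧ β ∈ index p q

/-- There is a chain of nonzero transitions from `α` to `β`. -/
def Reach (p q : ℕ) (a : ℝ) : ℕ × ℕ → ℕ × ℕ → Prop := Relation.ReflTransGen (Step p q a)

/-- There are chains of nonzero transitions in both directions. -/
def Conn (p q : ℕ) (a : ℝ) (α β : ℕ × ℕ) : Prop := Reach p q a α β ∧ Reach p q a β α

/-- The strong component of `α` in the transition graph. -/
def component (p q : ℕ) (a : ℝ) (α : ℕ × ℕ) : Set (ℕ × ℕ) := {β | Conn p q a α β}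

/-- The two coefficients between any two neighbours in the set have opposite signs. -/
def Opposed (p q : ℕ) (a : ℝ) (Ω : Set (ℕ × ℕ)) : Prop :=
  ∀ α β, Nb α β → α ∈ Ω → β ∈ Ω → OppSign (AA p q a α β) (AA p q a β α)

section Graph

variable {p q : ℕ} {a : ℝ}

lemma nb_pp (m n : ℕ) : Nb (m, n) (m + 1, n + 1) := ⟨Or.inl rfl, Or.inl rfl⟩

lemma nb_pm (m n : ℕ) : Nb (m, n + 1) (m + 1, n) := ⟨Or.inl rfl, Or.inr rfl⟩

lemma opposed_iff_edges {Ω : Set (ℕ × ℕ)} : Opposed p q a Ω ↔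
    (∀ m n, (m, n) ∈ Ω → (m + 1, n + 1) ∈ Ω →
      OppSign (AA p q a (m, n) (m + 1, n + 1)) (AA p q a (m + 1, n + 1) (m, n))) ∧
    (∀ m n, (m, n + 1) ∈ Ω → (m + 1, n) ∈ Ω →
      OppSign (AA p q a (m, n + 1) (m + 1, n)) (AA p q a (m + 1, n) (m, n + 1))) :=
  ⟨fun h => ⟨fun m n => h _ _ (nb_pp m n), fun m n => h _ _ (nb_pm m n)⟩, fun h _ _ =>
    Nb_cases (P := fun α β => α ∈ Ω → β ∈ Ω → OppSign (AA p q a α β) (AA p q a β α)) h.1 h.2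
      (fun m n h1 h2 => (h.2 m n h2 h1).symm) (fun m n h1 h2 => (h.1 m n h2 h1).symm)⟩

lemma Conn.refl (α : ℕ × ℕ) : Conn p q a α α := ⟨Relation.ReflTransGen.refl, Relation.ReflTransGen.refl⟩

lemma Conn.symm {α β : ℕ × ℕ} (h : Conn p q a α β) : Conn p q a β α := ⟨h.2, h.1⟩

lemma Conn.trans {α β γ : ℕ × ℕ} (h : Conn p q a α β) (h' : Conn p q a β γ) : Conn p q a α γ :=
  ⟨Relation.ReflTransGen.trans h.1 h'.1, Relation.ReflTransGen.trans h'.2 h.2⟩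

lemma Reach.mem_index {α β : ℕ × ℕ} (hα : α ∈ index p q) (h : Reach p q a α β) : β ∈ index p q := by
  induction h with
  | refl => exact hα
  | tail _ h _ => exact h.2.2

/-- A function of the `K`-type that controls the transitions along which it changes. -/
def IsLevel (p q : ℕ) (a : ℝ) (f : ℕ × ℕ → ℝ) : Prop := ∀ α β, Nb α β →
  f β = f α ∨
  (f β = f α + 2 ∧ AA p q a α β = shift p q a - f α ∧ AA p q a β α = shift p q a + f α) ∨
  (f α = f β + 2 ∧ AA p q a β α = shift p q a - f β ∧ AA p q a α β = shift p q a + f β)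

/-- The level of the transitions `(m, n) → (m + 1, n + 1)`. -/
def sumLevel (p q : ℕ) (α : ℕ × ℕ) : ℝ := α.1 + α.2 + ((p : ℝ) + q) / 2 - 1

/-- The level of the transitions `(m, n) → (m + 1, n - 1)`. -/
def diffLevel (p q : ℕ) (α : ℕ × ℕ) : ℝ := offset p q α + 1

lemma AA_pp_eq (m n : ℕ) :
    AA p q a (m, n) (m + 1, n + 1) = shift p q a - sumLevel p q (m, n) := by
  rw [AA_pp, App, shift, sumLevel]
  ring

lemma AA_mm_eq (m n : ℕ) :
    AA p q a (m + 1, n + 1) (m, n) = shift p q a + sumLevel p q (m, n) := by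
  rw [AA_mm, Amm, shift, sumLevel]
  push_cast
  ring

lemma AA_pm_eq (m n : ℕ) :
    AA p q a (m, n + 1) (m + 1, n) = shift p q a - diffLevel p q (m, n + 1) := by
  rw [AA_pm, Apm, shift, diffLevel, offset]
  push_cast
  ring

lemma AA_mp_eq (m n : ℕ) :
    AA p q a (m + 1, n) (m, n + 1) = shift p q a + diffLevel p q (m, n + 1) := by
  rw [AA_mp, Amp, shift, diffLevel, offset]
  push_cast
  ring

lemma isLevel_sumLevel : IsLevel p q a (sumLevel p q) := by
  intro α β h
  refine Nb_cases (P := fun α β => sumLevel p q β = sumLevel p q α ∨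
    (sumLevel p q β = sumLevel p q α + 2 ∧ AA p q a α β = shift p q a - sumLevel p q α ∧
      AA p q a β α = shift p q a + sumLevel p q α) ∨
    (sumLevel p q α = sumLevel p q β + 2 ∧ AA p q a β α = shift p q a - sumLevel p q β ∧
      AA p q a α β = shift p q a + sumLevel p q β)) ?_ ?_ ?_ ?_ h <;> intro m n
  · exact Or.inr (Or.inl ⟨by simp only [sumLevel]; push_cast; ring, AA_pp_eq m n, AA_mm_eq m n⟩)
  · exact Or.inl (by simp only [sumLevel]; push_cast; ring)
  · exact Or.inl (by simp only [sumLevel]; push_cast; ring)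
  · exact Or.inr (Or.inr ⟨by simp only [sumLevel]; push_cast; ring, AA_pp_eq m n, AA_mm_eq m n⟩)

lemma isLevel_diffLevel : IsLevel p q a (diffLevel p q) := by
  intro α β h
  refine Nb_cases (P := fun α β => diffLevel p q β = diffLevel p q α ∨
    (diffLevel p q β = diffLevel p q α + 2 ∧ AA p q a α β = shift p q a - diffLevel p q α ∧
      AA p q a β α = shift p q a + diffLevel p q α) ∨
    (diffLevel p q α = diffLevel p q β + 2 ∧ AA p q a β α = shift p q a - diffLevel p q β ∧
      AA p q a α β = shift p q a + diffLevel p q β)) ?_ ?_ ?_ ?_ h <;> intro m n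
  · exact Or.inl (by simp only [diffLevel, offset]; push_cast; ring)
  · exact Or.inr (Or.inl ⟨by simp only [diffLevel, offset]; push_cast; ring, AA_pm_eq m n,
      AA_mp_eq m n⟩)
  · exact Or.inr (Or.inr ⟨by simp only [diffLevel, offset]; push_cast; ring, AA_pm_eq m n,
      AA_mp_eq m n⟩)
  · exact Or.inl (by simp only [diffLevel, offset]; push_cast; ring)

lemma IsLevel.reach_congr {f : ℕ × ℕ → ℝ} (hf : IsLevel p q a f) {α β : ℕ × ℕ}
    (h : Reach p q a α β) {τ : ℝ} (hα : ∃ z : ℤ, f α = τ + 2 * z) : ∃ z : ℤ, f β = τ + 2 * z := by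
  induction h with
  | refl => exact hα
  | tail _ h ih =>
    obtain ⟨z, hz⟩ := ih
    rcases hf _ _ h.1 with h1 | ⟨h1, -⟩ | ⟨h1, -⟩
    · exact ⟨z, h1.trans hz⟩
    · exact ⟨z + 1, by rw [h1, hz]; push_cast; ring⟩
    · exact ⟨z - 1, by push_cast; linarith⟩

/-- A strong component lies on one side of the levels at which transitions are blocked. -/
lemma IsLevel.le_iff {f : ℕ × ℕ → ℝ} (hf : IsLevel p q a f) {α β : ℕ × ℕ} (h : Conn p q a α β)
    {τ : ℝ} (hτ : τ = shift p q a ∨ τ = -shift p q a) (hα : ∃ z : ℤ, f α = τ + 2 * z) :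
    f α ≤ τ ↔ f β ≤ τ := by
  have key : ∀ {γ δ : ℕ × ℕ}, Reach p q a γ δ → (∃ z : ℤ, f γ = τ + 2 * z) →
      (τ = shift p q a → f γ ≤ τ → f δ ≤ τ) ∧ (τ = -shift p q a → ¬ f γ ≤ τ → ¬ f δ ≤ τ) := by
    intro γ δ hγδ hγ
    induction hγδ with
    | refl => exact ⟨fun _ h => h, fun _ h => h⟩
    | tail hγ' h ih =>
      rename_i δ ε
      obtain ⟨z, hz⟩ := hf.reach_congr hγ' hγ
      refine ⟨fun h0 h1 => ?_, fun h0 h1 => ?_⟩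
      · have h2 := ih.1 h0 h1
        rcases hf _ _ h.1 with h3 | ⟨h3, h4, -⟩ | ⟨h3, -, -⟩
        · rwa [h3]
        · have h5 : z ≤ 0 := by
            have : (z : ℝ) ≤ 0 := by linarith
            exact_mod_cast this
          have h6 : z ≠ 0 := by
            rintro rfl
            refine h.2.1 ?_
            rw [h4, hz, ← h0]
            simp
          have h7 : (z : ℝ) ≤ -1 := by
            have : z ≤ -1 := by omega
            exact_mod_cast this
          linarith
        · linarith
      · have h2 := ih.2 h0 h1
        rcases hf _ _ h.1 with h3 | ⟨h3, -, -⟩ | ⟨h3, -, h4⟩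
        · rwa [h3]
        · intro h5
          exact h2 (by linarith)
        · intro h5
          have h6 : 0 < z := by
            have : (0 : ℝ) < z := by
              rw [hz, not_le] at h2
              linarith
            exact_mod_cast this
          have h7 : z ≠ 1 := by
            rintro rfl
            refine h.2.1 ?_
            rw [h4]
            have : f ε = τ := by
              push_cast at hz
              linarith
            rw [this, h0]
            ring
          have h8 : (2 : ℝ) ≤ z := by
            have : 2 ≤ z := by omega
            exact_mod_cast this
          linarith
  have hβ := hf.reach_congr h.1 hα
  rcases hτ with h0 | h0
  · exact ⟨(key h.1 hα).1 h0, (key h.2 hβ).1 h0⟩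
  · exact ⟨fun h1 => by_contra fun h2 => (key h.2 hβ).2 h0 h2 h1,
      fun h1 => by_contra fun h2 => (key h.1 hα).2 h0 h2 h1⟩

/-- Every transition between neighbours has a level. -/
lemma exists_level {α β : ℕ × ℕ} (h : Nb α β) : ∃ f : ℕ × ℕ → ℝ, IsLevel p q a f ∧
    ((f β = f α + 2 ∧ AA p q a α β = shift p q a - f α ∧ AA p q a β α = shift p q a + f α) ∨
    (f α = f β + 2 ∧ AA p q a β α = shift p q a - f β ∧ AA p q a α β = shift p q a + f β)) := by
  refine Nb_cases (P := fun α β => ∃ f : ℕ × ℕ → ℝ, IsLevel p q a f ∧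
    ((f β = f α + 2 ∧ AA p q a α β = shift p q a - f α ∧ AA p q a β α = shift p q a + f α) ∨
    (f α = f β + 2 ∧ AA p q a β α = shift p q a - f β ∧ AA p q a α β = shift p q a + f β)))
    ?_ ?_ ?_ ?_ h <;> intro m n
  · exact ⟨_, isLevel_sumLevel, Or.inl ⟨by simp only [sumLevel]; push_cast; ring, AA_pp_eq m n,
      AA_mm_eq m n⟩⟩
  · exact ⟨_, isLevel_diffLevel, Or.inl ⟨by simp only [diffLevel, offset]; push_cast; ring,
      AA_pm_eq m n, AA_mp_eq m n⟩⟩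
  · exact ⟨_, isLevel_diffLevel, Or.inr ⟨by simp only [diffLevel, offset]; push_cast; ring,
      AA_pm_eq m n, AA_mp_eq m n⟩⟩
  · exact ⟨_, isLevel_sumLevel, Or.inr ⟨by simp only [sumLevel]; push_cast; ring, AA_pp_eq m n,
      AA_mm_eq m n⟩⟩

/-- Transitions within a strong component do not vanish. -/
lemma Conn.AA_ne_zero {α β : ℕ × ℕ} (h : Conn p q a α β) (hn : Nb α β) : AA p q a α β ≠ 0 := by
  obtain ⟨f, hf, ⟨h1, h2, -⟩ | ⟨h1, -, h2⟩⟩ := exists_level (p := p) (q := q) (a := a) hn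
  · intro h0
    have h3 : f α = shift p q a := by linarith
    have h4 := (hf.le_iff h (Or.inl rfl) ⟨0, by simp [h3]⟩).1 h3.le
    linarith
  · intro h0
    have h3 : f β = -shift p q a := by linarith
    have h4 := (hf.le_iff h.symm (Or.inr rfl) ⟨0, by simp [h3]⟩).1 h3.le
    linarith

end Graph

variable {p q : ℕ} {a : ℝ} [NeZero p] [NeZero q]

lemma VT_ne_bot_iff_mem {α : ℕ × ℕ} : VT p q a α ≠ ⊥ ↔ α ∈ index p q := VT_ne_bot_iff

lemma TransClosed.reach {Ω : Set (ℕ × ℕ)} (hΩ : TransClosed p q a Ω) {α β : ℕ × ℕ} (hα : α ∈ Ω)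
    (h : Reach p q a α β) : β ∈ Ω := by
  induction h with
  | refl => exact hα
  | tail _ h ih => exact hΩ _ _ ih h.1 h.2.1 (VT_ne_bot_iff_mem.2 h.2.2)

lemma transClosed_reach (α : ℕ × ℕ) : TransClosed p q a {β | Reach p q a α β} :=
  fun _ _ hβ hn hA hγ => Relation.ReflTransGen.tail hβ ⟨hn, hA, VT_ne_bot_iff_mem.1 hγ⟩

lemma isSubmodule_eq_of_types {W W' : Submodule ℂ (Fn p q)} (hW : IsSubmodule p q (a : ℂ) W)
    (hW' : IsSubmodule p q (a : ℂ) W') (h : types a W = types a W') : W = W' := by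
  rw [← hW.map_pull, ← hW'.map_pull, hW.pull_eq, hW'.pull_eq, h]

lemma types_mono {W W' : Submodule ℂ (Fn p q)} (h : W ≤ W') : types a W ⊆ types a W' :=
  fun _ hα => ⟨hα.1, hα.2.trans (Submodule.comap_mono h)⟩

lemma le_of_types {W W' : Submodule ℂ (Fn p q)} (hW : IsSubmodule p q (a : ℂ) W)
    (hW' : IsSubmodule p q (a : ℂ) W') (h : types a W ⊆ types a W') : W ≤ W' := by
  rw [← hW.map_pull, ← hW'.map_pull, hW.pull_eq, hW'.pull_eq]
  exact Submodule.map_mono fun f hf α hα => hf α fun h' => hα (h h')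

/-- The `K`-types of a constituent form a strong component. -/
lemma IsConstituent.kTypes_eq {W₁ W₂ : Submodule ℂ (Fn p q)}
    (h : IsConstituent p q (a : ℂ) W₁ W₂) :
    ∃ α ∈ index p q, kTypes (a : ℂ) W₁ W₂ = component p q a α := by
  have hΩ₁ := h.top_sub.transClosed
  have hΩ₂ := h.bot_sub.transClosed
  have hsub : types a W₂ ⊆ types a W₁ := types_mono h.lt.le
  have hreach : ∀ {α β : ℕ × ℕ}, α ∈ types a W₁ → α ∉ types a W₂ → β ∈ types a W₁ →
      β ∉ types a W₂ → Reach p q a α β := by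
    intro α β hα hα' hβ hβ'
    have hcl : TransClosed p q a (types a W₂ ∪ {γ | Reach p q a α γ}) := by
      rintro γ δ (hγ | hγ) hn hA hδ
      · exact Or.inl (hΩ₂ γ δ hγ hn hA hδ)
      · exact Or.inr (transClosed_reach α γ δ hγ hn hA hδ)
    have hne : ∀ γ ∈ types a W₂ ∪ {γ | Reach p q a α γ}, VT p q a γ ≠ ⊥ := by
      rintro γ (hγ | hγ)
      · exact hγ.1
      · exact (hΩ₁.reach hα hγ).1
    have ht := types_NS hne
    have hS := hcl.isSubmodule
    rcases h.irreducible _ hS (le_of_types h.bot_sub hS (by rw [ht]; exact Set.subset_union_left))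
      (le_of_types hS h.top_sub (by
        rw [ht]
        exact Set.union_subset hsub fun γ hγ => hΩ₁.reach hα hγ)) with h1 | h1
    · exfalso
      rw [h1] at ht
      exact hα' (ht ▸ Or.inr Relation.ReflTransGen.refl)
    · rw [h1] at ht
      rw [ht] at hβ
      exact hβ.resolve_left hβ'
  obtain ⟨α, hα, hα'⟩ : ∃ α ∈ types a W₁, α ∉ types a W₂ := by
    by_contra hc
    push Not at hc
    exact h.lt.not_ge (le_of_types h.top_sub h.bot_sub hc)
  refine ⟨α, VT_ne_bot_iff_mem.1 hα.1, Set.ext fun β => ?_⟩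
  rw [mem_kTypes_iff]
  exact ⟨fun hβ => ⟨hreach hα hα' hβ.1 hβ.2, hreach hβ.1 hβ.2 hα hα'⟩,
    fun hβ => ⟨hΩ₁.reach hα hβ.1, fun h2 => hα' (hΩ₂.reach h2 hβ.2)⟩⟩

/-- Every strong component is the set of `K`-types of a constituent. -/
lemma exists_isConstituent {α : ℕ × ℕ} (hα : α ∈ index p q) :
    ∃ W₁ W₂ : Submodule ℂ (Fn p q), IsConstituent p q (a : ℂ) W₁ W₂ ∧
      kTypes (a : ℂ) W₁ W₂ = component p q a α := by
  set Ω₁ : Set (ℕ × ℕ) := {β | Reach p q a α β} with hΩ₁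
  set Ω₂ : Set (ℕ × ℕ) := {β | Reach p q a α β ∧ ¬ Reach p q a β α} with hΩ₂
  have hc₁ : TransClosed p q a Ω₁ := transClosed_reach α
  have hc₂ : TransClosed p q a Ω₂ := by
    intro β γ hβ hn hA hγ
    refine ⟨hc₁ β γ hβ.1 hn hA hγ, fun h => hβ.2 ?_⟩
    exact Relation.ReflTransGen.head ⟨hn, hA, VT_ne_bot_iff_mem.1 hγ⟩ h
  have hn₁ : ∀ β ∈ Ω₁, VT p q a β ≠ ⊥ := fun β hβ => VT_ne_bot_iff_mem.2 (Reach.mem_index hα hβ)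
  have hn₂ : ∀ β ∈ Ω₂, VT p q a β ≠ ⊥ := fun β hβ => hn₁ β hβ.1
  have ht₁ := types_NS hn₁
  have ht₂ := types_NS hn₂
  have hS₁ := hc₁.isSubmodule
  have hS₂ := hc₂.isSubmodule
  have hα₁ : α ∈ Ω₁ := Relation.ReflTransGen.refl
  refine ⟨_, _, ⟨hS₁, hS₂, ?_, fun W hW h2 h1 => ?_⟩, ?_⟩
  · refine lt_of_le_of_ne (le_of_types hS₂ hS₁ (by rw [ht₁, ht₂]; exact fun β hβ => hβ.1)) ?_
    intro he
    have : Ω₂ = Ω₁ := by rw [← ht₁, ← ht₂, he]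
    rw [← this] at hα₁
    exact hα₁.2 Relation.ReflTransGen.refl
  · have h2' : Ω₂ ⊆ types a W := by
      rw [← ht₂]
      exact types_mono h2
    have h1' : types a W ⊆ Ω₁ := by
      rw [← ht₁]
      exact types_mono h1
    by_cases hex : ∃ β ∈ types a W, Reach p q a β α
    · right
      obtain ⟨β, hβ, hβα⟩ := hex
      refine isSubmodule_eq_of_types hW hS₁ ?_
      rw [ht₁]
      refine h1'.antisymm fun γ hγ => ?_
      exact hW.transClosed.reach hβ (Relation.ReflTransGen.trans hβα hγ)
    · left
      push Not at hex
      refine isSubmodule_eq_of_types hW hS₂ ?_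
      rw [ht₂]
      exact Set.Subset.antisymm (fun γ hγ => ⟨h1' hγ, hex γ hγ⟩) h2'
  · ext β
    rw [mem_kTypes_iff, ht₁, ht₂]
    exact ⟨fun h => ⟨h.1, by_contra fun h' => h.2 ⟨h.1, h'⟩⟩, fun h => ⟨h.1, fun h' => h'.2 h.2⟩⟩

lemma isUnitary_iff_opposed {W₁ W₂ : Submodule ℂ (Fn p q)} (h₁ : IsSubmodule p q (a : ℂ) W₁)
    (h₂ : IsSubmodule p q (a : ℂ) W₂) :
    IsUnitary W₁ W₂ ↔ Opposed p q a (kTypes (a : ℂ) W₁ W₂) :=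
  ⟨fun h _ _ hn hα hβ => h.oppSign h₁ h₂ hn hα hβ, isUnitary_of_oppSign h₁ h₂⟩

lemma mem_unitaryKTypeSets {Ω : Set (ℕ × ℕ)} : Ω ∈ unitaryKTypeSets p q (a : ℂ) ↔
    ∃ α ∈ index p q, Ω = component p q a α ∧ Opposed p q a Ω := by
  constructor
  · rintro ⟨W₁, W₂, hc, hu, rfl⟩
    obtain ⟨α, hα, h⟩ := hc.kTypes_eq
    exact ⟨α, hα, h, (isUnitary_iff_opposed hc.top_sub hc.bot_sub).1 hu⟩
  · rintro ⟨α, hα, rfl, ho⟩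
    obtain ⟨W₁, W₂, hc, h⟩ := exists_isConstituent (a := a) hα
    refine ⟨W₁, W₂, hc, (isUnitary_iff_opposed hc.top_sub hc.bot_sub).2 ?_, h⟩
    rwa [h]

/-- The criterion for unitarity of a constituent. -/
lemma IsConstituent.isUnitary_iff {W₁ W₂ : Submodule ℂ (Fn p q)}
    (h : IsConstituent p q (a : ℂ) W₁ W₂) : IsUnitary W₁ W₂ ↔
      (∀ m n : ℕ, (m, n) ∈ kTypes (a : ℂ) W₁ W₂ → (m + 1, n + 1) ∈ kTypes (a : ℂ) W₁ W₂ →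
        App p q a m n / Amm p q a (m + 1) (n + 1) < 0) ∧
      (∀ m n : ℕ, 1 ≤ n → (m, n) ∈ kTypes (a : ℂ) W₁ W₂ →
        (m + 1, n - 1) ∈ kTypes (a : ℂ) W₁ W₂ →
        Apm p q a m n / Amp p q a (m + 1) (n - 1) < 0) := by
  rw [isUnitary_iff_opposed h.top_sub h.bot_sub]
  obtain ⟨γ, -, hγ⟩ := h.kTypes_eq
  rw [hγ]
  have hdiv : ∀ {α β : ℕ × ℕ}, Nb α β → α ∈ component p q a γ → β ∈ component p q a γ →
      (OppSign (AA p q a α β) (AA p q a β α) ↔ AA p q a α β / AA p q a β α < 0) := by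
    intro α β hn hα hβ
    refine ⟨fun ho => ?_, oppSign_of_div_neg⟩
    have h1 := ho.mul_neg ((hα.symm.trans hβ).AA_ne_zero hn)
    have h2 : AA p q a β α ≠ 0 := fun h => by rw [h, mul_zero] at h1; exact lt_irrefl _ h1
    rw [← mul_div_mul_right _ _ h2]
    exact div_neg_of_neg_of_pos h1 (mul_self_pos.2 h2)
  rw [opposed_iff_edges]
  refine and_congr (forall₂_congr fun m n => forall₂_congr fun h1 h2 => ?_)
    ⟨fun h m n hn h1 h2 => ?_, fun h m n h1 h2 => ?_⟩
  · rw [hdiv (nb_pp m n) h1 h2, AA_pp, AA_mm]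
  · obtain ⟨n, rfl⟩ := Nat.exists_eq_add_of_le' hn
    rw [Nat.add_sub_cancel] at h2 ⊢
    rw [← AA_pm, ← AA_mp, ← hdiv (nb_pm m n) h1 h2]
    exact h m n h1 h2
  · rw [hdiv (nb_pm m n) h1 h2, AA_pm, AA_mp]
    exact h m (n + 1) (Nat.le_add_left 1 n) h1 h2

end

section

/-! ### Components and unitarity for `p, q ≥ 2` -/

section Graph

variable {p q : ℕ} {a : ℝ}

lemma harmonicNonzero_of_two_le {n : ℕ} (hn : 2 ≤ n) (m : ℕ) : HarmonicNonzero n m := by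
  obtain ⟨k, rfl⟩ := Nat.exists_eq_add_of_le' hn
  have h01 : (1 : Fin (k + 2)) ≠ 0 := by simp
  set L : Pol (k + 2) := X 0 + C Complex.I * X 1 with hL
  have hd : ∀ j, pderiv j L = C ((if j = 0 then 1 else 0) + if j = 1 then Complex.I else 0) := by
    intro j
    rw [hL, map_add, MvPolynomial.pderiv_C_mul, map_add]
    congr 1
    · by_cases h : j = 0
      · subst h; simp
      · rw [MvPolynomial.pderiv_X_of_ne (Ne.symm h), if_neg h, map_zero]
    · by_cases h : j = 1
      · subst h; simp
      · rw [MvPolynomial.pderiv_X_of_ne (Ne.symm h), if_neg h, map_zero, mul_zero]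
  refine ⟨L ^ m, ⟨?_, ?_⟩, pow_ne_zero _ fun h => ?_⟩
  · have h1 : L.IsHomogeneous 1 := by
      refine (MvPolynomial.isHomogeneous_X _ _).add ?_
      simpa using (MvPolynomial.isHomogeneous_C (Fin (k + 2)) Complex.I).mul
        (MvPolynomial.isHomogeneous_X ℂ (1 : Fin (k + 2)))
    simpa using h1.pow m
  · have h2 : ∀ j, pderiv j (pderiv j (L ^ m)) =
        ((m : Pol (k + 2)) * ((m - 1 : ℕ) : Pol (k + 2)) * L ^ (m - 1 - 1)) *
          (pderiv j L * pderiv j L) := by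
      intro j
      rw [MvPolynomial.pderiv_pow, Derivation.leibniz, Derivation.leibniz,
        MvPolynomial.pderiv_pow, hd]
      simp only [MvPolynomial.pderiv_C, Derivation.map_natCast, smul_eq_mul, mul_zero, add_zero,
        zero_add]
      ring
    rw [Finset.sum_congr rfl fun j _ => h2 j, ← Finset.mul_sum]
    have h3 : ∑ j, pderiv j L * pderiv j L = 0 := by
      simp_rw [hd, ← map_mul, ← map_sum]
      rw [Fin.sum_univ_succ, Fin.sum_univ_succ]
      have h4 : ∀ i : Fin k, i.succ.succ ≠ 1 := fun i h => by
        have := congrArg Fin.val h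
        simp at this
      simp [h4]
    rw [h3, mul_zero]
  · have h1 := congrArg (MvPolynomial.eval (Pi.single 0 1 : Fin (k + 2) → ℂ)) h
    simp [hL] at h1

lemma index_eq_univ (hp : 2 ≤ p) (hq : 2 ≤ q) : index p q = Set.univ :=
  Set.eq_univ_of_forall fun α =>
    ⟨harmonicNonzero_of_two_le hp α.1, harmonicNonzero_of_two_le hq α.2⟩

lemma oppSign_sub_add {s f : ℝ} : OppSign (s - f) (s + f) ↔ |s| < |f| ∨ s = 0 ∧ f = 0 := by
  constructor
  · intro h
    by_cases h0 : s - f = 0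
    · have h1 : s + f = 0 := by
        by_contra hc
        exact h.ne_zero_iff.2 hc h0
      exact Or.inr ⟨by linarith, by linarith⟩
    · have := h.mul_neg h0
      exact Or.inl (sq_lt_sq.1 (by linarith))
  · rintro (h | ⟨rfl, rfl⟩)
    · have := sq_lt_sq.2 h
      have h1 : (s - f) * (s + f) < 0 := by linarith
      rcases mul_neg_iff.1 h1 with ⟨hx, hy⟩ | ⟨hx, hy⟩
      · exact ⟨-(s + f), s - f, by linarith, hx, by ring⟩
      · exact ⟨s + f, -(s - f), hy, by linarith, by ring⟩
    · exact ⟨1, 1, one_pos, one_pos, by ring⟩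

lemma sub_ne_zero_and_add_ne_zero {s f : ℝ} (h : |f| ≠ |s|) : s - f ≠ 0 ∧ s + f ≠ 0 :=
  ⟨fun h0 => h (by rw [sub_eq_zero.1 h0]), fun h0 => h (by
    rw [eq_neg_of_add_eq_zero_left h0, abs_neg])⟩

lemma conn_of_ne_zero {α β : ℕ × ℕ} (hn : Nb α β) (hα : α ∈ index p q) (hβ : β ∈ index p q)
    (h : AA p q a α β ≠ 0) (h' : AA p q a β α ≠ 0) : Conn p q a α β :=
  ⟨Relation.ReflTransGen.single ⟨hn, h, hβ⟩, Relation.ReflTransGen.single ⟨hn.symm, h', hα⟩⟩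

lemma opposed_iff {Ω : Set (ℕ × ℕ)} : Opposed p q a Ω ↔
    (∀ m n, (m, n) ∈ Ω → (m + 1, n + 1) ∈ Ω →
      |shift p q a| < |sumLevel p q (m, n)| ∨ shift p q a = 0 ∧ sumLevel p q (m, n) = 0) ∧
    (∀ m n, (m, n + 1) ∈ Ω → (m + 1, n) ∈ Ω →
      |shift p q a| < |diffLevel p q (m, n + 1)| ∨
        shift p q a = 0 ∧ diffLevel p q (m, n + 1) = 0) := by
  simp only [opposed_iff_edges, AA_pp_eq, AA_mm_eq, AA_pm_eq, AA_mp_eq, oppSign_sub_add]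

lemma opposed_of_lt {Ω : Set (ℕ × ℕ)}
    (h1 : ∀ α ∈ Ω, |shift p q a| < |sumLevel p q α|)
    (h2 : ∀ m n, (m, n + 1) ∈ Ω → (m + 1, n) ∈ Ω →
      |shift p q a| < |diffLevel p q (m, n + 1)|) : Opposed p q a Ω :=
  opposed_iff.2 ⟨fun _ _ h _ => Or.inl (h1 _ h), fun m n h h' => Or.inl (h2 m n h h')⟩

variable (hp : 2 ≤ p) (hq : 2 ≤ q)
include hp hq

lemma conn_pp {m n : ℕ} (h : |sumLevel p q (m, n)| ≠ |shift p q a|) :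
    Conn p q a (m, n) (m + 1, n + 1) := by
  have h1 := sub_ne_zero_and_add_ne_zero h
  refine conn_of_ne_zero (nb_pp m n) ?_ ?_ ?_ ?_
  · rw [index_eq_univ hp hq]; trivial
  · rw [index_eq_univ hp hq]; trivial
  · rw [AA_pp_eq]; exact h1.1
  · rw [AA_mm_eq]; exact h1.2

lemma conn_pm {m n : ℕ} (h : |diffLevel p q (m, n + 1)| ≠ |shift p q a|) :
    Conn p q a (m, n + 1) (m + 1, n) := by
  have h1 := sub_ne_zero_and_add_ne_zero h
  refine conn_of_ne_zero (nb_pm m n) ?_ ?_ ?_ ?_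
  · rw [index_eq_univ hp hq]; trivial
  · rw [index_eq_univ hp hq]; trivial
  · rw [AA_pm_eq]; exact h1.1
  · rw [AA_mp_eq]; exact h1.2

lemma one_le_sumLevel (α : ℕ × ℕ) : 1 ≤ sumLevel p q α := by
  have h1 : (2 : ℝ) ≤ p := by exact_mod_cast hp
  have h2 : (2 : ℝ) ≤ q := by exact_mod_cast hq
  have h3 := (Nat.cast_nonneg α.1 : (0 : ℝ) ≤ _)
  have h4 := (Nat.cast_nonneg α.2 : (0 : ℝ) ≤ _)
  rw [sumLevel]
  linarith

lemma abs_sumLevel (α : ℕ × ℕ) : |sumLevel p q α| = sumLevel p q α :=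
  abs_of_nonneg (zero_le_one.trans (one_le_sumLevel hp hq α))

lemma conn_up {m n : ℕ} (h : |shift p q a| < sumLevel p q (m, n)) (k : ℕ) :
    Conn p q a (m, n) (m + k, n + k) := by
  induction k with
  | zero => exact Conn.refl _
  | succ k ih =>
    refine ih.trans (conn_pp hp hq ?_)
    rw [abs_sumLevel hp hq]
    refine ne_of_gt (h.trans_le ?_)
    simp only [sumLevel]
    push_cast
    have := (Nat.cast_nonneg k : (0 : ℝ) ≤ _)
    linarith

lemma conn_diag (m n k : ℕ)
    (h : ∀ j < k, |offset p q (m, n + k) + 2 * j + 1| ≠ |shift p q a|) :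
    Conn p q a (m, n + k) (m + k, n) := by
  induction k generalizing m with
  | zero => exact Conn.refl _
  | succ k ih =>
    have h1 : Conn p q a (m, n + k + 1) (m + 1, n + k) := by
      refine conn_pm hp hq ?_
      simpa [diffLevel, add_assoc] using h 0 k.succ_pos
    have h2 := ih (m + 1) fun j hj => by
      have h3 := h (j + 1) (Nat.succ_lt_succ hj)
      convert h3 using 3
      simp only [offset]
      push_cast
      ring
    rw [show m + (k + 1) = m + 1 + k by ring]
    exact h1.trans h2

/-- Above the horizontal blocks, columns are connected unless a vertical block separates them. -/
lemma conn_of_levels {α β : ℕ × ℕ} (hα : |shift p q a| < sumLevel p q α)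
    (hβ : |shift p q a| < sumLevel p q β) {z : ℤ} (hz : offset p q β = offset p q α + 2 * z)
    (hv : ∀ y : ℤ, 0 ≤ y ∧ y < z ∨ z ≤ y ∧ y < 0 →
      |offset p q α + 2 * y + 1| ≠ |shift p q a|) : Conn p q a α β := by
  have key : ∀ {α β : ℕ × ℕ} {J : ℕ}, |shift p q a| < sumLevel p q α →
      |shift p q a| < sumLevel p q β → offset p q β = offset p q α + 2 * J →
      (∀ j < J, |offset p q α + 2 * j + 1| ≠ |shift p q a|) → Conn p q a α β := by
    rintro ⟨m, n⟩ ⟨m', n'⟩ J hα hβ hJ hv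
    have h1 : m' + n = m + n' + 2 * J := by
      simp only [offset] at hJ
      have : (m' + n : ℝ) = m + n' + 2 * J := by linarith
      exact_mod_cast this
    have h2 := conn_up hp hq hα (J + n')
    have h3 := conn_up hp hq hβ n
    have h4 : Conn p q a (m + (J + n'), n + n' + J) (m + (J + n') + J, n + n') := by
      refine conn_diag hp hq _ _ _ fun j hj => ?_
      convert hv j hj using 3
      simp only [offset]
      push_cast
      ring
    rw [show n + n' + J = n + (J + n') by ring] at h4
    rw [show m' + n = m + (J + n') + J by omega, show n' + n = n + n' by ring] at h3
    exact (h2.trans h4).trans h3.symm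
  obtain ⟨J, rfl | rfl⟩ := z.eq_nat_or_neg
  · refine key hα hβ (by simpa using hz) fun j hj => ?_
    exact_mod_cast hv j (Or.inl ⟨by positivity, by exact_mod_cast hj⟩)
  · push_cast at hz
    refine (key (J := J) hβ hα (by linarith) fun j hj => ?_).symm
    have := hv (-J + j) (Or.inr ⟨by omega, by omega⟩)
    convert this using 3
    rw [hz]
    push_cast
    ring

lemma exists_mem_column (α : ℕ × ℕ) (z : ℤ) : ∃ m n : ℕ,
    offset p q (m + 1, n + 1) = offset p q α + 2 * z ∧
      |shift p q a| < sumLevel p q (m + 1, n + 1) := by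
  obtain ⟨N, hN⟩ := exists_nat_gt |shift p q a|
  obtain ⟨J, rfl | rfl⟩ := z.eq_nat_or_neg
  · refine ⟨α.1 + N + 2 * J, α.2 + N, ?_, ?_⟩
    · simp only [offset]; push_cast; ring
    · refine hN.trans_le ?_
      have h1 := one_le_sumLevel hp hq α
      simp only [sumLevel] at h1 ⊢
      push_cast
      have h2 := (Nat.cast_nonneg J : (0 : ℝ) ≤ _)
      have h3 := (Nat.cast_nonneg N : (0 : ℝ) ≤ _)
      linarith
  · refine ⟨α.1 + N, α.2 + N + 2 * J, ?_, ?_⟩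
    · simp only [offset]; push_cast; ring
    · refine hN.trans_le ?_
      have h1 := one_le_sumLevel hp hq α
      simp only [sumLevel] at h1 ⊢
      push_cast
      have h2 := (Nat.cast_nonneg J : (0 : ℝ) ≤ _)
      have h3 := (Nat.cast_nonneg N : (0 : ℝ) ≤ _)
      linarith

/-! #### Components that carry opposite signs -/

lemma lt_sumLevel_add (α : ℕ × ℕ) : |offset p q α| + 1 ≤ sumLevel p q α := by
  have h1 : (2 : ℝ) ≤ p := by exact_mod_cast hp
  have h2 : (2 : ℝ) ≤ q := by exact_mod_cast hq
  have h3 := (Nat.cast_nonneg α.1 : (0 : ℝ) ≤ _)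
  have h4 := (Nat.cast_nonneg α.2 : (0 : ℝ) ≤ _)
  have : |offset p q α| ≤ sumLevel p q α - 1 := by
    rw [abs_le, sumLevel, offset]
    constructor <;> linarith
  linarith

/-- The right-hand constituents. -/
lemma rightWing_spec {c : ℝ} (hc : c - 1 = shift p q a ∨ c - 1 = -shift p q a)
    (hc' : |shift p q a| < c + 1) {α : ℕ × ℕ} (hα : α ∈ rightWing p q c) :
    rightWing p q c = component p q a α ∧ Opposed p q a (rightWing p q c) := by
  have hc0 : 0 ≤ c := by
    rcases hc with h | h <;> rcases abs_lt.1 hc' with ⟨h1, h2⟩ <;> linarith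
  have hge : ∀ β ∈ rightWing p q c, c ≤ offset p q β := by
    rintro β ⟨k, hk⟩
    have := (Nat.cast_nonneg k : (0 : ℝ) ≤ _)
    linarith
  have hσ : ∀ β ∈ rightWing p q c, |shift p q a| < sumLevel p q β := fun β hβ => by
    have h1 := hge β hβ
    have h2 := lt_sumLevel_add hp hq β
    rw [abs_of_nonneg (hc0.trans h1)] at h2
    linarith
  refine ⟨Set.ext fun β => ⟨fun hβ => ?_, fun hβ => ?_⟩, ?_⟩
  · obtain ⟨k, hk⟩ := id hα
    obtain ⟨l, hl⟩ := id hβ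
    refine conn_of_levels hp hq (hσ α hα) (hσ β hβ) (z := l - k)
      (by rw [hk, hl]; push_cast; ring) fun y hy => ?_
    have h1 : (0 : ℝ) ≤ k + y := by
      have : (0 : ℤ) ≤ k + y := by omega
      exact_mod_cast this
    rw [hk, abs_of_nonneg (by linarith)]
    exact ne_of_gt (by linarith)
  · obtain ⟨k, hk⟩ := hα
    have hk0 := (Nat.cast_nonneg k : (0 : ℝ) ≤ _)
    have hz : ∃ z : ℤ, diffLevel p q α = (c - 1) + 2 * z :=
      ⟨k + 1, by rw [diffLevel, hk]; push_cast; ring⟩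
    have h1 := isLevel_diffLevel.le_iff hβ hc hz
    obtain ⟨z, hz'⟩ := isLevel_diffLevel.reach_congr hβ.1 hz
    have h2 : ¬ diffLevel p q β ≤ c - 1 := by
      rw [← h1, diffLevel, hk]
      linarith
    rw [hz'] at h2
    have h3 : (0 : ℝ) < z := by linarith
    have h4 : 0 < z := by exact_mod_cast h3
    obtain ⟨l, rfl⟩ : ∃ l : ℕ, z = l + 1 := ⟨(z - 1).toNat, by omega⟩
    refine ⟨l, ?_⟩
    rw [diffLevel] at hz'
    push_cast at hz'
    linarith
  · refine opposed_of_lt (fun β hβ => ?_) fun m n h _ => ?_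
    · rw [abs_sumLevel hp hq]; exact hσ β hβ
    · have := hge _ h
      rw [diffLevel]
      exact lt_of_lt_of_le (by linarith) (le_abs_self _)

/-- The left-hand constituents. -/
lemma leftWing_spec {c : ℝ} (hc : c - 1 = shift p q a ∨ c - 1 = -shift p q a)
    (hc' : |shift p q a| < c + 1) {α : ℕ × ℕ} (hα : α ∈ leftWing p q c) :
    leftWing p q c = component p q a α ∧ Opposed p q a (leftWing p q c) := by
  have hc0 : 0 ≤ c := by
    rcases hc with h | h <;> rcases abs_lt.1 hc' with ⟨h1, h2⟩ <;> linarith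
  have hge : ∀ β ∈ leftWing p q c, offset p q β ≤ -c := by
    rintro β ⟨k, hk⟩
    have := (Nat.cast_nonneg k : (0 : ℝ) ≤ _)
    linarith
  have hσ : ∀ β ∈ leftWing p q c, |shift p q a| < sumLevel p q β := fun β hβ => by
    have h1 := hge β hβ
    have h2 := lt_sumLevel_add hp hq β
    rw [abs_of_nonpos (by linarith)] at h2
    linarith
  refine ⟨Set.ext fun β => ⟨fun hβ => ?_, fun hβ => ?_⟩, ?_⟩
  · obtain ⟨k, hk⟩ := id hα
    obtain ⟨l, hl⟩ := id hβ
    refine conn_of_levels hp hq (hσ α hα) (hσ β hβ) (z := k - l)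
      (by rw [hk, hl]; push_cast; ring) fun y hy => ?_
    have h1 : (y : ℝ) + 1 ≤ k := by
      have : y + 1 ≤ k := by omega
      exact_mod_cast this
    rw [hk, abs_of_nonpos (by linarith)]
    exact ne_of_gt (by linarith)
  · obtain ⟨k, hk⟩ := hα
    have hk0 := (Nat.cast_nonneg k : (0 : ℝ) ≤ _)
    have hz : ∃ z : ℤ, diffLevel p q α = (1 - c) + 2 * z :=
      ⟨-k, by rw [diffLevel, hk]; push_cast; ring⟩
    have h1 := isLevel_diffLevel.le_iff (τ := 1 - c) hβ
      (by rcases hc with h | h <;> [right; left] <;> linarith) hz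
    obtain ⟨z, hz'⟩ := isLevel_diffLevel.reach_congr hβ.1 hz
    have h2 : diffLevel p q β ≤ 1 - c := by
      rw [← h1, diffLevel, hk]
      linarith
    rw [hz'] at h2
    have h3 : (z : ℝ) ≤ 0 := by linarith
    have h4 : z ≤ 0 := by exact_mod_cast h3
    obtain ⟨l, rfl⟩ : ∃ l : ℕ, z = -l := ⟨(-z).toNat, by omega⟩
    refine ⟨l, ?_⟩
    rw [diffLevel] at hz'
    push_cast at hz'
    linarith
  · refine opposed_of_lt (fun β hβ => ?_) fun m n _ h => ?_
    · rw [abs_sumLevel hp hq]; exact hσ β hβ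
    · have := hge _ h
      have h1 : diffLevel p q (m, n + 1) = offset p q (m + 1, n) - 1 := by
        simp only [diffLevel, offset]; push_cast; ring
      rw [h1]
      exact lt_of_lt_of_le (by linarith) (neg_le_abs _)

end Graph

end

section

/-- The positions of a unitary component outside the wings `u = ±(h + 1 + 2k)`. -/
def Central (h u : ℝ) : Prop :=
  (h = 1 ∧ u = 0) ∨
  (h ≤ 1 ∧ (∃ k : ℕ, u = h - 1 - 2 * k) ∧ ¬ ∃ z : ℤ, u = -(h + 1 + 2 * z)) ∨
  (h ≤ 1 ∧ (∃ k : ℕ, u = 1 - h + 2 * k) ∧ ¬ ∃ z : ℤ, u = h + 1 + 2 * z) ∨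
  ((¬ ∃ z : ℤ, u = h + 1 + 2 * z) ∧ (¬ ∃ z : ℤ, u = -(h + 1 + 2 * z)) ∧
    ∀ z : ℤ, h ≤ |u + 2 * z + 1|)

section Lists

variable {p q : ℕ} {a : ℝ} (hp : 2 ≤ p) (hq : 2 ≤ q)
include hp hq

lemma zeroColumn_spec (h : |shift p q a| = 1) {Ω : Set (ℕ × ℕ)}
    (hΩ : Ω = {x | offset p q x = 0 ∧ ¬ (p = 2 ∧ q = 2 ∧ x = (0, 0))}) {α : ℕ × ℕ} (hα : α ∈ Ω) :
    Ω = component p q a α ∧ Opposed p q a Ω := by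
  have hτ : 1 = shift p q a ∨ 1 = -shift p q a := by
    rcases abs_choice (shift p q a) with h1 | h1 <;> rw [h1] at h <;> [left; right] <;> exact h.symm
  have hσ : ∀ β : ℕ × ℕ, ¬ (p = 2 ∧ q = 2 ∧ β = (0, 0)) → 1 < sumLevel p q β := by
    rintro ⟨m, n⟩ hβ
    by_contra hc
    refine hβ ?_
    simp only [sumLevel, not_lt] at hc
    have : 2 * (m + n) + p + q ≤ 4 := by
      have : (2 * (m + n) + p + q : ℝ) ≤ 4 := by linarith
      exact_mod_cast this
    refine ⟨by omega, by omega, ?_⟩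
    rw [Prod.mk.injEq]
    omega
  have hα0 : offset p q α = 0 := by rw [hΩ] at hα; exact hα.1
  have hα1 : ¬ (p = 2 ∧ q = 2 ∧ α = (0, 0)) := by rw [hΩ] at hα; exact hα.2
  refine ⟨Set.ext fun β => ⟨fun hβ => ?_, fun hβ => ?_⟩, opposed_of_lt (fun β hβ => ?_)
    fun m n h1 h2 => ?_⟩
  · rw [hΩ] at hβ
    refine conn_of_levels hp hq (z := 0) (by rw [h]; exact hσ α hα1) (by rw [h]; exact hσ β hβ.2)
      (by rw [hα0, hβ.1]; simp) fun y hy => by omega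
  · have hz : ∃ z : ℤ, diffLevel p q α = 1 + 2 * z := ⟨0, by rw [diffLevel, hα0]; simp⟩
    have hz' : ∃ z : ℤ, diffLevel p q α = -1 + 2 * z :=
      ⟨1, by rw [diffLevel, hα0]; norm_num⟩
    have h1 := isLevel_diffLevel.le_iff hβ hτ hz
    have h2 := isLevel_diffLevel.le_iff hβ
      (by rcases hτ with h | h <;> [right; left] <;> linarith) hz'
    obtain ⟨z, h3⟩ := isLevel_diffLevel.reach_congr hβ.1 hz
    rw [diffLevel, hα0] at h1 h2
    have h4 := h1.1 (by norm_num)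
    have h5 : ¬ diffLevel p q β ≤ -1 := fun hc => absurd (h2.2 hc) (by norm_num)
    rw [h3] at h4 h5
    have h6 : (z : ℝ) ≤ 0 := by linarith
    have h7 : (-1 : ℝ) < z := by
      by_contra hc
      exact h5 (by linarith)
    have h8 : z ≤ 0 := by exact_mod_cast h6
    have h9 : -1 < z := by exact_mod_cast h7
    obtain rfl : z = 0 := by omega
    rw [diffLevel] at h3
    rw [hΩ]
    refine ⟨by push_cast at h3; linarith, ?_⟩
    rintro ⟨rfl, rfl, rfl⟩
    have h10 : sumLevel 2 2 (0, 0) = 1 := by norm_num [sumLevel]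
    have h11 := isLevel_sumLevel.le_iff hβ.symm hτ ⟨0, by rw [h10]; simp⟩
    exact absurd (h11.1 h10.le) (not_le.2 (hσ α hα1))
  · rw [h, abs_sumLevel hp hq]
    rw [hΩ] at hβ
    exact hσ β hβ.2
  · rw [hΩ] at h1 h2
    have h3 := h1.1
    have h4 := h2.1
    simp only [offset] at h3 h4
    push_cast at h3 h4
    linarith

lemma parity_spec {e : ℕ} (h1 : |shift p q a| < 1)
    (h2 : ∀ α ∈ parity e, ∀ z : ℤ, |shift p q a| < |offset p q α + 2 * z + 1|) {α : ℕ × ℕ}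
    (hα : α ∈ parity e) : parity e = component p q a α ∧ Opposed p q a (parity e) := by
  have hσ := fun β => h1.trans_le (one_le_sumLevel hp hq β)
  refine ⟨Set.ext fun β => ⟨fun hβ => ?_, fun hβ => ?_⟩, opposed_of_lt (fun β hβ => ?_)
    fun m n h _ => ?_⟩
  · have h3 : α.1 + α.2 ≡ β.1 + β.2 [MOD 2] := Nat.ModEq.trans hα (Nat.ModEq.symm hβ)
    obtain ⟨z, hz⟩ : ∃ z : ℤ, (β.1 : ℤ) - β.2 = α.1 - α.2 + 2 * z :=
      ⟨((β.1 : ℤ) - β.2 - (α.1 - α.2)) / 2, by rw [Nat.ModEq] at h3; omega⟩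
    refine conn_of_levels hp hq (hσ α) (hσ β) (z := z) ?_ fun y _ => (h2 α hα y).ne'
    have : (β.1 : ℝ) - β.2 = α.1 - α.2 + 2 * z := by exact_mod_cast hz
    rw [offset, offset]
    linarith
  · obtain ⟨z, hz⟩ := isLevel_sumLevel.reach_congr hβ.1 (τ := sumLevel p q α) ⟨0, by simp⟩
    have h3 : (β.1 + β.2 : ℤ) = α.1 + α.2 + 2 * z := by
      simp only [sumLevel] at hz
      have : (β.1 + β.2 : ℝ) = α.1 + α.2 + 2 * z := by linarith
      exact_mod_cast this
    refine Nat.ModEq.trans ?_ hα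
    rw [Nat.ModEq]
    omega
  · rw [abs_sumLevel hp hq]; exact hσ β
  · simpa [diffLevel] using h2 _ h 0

omit hp hq in
lemma origin_spec (h : |shift p q a| = sumLevel p q (0, 0)) :
    {(0, 0)} = component p q a (0, 0) ∧ Opposed p q a {(0, 0)} := by
  have hτ : |shift p q a| = shift p q a ∨ |shift p q a| = -shift p q a := abs_choice _
  refine ⟨Set.ext fun β => ⟨fun hβ => ?_, fun hβ => ?_⟩, fun α β hn hα hβ => ?_⟩
  · rw [Set.mem_singleton_iff.1 hβ]
    exact Conn.refl _
  · have h1 := (isLevel_sumLevel.le_iff hβ hτ ⟨0, by rw [h]; simp⟩).1 h.ge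
    rw [h] at h1
    simp only [sumLevel, Nat.cast_zero] at h1
    have h2 : β.1 + β.2 ≤ 0 := by
      have : (β.1 + β.2 : ℝ) ≤ 0 := by linarith
      exact_mod_cast this
    rw [Set.mem_singleton_iff, Prod.ext_iff]
    exact ⟨by simp only; omega, by simp only; omega⟩
  · rw [Set.mem_singleton_iff.1 hα, Set.mem_singleton_iff.1 hβ] at hn
    exact absurd rfl hn.ne

section Opposed

variable {α : ℕ × ℕ} (ho : Opposed p q a (component p q a α))
include ho

lemma Opposed.le_sumLevel {β : ℕ × ℕ} (hβ : Conn p q a α β) : |shift p q a| ≤ sumLevel p q β := by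
  by_contra hc
  rw [not_le] at hc
  have h1 : |sumLevel p q β| < |shift p q a| := by rwa [abs_sumLevel hp hq]
  rcases (opposed_iff.1 ho).1 β.1 β.2 hβ (hβ.trans (conn_pp hp hq h1.ne)) with h | h
  · exact lt_asymm h h1
  · rw [h.1, abs_zero] at h1
    exact absurd (abs_nonneg _) (not_le.2 h1)

lemma Opposed.le_diffLevel {m n : ℕ} (h : Conn p q a α (m, n + 1) ∨ Conn p q a α (m + 1, n)) :
    |shift p q a| ≤ |diffLevel p q (m, n + 1)| := by
  by_contra hc
  rw [not_le] at hc
  have h1 := conn_pm hp hq hc.ne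
  have h2 : Conn p q a α (m, n + 1) := h.elim id fun h => h.trans h1.symm
  rcases (opposed_iff.1 ho).2 m n h2 (h2.trans h1) with h | h
  · exact lt_asymm h hc
  · rw [h.1, abs_zero] at hc
    exact absurd (abs_nonneg _) (not_le.2 hc)

lemma Opposed.lt_sumLevel_or :
    |shift p q a| < sumLevel p q α ∨ α = (0, 0) ∧ |shift p q a| = sumLevel p q (0, 0) := by
  have hp0 : (2 : ℝ) ≤ p := by exact_mod_cast hp
  have hq0 : (2 : ℝ) ≤ q := by exact_mod_cast hq
  rcases (Opposed.le_sumLevel hp hq ho (Conn.refl α)).lt_or_eq with h | h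
  · exact Or.inl h
  right
  obtain ⟨m, n⟩ := α
  rcases m with _ | m <;> rcases n with _ | n
  · exact ⟨rfl, h⟩
  · exfalso
    have h1 := Opposed.le_diffLevel hp hq ho (m := 0) (n := n) (Or.inl (Conn.refl _))
    have hn := (Nat.cast_nonneg n : (0 : ℝ) ≤ _)
    rw [h] at h1
    refine absurd h1 (not_le.2 (abs_lt.2 ?_))
    simp only [diffLevel, offset, sumLevel]
    push_cast
    constructor <;> linarith
  · exfalso
    have h1 := Opposed.le_diffLevel hp hq ho (m := m) (n := 0) (Or.inr (Conn.refl _))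
    have hm := (Nat.cast_nonneg m : (0 : ℝ) ≤ _)
    rw [h] at h1
    refine absurd h1 (not_le.2 (abs_lt.2 ?_))
    simp only [diffLevel, offset, sumLevel]
    push_cast
    constructor <;> linarith
  · exfalso
    have h1 : sumLevel p q (m + 1, n + 1) = sumLevel p q (m, n) + 2 := by
      simp only [sumLevel]; push_cast; ring
    have h2 : Conn p q a (m, n) (m + 1, n + 1) := conn_pp hp hq (by
      rw [abs_sumLevel hp hq]; exact ne_of_lt (by linarith))
    have := Opposed.le_sumLevel hp hq ho h2.symm
    linarith

lemma Opposed.gap (hα : |shift p q a| < sumLevel p q α) {z : ℤ}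
    (hv : ∀ y : ℤ, 0 ≤ y ∧ y < z ∨ z ≤ y ∧ y < 0 →
      |offset p q α + 2 * y + 1| ≠ |shift p q a|) :
    |shift p q a| ≤ |offset p q α + 2 * z + 1| ∧ |shift p q a| ≤ |offset p q α + 2 * z - 1| := by
  obtain ⟨m, n, h1, h2⟩ := exists_mem_column (a := a) hp hq α z
  have hc := conn_of_levels hp hq hα h2 h1 hv
  have h3 := Opposed.le_diffLevel hp hq ho (m := m + 1) (n := n) (Or.inl hc)
  have h4 := Opposed.le_diffLevel hp hq ho (m := m) (n := n + 1) (Or.inr hc)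
  rw [← h1]
  refine ⟨h3, ?_⟩
  convert h4 using 2
  simp only [diffLevel, offset]
  push_cast
  ring

lemma Opposed.classify (hα : |shift p q a| < sumLevel p q α) :
    (∃ k : ℕ, offset p q α = |shift p q a| + 1 + 2 * k) ∨
    (∃ k : ℕ, offset p q α = -(|shift p q a| + 1 + 2 * k)) ∨
    Central |shift p q a| (offset p q α) := by
  have hgap := fun z => Opposed.gap hp hq ho hα (z := z)
  set h := |shift p q a| with hh
  have h0 : 0 ≤ h := abs_nonneg _
  set u := offset p q α with hu
  have hne : ∀ {y : ℤ}, (¬ ∃ z : ℤ, u = h + 1 + 2 * z) ∨ u + 2 * y + 1 < h →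
      (¬ ∃ z : ℤ, u = -(h + 1 + 2 * z)) ∨ -h < u + 2 * y + 1 → |u + 2 * y + 1| ≠ h := by
    intro y hP hN hc
    rcases abs_choice (u + 2 * y + 1) with h1 | h1 <;> rw [h1] at hc
    · rcases hP with hP | hP
      · exact hP ⟨-y - 1, by push_cast; linarith⟩
      · exact hP.ne hc
    · rcases hN with hN | hN
      · exact hN ⟨y, by linarith⟩
      · linarith
  by_cases hP : ∃ z : ℤ, u = h + 1 + 2 * z <;> by_cases hN : ∃ z : ℤ, u = -(h + 1 + 2 * z)
  · obtain ⟨z, hz⟩ := hP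
    obtain ⟨z', hz'⟩ := hN
    rcases le_or_gt 0 z with h1 | h1
    · exact Or.inl ⟨z.toNat, by rw [hz]; congr 2; exact_mod_cast (Int.toNat_of_nonneg h1).symm⟩
    rcases le_or_gt 0 z' with h2 | h2
    · refine Or.inr (Or.inl ⟨z'.toNat, ?_⟩)
      rw [hz']; congr 3; exact_mod_cast (Int.toNat_of_nonneg h2).symm
    have h1' : (z : ℝ) ≤ -1 := by
      have : z ≤ -1 := by omega
      exact_mod_cast this
    have h2' : (z' : ℝ) ≤ -1 := by
      have : z' ≤ -1 := by omega
      exact_mod_cast this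
    have h3 := hgap 0 fun y hy => by omega
    simp only [Int.cast_zero, mul_zero, add_zero] at h3
    have h4 := le_abs.1 h3.1
    have h5 := le_abs.1 h3.2
    refine Or.inr (Or.inr (Or.inl ?_))
    rcases h4 with h4 | h4 <;> rcases h5 with h5 | h5 <;> constructor <;> linarith
  · obtain ⟨z, hz⟩ := hP
    rcases le_or_gt 0 z with h1 | h1
    · exact Or.inl ⟨z.toNat, by rw [hz]; congr 2; exact_mod_cast (Int.toNat_of_nonneg h1).symm⟩
    have h3 := (hgap (-1 - z) fun y hy => hne (Or.inr (by
      have : (y : ℝ) + 1 ≤ -1 - z := by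
        have : y + 1 ≤ -1 - z := by omega
        exact_mod_cast this
      rw [hz]; linarith)) (Or.inl hN)).2
    have h4 : u + 2 * ((-1 - z : ℤ) : ℝ) - 1 = h - 2 := by rw [hz]; push_cast; ring
    rw [h4] at h3
    refine Or.inr (Or.inr (Or.inr (Or.inl ⟨?_, ⟨(-1 - z).toNat, ?_⟩, hN⟩)))
    · rcases le_abs.1 h3 with h3 | h3 <;> linarith
    · have h5 : (((-1 - z).toNat : ℤ) : ℝ) = ((-1 - z : ℤ) : ℝ) := by
        rw [Int.toNat_of_nonneg (by omega)]
      rw [Int.cast_natCast] at h5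
      rw [h5, hz]; push_cast; ring
  · obtain ⟨z, hz⟩ := hN
    rcases le_or_gt 0 z with h1 | h1
    · refine Or.inr (Or.inl ⟨z.toNat, ?_⟩)
      rw [hz]; congr 3; exact_mod_cast (Int.toNat_of_nonneg h1).symm
    have h3 := (hgap (z + 1) fun y hy => hne (Or.inl hP) (Or.inr (by
      have : (z : ℝ) + 1 ≤ y := by
        have : z + 1 ≤ y := by omega
        exact_mod_cast this
      rw [hz]; linarith))).1
    have h4 : u + 2 * ((z + 1 : ℤ) : ℝ) + 1 = 2 - h := by rw [hz]; push_cast; ring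
    rw [h4] at h3
    refine Or.inr (Or.inr (Or.inr (Or.inr (Or.inl ⟨?_, ⟨(-1 - z).toNat, ?_⟩, hP⟩))))
    · rcases le_abs.1 h3 with h3 | h3 <;> linarith
    · have h5 : (((-1 - z).toNat : ℤ) : ℝ) = ((-1 - z : ℤ) : ℝ) := by
        rw [Int.toNat_of_nonneg (by omega)]
      rw [Int.cast_natCast] at h5
      rw [h5, hz]; push_cast; ring
  · exact Or.inr (Or.inr (Or.inr (Or.inr (Or.inr ⟨hP, hN, fun z =>
      (hgap z fun y _ => hne (Or.inl hP) (Or.inl hN)).1⟩))))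

end Opposed

end Lists

end

section

section Arithmetic

variable {p q : ℕ} {a : ℝ}

lemma offset_eq (α : ℕ × ℕ) :
    offset p q α = (((α.1 : ℤ) - α.2 : ℤ) : ℝ) + ((p : ℝ) - q) / 2 := by
  rw [offset]
  push_cast
  ring

lemma exists_offset_eq (j : ℤ) : ∃ α : ℕ × ℕ, offset p q α = j + ((p : ℝ) - q) / 2 := by
  refine ⟨(j.toNat, (-j).toNat), ?_⟩
  rw [offset_eq]
  congr 2
  simp only
  omega

lemma integral_iff :
    (∃ k : ℤ, a = k) ↔ ∃ j : ℤ, |shift p q a| + 1 = j + ((p : ℝ) - q) / 2 := by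
  rcases abs_choice (shift p q a) with h | h <;> rw [h, shift]
  · constructor
    · rintro ⟨k, rfl⟩
      exact ⟨k + q, by push_cast; ring⟩
    · rintro ⟨j, hj⟩
      exact ⟨j - q, by push_cast; linarith⟩
  · constructor
    · rintro ⟨k, rfl⟩
      exact ⟨2 - k - p, by push_cast; ring⟩
    · rintro ⟨j, hj⟩
      exact ⟨2 - j - p, by push_cast; linarith⟩

lemma integral_iff' :
    (∃ k : ℤ, a = k) ↔ ∃ j : ℤ, -(|shift p q a| + 1) = j + ((p : ℝ) - q) / 2 := by
  rw [integral_iff (p := p) (q := q)]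
  constructor
  · rintro ⟨j, hj⟩
    exact ⟨-j - p + q, by push_cast; linarith⟩
  · rintro ⟨j, hj⟩
    exact ⟨-j - p + q, by push_cast; linarith⟩

lemma abs_shift_eq_iff (h : 2 ≤ p + q) :
    |shift p q a| = sumLevel p q (0, 0) ↔ a = 0 ∨ a = 2 - (p : ℝ) - q := by
  have h2 : (2 : ℝ) ≤ p + q := by exact_mod_cast h
  rw [abs_eq (by simp only [sumLevel, Nat.cast_zero]; linarith)]
  simp only [sumLevel, shift, Nat.cast_zero]
  constructor <;> rintro (h | h) <;> [left; right; left; right] <;> linarith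

lemma exists_offset_even {d : ℤ} (hd : (p : ℤ) - q = 2 * d) (α : ℕ × ℕ) :
    offset p q α = (((α.1 : ℤ) - α.2 + d : ℤ) : ℝ) := by
  have : (p : ℝ) - q = 2 * d := by exact_mod_cast hd
  rw [offset_eq, this]
  push_cast
  ring

lemma exists_offset_odd {d : ℤ} (hd : (p : ℤ) - q = 2 * d + 1) (α : ℕ × ℕ) :
    offset p q α = (((α.1 : ℤ) - α.2 + d : ℤ) : ℝ) + 1 / 2 := by
  have : (p : ℝ) - q = 2 * d + 1 := by exact_mod_cast hd
  rw [offset_eq, this]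
  push_cast
  ring

lemma one_le_abs_level_even {e : ℕ} (he : (2 * e : ℤ) ≡ (p : ℤ) - q [ZMOD 4]) {α : ℕ × ℕ}
    (hα : α ∈ parity e) (z : ℤ) : 1 ≤ |offset p q α + 2 * z + 1| := by
  obtain ⟨d, hd⟩ : ∃ d : ℤ, (p : ℤ) - q = 2 * d := ⟨((p : ℤ) - q) / 2, by
    rw [Int.ModEq] at he; omega⟩
  have h : α.1 + α.2 ≡ e [MOD 2] := hα
  rw [Nat.ModEq] at h
  rw [Int.ModEq] at he
  rw [exists_offset_even hd]
  have h1 : (α.1 : ℤ) - α.2 + d + 2 * z + 1 ≠ 0 := by omega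
  have := Int.one_le_abs h1
  exact_mod_cast this

lemma half_le_abs_add_half (w : ℤ) : (1 : ℝ) / 2 ≤ |(w : ℝ) + 1 / 2| := by
  have h1 : 2 * w + 1 ≠ 0 := by omega
  have h2 : (1 : ℝ) ≤ |((2 * w + 1 : ℤ) : ℝ)| := by exact_mod_cast Int.one_le_abs h1
  have h3 : ((2 * w + 1 : ℤ) : ℝ) = 2 * ((w : ℝ) + 1 / 2) := by push_cast; ring
  rw [h3, abs_mul, abs_of_pos (by norm_num : (0 : ℝ) < 2)] at h2
  linarith

lemma half_le_abs_level_odd {d : ℤ} (hd : (p : ℤ) - q = 2 * d + 1) (α : ℕ × ℕ) (z : ℤ) :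
    1 / 2 ≤ |offset p q α + 2 * z + 1| := by
  rw [exists_offset_odd hd]
  convert half_le_abs_add_half ((α.1 : ℤ) - α.2 + d + 2 * z + 1) using 2
  push_cast
  ring

end Arithmetic

variable {p q : ℕ} {a : ℝ} [NeZero p] [NeZero q]

lemma mem_unitaryKTypeSets_of_spec (hp : 2 ≤ p) (hq : 2 ≤ q) {α : ℕ × ℕ} {Ω : Set (ℕ × ℕ)}
    (h : Ω = component p q a α ∧ Opposed p q a Ω) : Ω ∈ unitaryKTypeSets p q (a : ℂ) :=
  mem_unitaryKTypeSets.2 ⟨α, by rw [index_eq_univ hp hq]; trivial, h⟩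

lemma wing_mem (hp : 2 ≤ p) (hq : 2 ≤ q) (ha : ∃ k : ℤ, a = k) {Ω : Set (ℕ × ℕ)}
    (h : Ω = rightWing p q (|shift p q a| + 1) ∨ Ω = leftWing p q (|shift p q a| + 1)) :
    Ω ∈ unitaryKTypeSets p q (a : ℂ) := by
  have hc : |shift p q a| + 1 - 1 = shift p q a ∨ |shift p q a| + 1 - 1 = -shift p q a := by
    rw [add_sub_cancel_right]
    exact abs_choice _
  rcases h with rfl | rfl
  · obtain ⟨j, hj⟩ := (integral_iff (p := p) (q := q)).1 ha
    obtain ⟨α, hα⟩ := exists_offset_eq (p := p) (q := q) j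
    exact mem_unitaryKTypeSets_of_spec hp hq (rightWing_spec (α := α) hp hq hc (by linarith)
      ⟨0, by rw [hα, hj]; simp⟩)
  · obtain ⟨j, hj⟩ := (integral_iff' (p := p) (q := q)).1 ha
    obtain ⟨α, hα⟩ := exists_offset_eq (p := p) (q := q) j
    exact mem_unitaryKTypeSets_of_spec hp hq (leftWing_spec (α := α) hp hq hc (by linarith)
      ⟨0, by rw [hα, ← hj]; simp⟩)

/-- Wings, origin, or one of the cases without a wing. -/
lemma unitary_cases (hp : 2 ≤ p) (hq : 2 ≤ q) {Ω : Set (ℕ × ℕ)}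
    (h : Ω ∈ unitaryKTypeSets p q (a : ℂ)) :
    ((∃ k : ℤ, a = k) ∧
      (Ω = rightWing p q (|shift p q a| + 1) ∨ Ω = leftWing p q (|shift p q a| + 1))) ∨
    ((a = 0 ∨ a = 2 - (p : ℝ) - q) ∧ Ω = {(0, 0)}) ∨
    ∃ α, Ω = component p q a α ∧ |shift p q a| < sumLevel p q α ∧
      Central |shift p q a| (offset p q α) := by
  obtain ⟨α, -, rfl, ho⟩ := mem_unitaryKTypeSets.1 h
  have hc : |shift p q a| + 1 - 1 = shift p q a ∨ |shift p q a| + 1 - 1 = -shift p q a := by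
    rw [add_sub_cancel_right]
    exact abs_choice _
  rcases Opposed.lt_sumLevel_or hp hq ho with hα | ⟨rfl, hα⟩
  · rcases Opposed.classify hp hq ho hα with ⟨k, hk⟩ | ⟨k, hk⟩ | h
    · refine Or.inl ⟨(integral_iff (p := p) (q := q)).2 ⟨(α.1 : ℤ) - α.2 - 2 * k, ?_⟩, Or.inl ?_⟩
      · rw [offset] at hk
        push_cast
        linarith
      · exact (rightWing_spec hp hq hc (by linarith) ⟨k, hk⟩).1.symm
    · refine Or.inl ⟨(integral_iff' (p := p) (q := q)).2 ⟨(α.1 : ℤ) - α.2 + 2 * k, ?_⟩, Or.inr ?_⟩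
      · rw [offset] at hk
        push_cast
        linarith
      · exact (leftWing_spec hp hq hc (by linarith) ⟨k, hk⟩).1.symm
    · exact Or.inr (Or.inr ⟨α, rfl, hα, h⟩)
  · exact Or.inr (Or.inl ⟨(abs_shift_eq_iff (by omega)).1 hα, (origin_spec hα).1.symm⟩)

/-- The unitary constituents for `p + q` even. -/
lemma mem_unitaryKTypeSets_even (hp : 2 ≤ p) (hq : 2 ≤ q) (he : Even (p + q))
    {Ω : Set (ℕ × ℕ)} : Ω ∈ unitaryKTypeSets p q (a : ℂ) ↔
      ((∃ e : ℕ, (2 * e : ℤ) ≡ (p : ℤ) - q [ZMOD 4] ∧ |shift p q a| < 1 ∧ Ω = parity e) ∨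
        ((∃ k : ℤ, a = k) ∧
          (Ω = rightWing p q (|shift p q a| + 1) ∨ Ω = leftWing p q (|shift p q a| + 1))) ∨
        (|shift p q a| = 1 ∧ Ω = {x | offset p q x = 0 ∧ ¬ (p = 2 ∧ q = 2 ∧ x = (0, 0))}) ∨
        ((a = 0 ∨ a = 2 - (p : ℝ) - q) ∧ Ω = {(0, 0)})) := by
  obtain ⟨d, hd⟩ : ∃ d : ℤ, (p : ℤ) - q = 2 * d := ⟨((p : ℤ) - q) / 2, by
    rw [Nat.even_iff] at he; omega⟩
  constructor
  · intro h
    rcases unitary_cases hp hq h with h | h | ⟨α, rfl, hα, h⟩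
    · exact Or.inr (Or.inl h)
    · exact Or.inr (Or.inr (Or.inr h))
    have hu := exists_offset_even hd α
    set w : ℤ := (α.1 : ℤ) - α.2 + d with hw
    rcases h with ⟨h1, h2⟩ | ⟨-, ⟨k, hk⟩, hN⟩ | ⟨-, ⟨k, hk⟩, hP⟩ | ⟨hP, hN, hgap⟩
    · refine Or.inr (Or.inr (Or.inl ⟨h1, (zeroColumn_spec hp hq h1 rfl ⟨h2, ?_⟩).1.symm⟩))
      rintro ⟨rfl, rfl, rfl⟩
      rw [h1] at hα
      norm_num [sumLevel] at hα
    · exact absurd ⟨-(w + 1 + k), by push_cast; linarith⟩ hN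
    · exact absurd ⟨w - 1 - k, by push_cast; linarith⟩ hP
    · left
      obtain ⟨t, ht | ht⟩ := w.even_or_odd'
      · have h1 := hgap (-t)
        rw [hu, ht] at h1
        push_cast at h1
        rw [show (2 * (t : ℝ) + 2 * -t + 1) = 1 by ring, abs_one] at h1
        have h2 : |shift p q a| < 1 := lt_of_le_of_ne h1 fun h2 =>
          hP ⟨t - 1, by rw [hu, h2, ht]; push_cast; ring⟩
        have h3 : (2 * (α.1 + α.2 : ℕ) : ℤ) ≡ (p : ℤ) - q [ZMOD 4] := by
          rw [Int.ModEq]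
          push_cast
          omega
        exact ⟨α.1 + α.2, h3, h2, (parity_spec hp hq h2
          (fun β hβ z => h2.trans_le (one_le_abs_level_even h3 hβ z)) rfl).1.symm⟩
      · exfalso
        have h1 := hgap (-t - 1)
        rw [hu, ht] at h1
        push_cast at h1
        rw [show (2 * (t : ℝ) + 1 + 2 * (-t - 1) + 1) = 0 by ring, abs_zero] at h1
        have h2 := le_antisymm h1 (abs_nonneg _)
        exact hP ⟨t, by rw [hu, h2, ht]; push_cast; ring⟩
  · rintro (⟨e, he, h, rfl⟩ | ⟨ha, h⟩ | ⟨h, hΩ⟩ | ⟨h, rfl⟩)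
    · exact mem_unitaryKTypeSets_of_spec hp hq (parity_spec hp hq h
        (fun β hβ z => h.trans_le (one_le_abs_level_even he hβ z)) (α := (e, 0))
          (show e + 0 ≡ e [MOD 2] from rfl))
    · exact wing_mem hp hq ha h
    · refine mem_unitaryKTypeSets_of_spec hp hq (zeroColumn_spec hp hq h hΩ
        (α := ((-d).toNat + 1, d.toNat + 1)) ?_)
      rw [hΩ]
      refine ⟨?_, by simp⟩
      rw [exists_offset_even hd, Int.cast_eq_zero]
      push_cast
      omega
    · exact mem_unitaryKTypeSets_of_spec hp hq (origin_spec ((abs_shift_eq_iff (by omega)).2 h))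

/-- The unitary constituents for `p + q` odd. -/
lemma mem_unitaryKTypeSets_odd (hp : 2 ≤ p) (hq : 2 ≤ q) (he : Odd (p + q))
    {Ω : Set (ℕ × ℕ)} : Ω ∈ unitaryKTypeSets p q (a : ℂ) ↔
      ((|shift p q a| < 1 / 2 ∧ ∃ e : ℕ, Ω = parity e) ∨
        ((∃ k : ℤ, a = k) ∧
          (Ω = rightWing p q (|shift p q a| + 1) ∨ Ω = leftWing p q (|shift p q a| + 1))) ∨
        (|shift p q a| = 1 / 2 ∧ (Ω = rightWing p q (1 / 2) ∨ Ω = leftWing p q (1 / 2))) ∨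
        ((a = 0 ∨ a = 2 - (p : ℝ) - q) ∧ Ω = {(0, 0)})) := by
  obtain ⟨d, hd⟩ : ∃ d : ℤ, (p : ℤ) - q = 2 * d + 1 := ⟨((p : ℤ) - q) / 2, by
    rw [Nat.odd_iff] at he; omega⟩
  have hd' : (p : ℝ) - q = 2 * d + 1 := by exact_mod_cast hd
  have hc : |shift p q a| = 1 / 2 →
      (1 / 2 - 1 : ℝ) = shift p q a ∨ (1 / 2 - 1 : ℝ) = -shift p q a := by
    intro h
    rcases abs_choice (shift p q a) with h1 | h1 <;> rw [h1] at h <;> [right; left] <;> linarith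
  have hhalf : ∀ j : ℤ, |shift p q a| ≤ 1 → |shift p q a| = j + 1 / 2 → |shift p q a| = 1 / 2 := by
    intro j h1 h2
    have h3 := abs_nonneg (shift p q a)
    rw [h2] at h1 h3 ⊢
    have h4 : (j : ℝ) < 1 := by linarith
    have h5 : (-1 : ℝ) < j := by linarith
    have h6 : j < 1 := by exact_mod_cast h4
    have h7 : -1 < j := by exact_mod_cast h5
    obtain rfl : j = 0 := by omega
    simp
  constructor
  · intro h
    rcases unitary_cases hp hq h with h | h | ⟨α, rfl, hα, h⟩
    · exact Or.inr (Or.inl h)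
    · exact Or.inr (Or.inr (Or.inr h))
    have hu := exists_offset_odd hd α
    set w : ℤ := (α.1 : ℤ) - α.2 + d with hw
    rcases h with ⟨-, h2⟩ | ⟨h1, ⟨k, hk⟩, -⟩ | ⟨h1, ⟨k, hk⟩, -⟩ | ⟨hP, hN, hgap⟩
    · have := half_le_abs_add_half w
      rw [← hu, h2, abs_zero] at this
      norm_num at this
    · have h := hhalf (w + 1 + 2 * k) h1 (by push_cast; linarith)
      refine Or.inr (Or.inr (Or.inl ⟨h, Or.inr ?_⟩))
      exact (leftWing_spec hp hq (hc h) (by rw [h]; norm_num) ⟨k, by rw [hk, h]; ring⟩).1.symm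
    · have h := hhalf (-w + 2 * k) h1 (by push_cast; linarith)
      refine Or.inr (Or.inr (Or.inl ⟨h, Or.inl ?_⟩))
      exact (rightWing_spec hp hq (hc h) (by rw [h]; norm_num) ⟨k, by rw [hk, h]; ring⟩).1.symm
    · left
      have h2 : |shift p q a| < 1 / 2 := by
        obtain ⟨t, ht | ht⟩ := w.even_or_odd'
        · have h1 := hgap (-t - 1)
          rw [hu, ht] at h1
          push_cast at h1
          rw [show (2 * (t : ℝ) + 1 / 2 + 2 * (-t - 1) + 1) = -(1 / 2) by ring, abs_neg,
            abs_of_pos (one_half_pos : (0 : ℝ) < 1 / 2)] at h1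
          exact lt_of_le_of_ne h1 fun h2 =>
            hN ⟨-1 - t, by rw [hu, h2, ht]; push_cast; ring⟩
        · have h1 := hgap (-t - 1)
          rw [hu, ht] at h1
          push_cast at h1
          rw [show (2 * (t : ℝ) + 1 + 1 / 2 + 2 * (-t - 1) + 1) = 1 / 2 by ring,
            abs_of_pos (one_half_pos : (0 : ℝ) < 1 / 2)] at h1
          exact lt_of_le_of_ne h1 fun h2 =>
            hP ⟨t, by rw [hu, h2, ht]; push_cast; ring⟩
      exact ⟨h2, α.1 + α.2, (parity_spec hp hq (by linarith)
        (fun β _ z => h2.trans_le (half_le_abs_level_odd hd β z)) rfl).1.symm⟩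
  · rintro (⟨h, e, rfl⟩ | ⟨ha, h⟩ | ⟨h, rfl | rfl⟩ | ⟨h, rfl⟩)
    · exact mem_unitaryKTypeSets_of_spec hp hq (parity_spec hp hq (by linarith)
        (fun β _ z => h.trans_le (half_le_abs_level_odd hd β z)) (α := (e, 0))
          (show e + 0 ≡ e [MOD 2] from rfl))
    · exact wing_mem hp hq ha h
    · obtain ⟨α, hα⟩ := exists_offset_eq (p := p) (q := q) (-d)
      refine mem_unitaryKTypeSets_of_spec hp hq (rightWing_spec (α := α) hp hq (hc h)
        (by rw [h]; norm_num) ⟨0, ?_⟩)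
      rw [hα, hd']
      push_cast
      ring
    · obtain ⟨α, hα⟩ := exists_offset_eq (p := p) (q := q) (-d - 1)
      refine mem_unitaryKTypeSets_of_spec hp hq (leftWing_spec (α := α) hp hq (hc h)
        (by rw [h]; norm_num) ⟨0, ?_⟩)
      rw [hα, hd']
      push_cast
      ring
    · exact mem_unitaryKTypeSets_of_spec hp hq (origin_spec ((abs_shift_eq_iff (by omega)).2 h))

end

section

variable {p q : ℕ} {a : ℝ} [NeZero p] [NeZero q]

/-! ### The parity summands -/

/-- Two elements of `S^a(X⁰)` agree up to a factor at opposite points if they do on the spheres. -/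
lemma HS.apply_neg {f : HS p q a} {c : ℂ}
    (h : ∀ k k' : K p q, (pt k' : V p q) = -(pt k : V p q) → f (pt k') = c * f (pt k))
    {w w' : cone p q} (hw : (w' : V p q) = -(w : V p q)) : f w' = c * f w := by
  obtain ⟨k, hk⟩ := exists_pt_smul w
  have h0 : 0 < √(nx w.1) := Real.sqrt_pos.2 (cone_pos w)
  have h1 : -(pt k : V p q) ∈ spheres p q := by
    have h2 := pt_mem_spheres k
    rw [mem_spheres] at h2 ⊢
    simpa [nx, ny] using h2
  obtain ⟨k', hk'⟩ := exists_pt h1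
  have h3 : (w' : V p q) = √(nx w.1) • (pt k' : V p q) := by rw [hk', smul_neg, ← hk, hw]
  rw [f.homogeneous h0 hk, f.homogeneous h0 h3, h k k' hk']
  ring

lemma rho_mem_S {f : Fn p q} (hf : f ∈ S p q (a : ℂ)) (g : O p q) : rho g f ∈ S p q (a : ℂ) :=
  (rhoS g (HS.mk f hf)).mem

lemma isSubmodule_SPar (e : ℕ) : IsSubmodule p q (a : ℂ) (SPar p q (a : ℂ) e) where
  le := fun _ hf => hf.1
  invariant := fun g f hf => ⟨rho_mem_S hf.1 g, fun w w' hw => hf.2 _ _ (by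
    change g⁻¹.1 w'.1 = -(g⁻¹.1 w.1)
    rw [hw, map_neg])⟩
  closed := fun f hf happ => by
    refine ⟨hf, fun w w' hw => HS.apply_neg (f := HS.mk f hf) (fun k k' hk => ?_) hw⟩
    by_contra hne
    set F := HS.mk f hf with hF
    have hd : 0 < ‖F (pt k') - (-1) ^ e * F (pt k)‖ := norm_pos_iff.2 (sub_ne_zero.2 hne)
    obtain ⟨g, hg, hN⟩ := happ 0 (‖F (pt k') - (-1) ^ e * F (pt k)‖ / 4) (by positivity)
    have h1 : ∀ l, ‖F (pt l) - g (pt l)‖ ≤ ‖F (pt k') - (-1) ^ e * F (pt k)‖ / 4 := fun l =>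
      NormLE.norm_pt_le (f := F - HS.mk g hg.1) hN l
    have h2 : F (pt k') - (-1) ^ e * F (pt k) =
        (F (pt k') - g (pt k')) - (-1) ^ e * (F (pt k) - g (pt k)) := by
      rw [hg.2 _ _ hk]
      ring
    have h3 := norm_sub_le (F (pt k') - g (pt k')) ((-1) ^ e * (F (pt k) - g (pt k)))
    rw [← h2, norm_mul, norm_pow, norm_neg, norm_one, one_pow, one_mul] at h3
    have h4 := h1 k
    have h5 := h1 k'
    linarith

lemma isSubmodule_bot : IsSubmodule p q (a : ℂ) ⊥ where
  le := bot_le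
  invariant := fun g f hf => by
    rw [Submodule.mem_bot] at hf ⊢
    rw [hf, map_zero]
  closed := fun f hf happ => by
    have h0 : HS.mk f hf = 0 := HS.ext_pt fun k => by
      by_contra hne
      have hd : 0 < ‖HS.mk f hf (pt k)‖ := norm_pos_iff.2 hne
      obtain ⟨g, hg, hN⟩ := happ 0 (‖HS.mk f hf (pt k)‖ / 2) (by positivity)
      rw [(Submodule.mem_bot ℂ).1 hg, sub_zero] at hN
      have := NormLE.norm_pt_le (f := HS.mk f hf) hN k
      linarith
    exact (Submodule.mem_bot ℂ).2 (congrArg HS.fn h0)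

lemma exists_cone_neg (w : cone p q) : ∃ w' : cone p q, (w' : V p q) = -(w : V p q) := by
  refine ⟨⟨-w.1, neg_ne_zero.2 w.2.1, ?_⟩, rfl⟩
  have := w.2.2
  simpa [form] using this

lemma VT_apply_neg {α : ℕ × ℕ} {v : HS p q a} (hv : v ∈ VT p q a α) {w w' : cone p q}
    (hw : (w' : V p q) = -(w : V p q)) : v w' = (-1) ^ (α.1 + α.2) * v w := by
  refine VT_induction hv (fun h₁ h₂ H₁ H₂ => ?_) fun u v hu hv => ?_
  · change jMap (a : ℂ) α.1 α.2 h₁ h₂ w' = (-1) ^ (α.1 + α.2) * jMap (a : ℂ) α.1 α.2 h₁ h₂ w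
    have h1 : (w' : V p q) = (-1 : ℝ) • (w : V p q) := by rw [hw, neg_one_smul]
    rw [jMap_apply, jMap_apply, h1, Prod.smul_fst, Prod.smul_snd, pe_smul H₁.1, pe_smul H₂.1,
      nx_smul, pow_add]
    push_cast
    norm_num
    ring
  · rw [HS.add_apply, HS.add_apply, hu, hv, mul_add]

lemma kTypes_SPar (e : ℕ) : kTypes (a : ℂ) (SPar p q (a : ℂ) e) ⊥ = parity e ∩ index p q := by
  have hpow : ∀ i j : ℕ, (-1 : ℂ) ^ i = (-1) ^ j ↔ i ≡ j [MOD 2] := by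
    intro i j
    rw [Nat.ModEq]
    rcases i.even_or_odd with hi | hi <;> rcases j.even_or_odd with hj | hj <;>
      rw [hi.neg_one_pow, hj.neg_one_pow] <;>
      first | rw [Nat.even_iff] at hi | rw [Nat.odd_iff] at hi
    all_goals first | rw [Nat.even_iff] at hj | rw [Nat.odd_iff] at hj
    all_goals rw [hi, hj]
    all_goals norm_num
  ext α
  have hbot : pull a (⊥ : Submodule ℂ (Fn p q)) = ⊥ :=
    (LinearMap.ker_eq_bot (f := toFn p q a)).2 HS.fn_injective
  rw [mem_kTypes, hbot, le_bot_iff, Set.mem_inter_iff, ← VT_ne_bot_iff_mem (a := a)]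
  refine and_congr_left fun hne => ⟨fun h => ?_, fun h v hv => ⟨v.mem, fun w w' hw => ?_⟩⟩
  · obtain ⟨v, hv, hv0⟩ := (Submodule.ne_bot_iff _).1 hne
    obtain ⟨w, hw⟩ : ∃ w, v w ≠ 0 := by
      by_contra hc
      push Not at hc
      exact hv0 (HS.ext hc)
    obtain ⟨w', hw'⟩ := exists_cone_neg w
    have h1 := (h hv).2 w w' hw'
    have h2 := VT_apply_neg hv hw'
    exact (hpow _ _).1 (mul_right_cancel₀ hw (h2.symm.trans h1))
  · rw [← (hpow _ _).2 h]
    exact VT_apply_neg hv hw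

lemma isUnitary_SPar_iff (e : ℕ) :
    IsUnitary (SPar p q (a : ℂ) e) ⊥ ↔ Opposed p q a (parity e ∩ index p q) := by
  rw [isUnitary_iff_opposed (isSubmodule_SPar e) isSubmodule_bot, kTypes_SPar]

omit [NeZero p] [NeZero q] in
lemma Opposed.level_parity {e : ℕ} (ho : Opposed p q a (parity e)) {d : ℤ} {δ : ℝ}
    (hd : ((p : ℝ) - q) / 2 = d + δ) {v : ℤ} (hv : (v - d - 1 - e) % 2 = 0) :
    |shift p q a| < |v + δ| ∨ shift p q a = 0 ∧ v + δ = 0 := by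
  obtain ⟨m, hm⟩ : ∃ m : ℕ, (m : ℤ) = (d - v).natAbs - d + v :=
    ⟨((d - v).natAbs - d + v).toNat, by omega⟩
  have h : m + ((d - v).natAbs + 1) ≡ e [MOD 2] := by rw [Nat.ModEq]; omega
  have h1 : m + 1 + (d - v).natAbs ≡ e [MOD 2] := by rw [Nat.ModEq]; omega
  have h2 : diffLevel p q (m, (d - v).natAbs + 1) = v + δ := by
    have : ((m : ℤ) : ℝ) = (((d - v).natAbs : ℤ) : ℝ) - d + v := by rw [hm]; push_cast; ring
    rw [Int.cast_natCast, Int.cast_natCast] at this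
    rw [diffLevel, offset, hd]
    push_cast
    rw [this]
    ring
  rw [← h2]
  exact (opposed_iff.1 ho).2 m _ h h1

lemma isUnitary_SPar_even (hp : 2 ≤ p) (hq : 2 ≤ q) (he : Even (p + q)) (e : ℕ) :
    IsUnitary (SPar p q (a : ℂ) e) ⊥ ↔
      (((2 * e : ℤ) ≡ (p : ℤ) - q [ZMOD 4] ∧ |shift p q a| < 1) ∨ shift p q a = 0) := by
  obtain ⟨d, hd⟩ : ∃ d : ℤ, (p : ℤ) - q = 2 * d := ⟨((p : ℤ) - q) / 2, by
    rw [Nat.even_iff] at he; omega⟩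
  have hd' : ((p : ℝ) - q) / 2 = d + 0 := by
    have : (p : ℝ) - q = 2 * d := by exact_mod_cast hd
    rw [this]
    ring
  rw [isUnitary_SPar_iff, index_eq_univ hp hq, Set.inter_univ]
  constructor
  · intro ho
    by_cases h : (2 * e : ℤ) ≡ (p : ℤ) - q [ZMOD 4]
    · refine (ho.level_parity hd' (v := 1) (by rw [Int.ModEq] at h; omega)).imp
        (fun h1 => ⟨h, by simpa using h1⟩) fun h1 => h1.1
    · refine Or.inr ((ho.level_parity hd' (v := 0) (by rw [Int.ModEq] at h; omega)).elim
        (fun h1 => ?_) fun h1 => h1.1)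
      rw [Int.cast_zero, add_zero, abs_zero] at h1
      exact absurd (abs_nonneg _) (not_le.2 h1)
  · rintro (⟨h, h1⟩ | h)
    · exact opposed_of_lt (fun β _ => by
        rw [abs_sumLevel hp hq]; exact h1.trans_le (one_le_sumLevel hp hq β))
        fun m n h2 _ => h1.trans_le (by simpa [diffLevel] using one_le_abs_level_even h h2 0)
    · refine opposed_iff.2 ⟨fun m n _ _ => ?_, fun m n _ _ => ?_⟩ <;> rw [h, abs_zero] <;>
      exact (eq_or_ne _ 0).symm.imp abs_pos.2 fun h => ⟨rfl, h⟩

lemma isUnitary_SPar_odd (hp : 2 ≤ p) (hq : 2 ≤ q) (he : Odd (p + q)) (e : ℕ) :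
    IsUnitary (SPar p q (a : ℂ) e) ⊥ ↔ |shift p q a| < 1 / 2 := by
  obtain ⟨d, hd⟩ : ∃ d : ℤ, (p : ℤ) - q = 2 * d + 1 := ⟨((p : ℤ) - q) / 2, by
    rw [Nat.odd_iff] at he; omega⟩
  have hd' : ((p : ℝ) - q) / 2 = d + 1 / 2 := by
    have : (p : ℝ) - q = 2 * d + 1 := by exact_mod_cast hd
    rw [this]
    ring
  rw [isUnitary_SPar_iff, index_eq_univ hp hq, Set.inter_univ]
  constructor
  · intro ho
    rcases Int.emod_two_eq_zero_or_one (0 - d - 1 - e) with h | h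
    · rcases ho.level_parity hd' (v := 0) h with h1 | h1
      · rwa [Int.cast_zero, zero_add, abs_of_pos (by norm_num : (0 : ℝ) < 1 / 2)] at h1
      · norm_num at h1
    · rcases ho.level_parity hd' (v := -1) (by omega) with h1 | h1
      · rw [show (((-1 : ℤ) : ℝ) + 1 / 2) = -(1 / 2) by norm_num, abs_neg,
          abs_of_pos (by norm_num : (0 : ℝ) < 1 / 2)] at h1
        exact h1
      · norm_num at h1
  · intro h
    exact opposed_of_lt (fun β _ => by
      rw [abs_sumLevel hp hq]
      exact lt_of_lt_of_le (by linarith) (one_le_sumLevel hp hq β))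
      fun m n h2 _ => h.trans_le (by simpa [diffLevel] using half_le_abs_level_odd hd (m, n + 1) 0)

end

section

/-! ### Components and unitarity for `q = 1` -/

lemma harmonicNonzero_one {m : ℕ} : HarmonicNonzero 1 m ↔ m ≤ 1 := by
  constructor
  · rintro ⟨h, ⟨hh, hΔ⟩, h0⟩
    by_contra hm
    refine h0 ?_
    rw [Fin.sum_univ_one] at hΔ
    have h1 := hh.sum_X_mul_pderiv
    have h2 := (hh.pderiv (i := 0)).sum_X_mul_pderiv
    rw [Fin.sum_univ_one] at h1 h2
    rw [hΔ, mul_zero, eq_comm, smul_eq_zero] at h2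
    rw [h2.resolve_left (by omega), mul_zero, eq_comm, smul_eq_zero] at h1
    exact h1.resolve_left (by omega)
  · intro hm
    interval_cases m
    · exact ⟨1, ⟨MvPolynomial.isHomogeneous_one _ _, by simp⟩, one_ne_zero⟩
    · exact ⟨X 0, ⟨MvPolynomial.isHomogeneous_X _ _, by simp⟩, MvPolynomial.X_ne_zero 0⟩

variable {p : ℕ} {a : ℝ}

lemma mem_index_one (hp : 2 ≤ p) {α : ℕ × ℕ} : α ∈ index p 1 ↔ α.2 ≤ 1 := by
  rw [index, Set.mem_ofPred_eq, harmonicNonzero_one]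
  exact and_iff_right (harmonicNonzero_of_two_le hp α.1)

lemma Nb.line_cases {α β : ℕ × ℕ} (h : Nb α β) (hα : α.2 ≤ 1) (hβ : β.2 ≤ 1) :
    (β.1 = α.1 + 1 ∧ AA p 1 a α β = a - α.1 ∧ AA p 1 a β α = a + α.1 + p - 1) ∨
    (α.1 = β.1 + 1 ∧ AA p 1 a β α = a - β.1 ∧ AA p 1 a α β = a + β.1 + p - 1) := by
  have h1 : ∀ m n : ℕ, n + 1 ≤ 1 → AA p 1 a (m, n) (m + 1, n + 1) = a - m ∧
      AA p 1 a (m + 1, n + 1) (m, n) = a + m + p - 1 := by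
    intro m n hn
    obtain rfl : n = 0 := by omega
    rw [AA_pp, AA_mm, App, Amm]
    constructor <;> push_cast <;> ring
  have h2 : ∀ m n : ℕ, n + 1 ≤ 1 → AA p 1 a (m, n + 1) (m + 1, n) = a - m ∧
      AA p 1 a (m + 1, n) (m, n + 1) = a + m + p - 1 := by
    intro m n hn
    obtain rfl : n = 0 := by omega
    rw [AA_pm, AA_mp, Apm, Amp]
    constructor <;> push_cast <;> ring
  refine Nb_cases (P := fun α β => α.2 ≤ 1 → β.2 ≤ 1 →
    (β.1 = α.1 + 1 ∧ AA p 1 a α β = a - α.1 ∧ AA p 1 a β α = a + α.1 + p - 1) ∨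
    (α.1 = β.1 + 1 ∧ AA p 1 a β α = a - β.1 ∧ AA p 1 a α β = a + β.1 + p - 1))
    ?_ ?_ ?_ ?_ h hα hβ <;> intro m n hα hβ
  · exact Or.inl ⟨rfl, h1 m n hβ⟩
  · exact Or.inl ⟨rfl, h2 m n hα⟩
  · exact Or.inr ⟨rfl, h2 m n hβ⟩
  · exact Or.inr ⟨rfl, h1 m n hα⟩

/-- The `K`-types of one parity for `q = 1`, in order. -/
def lineType (e m : ℕ) : ℕ × ℕ := (m, (m + e) % 2)

lemma nb_lineType (e m : ℕ) : Nb (lineType e m) (lineType e (m + 1)) :=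
  ⟨Or.inl rfl, by simp only [lineType]; omega⟩

lemma lineType_mem (e m k : ℕ) (h : k ≤ m) : lineType e m ∈ ray e k := by
  refine ⟨?_, by simp only [lineType]; omega, h⟩
  change m + (m + e) % 2 ≡ e [MOD 2]
  rw [Nat.ModEq]
  omega

lemma eq_lineType {e k : ℕ} {α : ℕ × ℕ} (h : α ∈ ray e k) : α = lineType e α.1 := by
  obtain ⟨m, n⟩ := α
  obtain ⟨h1, h2, -⟩ := h
  have h1 : m + n ≡ e [MOD 2] := h1
  rw [Nat.ModEq] at h1
  simp only at h2
  simp only [lineType, Prod.mk.injEq, true_and]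
  omega

/-- The position at which the chains of transitions are blocked. -/
def Blocked (p : ℕ) (a : ℝ) (k : ℕ) : Prop := a = k ∨ a = 1 - (p : ℝ) - k

variable (hp : 2 ≤ p)
include hp

lemma Blocked.unique {k l : ℕ} (hk : Blocked p a k) (hl : Blocked p a l) : k = l := by
  have h0 : (2 : ℝ) ≤ p := by exact_mod_cast hp
  have h1 := (Nat.cast_nonneg k : (0 : ℝ) ≤ _)
  have h2 := (Nat.cast_nonneg l : (0 : ℝ) ≤ _)
  have : (k : ℝ) = l := by
    rcases hk with hk | hk <;> rcases hl with hl | hl <;> linarith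
  exact_mod_cast this

lemma conn_lineType {e m n : ℕ} (hmn : m ≤ n) (h : ∀ j, m ≤ j → j < n → ¬ Blocked p a j) :
    Conn p 1 a (lineType e m) (lineType e n) := by
  induction n, hmn using Nat.le_induction with
  | base => exact Conn.refl _
  | succ n hmn ih =>
    refine (ih fun j h1 h2 => h j h1 (by omega)).trans ?_
    have hb := h n hmn n.lt_succ_self
    have h1 := (lineType_mem e n 0 (Nat.zero_le _)).2.1
    have h2 := (lineType_mem e (n + 1) 0 (Nat.zero_le _)).2.1
    rcases (nb_lineType e n).line_cases (p := p) (a := a) h1 h2 with ⟨-, h3, h4⟩ | ⟨h3, -⟩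
    · refine conn_of_ne_zero (nb_lineType e n) ((mem_index_one hp).2 h1)
        ((mem_index_one hp).2 h2) ?_ ?_
      · rw [h3]
        exact fun h0 => hb (Or.inl (sub_eq_zero.1 h0))
      · rw [h4]
        exact fun h0 => hb (Or.inr (by simp only [lineType] at h0; linarith))
    · simp only [lineType] at h3
      omega

lemma Conn.ray {e : ℕ} {α β : ℕ × ℕ} (hα : α ∈ ray e 0) (h : Conn p 1 a α β) :
    β ∈ LightCone.ray e 0 := by
  refine ⟨?_, ?_, Nat.zero_le _⟩
  · obtain ⟨z, hz⟩ := isLevel_sumLevel.reach_congr h.1 (τ := sumLevel p 1 α) ⟨0, by simp⟩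
    have h3 : (β.1 + β.2 : ℤ) = α.1 + α.2 + 2 * z := by
      simp only [sumLevel] at hz
      have : (β.1 + β.2 : ℝ) = α.1 + α.2 + 2 * z := by linarith
      exact_mod_cast this
    refine Nat.ModEq.trans ?_ hα.1
    rw [Nat.ModEq]
    omega
  · exact (mem_index_one hp).1 (Reach.mem_index ((mem_index_one hp).2 hα.2.1) h.1)

lemma Blocked.le_iff {k : ℕ} (hk : Blocked p a k) {α β : ℕ × ℕ} (hα : α ∈ index p 1)
    (h : Conn p 1 a α β) : α.1 ≤ k ↔ β.1 ≤ k := by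
  have key : ∀ {γ δ : ℕ × ℕ}, γ ∈ index p 1 → Reach p 1 a γ δ →
      (a = k → γ.1 ≤ k → δ.1 ≤ k) ∧ (a = 1 - (p : ℝ) - k → ¬ γ.1 ≤ k → ¬ δ.1 ≤ k) := by
    intro γ δ hγ h
    induction h with
    | refl => exact ⟨fun _ h => h, fun _ h => h⟩
    | tail h' h ih =>
      rename_i δ ε
      have h1 := (mem_index_one hp).1 (Reach.mem_index hγ h')
      have h2 := (mem_index_one hp).1 h.2.2
      rcases h.1.line_cases (p := p) (a := a) h1 h2 with ⟨h3, h4, -⟩ | ⟨h3, -, h4⟩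
      · refine ⟨fun ha hγk => ?_, fun ha hγk => ?_⟩
        · have h5 := ih.1 ha hγk
          have h6 : δ.1 ≠ k := fun h6 => h.2.1 (by rw [h4, ha, h6, sub_self])
          omega
        · have h5 := ih.2 ha hγk
          omega
      · refine ⟨fun ha hγk => ?_, fun ha hγk => ?_⟩
        · have h5 := ih.1 ha hγk
          omega
        · have h5 := ih.2 ha hγk
          have h6 : ε.1 ≠ k := fun h6 => h.2.1 (by rw [h4, ha, h6]; ring)
          omega
  have hβ := Reach.mem_index hα h.1
  rcases hk with h0 | h0
  · exact ⟨(key hα h.1).1 h0, (key hβ h.2).1 h0⟩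
  · exact not_iff_not.1 ⟨(key hα h.1).2 h0, (key hβ h.2).2 h0⟩

lemma oppSign_line {m : ℕ} :
    OppSign (a - m) (a + m + p - 1) ↔ 1 - (p : ℝ) - m < a ∧ a < m := by
  have h0 : (2 : ℝ) ≤ p := by exact_mod_cast hp
  have h1 := (Nat.cast_nonneg m : (0 : ℝ) ≤ _)
  constructor
  · intro h
    have h2 : a - m ≠ 0 := fun h2 => h.ne_zero_iff.2 (by linarith) h2
    rcases mul_neg_iff.1 (h.mul_neg h2) with h | h <;> constructor <;> linarith
  · rintro ⟨h2, h3⟩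
    exact ⟨a + m + p - 1, -(a - m), by linarith, by linarith, by ring⟩

lemma opposed_line {Ω : Set (ℕ × ℕ)} (hΩ : ∀ α ∈ Ω, α.2 ≤ 1)
    (h : ∀ α ∈ Ω, ∀ β ∈ Ω, β.1 = α.1 + 1 → 1 - (p : ℝ) - α.1 < a ∧ a < α.1) :
    Opposed p 1 a Ω := by
  intro α β hn hα hβ
  rcases hn.line_cases (p := p) (a := a) (hΩ α hα) (hΩ β hβ) with ⟨h1, h2, h3⟩ | ⟨h1, h2, h3⟩
  · rw [h2, h3, oppSign_line hp]
    exact h α hα β hβ h1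
  · refine OppSign.symm ?_
    rw [h2, h3, oppSign_line hp]
    exact h β hβ α hα h1

lemma Opposed.line {Ω : Set (ℕ × ℕ)} (ho : Opposed p 1 a Ω) {e m : ℕ} (h : lineType e m ∈ Ω)
    (h' : lineType e (m + 1) ∈ Ω) : 1 - (p : ℝ) - m < a ∧ a < m := by
  have h1 := ho _ _ (nb_lineType e m) h h'
  rcases (nb_lineType e m).line_cases (p := p) (a := a) (lineType_mem e m 0 (Nat.zero_le _)).2.1
    (lineType_mem e (m + 1) 0 (Nat.zero_le _)).2.1 with ⟨-, h3, h4⟩ | ⟨h3, -⟩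
  · rw [h3, h4] at h1
    exact (oppSign_line hp).1 h1
  · simp only [lineType] at h3
    omega

lemma ray_eq_component {e k : ℕ} (hb : ∀ j, Blocked p a j → j < k)
    (hk : k = 0 ∨ ∃ l, Blocked p a l ∧ k = l + 1) {α : ℕ × ℕ} (hα : α ∈ ray e k) :
    ray e k = component p 1 a α := by
  have hα0 : α ∈ ray e 0 := ⟨hα.1, hα.2.1, Nat.zero_le _⟩
  have hc : ∀ m, k ≤ m → Conn p 1 a (lineType e k) (lineType e m) := fun m hm =>
    conn_lineType hp hm fun j h1 _ h2 => absurd (hb j h2) (not_lt.2 h1)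
  ext β
  refine ⟨fun hβ => ?_, fun hβ => ?_⟩
  · rw [eq_lineType hα, eq_lineType hβ]
    exact (hc _ hα.2.2).symm.trans (hc _ hβ.2.2)
  · have h1 := Conn.ray hp hα0 hβ
    refine ⟨h1.1, h1.2.1, ?_⟩
    rcases hk with rfl | ⟨l, hl, rfl⟩
    · exact Nat.zero_le _
    · have := Blocked.le_iff hp hl ((mem_index_one hp).2 hα.2.1) hβ
      have := hα.2.2
      omega

lemma singleton_eq_component {e : ℕ} (hb : Blocked p a 0) :
    {lineType e 0} = component p 1 a (lineType e 0) := by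
  ext β
  refine ⟨fun hβ => ?_, fun hβ => ?_⟩
  · rw [Set.mem_singleton_iff.1 hβ]
    exact Conn.refl _
  · have h0 := lineType_mem e 0 0 le_rfl
    have h1 := (Blocked.le_iff hp hb ((mem_index_one hp).2 h0.2.1) hβ).1 le_rfl
    rw [Set.mem_singleton_iff, eq_lineType (Conn.ray hp h0 hβ), Nat.le_zero.1 h1]

lemma opposed_ray_zero_iff (e : ℕ) :
    Opposed p 1 a (ray e 0) ↔ -((p : ℝ) - 1) < a ∧ a < 0 := by
  constructor
  · intro h
    have := h.line hp (lineType_mem e 0 0 le_rfl) (lineType_mem e 1 0 zero_le_one)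
    rw [Nat.cast_zero] at this
    exact ⟨by linarith, this.2⟩
  · rintro ⟨h1, h2⟩
    refine opposed_line hp (fun α hα => hα.2.1) fun α _ _ _ _ => ?_
    have := (Nat.cast_nonneg α.1 : (0 : ℝ) ≤ _)
    constructor <;> linarith

variable [NeZero p]

lemma isUnitary_SPar_one (e : ℕ) :
    IsUnitary (SPar p 1 (a : ℂ) e) ⊥ ↔ -((p : ℝ) - 1) < a ∧ a < 0 := by
  rw [isUnitary_SPar_iff, ← opposed_ray_zero_iff hp e]
  congr! 1
  ext α
  rw [Set.mem_inter_iff, mem_index_one hp]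
  exact ⟨fun h => ⟨h.1, h.2, Nat.zero_le _⟩, fun h => ⟨h.1, h.2.1⟩⟩

/-- The unitary constituents for `q = 1`. -/
lemma mem_unitaryKTypeSets_one {Ω : Set (ℕ × ℕ)} : Ω ∈ unitaryKTypeSets p 1 (a : ℂ) ↔
    ((-((p : ℝ) - 1) < a ∧ a < 0 ∧ ∃ e : ℕ, Ω = ray e 0) ∨
      (∃ k e : ℕ, (a = k ∨ a = 1 - (p : ℝ) - k) ∧ Ω = ray e (k + 1)) ∨
      ((a = 0 ∨ a = 1 - (p : ℝ)) ∧ (Ω = {(0, 0)} ∨ Ω = {(0, 1)}))) := by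
  have h0 : (2 : ℝ) ≤ p := by exact_mod_cast hp
  rw [mem_unitaryKTypeSets]
  constructor
  · rintro ⟨α, hα, rfl, ho⟩
    have hαr : α ∈ ray (α.1 + α.2) 0 := ⟨rfl, (mem_index_one hp).1 hα, Nat.zero_le _⟩
    have hαe := eq_lineType hαr
    set e := α.1 + α.2 with he
    by_cases hb : ∃ k, Blocked p a k
    · obtain ⟨k, hk⟩ := hb
      rcases Nat.lt_or_ge k α.1 with h1 | h1
      · exact Or.inr (Or.inl ⟨k, e, hk, (ray_eq_component hp
          (fun j hj => Nat.lt_succ_of_le (Blocked.unique hp hj hk).le) (Or.inr ⟨k, hk, rfl⟩)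
          ⟨hαr.1, hαr.2.1, h1⟩).symm⟩)
      · rcases Nat.eq_zero_or_pos k with rfl | hk0
        · right; right
          refine ⟨by simpa [Blocked] using hk, ?_⟩
          rw [Nat.le_zero.1 h1] at hαe
          rw [hαe, ← singleton_eq_component hp hk, lineType, zero_add]
          rcases Nat.mod_two_eq_zero_or_one e with h2 | h2 <;> rw [h2] <;> simp
        · exfalso
          have hnb : ∀ j, j < k → ¬ Blocked p a j := fun j hj hj' =>
            hj.ne (Blocked.unique hp hj' hk)
          have h2 : Conn p 1 a (lineType e 0) α := by
            rw [hαe]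
            exact conn_lineType hp (Nat.zero_le _) fun j _ hj => hnb j (hj.trans_le h1)
          have h3 : Conn p 1 a (lineType e 0) (lineType e 1) :=
            conn_lineType hp zero_le_one fun j _ hj => hnb j (by omega)
          have h4 := ho.line hp (e := e) (m := 0) h2.symm (h2.symm.trans h3)
          have h5 := (Nat.cast_nonneg k : (0 : ℝ) ≤ _)
          rw [Nat.cast_zero] at h4
          rcases hk with hk | hk <;> linarith
    · push Not at hb
      have h1 := ray_eq_component hp (fun j hj => absurd hj (hb j)) (Or.inl rfl) hαr
      have h2 := (opposed_ray_zero_iff hp e).1 (h1 ▸ ho)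
      exact Or.inl ⟨h2.1, h2.2, e, h1.symm⟩
  · rintro (⟨h1, h2, e, rfl⟩ | ⟨k, e, hk, rfl⟩ | ⟨h, h'⟩)
    · refine ⟨lineType e 0, (mem_index_one hp).2 (lineType_mem e 0 0 le_rfl).2.1,
        ray_eq_component hp (fun j hj => ?_) (Or.inl rfl) (lineType_mem e 0 0 le_rfl),
        (opposed_ray_zero_iff hp e).2 ⟨h1, h2⟩⟩
      have := (Nat.cast_nonneg j : (0 : ℝ) ≤ _)
      rcases hj with hj | hj <;> linarith
    · have hm := lineType_mem e (k + 1) (k + 1) le_rfl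
      refine ⟨lineType e (k + 1), (mem_index_one hp).2 hm.2.1,
        ray_eq_component hp (fun j hj => Nat.lt_succ_of_le (Blocked.unique hp hj hk).le)
          (Or.inr ⟨k, hk, rfl⟩) hm, opposed_line hp (fun α hα => hα.2.1) fun α hα _ _ _ => ?_⟩
      have h1 : (k : ℝ) + 1 ≤ α.1 := by exact_mod_cast hα.2.2
      have h2 := (Nat.cast_nonneg k : (0 : ℝ) ≤ _)
      rcases hk with hk | hk <;> constructor <;> linarith
    · have key : ∀ e, lineType e 0 ∈ index p 1 ∧ {lineType e 0} = component p 1 a (lineType e 0) ∧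
          Opposed p 1 a {lineType e 0} := by
        intro e
        refine ⟨(mem_index_one hp).2 (lineType_mem e 0 0 le_rfl).2.1,
          singleton_eq_component hp (by simpa [Blocked] using h), fun α β hn hα hβ => ?_⟩
        rw [Set.mem_singleton_iff.1 hα, Set.mem_singleton_iff.1 hβ] at hn
        exact absurd rfl hn.ne
      rcases h' with rfl | rfl
      · exact ⟨_, key 0⟩
      · exact ⟨_, key 1⟩

end

end LightCone

end

theorem mainTheorem6 (p q : ℕ) (hq : 1 ≤ q) (hpq : q ≤ p) (a : ℝ) :
    -- the criterion
    (∀ W₁ W₂ : Submodule ℂ (LightCone.Fn p q), LightCone.IsConstituent p q a W₁ W₂ →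
      (LightCone.IsUnitary W₁ W₂ ↔
        (∀ m n : ℕ, (m, n) ∈ LightCone.kTypes a W₁ W₂ →
          (m + 1, n + 1) ∈ LightCone.kTypes a W₁ W₂ →
          LightCone.App p q a m n / LightCone.Amm p q a (m + 1) (n + 1) < 0) ∧
        (∀ m n : ℕ, 1 ≤ n → (m, n) ∈ LightCone.kTypes a W₁ W₂ →
          (m + 1, n - 1) ∈ LightCone.kTypes a W₁ W₂ →
          LightCone.Apm p q a m n / LightCone.Amp p q a (m + 1) (n - 1) < 0))) ∧
    -- `q ≥ 2`, `p + q` even: the full modules and the list of unitary constituents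
    (2 ≤ q → Even (p + q) →
      (∀ e : ℕ, LightCone.IsUnitary (LightCone.SPar p q a e) ⊥ ↔
        (((2 * e : ℤ) ≡ (p : ℤ) - q [ZMOD 4] ∧ |LightCone.shift p q a| < 1) ∨
          LightCone.shift p q a = 0)) ∧
      (∀ Ω : Set (ℕ × ℕ), Ω ∈ LightCone.unitaryKTypeSets p q a ↔
        ((∃ e : ℕ, (2 * e : ℤ) ≡ (p : ℤ) - q [ZMOD 4] ∧ |LightCone.shift p q a| < 1 ∧
            Ω = LightCone.parity e) ∨
          ((∃ k : ℤ, a = k) ∧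
            (Ω = LightCone.rightWing p q (|LightCone.shift p q a| + 1) ∨
              Ω = LightCone.leftWing p q (|LightCone.shift p q a| + 1))) ∨
          (|LightCone.shift p q a| = 1 ∧
            Ω = {x | LightCone.offset p q x = 0 ∧ ¬ (p = 2 ∧ q = 2 ∧ x = (0, 0))}) ∨
          ((a = 0 ∨ a = 2 - (p : ℝ) - q) ∧ Ω = {(0, 0)})))) ∧
    -- `q ≥ 2`, `p + q` odd
    (2 ≤ q → Odd (p + q) →
      (∀ e : ℕ, LightCone.IsUnitary (LightCone.SPar p q a e) ⊥ ↔
        |LightCone.shift p q a| < 1 / 2) ∧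
      (∀ Ω : Set (ℕ × ℕ), Ω ∈ LightCone.unitaryKTypeSets p q a ↔
        ((|LightCone.shift p q a| < 1 / 2 ∧ ∃ e : ℕ, Ω = LightCone.parity e) ∨
          ((∃ k : ℤ, a = k) ∧
            (Ω = LightCone.rightWing p q (|LightCone.shift p q a| + 1) ∨
              Ω = LightCone.leftWing p q (|LightCone.shift p q a| + 1))) ∨
          (|LightCone.shift p q a| = 1 / 2 ∧
            (Ω = LightCone.rightWing p q (1 / 2) ∨ Ω = LightCone.leftWing p q (1 / 2))) ∨
          ((a = 0 ∨ a = 2 - (p : ℝ) - q) ∧ Ω = {(0, 0)})))) ∧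
    -- `q = 1`, `p ≥ 2`
    (q = 1 → 2 ≤ p →
      (∀ e : ℕ, LightCone.IsUnitary (LightCone.SPar p q a e) ⊥ ↔
        (-((p : ℝ) - 1) < a ∧ a < 0)) ∧
      (∀ Ω : Set (ℕ × ℕ), Ω ∈ LightCone.unitaryKTypeSets p q a ↔
        ((-((p : ℝ) - 1) < a ∧ a < 0 ∧ ∃ e : ℕ, Ω = LightCone.ray e 0) ∨
          (∃ k e : ℕ, (a = k ∨ a = 1 - (p : ℝ) - k) ∧ Ω = LightCone.ray e (k + 1)) ∨
          ((a = 0 ∨ a = 1 - (p : ℝ)) ∧ (Ω = {(0, 0)} ∨ Ω = {(0, 1)}))))) := by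
  have : NeZero q := ⟨by omega⟩
  have : NeZero p := ⟨by omega⟩
  refine ⟨fun W₁ W₂ h => h.isUnitary_iff, fun hq2 he => ⟨fun e => ?_, fun Ω => ?_⟩,
    fun hq2 he => ⟨fun e => ?_, fun Ω => ?_⟩, fun hq1 hp2 => ?_⟩
  · exact LightCone.isUnitary_SPar_even (hq2.trans hpq) hq2 he e
  · exact LightCone.mem_unitaryKTypeSets_even (hq2.trans hpq) hq2 he
  · exact LightCone.isUnitary_SPar_odd (hq2.trans hpq) hq2 he e
  · exact LightCone.mem_unitaryKTypeSets_odd (hq2.trans hpq) hq2 he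
  · subst hq1
    exact ⟨fun e => LightCone.isUnitary_SPar_one hp2 e,
      fun Ω => LightCone.mem_unitaryKTypeSets_one hp2⟩
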